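/- \textbf{Lemma.} Let \[ T(p,t,y)=p+\sum_{k\ge 1}T_k(p,t)\,y^k,\qquad T_k(p,t)=\sum_{\mathfrak t\in\mathcal T_k}t^{e(\mathfrak t)}p^{v_{\mathrm{out}}(\mathfrak t)}, \] where $\mathcal T_k$ is the set of rooted planar maps (loops and multiple edges are allowed, and maps are considered up to root-preserving isomorphism) whose root face (the boundary, not necessarily simple) has degree $k$ and whose other faces all have degree $3$; $e(\mathfrak t)$ is the number of edges of $\mathfrak t$ and $v_{\mathrm{out}}(\mathfrak t)$ its number of distinct vertices incident to the boundary face. The term $p$ accounts for the map reduced to a single vertex. Write $x=t^3$, and let $t_c>0$ be given by $t_c^3=\frac{\sqrt3}{36}$. \textbf{(1)} There is a unique power series $U\in\mathbb Q[[x]]$ with constant term $0$ such that $x=\hat w(U):=\frac12U(1-U)(1-2U)$. There is a unique power series $V\in\mathbb Q[p][[x]][[y]]$ with constant term in $y$ equal to $0$ such that \[ y=\hat y(p,U,V):=\frac{2V(2-4U-V)}{4pU(1-U)(1-2U)+2U(1-3U)V+2(1-3U)V^2-V^3}, \] and the coefficients in $y$ of $V$ belong to $\mathbb Q[p,U,\frac1{1-2U}]$.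 The series $T(p,t,ty)$ is a power series in $t^3$ and $y$ with coefficients in $\mathbb Q[p]$; it is algebraic over $\mathbb Q(p,t^3,y)$, and \[ T(p,t,ty)=\hat T(p,U,V):=\frac{4pU(1-U)(1-2U)+2U(1-3U)V+2(1-3U)V^2-V^3}{4U(1-U)(1-2U)}. \] This rational parametrization $(t^3,y,T)=(\hat w(U),\hat y(p,U,V),\hat T(p,U,V))$ is proper: for indeterminates $p,U,V$, the rational functions $p$, $\hat w(U)$, $\hat y(p,U,V)$ and $\hat T(p,U,V)$ generate the field $\mathbb Q(p,U,V)$ over $\mathbb Q$. \textbf{(2)} Let $p\in(0,1]$ and $t\in(0,t_c]$. The series $T_k(p,t)$, $k\ge1$, converge, and there are $y_+=y_+(p,t)\in(1,\infty)$ and $y_-=y_-(p,t)\in[-\infty,-y_+)$ such that the power series $y\mapsto T(p,t,ty)$ has radius of convergence $y_+$ and continues analytically to the domain $\mathbb C\setminus\big((-\infty,y_-]\cup[y_+,+\infty)\big)$ (where $(-\infty,y_-]$ is empty if $y_-=-\infty$), the continuation being singular at $y_+$, and also at $y_-$ if $y_-$ is finite. -/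

import Mathlib

open Filter Topology

noncomputable section

namespace PercMaps

/-! ### Rooted planar maps, coded by permutations of their darts (oriented edges) -/

/-- A rooted connected map on an oriented surface, with set of darts `D`. A dart is an oriented
edge. `vertexPerm` turns a dart around its origin, `edgePerm` reverses a dart; loops and multiple
edges are allowed. -/
structure RootedMap (D : Type*) where
  vertexPerm : Equiv.Perm D
  edgePerm : Equiv.Perm D
  edgePerm_edgePerm : ∀ d, edgePerm (edgePerm d) = d
  edgePerm_ne : ∀ d, edgePerm d ≠ d
  connected : ∀ d d', ∃ g ∈ Subgroup.closure {vertexPerm, edgePerm}, g d = d'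
  root : D

namespace RootedMap

variable {D D' : Type*}

/-- Follows the contour of a face: `facePerm d` starts at the endpoint of `d`. -/
def facePerm (m : RootedMap D) : Equiv.Perm D := m.vertexPerm * m.edgePerm

/-- The cycles of `vertexPerm`. -/
abbrev Vertex (m : RootedMap D) : Type _ := Quotient (Equiv.Perm.SameCycle.setoid m.vertexPerm)

/-- The cycles of `edgePerm`. -/
abbrev Edge (m : RootedMap D) : Type _ := Quotient (Equiv.Perm.SameCycle.setoid m.edgePerm)

/-- The cycles of `facePerm`. -/
abbrev Face (m : RootedMap D) : Type _ := Quotient (Equiv.Perm.SameCycle.setoid m.facePerm)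

/-- The vertex from which a dart starts. -/
def origin (m : RootedMap D) (d : D) : m.Vertex := Quotient.mk _ d

/-- The darts on the contour of the face incident to `d`. -/
def contour (m : RootedMap D) (d : D) : Set D := {d' | m.facePerm.SameCycle d d'}

/-- Genus zero, through Euler's formula. -/
def IsPlanar (m : RootedMap D) : Prop :=
  (Nat.card m.Vertex : ℤ) - Nat.card m.Edge + Nat.card m.Face = 2

/-- The degree of the face incident to the root, the boundary face. -/
def boundaryLength (m : RootedMap D) : ℕ := (m.contour m.root).ncard

/-- The number of distinct vertices incident to the boundary face. -/
def numOuterVertices (m : RootedMap D) : ℕ := (m.origin '' m.contour m.root).ncard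

/-- A triangulation with a boundary (not necessarily simple): the map is planar and all faces
other than the boundary face have degree three. -/
def IsBoundaryTriangulation (m : RootedMap D) : Prop :=
  m.IsPlanar ∧ ∀ d, d ∉ m.contour m.root → (m.contour d).ncard = 3

/-- Isomorphism of rooted maps: a relabelling of the darts. -/
def Iso (m : RootedMap D) (m' : RootedMap D') : Prop :=
  ∃ f : D ≃ D', (∀ d, f (m.vertexPerm d) = m'.vertexPerm (f d)) ∧
    (∀ d, f (m.edgePerm d) = m'.edgePerm (f d)) ∧ f m.root = m'.root

/-- Rooted maps are considered up to isomorphism. -/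
def isoSetoid (D : Type*) : Setoid (RootedMap D) where
  r := Iso
  iseqv :=
    { refl := fun _ => ⟨Equiv.refl _, by simp⟩
      symm := by
        rintro m m' ⟨f, hv, he, hr⟩
        refine ⟨f.symm, fun d => ?_, fun d => ?_, ?_⟩
        · rw [Equiv.symm_apply_eq, hv, Equiv.apply_symm_apply]
        · rw [Equiv.symm_apply_eq, he, Equiv.apply_symm_apply]
        · rw [Equiv.symm_apply_eq, hr]
      trans := by
        rintro m m' m'' ⟨f, hv, he, hr⟩ ⟨f', hv', he', hr'⟩
        exact ⟨f.trans f', by simp [hv, hv'], by simp [he, he'], by simp [hr, hr']⟩ }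

end RootedMap

/-- The number of rooted triangulations (up to isomorphism) with a boundary of length `k`, with
`e ≥ 1` edges and with `v` boundary vertices. A map with `e` edges has `2 * e` darts. -/
def numTriangulations (k e v : ℕ) : ℕ :=
  Nat.card {c : Quotient (RootedMap.isoSetoid (Fin (2 * e))) //
    ∃ m : RootedMap (Fin (2 * e)), Quotient.mk _ m = c ∧ m.IsBoundaryTriangulation ∧
      m.boundaryLength = k ∧ m.numOuterVertices = v}

/-- The coefficient of `t ^ e * y ^ k` in the generating series, a polynomial in `p`.
A boundary of length `k` has at most `k` distinct vertices. The map reduced to one vertex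
(`k = 0`, `e = 0`, one boundary vertex) has no dart and is added separately. -/
def triangulationPoly (k e : ℕ) : Polynomial ℚ :=
  (if k = 0 ∧ e = 0 then Polynomial.X else 0) +
    ∑ v ∈ Finset.range (k + 1), (numTriangulations k e v : Polynomial ℚ) * Polynomial.X ^ v

/-- The generating series `T(p, t, y)` in `ℚ[p]⟦t⟧⟦y⟧`. -/
def triangulationSeries : PowerSeries (PowerSeries (Polynomial ℚ)) :=
  PowerSeries.mk fun k => PowerSeries.mk fun e => triangulationPoly k e

/-- The series `T(p, t, t y)` in `ℚ[p]⟦t⟧⟦y⟧`. -/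
def rescaledSeries : PowerSeries (PowerSeries (Polynomial ℚ)) :=
  PowerSeries.rescale (PowerSeries.X : PowerSeries (Polynomial ℚ)) triangulationSeries

/-- The replacement of the variable by its cube in a power series. -/
def expandCube (R : Type*) [CommRing R] : PowerSeries R →+* PowerSeries R :=
  (PowerSeries.expand (R := R) 3 three_ne_zero).toRingHom

/-- The replacement of `x` by `t ^ 3`, from `ℚ[p]⟦x⟧⟦y⟧` to `ℚ[p]⟦t⟧⟦y⟧`. -/
def substCube :
    PowerSeries (PowerSeries (Polynomial ℚ)) →+* PowerSeries (PowerSeries (Polynomial ℚ)) :=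
  PowerSeries.map (expandCube (Polynomial ℚ))

/-! ### The rational parametrization -/

/-- `u (1 - u) (1 - 2 u) / 2`. -/
def wHat {R : Type*} [CommRing R] [Algebra ℚ R] (u : R) : R :=
  algebraMap ℚ R (1 / 2) * u * (1 - u) * (1 - 2 * u)

/-- The rational function `ŷ(p, U, V)`. -/
def yHat {K : Type*} [Field K] (p u v : K) : K :=
  2 * v * (2 - 4 * u - v) /
    (4 * p * u * (1 - u) * (1 - 2 * u) + 2 * u * (1 - 3 * u) * v + 2 * (1 - 3 * u) * v ^ 2 - v ^ 3)

/-- The rational function `T̂(p, U, V)`. -/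
def tHat {K : Type*} [Field K] (p u v : K) : K :=
  (4 * p * u * (1 - u) * (1 - 2 * u) + 2 * u * (1 - 3 * u) * v + 2 * (1 - 3 * u) * v ^ 2 - v ^ 3) /
    (4 * u * (1 - u) * (1 - 2 * u))

/-- `U` has constant term `0` and `x = U (1 - U) (1 - 2 U) / 2` in `ℚ⟦x⟧`. -/
def IsSeriesU (U : PowerSeries ℚ) : Prop :=
  PowerSeries.constantCoeff U = 0 ∧ PowerSeries.X = wHat U

/-- The ring `ℚ[p]⟦x⟧⟦y⟧`. -/
abbrev SeriesRing : Type := PowerSeries (PowerSeries (Polynomial ℚ))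

/-- The variable `p`. -/
def pVar : SeriesRing := PowerSeries.C (PowerSeries.C Polynomial.X)

/-- The variable `x`, which stands for `t ^ 3`. -/
def xVar : SeriesRing := PowerSeries.C PowerSeries.X

/-- The variable `y`. -/
def yVar : SeriesRing := PowerSeries.X

/-- The inclusion of `ℚ⟦x⟧` into `ℚ[p]⟦x⟧`. -/
def inclX : PowerSeries ℚ →+* PowerSeries (Polynomial ℚ) := PowerSeries.map Polynomial.C

/-- The inclusion of `ℚ[p]⟦x⟧⟦y⟧` into its field of fractions. -/
def toFrac : SeriesRing →+* FractionRing SeriesRing := algebraMap _ _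

/-- `V` has constant term `0` in `y`, and `y = ŷ(p, U, V)`. -/
def IsSeriesV (U : PowerSeries ℚ) (V : SeriesRing) : Prop :=
  PowerSeries.constantCoeff V = 0 ∧
    toFrac yVar = yHat (toFrac pVar) (toFrac (PowerSeries.C (inclX U))) (toFrac V)

/-- The subring `ℚ[p, U, 1 / (1 - 2 U)]` of `ℚ[p]⟦x⟧`. -/
def coeffRing (U : PowerSeries ℚ) : Subalgebra ℚ (PowerSeries (Polynomial ℚ)) :=
  Algebra.adjoin ℚ {PowerSeries.C Polynomial.X, inclX U, inclX (1 - 2 * U)⁻¹}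

/-- The field `ℚ(p, U, V)` of rational functions in three indeterminates. -/
abbrev RatFun3 : Type := FractionRing (MvPolynomial (Fin 3) ℚ)

/-- The three indeterminates `p`, `U`, `V` of `ℚ(p, U, V)`. -/
def indet (i : Fin 3) : RatFun3 := algebraMap (MvPolynomial (Fin 3) ℚ) RatFun3 (MvPolynomial.X i)

/-- The parametrization `(U, V) ↦ (ŵ(U), ŷ(p, U, V), T̂(p, U, V))` over `ℚ(p)` is proper, that is,
birational onto its image: its components generate the field `ℚ(p, U, V)` over `ℚ(p)`. -/
def ParametrizationIsProper : Prop :=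
  IntermediateField.adjoin ℚ
    ({indet 0, wHat (indet 1), yHat (indet 0) (indet 1) (indet 2),
      tHat (indet 0) (indet 1) (indet 2)} : Set RatFun3) = ⊤

/-! ### Analytic notions -/

/-- The critical value `t_c = (√3 / 36) ^ (1 / 3)`. -/
def tCrit : ℝ := (√3 / 36) ^ (1 / 3 : ℝ)

/-- The term of index `e` of the series `T_k(p, t)`, at real numbers `p` and `t`. -/
def boundaryTerm (p t : ℝ) (k e : ℕ) : ℝ :=
  Polynomial.aeval p (PowerSeries.coeff e (PowerSeries.coeff k triangulationSeries)) * t ^ e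

/-- The coefficient `t ^ k * T_k(p, t)` of `y ^ k` in `T(p, t, t y)`. -/
def rescaledCoeff (p t : ℝ) (k : ℕ) : ℝ := t ^ k * ∑' e, boundaryTerm p t k e

/-- The plane `ℂ` without the half-lines `(-∞, a]` and `[b, ∞)`. -/
def slitPlane₂ (a b : EReal) : Set ℂ :=
  {z | ¬ (z.im = 0 ∧ ((z.re : EReal) ≤ a ∨ b ≤ (z.re : EReal)))}

/-- The function `f` on the domain `Ω` has no analytic continuation to a neighbourhood of `a`. -/
def IsSingularAt (f : ℂ → ℂ) (Ω : Set ℂ) (a : ℂ) : Prop :=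
  ¬ ∃ g : ℂ → ℂ, AnalyticAt ℂ g a ∧ ∀ᶠ z in 𝓝[Ω] a, g z = f z

end PercMaps

end

/-!
Maps are coded by a vertex permutation `σ` and an edge permutation `α` of a finite set of darts, the
faces being the cycles of `σ * α`. A corner of the boundary is marked by a *leg*, a fixed point of
`α`, so that the map reduced to a vertex is a map like any other (`IsOne`). Planarity, equality in
Euler's inequality `euler_le`, is defined without connectedness, so that it can be followed through
multiplication by a transposition: one transposition cuts or glues a vertex or an edge, and the
number of components tells whether the genus stays zero (`Planar.split`, `Planar.merge`,
`Planar.split_of_not`, `Planar.merge_of_sc`).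

Labelled counting turns disjoint pairs of maps into products of exponential generating functions
(`sum_isTwo_eq`), and rooted maps have no symmetries, so that labelled maps count isomorphism
classes (`card_labelled`). Two decompositions yield Tutte's equations `IsTutte` for `T(p, t, y)` and
the series of the maps whose boundary visits the root vertex once: the first return of the boundary
to the root vertex (`sum_first_return`), and the removal of the root edge, which is a bridge
(`sum_bridge`) or a side of an inner triangle (`sum_triangle`). In the last case the third vertex of
the triangle may or may not be new on the boundary, which matters for the exponent of `p`; moving
the root by one step (`total_isSimpleNext`) turns this condition into one on the root vertex. The
equations determine the solution order by order in `t` (`IsTutte.unique`), and a solution is written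
down from the series `V`, the solution of a cubic equation (`exists_isTutte`); hence the rational
parametrization `IsSeriesU.rescaledSeries_eq`. For its properness, `U` is eliminated by hand
(`parametrizationIsProper`).

For the analytic part write `a = u (1 - u)` and `b = 2 - 4 u`. Then
`1 / ŷ(p, u, V) = V / 2 + u + a p / V - a (1 - p) / (b - V)`, and the imaginary part of this function
is the product of `V.im` with a real function (`im_omg`) that is nonnegative on the circle of radius
`√(2 a)` about `0`, so that no solution `V` of `y = ŷ(p, u, V)` in the half-plane of `y` lies on this
circle. The open mapping theorem on the half-disc, used at `0` and, through a symmetry, at `b`,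
locates the three solutions for non-real `y`: exactly one of them lies both in the disc and in the
half-plane of `y` (`exists_factor`). The real `y` are treated by monotonicity between the critical
points of `ŷ` nearest to `0` (`IsCritPair`), whose values are `y₊` and, if negative, `y₋`. So `V`
continues to a function `branch` on the slit plane, analytic by the inverse function theorem
(`differentiableAt_branch`). It is singular at `y₊` and `y₋`: an analytic extension `W` would
satisfy `W (ŷ V) = V` near a point where `ŷ` has derivative zero (`isSingularAt_of_gap_eq_zero`).

The formal and the analytic objects are compared as follows. The series `1 / (1 - U)` and
`1 / (1 - 2 U)` have nonnegative coefficients and therefore converge up to the critical value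
`x = √3 / 36` (`partialSum_le`); evaluated there, the coefficients of `T(p, t, t y)` are the Taylor
coefficients of the continuation (`taylorCoeff_continuation`), and the radius of convergence is `y₊`
by the identity theorem (`radius_eq`).
-/

noncomputable section

set_option linter.unusedSectionVars false

namespace PercMaps

open Equiv

/-! ### Merging two classes of a setoid -/

section Setoids

variable {D D' : Type*}

/-- The setoid obtained from `s` by merging the classes of `a` and `b`. -/
def glue (s : Setoid D) (a b : D) : Setoid D where
  r x y := s x y ∨ (s x a ∨ s x b) ∧ (s y a ∨ s y b)
  iseqv :=
    { refl := fun x => Or.inl (s.refl x)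
      symm := by
        rintro x y (h | ⟨h, h'⟩)
        · exact Or.inl (s.symm h)
        · exact Or.inr ⟨h', h⟩
      trans := by
        rintro x y z (h | ⟨h, h'⟩) (k | ⟨k, k'⟩)
        · exact Or.inl (s.trans h k)
        · exact Or.inr ⟨k.imp (s.trans h) (s.trans h), k'⟩
        · exact Or.inr ⟨h, h'.imp (s.trans (s.symm k)) (s.trans (s.symm k))⟩
        · exact Or.inr ⟨h, k'⟩ }

theorem glue_apply {s : Setoid D} {a b x y : D} :
    glue s a b x y ↔ s x y ∨ (s x a ∨ s x b) ∧ (s y a ∨ s y b) := Iff.rfl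

theorem le_glue (s : Setoid D) (a b : D) : s ≤ glue s a b := fun _ _ h => Or.inl h

theorem glue_rel (s : Setoid D) (a b : D) : glue s a b a b :=
  Or.inr ⟨Or.inl (s.refl a), Or.inr (s.refl b)⟩

theorem glue_le_iff {s r : Setoid D} {a b : D} : glue s a b ≤ r ↔ s ≤ r ∧ r a b := by
  constructor
  · intro h
    exact ⟨(le_glue s a b).trans h, h (glue_rel s a b)⟩
  · rintro ⟨h, hab⟩ x y (hxy | ⟨hx, hy⟩)
    · exact h hxy
    · have h1 : r x a := by
        rcases hx with hx | hx
        · exact h hx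
        · exact r.trans (h hx) (r.symm hab)
      have h2 : r y a := by
        rcases hy with hy | hy
        · exact h hy
        · exact r.trans (h hy) (r.symm hab)
      exact r.trans h1 (r.symm h2)

theorem glue_eq_self {s : Setoid D} {a b : D} (h : s a b) : glue s a b = s :=
  le_antisymm (glue_le_iff.2 ⟨le_rfl, h⟩) (le_glue s a b)

theorem glue_sup (s t : Setoid D) (a b : D) : glue s a b ⊔ t = glue (s ⊔ t) a b := by
  apply le_antisymm
  · refine sup_le (glue_le_iff.2 ⟨le_sup_left.trans (le_glue _ a b), glue_rel _ a b⟩)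
      (le_sup_right.trans (le_glue _ a b))
  · refine glue_le_iff.2 ⟨sup_le_sup_right (le_glue s a b) t, ?_⟩
    exact (le_sup_left : glue s a b ≤ _) (glue_rel s a b)

/-- The number of classes of `s` that meet `A`. -/
def numClasses (s : Setoid D) (A : Set D) : ℕ := (Quotient.mk s '' A).ncard

theorem numClasses_le_of_rel [Finite D'] {s : Setoid D} {s' : Setoid D'} {A : Set D} {A' : Set D'}
    (R : D → D' → Prop) (h₁ : ∀ a ∈ A, ∃ a' ∈ A', R a a')
    (h₂ : ∀ a a' b b', R a a' → R b b' → s' a' b' → s a b) :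
    numClasses s A ≤ numClasses s' A' := by
  have key : ∀ q ∈ Quotient.mk s '' A, ∃ a a', a ∈ A ∧ a' ∈ A' ∧ R a a' ∧ Quotient.mk s a = q := by
    rintro q ⟨a, ha, rfl⟩
    obtain ⟨a', ha', hR⟩ := h₁ a ha
    exact ⟨a, a', ha, ha', hR, rfl⟩
  rcases A.eq_empty_or_nonempty with rfl | ⟨a₀, ha₀⟩
  · simp [numClasses]
  have : Nonempty D := ⟨a₀⟩
  have : Nonempty D' := ⟨(h₁ a₀ ha₀).choose⟩
  choose! f g hf hg hR hq using key
  refine Set.ncard_le_ncard_of_injOn (fun q => Quotient.mk s' (g q)) ?_ ?_ (Set.toFinite _)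
  · intro q hq'
    exact ⟨g q, hg q hq', rfl⟩
  · intro q₁ h₁' q₂ h₂' h
    have := h₂ _ _ _ _ (hR q₁ h₁') (hR q₂ h₂') (Quotient.exact h)
    rw [← hq q₁ h₁', ← hq q₂ h₂']
    exact Quotient.sound this

theorem numClasses_congr [Finite D] [Finite D'] {s : Setoid D} {s' : Setoid D'} {A : Set D}
    {A' : Set D'} (R : D → D' → Prop) (h₁ : ∀ a ∈ A, ∃ a' ∈ A', R a a')
    (h₁' : ∀ a' ∈ A', ∃ a ∈ A, R a a')
    (h₂ : ∀ a a' b b', R a a' → R b b' → (s a b ↔ s' a' b')) :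
    numClasses s A = numClasses s' A' :=
  le_antisymm
    (numClasses_le_of_rel R h₁ fun a a' b b' h h' => (h₂ a a' b b' h h').2)
    (numClasses_le_of_rel (fun a' a => R a a') h₁' fun a' a b' b h h' => (h₂ a a' b b' h h').1)

theorem numClasses_union [Finite D] {s : Setoid D} {A B : Set D}
    (h : ∀ a ∈ A, ∀ b ∈ B, ¬ s a b) :
    numClasses s (A ∪ B) = numClasses s A + numClasses s B := by
  rw [numClasses, Set.image_union]
  refine Set.ncard_union_eq ?_ (Set.toFinite _) (Set.toFinite _)
  rw [Set.disjoint_left]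
  rintro _ ⟨a, ha, rfl⟩ ⟨b, hb, hab⟩
  exact h a ha b hb (s.symm (Quotient.exact hab))

/-- Merging two classes that meet `A` lowers the number of classes by one. -/
theorem numClasses_glue [Finite D] {s : Setoid D} {A : Set D} {a b : D} (ha : a ∈ A) (hb : b ∈ A)
    (hab : ¬ s a b) : numClasses (glue s a b) A + 1 = numClasses s A := by
  let f : Quotient s → Quotient (glue s a b) :=
    Quotient.map' id (fun _ _ h => le_glue s a b h)
  have hf : ∀ x, f (Quotient.mk s x) = Quotient.mk (glue s a b) x := fun _ => rfl
  have h1 : Quotient.mk (glue s a b) '' A = f '' (Quotient.mk s '' A \ {Quotient.mk s b}) := by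
    ext q
    constructor
    · rintro ⟨x, hx, rfl⟩
      by_cases hxb : s x b
      · refine ⟨Quotient.mk s a, ⟨⟨a, ha, rfl⟩, fun h => hab (Quotient.exact h)⟩, ?_⟩
        rw [hf]
        exact Quotient.sound (Or.inr ⟨Or.inl (s.refl a), Or.inr hxb⟩)
      · exact ⟨Quotient.mk s x, ⟨⟨x, hx, rfl⟩, fun h => hxb (Quotient.exact h)⟩, rfl⟩
    · rintro ⟨_, ⟨⟨x, hx, rfl⟩, _⟩, rfl⟩
      exact ⟨x, hx, rfl⟩
  rw [numClasses, h1, Set.InjOn.ncard_image, numClasses]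
  · exact Set.ncard_sdiff_singleton_add_one ⟨b, hb, rfl⟩ (Set.toFinite _)
  · rintro _ ⟨⟨x, _, rfl⟩, hx⟩ _ ⟨⟨y, _, rfl⟩, hy⟩ h
    have hx' : ¬ s x b := fun h => hx (Quotient.sound h)
    have hy' : ¬ s y b := fun h => hy (Quotient.sound h)
    rw [hf, hf] at h
    rcases Quotient.exact h with h | ⟨h, h'⟩
    · exact Quotient.sound h
    · exact Quotient.sound (s.trans (h.resolve_right hx') (s.symm (h'.resolve_right hy')))

theorem numClasses_univ (s : Setoid D) : numClasses s Set.univ = Nat.card (Quotient s) := by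
  rw [numClasses, Set.image_univ, Set.range_eq_univ.2 Quotient.mk_surjective, Set.ncard_univ]

theorem numClasses_le_ncard [Finite D] (s : Setoid D) (A : Set D) : numClasses s A ≤ A.ncard :=
  Set.ncard_image_le (Set.toFinite _)

end Setoids

/-! ### Cycles of a permutation multiplied by a transposition -/

section Cycles

variable {D : Type*}

/-- The partition into cycles. -/
abbrev sc (π : Perm D) : Setoid D := Equiv.Perm.SameCycle.setoid π

theorem sc_apply {π : Perm D} {x y : D} : sc π x y ↔ π.SameCycle x y := Iff.rfl

theorem sc_step (π : Perm D) (x : D) : sc π x (π x) := ⟨1, by simp⟩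

theorem sc_le_iff {π : Perm D} {r : Setoid D} : sc π ≤ r ↔ ∀ x, r x (π x) := by
  constructor
  · intro h x
    exact h (sc_step π x)
  · rintro h x y ⟨i, rfl⟩
    induction i using Int.induction_on with
    | zero => exact r.refl x
    | succ i ih =>
      refine r.trans ih ?_
      have := h ((π ^ (i : ℤ)) x)
      rwa [← Perm.mul_apply, ← zpow_one_add, add_comm] at this
    | pred i ih =>
      refine r.trans ih (r.symm ?_)
      have := h ((π ^ (-(i : ℤ) - 1)) x)
      rwa [← Perm.mul_apply, ← zpow_one_add, add_sub_cancel] at this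

theorem sc_inv (π : Perm D) : sc π⁻¹ = sc π := by
  ext x y
  exact Perm.sameCycle_inv

theorem sc_one : sc (1 : Perm D) = ⊥ :=
  le_bot_iff.1 (sc_le_iff.2 fun _ => rfl)

theorem sc_mul_le (σ α : Perm D) : sc (σ * α) ≤ sc σ ⊔ sc α :=
  sc_le_iff.2 fun x => Setoid.trans' _
    ((le_sup_right : sc α ≤ sc σ ⊔ sc α) (sc_step α x))
    ((le_sup_left : sc σ ≤ sc σ ⊔ sc α) (sc_step σ (α x)))

/-- If `π ^ j` fixes `a`, the cycle of `a` is its orbit under the powers below `j`. -/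
theorem sameCycle_iff_of_pow_eq {π : Perm D} {a x : D} {j : ℕ} (hj : 0 < j) (h : (π ^ j) a = a) :
    π.SameCycle a x ↔ ∃ i < j, (π ^ i) a = x := by
  constructor
  · rintro ⟨i, rfl⟩
    refine ⟨(i % j).toNat, ?_, ?_⟩
    · have := Int.emod_lt_of_pos i (by exact_mod_cast hj : (0 : ℤ) < j)
      have := Int.emod_nonneg i (by exact_mod_cast hj.ne' : (j : ℤ) ≠ 0)
      omega
    · have h0 := Int.emod_nonneg i (by exact_mod_cast hj.ne' : (j : ℤ) ≠ 0)
      have h1 : ((i % j).toNat : ℤ) = i % j := Int.toNat_of_nonneg h0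
      rw [← zpow_natCast, h1]
      conv_rhs => rw [← Int.emod_add_mul_ediv i j, zpow_add, zpow_mul, zpow_natCast]
      rw [Perm.mul_apply, Perm.zpow_apply_eq_self_of_apply_eq_self h]
  · rintro ⟨i, _, rfl⟩
    exact ⟨i, by simp⟩

/-- A product with a transposition follows the same path until it meets the transposition. -/
theorem swap_mul_pow_apply [DecidableEq D] {π : Perm D} {a b r : D} {j : ℕ}
    (h : ∀ i, 0 < i → i < j → (π ^ i) r ≠ a ∧ (π ^ i) r ≠ b) :
    ∀ i < j, ((swap a b * π) ^ i) r = (π ^ i) r := by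
  intro i
  induction i with
  | zero => simp
  | succ i ih =>
    intro hi
    rw [pow_succ', Perm.mul_apply, ih (by omega), Perm.mul_apply, ← Perm.mul_apply π, ← pow_succ']
    obtain ⟨h1, h2⟩ := h (i + 1) (by omega) hi
    exact swap_apply_of_ne_of_ne h1 h2

theorem exists_pow_first [Finite D] {π : Perm D} {a b : D} (h : π.SameCycle a b) :
    ∃ j, 0 < j ∧ (π ^ j) a = b ∧ ∀ i, 0 < i → i < j → (π ^ i) a ≠ b := by
  classical
  have hex : ∃ j, 0 < j ∧ (π ^ j) a = b := by
    obtain ⟨i, hi, _, h⟩ := h.exists_pow_eq''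
    exact ⟨i, hi, h⟩
  refine ⟨Nat.find hex, (Nat.find_spec hex).1, (Nat.find_spec hex).2, fun i hi hlt heq => ?_⟩
  exact Nat.find_min hex hlt ⟨hi, heq⟩

/-- A transposition of points of two different cycles merges these cycles. -/
theorem sc_swap_mul_of_not [Finite D] [DecidableEq D] {π : Perm D} {a b : D} (h : ¬ sc π a b) :
    sc (swap a b * π) = glue (sc π) a b := by
  apply le_antisymm
  · refine sc_le_iff.2 fun x => ?_
    rw [Perm.mul_apply]
    by_cases ha : π x = a
    · rw [ha, swap_apply_left]
      exact Or.inr ⟨Or.inl (ha ▸ sc_step π x), Or.inr (Setoid.refl' _ b)⟩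
    by_cases hb : π x = b
    · rw [hb, swap_apply_right]
      exact Or.inr ⟨Or.inr (hb ▸ sc_step π x), Or.inl (Setoid.refl' _ a)⟩
    · rw [swap_apply_of_ne_of_ne ha hb]
      exact Or.inl (sc_step π x)
  · have hab : sc (swap a b * π) a b := by
      obtain ⟨j, hj, hja, hmin⟩ := exists_pow_first (Perm.SameCycle.refl π a)
      refine ⟨j, ?_⟩
      obtain ⟨m, rfl⟩ : ∃ m, j = m + 1 := ⟨j - 1, by omega⟩
      have := swap_mul_pow_apply (π := π) (a := a) (b := b) (r := a) (j := m + 1)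
        (fun i h0 h1 => ⟨hmin i h0 h1, fun hb => h ⟨i, by simpa using hb⟩⟩) m (by omega)
      rw [zpow_natCast, pow_succ', Perm.mul_apply, this, Perm.mul_apply, ← Perm.mul_apply π,
        ← pow_succ', hja, swap_apply_left]
    refine glue_le_iff.2 ⟨sc_le_iff.2 fun x => ?_, hab⟩
    have hx := sc_step (swap a b * π) x
    rw [Perm.mul_apply] at hx
    by_cases ha : π x = a
    · rw [ha, swap_apply_left] at hx
      rw [ha]
      exact Setoid.trans' _ hx (Setoid.symm' _ hab)
    by_cases hb : π x = b
    · rw [hb, swap_apply_right] at hx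
      rw [hb]
      exact Setoid.trans' _ hx hab
    · rwa [swap_apply_of_ne_of_ne ha hb] at hx

/-- A transposition of two points of the same cycle splits this cycle. -/
theorem not_sc_swap_mul [Finite D] [DecidableEq D] {π : Perm D} {a b : D} (hab : a ≠ b)
    (h : sc π a b) : ¬ sc (swap a b * π) a b := by
  obtain ⟨j, hj, hjb, hmin⟩ := exists_pow_first h
  obtain ⟨k, hk, hka, hkmin⟩ := exists_pow_first (Perm.SameCycle.refl π a)
  have hjk : ∀ i, 0 < i → i < j → (π ^ i) a ≠ a := by
    intro i hi hij hia
    -- the powers of `π` at `a` would be periodic before `b` is met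
    have := (sameCycle_iff_of_pow_eq (x := b) hi hia).1 h
    obtain ⟨l, hl, hlb⟩ := this
    rcases Nat.eq_zero_or_pos l with rfl | hl0
    · exact hab (by simpa using hlb)
    · exact hmin l hl0 (by omega) hlb
  obtain ⟨m, rfl⟩ : ∃ m, j = m + 1 := ⟨j - 1, by omega⟩
  have hpow := swap_mul_pow_apply (π := π) (a := a) (b := b) (r := a) (j := m + 1)
        (fun i h0 h1 => ⟨hjk i h0 h1, hmin i h0 h1⟩)
  have hret : ((swap a b * π) ^ (m + 1)) a = a := by
    rw [pow_succ', Perm.mul_apply, hpow m (by omega), Perm.mul_apply, ← Perm.mul_apply π,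
        ← pow_succ', hjb, swap_apply_right]
  intro hc
  obtain ⟨i, hi, hib⟩ := (sameCycle_iff_of_pow_eq hj hret).1 hc
  rw [hpow i hi] at hib
  rcases Nat.eq_zero_or_pos i with rfl | hi0
  · exact hab (by simpa using hib)
  · exact hmin i hi0 hi hib

/-- Undoing the transposition merges the two cycles again. -/
theorem sc_eq_glue_of_sc [Finite D] [DecidableEq D] {π : Perm D} {a b : D} (hab : a ≠ b)
    (h : sc π a b) : sc π = glue (sc (swap a b * π)) a b := by
  have := sc_swap_mul_of_not (not_sc_swap_mul hab h)
  rwa [swap_mul_self_mul] at this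

/-- The number of cycles, fixed points included. -/
def numCycles (π : Perm D) : ℕ := numClasses (sc π) Set.univ

theorem numCycles_swap_mul_of_not [Finite D] [DecidableEq D] {π : Perm D} {a b : D}
    (h : ¬ sc π a b) : numCycles (swap a b * π) + 1 = numCycles π := by
  rw [numCycles, sc_swap_mul_of_not h]
  exact numClasses_glue (Set.mem_univ a) (Set.mem_univ b) h

theorem numCycles_swap_mul [Finite D] [DecidableEq D] {π : Perm D} {a b : D} (hab : a ≠ b)
    (h : sc π a b) : numCycles (swap a b * π) = numCycles π + 1 := by
  have := numCycles_swap_mul_of_not (not_sc_swap_mul hab h)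
  rw [swap_mul_self_mul] at this
  exact this.symm

end Cycles

/-! ### Euler's inequality and planar maps -/

section Euler

variable {D : Type*}

/-- The partition into connected components. -/
def conn (σ α : Perm D) : Setoid D := sc σ ⊔ sc α

/-- The number of connected components. -/
def numComps (σ α : Perm D) : ℕ := numClasses (conn σ α) Set.univ

theorem sc_le_conn_left (σ α : Perm D) : sc σ ≤ conn σ α := le_sup_left

theorem sc_le_conn_right (σ α : Perm D) : sc α ≤ conn σ α := le_sup_right

theorem sc_mul_le_conn (σ α : Perm D) : sc (σ * α) ≤ conn σ α := sc_mul_le σ α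

theorem conn_le_iff {σ α : Perm D} {r : Setoid D} :
    conn σ α ≤ r ↔ (∀ x, r x (σ x)) ∧ ∀ x, r x (α x) := by
  rw [conn, sup_le_iff, sc_le_iff, sc_le_iff]

theorem conn_swap_mul_of_not [Finite D] [DecidableEq D] {σ α : Perm D} {a b : D}
    (h : ¬ sc σ a b) : conn (swap a b * σ) α = glue (conn σ α) a b := by
  rw [conn, sc_swap_mul_of_not h, glue_sup, conn]

theorem conn_eq_glue_of_sc [Finite D] [DecidableEq D] {σ α : Perm D} {a b : D} (hab : a ≠ b)
    (h : sc σ a b) : conn σ α = glue (conn (swap a b * σ) α) a b := by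
  rw [conn, sc_eq_glue_of_sc hab h, glue_sup, conn]

/-- **Euler's inequality**: the genus of a map is nonnegative. -/
theorem euler_le [Finite D] (σ α : Perm D) :
    numCycles σ + numCycles α + numCycles (σ * α) ≤ Nat.card D + 2 * numComps σ α := by
  classical
  have hle : ∀ π : Perm D, numCycles π ≤ Nat.card D := fun π => by
    have := numClasses_le_ncard (sc π) Set.univ
    rwa [Set.ncard_univ] at this
  suffices H : ∀ n (σ : Perm D), Nat.card D ≤ numCycles σ + n →
      numCycles σ + numCycles α + numCycles (σ * α) ≤ Nat.card D + 2 * numComps σ α from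
    H (Nat.card D) σ (by omega)
  intro n
  induction n with
  | zero =>
    intro σ hσ
    by_cases h1 : σ = 1
    · subst h1
      have : numComps 1 α = numCycles α := by rw [numComps, conn, sc_one, bot_sup_eq, numCycles]
      rw [one_mul, this]
      have := hle 1
      omega
    · obtain ⟨a, ha⟩ : ∃ a, σ a ≠ a := by
        by_contra! h
        exact h1 (Equiv.ext h)
      have := numCycles_swap_mul (Ne.symm ha) (sc_step σ a)
      have := hle (swap a (σ a) * σ)
      omega
  | succ n ih =>
    intro σ hσ
    by_cases h1 : σ = 1
    · subst h1
      have : numComps 1 α = numCycles α := by rw [numComps, conn, sc_one, bot_sup_eq, numCycles]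
      rw [one_mul, this]
      have := hle 1
      omega
    obtain ⟨a, ha⟩ : ∃ a, σ a ≠ a := by
      by_contra! h
      exact h1 (Equiv.ext h)
    set b := σ a with hb
    have hab : a ≠ b := Ne.symm ha
    have hsc : sc σ a b := sc_step σ a
    have hcyc := numCycles_swap_mul hab hsc
    have := ih (swap a b * σ) (by omega)
    have hconn := conn_eq_glue_of_sc (α := α) hab hsc
    have hcomp : numComps (swap a b * σ) α ≤ numComps σ α + 1 := by
      by_cases hc : conn (swap a b * σ) α a b
      · rw [numComps, numComps, hconn, glue_eq_self hc]
        omega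
      · have := numClasses_glue (Set.mem_univ a) (Set.mem_univ b) hc
        rw [← hconn] at this
        exact this.ge
    rw [mul_assoc] at this
    by_cases hφ : sc (σ * α) a b
    · have := numCycles_swap_mul hab hφ
      omega
    · have h2 := numCycles_swap_mul_of_not hφ
      -- the two faces merge, so that `a` and `b` stay connected
      have hc : conn (swap a b * σ) α a b := by
        refine sc_mul_le_conn (swap a b * σ) α ?_
        rw [mul_assoc, sc_swap_mul_of_not hφ]
        exact glue_rel _ a b
      have : numComps (swap a b * σ) α = numComps σ α := by
        rw [numComps, numComps, hconn, glue_eq_self hc]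
      omega

/-- Every connected component has genus zero. -/
def Planar (σ α : Perm D) : Prop :=
  numCycles σ + numCycles α + numCycles (σ * α) = Nat.card D + 2 * numComps σ α

theorem Planar.inv {σ α : Perm D} (h : Planar σ α) : Planar α⁻¹ σ⁻¹ := by
  unfold Planar at *
  have h1 : numCycles σ⁻¹ = numCycles σ := by rw [numCycles, sc_inv, numCycles]
  have h2 : numCycles α⁻¹ = numCycles α := by rw [numCycles, sc_inv, numCycles]
  have h3 : numCycles (α⁻¹ * σ⁻¹) = numCycles (σ * α) := by
    rw [← mul_inv_rev, numCycles, sc_inv, numCycles]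
  have h4 : numComps α⁻¹ σ⁻¹ = numComps σ α := by
    rw [numComps, conn, sc_inv, sc_inv, sup_comm, numComps, conn]
  omega

/-- A vertex of a planar map that meets a face twice is a cut vertex. -/
theorem Planar.split [Finite D] [DecidableEq D] {σ α : Perm D} {a b : D} (h : Planar σ α)
    (hab : a ≠ b) (hσ : sc σ a b) (hφ : sc (σ * α) a b) :
    Planar (swap a b * σ) α ∧ ¬ conn (swap a b * σ) α a b := by
  have h1 := numCycles_swap_mul hab hσ
  have h2 := numCycles_swap_mul hab hφ
  have h3 := euler_le (swap a b * σ) α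
  have hconn := conn_eq_glue_of_sc (α := α) hab hσ
  unfold Planar at *
  rw [mul_assoc] at *
  have hc : ¬ conn (swap a b * σ) α a b := by
    intro hc
    have : numComps (swap a b * σ) α = numComps σ α := by
      rw [numComps, numComps, hconn, glue_eq_self hc]
    omega
  have := numClasses_glue (Set.mem_univ a) (Set.mem_univ b) hc
  rw [← hconn] at this
  change numComps σ α + 1 = numComps (swap a b * σ) α at this
  exact ⟨by omega, hc⟩

/-- Gluing two components of a planar map at a vertex. -/
theorem Planar.merge [Finite D] [DecidableEq D] {σ α : Perm D} {a b : D} (h : Planar σ α)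
    (hc : ¬ conn σ α a b) : Planar (swap a b * σ) α := by
  have hσ : ¬ sc σ a b := fun h => hc (sc_le_conn_left σ α h)
  have hφ : ¬ sc (σ * α) a b := fun h => hc (sc_mul_le_conn σ α h)
  have h1 := numCycles_swap_mul_of_not hσ
  have h2 := numCycles_swap_mul_of_not hφ
  have := numClasses_glue (Set.mem_univ a) (Set.mem_univ b) hc
  rw [← conn_swap_mul_of_not hσ] at this
  change numComps (swap a b * σ) α + 1 = numComps σ α at this
  unfold Planar at *
  rw [mul_assoc]
  omega

/-- Splitting a vertex that meets two faces keeps the map planar and connected. -/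
theorem Planar.split_of_not [Finite D] [DecidableEq D] {σ α : Perm D} {a b : D} (h : Planar σ α)
    (hab : a ≠ b) (hσ : sc σ a b) (hφ : ¬ sc (σ * α) a b) :
    Planar (swap a b * σ) α ∧ conn (swap a b * σ) α = conn σ α := by
  have h1 := numCycles_swap_mul hab hσ
  have h2 := numCycles_swap_mul_of_not hφ
  have hconn := conn_eq_glue_of_sc (α := α) hab hσ
  have hc : conn (swap a b * σ) α a b := by
    refine sc_mul_le_conn (swap a b * σ) α ?_
    rw [mul_assoc, sc_swap_mul_of_not hφ]
    exact glue_rel _ a b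
  rw [glue_eq_self hc] at hconn
  unfold Planar numComps at *
  rw [mul_assoc, ← hconn]
  exact ⟨by omega, rfl⟩

/-- Merging two vertices of the same face keeps the map planar. -/
theorem Planar.merge_of_sc [Finite D] [DecidableEq D] {σ α : Perm D} {a b : D} (h : Planar σ α)
    (hab : a ≠ b) (hσ : ¬ sc σ a b) (hφ : sc (σ * α) a b) :
    Planar (swap a b * σ) α ∧ conn (swap a b * σ) α = conn σ α := by
  have h1 := numCycles_swap_mul_of_not hσ
  have h2 := numCycles_swap_mul hab hφ
  have hconn := conn_swap_mul_of_not (α := α) hσ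
  rw [glue_eq_self (sc_mul_le_conn σ α hφ)] at hconn
  unfold Planar numComps at *
  rw [mul_assoc, hconn]
  exact ⟨by omega, rfl⟩

end Euler

/-! ### Embeddings of maps -/

section Embeddings

variable {D D' : Type*}

/-- An embedding of a map as a union of connected components of another one. -/
structure IsEmb (i : D → D') (σ α : Perm D) (σ' α' : Perm D') : Prop where
  inj : Function.Injective i
  left : ∀ x, i (σ x) = σ' (i x)
  right : ∀ x, i (α x) = α' (i x)

variable {i : D → D'} {σ α : Perm D} {σ' α' : Perm D'}

theorem IsEmb.mul (h : IsEmb i σ α σ' α') : IsEmb i (σ * α) (σ * α) (σ' * α') (σ' * α') where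
  inj := h.inj
  left x := by rw [Perm.mul_apply, h.left, h.right, Perm.mul_apply]
  right x := by rw [Perm.mul_apply, h.left, h.right, Perm.mul_apply]

theorem IsEmb.diag (h : IsEmb i σ α σ' α') : IsEmb i σ σ σ' σ' := ⟨h.inj, h.left, h.left⟩

theorem IsEmb.diag' (h : IsEmb i σ α σ' α') : IsEmb i α α α' α' := ⟨h.inj, h.right, h.right⟩

theorem sc_eq_conn (σ : Perm D) : sc σ = conn σ σ := (sup_idem _).symm

/-- The image of an embedding is a union of connected components. -/
theorem IsEmb.conn_iff (h : IsEmb i σ α σ' α') {a : D} {y : D'} :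
    conn σ' α' (i a) y ↔ ∃ b, i b = y ∧ conn σ α a b := by
  let r : Setoid D' :=
    { r := fun x y => (x ∈ Set.range i ↔ y ∈ Set.range i) ∧
        ∀ a b, i a = x → i b = y → conn σ α a b
      iseqv :=
        { refl := fun x => ⟨Iff.rfl, fun a b ha hb => by
            rw [h.inj (ha.trans hb.symm)]⟩
          symm := fun h => ⟨h.1.symm, fun a b ha hb => Setoid.symm' _ (h.2 b a hb ha)⟩
          trans := by
            rintro x y z ⟨h1, h2⟩ ⟨k1, k2⟩
            refine ⟨h1.trans k1, fun a b ha hb => ?_⟩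
            obtain ⟨c, hc⟩ := h1.1 ⟨a, ha⟩
            exact Setoid.trans' _ (h2 a c ha hc) (k2 c b hc hb) } }
  have step : ∀ (π : Perm D) (π' : Perm D'), (∀ x, i (π x) = π' (i x)) →
      (∀ x, conn σ α x (π x)) → ∀ x, r x (π' x) := by
    intro π π' hi hc x
    refine ⟨⟨?_, ?_⟩, ?_⟩
    · rintro ⟨a, rfl⟩
      exact ⟨π a, hi a⟩
    · rintro ⟨b, hb⟩
      refine ⟨π.symm b, π'.injective ?_⟩
      rw [← hi, Equiv.apply_symm_apply, hb]
    · rintro a b rfl hb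
      rw [← hi] at hb
      rw [h.inj hb]
      exact hc a
  constructor
  · intro hc
    have hle : conn σ' α' ≤ r := conn_le_iff.2
      ⟨step σ σ' h.left fun x => sc_le_conn_left σ α (sc_step σ x),
        step α α' h.right fun x => sc_le_conn_right σ α (sc_step α x)⟩
    obtain ⟨h1, h2⟩ := hle hc
    obtain ⟨b, hb⟩ := h1.1 ⟨a, rfl⟩
    exact ⟨b, hb, h2 a b rfl hb⟩
  · rintro ⟨b, rfl, hb⟩
    have hle : conn σ α ≤ Setoid.comap i (conn σ' α') := conn_le_iff.2
      ⟨fun x => by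
        change conn σ' α' (i x) (i (σ x))
        rw [h.left]
        exact sc_le_conn_left σ' α' (sc_step σ' _),
      fun x => by
        change conn σ' α' (i x) (i (α x))
        rw [h.right]
        exact sc_le_conn_right σ' α' (sc_step α' _)⟩
    exact hle hb

theorem IsEmb.conn_iff' (h : IsEmb i σ α σ' α') {a b : D} :
    conn σ' α' (i a) (i b) ↔ conn σ α a b := by
  rw [h.conn_iff]
  exact ⟨fun ⟨c, hc, h'⟩ => h.inj hc ▸ h', fun h' => ⟨b, rfl, h'⟩⟩

theorem IsEmb.sc_iff (h : IsEmb i σ α σ' α') {a : D} {y : D'} :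
    sc σ' (i a) y ↔ ∃ b, i b = y ∧ sc σ a b := by
  rw [sc_eq_conn, sc_eq_conn]
  exact h.diag.conn_iff

theorem IsEmb.sc_iff' (h : IsEmb i σ α σ' α') {a b : D} : sc σ' (i a) (i b) ↔ sc σ a b := by
  rw [sc_eq_conn, sc_eq_conn]
  exact h.diag.conn_iff'

/-- The cycle of `r`, as a set. -/
def cyc (φ : Perm D) (r : D) : Set D := {x | sc φ r x}

theorem mem_cyc {φ : Perm D} {r x : D} : x ∈ cyc φ r ↔ sc φ r x := Iff.rfl

theorem self_mem_cyc (φ : Perm D) (r : D) : r ∈ cyc φ r := (sc φ).refl r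

theorem IsEmb.image_cyc (h : IsEmb i σ α σ' α') (a : D) : i '' cyc σ a = cyc σ' (i a) := by
  ext y
  rw [mem_cyc, h.sc_iff]
  exact ⟨fun ⟨b, hb, hy⟩ => ⟨b, hy, hb⟩, fun ⟨b, hy, hb⟩ => ⟨b, hb, hy⟩⟩

theorem IsEmb.ncard_cyc (h : IsEmb i σ α σ' α') (a : D) :
    (cyc σ' (i a)).ncard = (cyc σ a).ncard := by
  rw [← h.image_cyc, Set.ncard_image_of_injective _ h.inj]

theorem IsEmb.numClasses_image [Finite D] [Finite D'] (h : IsEmb i σ α σ' α') (A : Set D) :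
    numClasses (sc σ') (i '' A) = numClasses (sc σ) A := by
  symm
  refine numClasses_congr (fun a y => i a = y) (fun a ha => ⟨i a, ⟨a, ha, rfl⟩, rfl⟩) ?_ ?_
  · rintro _ ⟨a, ha, rfl⟩
    exact ⟨a, ha, rfl⟩
  · rintro a _ b _ rfl rfl
    exact h.sc_iff'.symm

theorem IsEmb.numClasses_conn_image [Finite D] [Finite D'] (h : IsEmb i σ α σ' α') (A : Set D) :
    numClasses (conn σ' α') (i '' A) = numClasses (conn σ α) A := by
  symm
  refine numClasses_congr (fun a y => i a = y) (fun a ha => ⟨i a, ⟨a, ha, rfl⟩, rfl⟩) ?_ ?_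
  · rintro _ ⟨a, ha, rfl⟩
    exact ⟨a, ha, rfl⟩
  · rintro a _ b _ rfl rfl
    exact h.conn_iff'.symm

end Embeddings

/-! ### Disjoint unions of maps -/

section Sums

variable {D₁ D₂ D : Type*}

/-- The disjoint union of two permutations, carried to `D` by an equivalence. -/
def join (e : D₁ ⊕ D₂ ≃ D) (π₁ : Perm D₁) (π₂ : Perm D₂) : Perm D :=
  e.permCongr (Perm.sumCongr π₁ π₂)

theorem join_inl (e : D₁ ⊕ D₂ ≃ D) (π₁ : Perm D₁) (π₂ : Perm D₂) (x : D₁) :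
    join e π₁ π₂ (e (Sum.inl x)) = e (Sum.inl (π₁ x)) := by
  simp [join, Equiv.permCongr_apply]

theorem join_inr (e : D₁ ⊕ D₂ ≃ D) (π₁ : Perm D₁) (π₂ : Perm D₂) (x : D₂) :
    join e π₁ π₂ (e (Sum.inr x)) = e (Sum.inr (π₂ x)) := by
  simp [join, Equiv.permCongr_apply]

theorem join_mul (e : D₁ ⊕ D₂ ≃ D) (π₁ ρ₁ : Perm D₁) (π₂ ρ₂ : Perm D₂) :
    join e (π₁ * ρ₁) (π₂ * ρ₂) = join e π₁ π₂ * join e ρ₁ ρ₂ := by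
  ext x
  obtain ⟨x | x, rfl⟩ := e.surjective x
  · simp only [Perm.mul_apply, join_inl]
  · simp only [Perm.mul_apply, join_inr]

theorem join_inj {e : D₁ ⊕ D₂ ≃ D} {π₁ ρ₁ : Perm D₁} {π₂ ρ₂ : Perm D₂} :
    join e π₁ π₂ = join e ρ₁ ρ₂ ↔ π₁ = ρ₁ ∧ π₂ = ρ₂ := by
  constructor
  · intro h
    constructor <;> ext x
    · have := congrArg (fun f : Perm D => f (e (Sum.inl x))) h
      simp only [join_inl] at this
      exact Sum.inl_injective (e.injective this)
    · have := congrArg (fun f : Perm D => f (e (Sum.inr x))) h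
      simp only [join_inr] at this
      exact Sum.inr_injective (e.injective this)
  · rintro ⟨rfl, rfl⟩
    rfl

theorem exists_join [Finite D₁] [Finite D₂] (e : D₁ ⊕ D₂ ≃ D) {π : Perm D}
    (h : ∀ x, ∃ y, π (e (Sum.inl x)) = e (Sum.inl y)) : ∃ π₁ π₂, join e π₁ π₂ = π := by
  have : e.symm.permCongr π ∈ (Perm.sumCongrHom D₁ D₂).range := by
    refine Perm.mem_sumCongrHom_range_of_perm_mapsTo_inl ?_
    rintro _ ⟨x, rfl⟩
    obtain ⟨y, hy⟩ := h x
    exact ⟨y, by simp [Equiv.permCongr_apply, hy]⟩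
  obtain ⟨⟨π₁, π₂⟩, h⟩ := this
  refine ⟨π₁, π₂, ?_⟩
  rw [join]
  change e.permCongr (Perm.sumCongrHom D₁ D₂ (π₁, π₂)) = π
  rw [h]
  ext x
  simp [Equiv.permCongr_apply]

variable {e : D₁ ⊕ D₂ ≃ D} {σ₁ α₁ : Perm D₁} {σ₂ α₂ : Perm D₂}

theorem isEmb_inl : IsEmb (fun x => e (Sum.inl x)) σ₁ α₁ (join e σ₁ σ₂) (join e α₁ α₂) :=
  ⟨e.injective.comp Sum.inl_injective, fun x => (join_inl e _ _ x).symm,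
    fun x => (join_inl e _ _ x).symm⟩

theorem isEmb_inr : IsEmb (fun x => e (Sum.inr x)) σ₂ α₂ (join e σ₁ σ₂) (join e α₁ α₂) :=
  ⟨e.injective.comp Sum.inr_injective, fun x => (join_inr e _ _ x).symm,
    fun x => (join_inr e _ _ x).symm⟩

theorem not_conn_join {x : D₁} {y : D₂} :
    ¬ conn (join e σ₁ σ₂) (join e α₁ α₂) (e (Sum.inl x)) (e (Sum.inr y)) := by
  intro h
  obtain ⟨b, hb, _⟩ := isEmb_inl.conn_iff.1 h
  exact Sum.inl_ne_inr (e.injective hb)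

theorem numComps_join [Finite D₁] [Finite D₂] :
    numComps (join e σ₁ σ₂) (join e α₁ α₂) = numComps σ₁ α₁ + numComps σ₂ α₂ := by
  have : Finite D := Finite.of_equiv _ e
  have hu : (Set.univ : Set D) =
      (fun x => e (Sum.inl x)) '' Set.univ ∪ (fun x => e (Sum.inr x)) '' Set.univ := by
    ext x
    obtain ⟨x | x, rfl⟩ := e.surjective x <;> simp
  rw [numComps, hu, numClasses_union, isEmb_inl.numClasses_conn_image,
    isEmb_inr.numClasses_conn_image, numComps, numComps]
  rintro _ ⟨x, _, rfl⟩ _ ⟨y, _, rfl⟩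
  exact not_conn_join

theorem numCycles_join [Finite D₁] [Finite D₂] :
    numCycles (join e σ₁ σ₂) = numCycles σ₁ + numCycles σ₂ := by
  have := numComps_join (e := e) (σ₁ := σ₁) (α₁ := σ₁) (σ₂ := σ₂) (α₂ := σ₂)
  simpa only [numComps, ← sc_eq_conn, numCycles] using this

/-- The two sides of Euler's inequality are additive, so that equality holds for the union if and
only if it holds for both parts. -/
theorem planar_join [Finite D₁] [Finite D₂] :
    Planar (join e σ₁ σ₂) (join e α₁ α₂) ↔ Planar σ₁ α₁ ∧ Planar σ₂ α₂ := by
  have h1 := euler_le σ₁ α₁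
  have h2 := euler_le σ₂ α₂
  have h3 : Nat.card D = Nat.card D₁ + Nat.card D₂ := by
    rw [← Nat.card_congr e, Nat.card_sum]
  unfold Planar
  rw [← join_mul, numCycles_join, numCycles_join, numCycles_join, numComps_join, h3]
  omega

end Sums

/-! ### Triangulations with legs -/

section Legs

variable {D D' : Type*}

/-- A planar triangulation with one leg `r`, that is, one dart without opposite dart, drawn in the
boundary face. The leg marks a corner of the boundary face, so that the map reduced to a vertex
is no exception: its only dart is the leg. -/
structure IsOne (σ α : Perm D) (r : D) : Prop where
  invol : ∀ x, α (α x) = x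
  fixed : ∀ x, α x = x ↔ x = r
  conn : ∀ x, conn σ α r x
  planar : Planar σ α
  faces : ∀ x, ¬ sc (σ * α) r x → (cyc (σ * α) x).ncard = 3

/-- A pair of disjoint planar triangulations with one leg, `r` and `s` respectively. -/
structure IsTwo (σ α : Perm D) (r s : D) : Prop where
  invol : ∀ x, α (α x) = x
  fixed : ∀ x, α x = x ↔ x = r ∨ x = s
  conn : ∀ x, conn σ α r x ∨ conn σ α s x
  disj : ¬ PercMaps.conn σ α r s
  planar : Planar σ α
  faces : ∀ x, ¬ sc (σ * α) r x → ¬ sc (σ * α) s x → (cyc (σ * α) x).ncard = 3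

/-- Disjoint unions of triangulations with one leg are the pairs of disjoint triangulations whose
first component is the image of the first summand. -/
theorem isTwo_join [Finite D'] {D₁ D₂ : Type*} [Finite D₁] [Finite D₂] {e : D₁ ⊕ D₂ ≃ D'}
    {σ₁ α₁ : Perm D₁} {σ₂ α₂ : Perm D₂} {r : D₁} {s : D₂} :
    (IsTwo (join e σ₁ σ₂) (join e α₁ α₂) (e (Sum.inl r)) (e (Sum.inr s)) ∧
      ∀ x, PercMaps.conn (join e σ₁ σ₂) (join e α₁ α₂) (e (Sum.inl r)) (e (Sum.inl x))) ↔
      IsOne σ₁ α₁ r ∧ IsOne σ₂ α₂ s := by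
  have hl : IsEmb (fun x => e (Sum.inl x)) σ₁ α₁ (join e σ₁ σ₂) (join e α₁ α₂) := isEmb_inl
  have hr : IsEmb (fun x => e (Sum.inr x)) σ₂ α₂ (join e σ₁ σ₂) (join e α₁ α₂) := isEmb_inr
  have nsc : ∀ x y, ¬ sc (join e σ₁ σ₂ * join e α₁ α₂) (e (Sum.inl x)) (e (Sum.inr y)) :=
    fun x y h => not_conn_join (sc_mul_le_conn _ _ h)
  have nsc' : ∀ x y, ¬ sc (join e σ₁ σ₂ * join e α₁ α₂) (e (Sum.inr y)) (e (Sum.inl x)) :=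
    fun x y h => nsc x y (Setoid.symm' _ h)
  constructor
  · rintro ⟨h, hc⟩
    obtain ⟨p1, p2⟩ := planar_join.1 h.planar
    refine ⟨⟨fun x => ?_, fun x => ?_, fun x => hl.conn_iff'.1 (hc x), p1, fun x hx => ?_⟩,
      ⟨fun x => ?_, fun x => ?_, fun x => ?_, p2, fun x hx => ?_⟩⟩
    · have := h.invol (e (Sum.inl x))
      rw [join_inl, join_inl] at this
      exact Sum.inl_injective (e.injective this)
    · have := h.fixed (e (Sum.inl x))
      rw [join_inl] at this
      simpa using this
    · rw [← hl.mul.ncard_cyc]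
      exact h.faces _ (fun h' => hx (hl.mul.sc_iff'.1 h')) (nsc' _ _)
    · have := h.invol (e (Sum.inr x))
      rw [join_inr, join_inr] at this
      exact Sum.inr_injective (e.injective this)
    · have := h.fixed (e (Sum.inr x))
      rw [join_inr] at this
      simpa using this
    · rcases h.conn (e (Sum.inr x)) with h' | h'
      · exact absurd h' not_conn_join
      · exact hr.conn_iff'.1 h'
    · rw [← hr.mul.ncard_cyc]
      exact h.faces _ (nsc _ _) (fun h' => hx (hr.mul.sc_iff'.1 h'))
  · rintro ⟨h1, h2⟩
    refine ⟨⟨fun x => ?_, fun x => ?_, fun x => ?_, not_conn_join,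
      planar_join.2 ⟨h1.planar, h2.planar⟩, fun x hx hx' => ?_⟩,
      fun x => hl.conn_iff'.2 (h1.conn x)⟩
    · obtain ⟨x | x, rfl⟩ := e.surjective x
      · rw [join_inl, join_inl, h1.invol]
      · rw [join_inr, join_inr, h2.invol]
    · obtain ⟨x | x, rfl⟩ := e.surjective x
      · rw [join_inl]
        simpa using h1.fixed x
      · rw [join_inr]
        simpa using h2.fixed x
    · obtain ⟨x | x, rfl⟩ := e.surjective x
      · exact Or.inl (hl.conn_iff'.2 (h1.conn x))
      · exact Or.inr (hr.conn_iff'.2 (h2.conn x))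
    · obtain ⟨x | x, rfl⟩ := e.surjective x
      · exact (hl.mul.ncard_cyc x).trans (h1.faces x fun h => hx (hl.mul.sc_iff'.2 h))
      · exact (hr.mul.ncard_cyc x).trans (h2.faces x fun h => hx' (hr.mul.sc_iff'.2 h))

theorem permCongr_isEmb (e : D ≃ D') (σ α : Perm D) :
    IsEmb e σ α (e.permCongr σ) (e.permCongr α) :=
  ⟨e.injective, fun x => by simp [Equiv.permCongr_apply],
    fun x => by simp [Equiv.permCongr_apply]⟩

theorem planar_permCongr [Finite D] (e : D ≃ D') {σ α : Perm D} (h : Planar σ α) :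
    Planar (e.permCongr σ) (e.permCongr α) := by
  have : Finite D' := Finite.of_equiv _ e
  have he := permCongr_isEmb e σ α
  have hu : (Set.univ : Set D') = e '' Set.univ := by simp
  have hm : e.permCongr σ * e.permCongr α = e.permCongr (σ * α) := by
    ext x
    simp [Equiv.permCongr_apply]
  unfold Planar numCycles numComps at *
  have h1 := (permCongr_isEmb e (σ * α) 1).numClasses_image Set.univ
  rw [hu, he.numClasses_image, he.diag'.numClasses_image, he.numClasses_conn_image, hm,
    h1, h, Nat.card_congr e]

theorem IsOne.permCongr [Finite D] (e : D ≃ D') {σ α : Perm D} {r : D} (h : IsOne σ α r) :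
    IsOne (e.permCongr σ) (e.permCongr α) (e r) := by
  have he := permCongr_isEmb e σ α
  refine ⟨fun x => ?_, fun x => ?_, fun x => ?_, planar_permCongr e h.planar, fun x hx => ?_⟩
  · simp [Equiv.permCongr_apply, h.invol]
  · have := h.fixed (e.symm x)
    rw [Equiv.permCongr_apply, ← e.eq_symm_apply, this, e.symm_apply_eq]
  · obtain ⟨x, rfl⟩ := e.surjective x
    exact he.conn_iff'.2 (h.conn x)
  · obtain ⟨x, rfl⟩ := e.surjective x
    rw [he.mul.ncard_cyc]
    exact h.faces x fun h' => hx (he.mul.sc_iff'.2 h')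

end Legs

/-! ### Labelled counting -/

section Counting

variable {R : Type*} [CommRing R]

/-- A weight that depends only on the connected component of the leg. -/
def IsLocal (f : ∀ D : Type, Perm D → Perm D → D → R) : Prop :=
  ∀ (D D' : Type) [Finite D] [Finite D'] (i : D → D') (σ α : Perm D) (σ' α' : Perm D'),
    IsEmb i σ α σ' α' → ∀ r, f D' σ' α' (i r) = f D σ α r

/-- The total weight of the triangulations with leg `r` on the set of darts `D`. -/
def total (f : ∀ D : Type, Perm D → Perm D → D → R) (D : Type) (r : D) : R :=
  ∑ᶠ M ∈ {M : Perm D × Perm D | IsOne M.1 M.2 r}, f D M.1 M.2 r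

theorem total_congr {f : ∀ D : Type, Perm D → Perm D → D → R} (hf : IsLocal f) {D D' : Type}
    [Finite D] (e : D ≃ D') (r : D) : total f D r = total f D' (e r) := by
  have : Finite D' := Finite.of_equiv _ e
  refine finsum_mem_eq_of_bijOn (fun M => (e.permCongr M.1, e.permCongr M.2)) ⟨?_, ?_, ?_⟩ ?_
  · intro M hM
    exact hM.permCongr e
  · rintro ⟨a, b⟩ _ ⟨a', b'⟩ _ h
    simpa using h
  · rintro ⟨a, b⟩ h
    refine ⟨(e.symm.permCongr a, e.symm.permCongr b), ?_, ?_⟩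
    · have := h.permCongr e.symm
      rwa [e.symm_apply_apply] at this
    · ext x <;> simp [Equiv.permCongr_apply]
  · intro M _
    exact (hf D D' e _ _ _ _ (permCongr_isEmb e M.1 M.2) r).symm

theorem finsum_mem_prod_mul {X Y : Type*} [Finite X] [Finite Y] (S : Set X) (T : Set Y)
    (f : X → R) (g : Y → R) :
    ∑ᶠ z ∈ S ×ˢ T, f z.1 * g z.2 = (∑ᶠ x ∈ S, f x) * ∑ᶠ y ∈ T, g y := by
  classical
  have := Fintype.ofFinite X
  have := Fintype.ofFinite Y
  rw [finsum_mem_eq_toFinset_sum, finsum_mem_eq_toFinset_sum, finsum_mem_eq_toFinset_sum,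
    Set.toFinset_prod, Finset.sum_product, Finset.sum_mul_sum]

/-- Pairs with prescribed sets of darts of the two components. -/
theorem sum_isTwo_of_sum {f g : ∀ D : Type, Perm D → Perm D → D → R} (hf : IsLocal f)
    (hg : IsLocal g) {D₁ D₂ D : Type} [Finite D₁] [Finite D₂] (e : D₁ ⊕ D₂ ≃ D)
    (r : D₁) (s : D₂) :
    ∑ᶠ M ∈ {M : Perm D × Perm D | IsTwo M.1 M.2 (e (Sum.inl r)) (e (Sum.inr s)) ∧
      ∀ x, conn M.1 M.2 (e (Sum.inl r)) x ↔ ∃ y, e (Sum.inl y) = x},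
        f D M.1 M.2 (e (Sum.inl r)) * g D M.1 M.2 (e (Sum.inr s)) =
      total f D₁ r * total g D₂ s := by
  have : Finite D := Finite.of_equiv _ e
  rw [total, total, ← finsum_mem_prod_mul]
  symm
  refine finsum_mem_eq_of_bijOn
    (fun M => (join e M.1.1 M.2.1, join e M.1.2 M.2.2)) ⟨?_, ?_, ?_⟩ ?_
  · rintro ⟨⟨σ₁, α₁⟩, ⟨σ₂, α₂⟩⟩ ⟨h1, h2⟩
    obtain ⟨h, hc⟩ := isTwo_join (e := e).2 ⟨h1, h2⟩
    refine ⟨h, fun x => ⟨fun hx => ?_, ?_⟩⟩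
    · obtain ⟨b, hb, _⟩ := isEmb_inl.conn_iff.1 hx
      exact ⟨b, hb⟩
    · rintro ⟨y, rfl⟩
      exact hc y
  · rintro ⟨⟨σ₁, α₁⟩, ⟨σ₂, α₂⟩⟩ _ ⟨⟨σ₁', α₁'⟩, ⟨σ₂', α₂'⟩⟩ _ h
    rw [Prod.mk.injEq, join_inj, join_inj] at h
    obtain ⟨⟨h1, h2⟩, h3, h4⟩ := h
    simp only at h1 h2 h3 h4
    rw [h1, h2, h3, h4]
  · rintro ⟨σ, α⟩ ⟨h, hc⟩
    have key : ∀ π : Perm D, sc π ≤ conn σ α → ∃ π₁ π₂, join e π₁ π₂ = π := by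
      intro π hπ
      refine exists_join e fun x => ?_
      have h1 : conn σ α (e (Sum.inl r)) (e (Sum.inl x)) := (hc _).2 ⟨x, rfl⟩
      obtain ⟨y, hy⟩ := (hc _).1 (Setoid.trans' _ h1 (hπ (sc_step π _)))
      exact ⟨y, hy.symm⟩
    obtain ⟨σ₁, σ₂, rfl⟩ := key σ (sc_le_conn_left σ α)
    obtain ⟨α₁, α₂, rfl⟩ := key α (sc_le_conn_right _ α)
    exact ⟨((σ₁, α₁), (σ₂, α₂)), isTwo_join.1 ⟨h, fun x => (hc _).2 ⟨x, rfl⟩⟩, rfl⟩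
  · rintro ⟨⟨σ₁, α₁⟩, ⟨σ₂, α₂⟩⟩ _
    exact congrArg₂ (· * ·) (hf _ _ _ _ _ _ _ isEmb_inl r).symm (hg _ _ _ _ _ _ _ isEmb_inr s).symm

/-- A pair of disjoint triangulations is sorted by the set of darts of its first component. -/
theorem sum_isTwo {f g : ∀ D : Type, Perm D → Perm D → D → R} (hf : IsLocal f)
    (hg : IsLocal g) {D : Type} [Finite D] (r s : D) :
    ∑ᶠ M ∈ {M : Perm D × Perm D | IsTwo M.1 M.2 r s}, f D M.1 M.2 r * g D M.1 M.2 s =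
      ∑ᶠ C : {C : Set D // r ∈ C ∧ s ∉ C}, total f C.1 ⟨r, C.2.1⟩ *
        total g (C.1ᶜ : Set D) ⟨s, C.2.2⟩ := by
  classical
  have hU : {M : Perm D × Perm D | IsTwo M.1 M.2 r s} =
      ⋃ C : {C : Set D // r ∈ C ∧ s ∉ C},
        {M : Perm D × Perm D | IsTwo M.1 M.2 r s ∧ ∀ x, conn M.1 M.2 r x ↔ x ∈ C.1} := by
    ext M
    simp only [Set.mem_ofPred_eq, Set.mem_iUnion]
    constructor
    · intro h
      exact ⟨⟨{x | conn M.1 M.2 r x}, (conn M.1 M.2).refl r, h.disj⟩, h, fun x => Iff.rfl⟩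
    · rintro ⟨_, h, _⟩
      exact h
  rw [hU, finsum_mem_iUnion]
  · refine finsum_congr fun C => ?_
    have := sum_isTwo_of_sum hf hg (Equiv.Set.sumCompl C.1) ⟨r, C.2.1⟩ ⟨s, C.2.2⟩
    rw [← this]
    simp only [Equiv.Set.sumCompl_apply_inl, Equiv.Set.sumCompl_apply_inr]
    congr! 5 with M
    simp
  · intro C C' hCC'
    rw [Function.onFun, Set.disjoint_left]
    rintro M ⟨_, h⟩ ⟨_, h'⟩
    exact hCC' (Subtype.ext (Set.ext fun x => (h x).symm.trans (h' x)))
  · intro C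
    exact Set.toFinite _

variable [Algebra ℚ R]

/-- The total weight of the triangulations with a leg and `n` other darts, up to relabelling of
the latter. -/
def rootedTotal (f : ∀ D : Type, Perm D → Perm D → D → R) (n : ℕ) : R :=
  algebraMap ℚ R (1 / n.factorial) * total f (Fin (n + 1)) 0

/-- The total weight does not depend on the names of the darts. -/
theorem total_eq {f : ∀ D : Type, Perm D → Perm D → D → R} (hf : IsLocal f) {D : Type}
    [Finite D] (r : D) {n : ℕ} (hD : Nat.card D = n + 1) :
    total f D r = algebraMap ℚ R n.factorial * rootedTotal f n := by
  have e : D ≃ Fin (n + 1) := Finite.equivFinOfCardEq hD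
  rw [rootedTotal, ← mul_assoc, ← map_mul, mul_one_div_cancel, map_one, one_mul,
    total_congr hf (e.trans (Equiv.swap (e r) 0)) r]
  · simp
  · exact_mod_cast n.factorial_ne_zero

/-- The product formula for exponential generating functions: the pairs of disjoint triangulations
are the shuffles of two triangulations with a leg. -/
theorem sum_isTwo_eq {f g : ∀ D : Type, Perm D → Perm D → D → R} (hf : IsLocal f)
    (hg : IsLocal g) {D : Type} [Finite D] {r s : D} (hrs : r ≠ s) {n : ℕ}
    (hD : Nat.card D = n + 2) :
    ∑ᶠ M ∈ {M : Perm D × Perm D | IsTwo M.1 M.2 r s}, f D M.1 M.2 r * g D M.1 M.2 s =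
      algebraMap ℚ R n.factorial *
        ∑ ij ∈ Finset.HasAntidiagonal.antidiagonal n, rootedTotal f ij.1 * rootedTotal g ij.2 := by
  classical
  have := Fintype.ofFinite D
  have hcard : Fintype.card D = n + 2 := by rw [← Nat.card_eq_fintype_card, hD]
  set E : Finset D := Finset.univ \ {r, s} with hE
  have hEcard : E.card = n := by
    rw [hE, Finset.card_sdiff_of_subset (Finset.subset_univ _), Finset.card_univ, hcard,
      Finset.card_pair hrs]
    omega
  let h : ℕ → R := fun i => (algebraMap ℚ R i.factorial * rootedTotal f i) *
    (algebraMap ℚ R (n - i).factorial * rootedTotal g (n - i))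
  have h1 : ∀ C : {C : Set D // r ∈ C ∧ s ∉ C},
      total f C.1 ⟨r, C.2.1⟩ * total g (C.1ᶜ : Set D) ⟨s, C.2.2⟩ = h (C.1.ncard - 1) := by
    rintro ⟨C, hr, hs⟩
    have hpos : 0 < C.ncard := (Set.ncard_pos).2 ⟨r, hr⟩
    have hpos' : 0 < Cᶜ.ncard := (Set.ncard_pos).2 ⟨s, hs⟩
    have hsum := Set.ncard_add_ncard_compl C
    rw [hD] at hsum
    have e1 : Nat.card C = (C.ncard - 1) + 1 := by rw [Nat.card_coe_set_eq]; omega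
    have e2 : Nat.card (Cᶜ : Set D) = (n - (C.ncard - 1)) + 1 := by
      rw [Nat.card_coe_set_eq]; omega
    simp only [h]
    rw [total_eq hf _ e1, total_eq hg _ e2]
  rw [sum_isTwo hf hg, finsum_congr h1]
  have h2 : ∑ᶠ C : {C : Set D // r ∈ C ∧ s ∉ C}, h (C.1.ncard - 1) =
      ∑ A ∈ E.powerset, h A.card := by
    rw [finsum_eq_sum_of_fintype]
    refine Finset.sum_bij (fun C _ => C.1.toFinset \ {r}) ?_ ?_ ?_ ?_
    · rintro ⟨C, hr, hs⟩ _
      rw [Finset.mem_powerset, hE]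
      intro x
      simp only [Finset.mem_sdiff, Set.mem_toFinset, Finset.mem_singleton, Finset.mem_univ,
        Finset.mem_insert, true_and]
      rintro ⟨hx, hxr⟩ (h | rfl)
      · exact hxr h
      · exact hs hx
    · rintro ⟨C, hr, hs⟩ _ ⟨C', hr', hs'⟩ _ h
      refine Subtype.ext (Set.ext fun x => ?_)
      have := congrArg (fun A : Finset D => x ∈ A) h
      simp only [Finset.mem_sdiff, Set.mem_toFinset, Finset.mem_singleton, eq_iff_iff] at this
      by_cases hx : x = r
      · subst hx
        exact ⟨fun _ => hr', fun _ => hr⟩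
      · simpa [hx] using this
    · intro A hA
      rw [Finset.mem_powerset, hE] at hA
      have hrA : r ∉ A := fun h => by simpa using hA h
      have hsA : s ∉ A := fun h => by simpa using hA h
      refine ⟨⟨insert r (A : Set D), Set.mem_insert _ _, ?_⟩, Finset.mem_univ _, ?_⟩
      · simp [hrs.symm, hsA]
      · ext x
        by_cases hx : x = r
        · subst hx
          simp [hrA]
        · simp [hx]
    · rintro ⟨C, hr, hs⟩ _
      congr 1
      rw [Finset.card_sdiff_of_subset (by simpa using hr), Finset.card_singleton,
        Set.ncard_eq_toFinset_card']
  rw [h2, Finset.sum_powerset_apply_card, hEcard, Finset.Nat.sum_antidiagonal_eq_sum_range_succ_mk,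
    Finset.mul_sum]
  refine Finset.sum_congr rfl fun i hi => ?_
  have hin : i ≤ n := Nat.lt_succ_iff.1 (Finset.mem_range.1 hi)
  simp only [h]
  rw [nsmul_eq_mul, ← Nat.choose_mul_factorial_mul_factorial hin]
  simp only [map_natCast]
  push_cast
  ring

end Counting

/-! ### Cutting and gluing triangulations -/

section Transitions

variable {D : Type*}

/-- A planar triangulation with two legs `r` and `s`, both in the boundary face. -/
structure IsJoined (σ α : Perm D) (r s : D) : Prop where
  invol : ∀ x, α (α x) = x
  fixed : ∀ x, α x = x ↔ x = r ∨ x = s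
  conn : ∀ x, conn σ α r x
  planar : Planar σ α
  face : sc (σ * α) r s
  faces : ∀ x, ¬ sc (σ * α) r x → (cyc (σ * α) x).ncard = 3

/-- A planar triangulation with root `d` and without leg. -/
structure IsMap (σ α : Perm D) (d : D) : Prop where
  invol : ∀ x, α (α x) = x
  fixed : ∀ x, α x ≠ x
  conn : ∀ x, conn σ α d x
  planar : Planar σ α
  faces : ∀ x, ¬ sc (σ * α) d x → (cyc (σ * α) x).ncard = 3

theorem cyc_eq_of_sc_eq_glue {φ φ' : Perm D} {a b x : D} (h : sc φ' = glue (sc φ) a b)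
    (ha : ¬ sc φ x a) (hb : ¬ sc φ x b) : cyc φ' x = cyc φ x := by
  ext y
  rw [mem_cyc, mem_cyc, h, glue_apply]
  tauto

theorem cyc_eq_union_of_sc_eq_glue {φ φ' : Perm D} {a b : D} (h : sc φ' = glue (sc φ) a b) :
    cyc φ' a = cyc φ a ∪ cyc φ b := by
  ext y
  rw [Set.mem_union, mem_cyc, mem_cyc, mem_cyc, h, glue_apply]
  constructor
  · rintro (h | ⟨_, h | h⟩)
    · exact Or.inl h
    · exact Or.inl (Setoid.symm' _ h)
    · exact Or.inr (Setoid.symm' _ h)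
  · rintro (h | h)
    · exact Or.inl h
    · exact Or.inr ⟨Or.inl (Setoid.refl' _ _), Or.inr (Setoid.symm' _ h)⟩

theorem cyc_eq_of_sc {φ : Perm D} {a b : D} (h : sc φ a b) : cyc φ a = cyc φ b := by
  ext y
  exact ⟨fun h' => Setoid.trans' _ (Setoid.symm' _ h) h', fun h' => Setoid.trans' _ h h'⟩

theorem eq_of_sc_of_fixed {π : Perm D} {s x : D} (h : π s = s) (hx : sc π s x) : x = s := by
  obtain ⟨i, rfl⟩ := hx
  exact Perm.zpow_apply_eq_self_of_apply_eq_self h i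

theorem eq_of_conn_of_fixed {σ α : Perm D} {s x : D} (h : σ s = s) (h' : α s = s)
    (hx : conn σ α s x) : x = s := by
  let r : Setoid D :=
    { r := fun x y => x = s ↔ y = s
      iseqv := ⟨fun _ => Iff.rfl, fun h => h.symm, fun h h' => h.trans h'⟩ }
  have : conn σ α ≤ r := conn_le_iff.2 ⟨fun x => ⟨fun hx => by rw [hx, h],
      fun hx => σ.injective (hx.trans h.symm)⟩, fun x => ⟨fun hx => by rw [hx, h'],
      fun hx => α.injective (hx.trans h'.symm)⟩⟩
  exact (this hx).1 rfl

theorem IsTwo.ne {σ α : Perm D} {r s : D} (h : IsTwo σ α r s) : r ≠ s := by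
  rintro rfl
  exact h.disj (Setoid.refl' _ r)

theorem IsTwo.not_face {σ α : Perm D} {r s : D} (h : IsTwo σ α r s) : ¬ sc (σ * α) r s :=
  fun h' => h.disj (sc_mul_le_conn σ α h')

variable [Finite D] [DecidableEq D]

theorem IsTwo.not_conn {σ α : Perm D} {r s a b : D} (h : IsTwo σ α r s) (ha : sc (σ * α) r a)
    (hb : sc (σ * α) s b) : ¬ PercMaps.conn σ α a b := fun hab =>
  h.disj (Setoid.trans' _ (sc_mul_le_conn σ α ha)
    (Setoid.trans' _ hab (Setoid.symm' _ (sc_mul_le_conn σ α hb))))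

theorem IsTwo.sc_merge {σ α : Perm D} {r s a b : D} (h : IsTwo σ α r s) (ha : sc (σ * α) r a)
    (hb : sc (σ * α) s b) : sc (swap a b * σ) = glue (sc σ) a b :=
  sc_swap_mul_of_not fun h' => h.not_conn ha hb (sc_le_conn_left σ α h')

theorem IsTwo.sc_face_merge {σ α : Perm D} {r s a b : D} (h : IsTwo σ α r s)
    (ha : sc (σ * α) r a) (hb : sc (σ * α) s b) :
    sc (swap a b * σ * α) = glue (sc (σ * α)) a b := by
  rw [mul_assoc]
  exact sc_swap_mul_of_not fun h' => h.not_conn ha hb (sc_mul_le_conn σ α h')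

/-- Gluing two triangulations at corners `a` and `b` of their boundaries. -/
theorem IsTwo.merge {σ α : Perm D} {r s a b : D} (h : IsTwo σ α r s) (ha : sc (σ * α) r a)
    (hb : sc (σ * α) s b) : IsJoined (swap a b * σ) α r s := by
  have hab := h.not_conn ha hb
  have hφ := h.sc_face_merge ha hb
  refine ⟨h.invol, h.fixed, fun x => ?_, h.planar.merge hab, ?_, fun x hx => ?_⟩
  · rw [conn_swap_mul_of_not fun h' => hab (sc_le_conn_left σ α h')]
    rcases h.conn x with hx | hx
    · exact Or.inl hx
    · exact Or.inr ⟨Or.inl (sc_mul_le_conn σ α ha),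
        Or.inr (Setoid.trans' _ (Setoid.symm' _ hx) (sc_mul_le_conn σ α hb))⟩
  · rw [hφ]
    exact Or.inr ⟨Or.inl ha, Or.inr hb⟩
  · rw [hφ] at hx
    have h1 : ¬ sc (σ * α) r x := fun h' => hx (Or.inl h')
    have h2 : ¬ sc (σ * α) x a := fun h' => hx (Or.inr ⟨Or.inl ha, Or.inl h'⟩)
    have h3 : ¬ sc (σ * α) x b := fun h' => hx (Or.inr ⟨Or.inl ha, Or.inr h'⟩)
    rw [cyc_eq_of_sc_eq_glue hφ h2 h3]
    exact h.faces x h1 fun h' => h3 (Setoid.trans' _ (Setoid.symm' _ h') hb)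

/-- Cutting a triangulation at a vertex that the boundary visits twice. -/
theorem IsJoined.split {σ α : Perm D} {r s a b : D} (h : IsJoined σ α r s) (hab : a ≠ b)
    (hσ : sc σ a b) (ha : sc (σ * α) r a) (hb : sc (σ * α) r b)
    (hrs : ¬ PercMaps.conn (swap a b * σ) α r s) : IsTwo (swap a b * σ) α r s := by
  have hφ : sc (σ * α) a b := Setoid.trans' _ (Setoid.symm' _ ha) hb
  obtain ⟨hp, hc⟩ := h.planar.split hab hσ hφ
  have hg := conn_eq_glue_of_sc (α := α) hab hσ
  have hf := sc_eq_glue_of_sc hab hφ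
  rw [← mul_assoc] at hf
  have key : ∀ x, PercMaps.conn (swap a b * σ) α x a ∨ PercMaps.conn (swap a b * σ) α x b →
      PercMaps.conn (swap a b * σ) α r x ∨ PercMaps.conn (swap a b * σ) α s x := by
    intro x hx
    have hr := h.face
    rw [hf] at ha hr
    have e1 : PercMaps.conn (swap a b * σ) α r a ∨ PercMaps.conn (swap a b * σ) α r b := by
      rcases ha with h1 | ⟨h1, -⟩
      · exact Or.inl (sc_mul_le_conn _ _ h1)
      · exact h1.imp (fun h => sc_mul_le_conn _ _ h) (fun h => sc_mul_le_conn _ _ h)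
    have e2 : PercMaps.conn (swap a b * σ) α s a ∨ PercMaps.conn (swap a b * σ) α s b := by
      rcases hr with h1 | ⟨-, h1⟩
      · exact absurd (sc_mul_le_conn _ _ h1) hrs
      · exact h1.imp (fun h => sc_mul_le_conn _ _ h) (fun h => sc_mul_le_conn _ _ h)
    rcases e1 with e1 | e1 <;> rcases e2 with e2 | e2
    · exact absurd (Setoid.trans' _ e1 (Setoid.symm' _ e2)) hrs
    · exact hx.imp (fun h => Setoid.trans' _ e1 (Setoid.symm' _ h))
        (fun h => Setoid.trans' _ e2 (Setoid.symm' _ h))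
    · exact hx.symm.imp (fun h => Setoid.trans' _ e1 (Setoid.symm' _ h))
        (fun h => Setoid.trans' _ e2 (Setoid.symm' _ h))
    · exact absurd (Setoid.trans' _ e1 (Setoid.symm' _ e2)) hrs
  refine ⟨h.invol, h.fixed, fun x => ?_, hrs, hp, fun x hr hs => ?_⟩
  · have := h.conn x
    rw [hg] at this
    rcases this with h1 | ⟨-, h1⟩
    · exact Or.inl h1
    · exact key x h1
  · have hx : ¬ sc (σ * α) r x := by
      rw [hf]
      have hsf := h.face
      rw [hf] at hsf ha
      rintro (h1 | ⟨h1, h2⟩)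
      · exact hr h1
      · have e2 := (hsf.resolve_left fun h' => hrs (sc_mul_le_conn _ _ h')).2
        rcases h1 with e1 | e1 <;> rcases e2 with e2 | e2 <;> rcases h2 with h2 | h2 <;>
        first
        | exact hr (Setoid.trans' _ e1 (Setoid.symm' _ h2))
        | exact hs (Setoid.trans' _ e2 (Setoid.symm' _ h2))
        | exact hrs (sc_mul_le_conn _ _ (Setoid.trans' _ e1 (Setoid.symm' _ e2)))
    have h3 := h.faces x hx
    rwa [cyc_eq_of_sc_eq_glue hf] at h3
    · intro h'
      refine hx ?_
      rw [hf] at ha ⊢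
      exact Setoid.trans' _ ha (Or.inl (Setoid.symm' _ h'))
    · intro h'
      refine hx ?_
      rw [hf] at hb ⊢
      exact Setoid.trans' _ hb (Or.inl (Setoid.symm' _ h'))

/-- Detaching the leg `s` from the boundary. -/
theorem IsJoined.detach {σ α : Perm D} {r s : D} (h : IsJoined σ α r s) (hrs : r ≠ s) :
    IsTwo (swap s (σ s) * σ) α r s ∧ (swap s (σ s) * σ) s = s := by
  have hfix : (swap s (σ s) * σ) s = s := by simp
  have hα : α s = s := (h.fixed s).2 (Or.inr rfl)
  have hne : s ≠ σ s := by
    intro h'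
    exact hrs (eq_of_conn_of_fixed h'.symm hα (Setoid.symm' _ (h.conn s)))
  have hs : sc (σ * α) r (σ s) := by
    have := sc_step (σ * α) s
    rw [Perm.mul_apply, hα] at this
    exact Setoid.trans' _ h.face this
  exact ⟨h.split hne (sc_step σ s) h.face hs fun h' =>
    hrs (eq_of_conn_of_fixed hfix hα (Setoid.symm' _ h')), hfix⟩

/-- The place from which the leg `s` was detached is on the boundary. -/
theorem IsJoined.detach_face {σ α : Perm D} {r s : D} (h : IsJoined σ α r s) (hrs : r ≠ s) :
    sc (swap s (σ s) * σ * α) r (σ s) := by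
  obtain ⟨h2, hfix⟩ := h.detach hrs
  have hα : α s = s := (h.fixed s).2 (Or.inr rfl)
  have hne : s ≠ σ s := by
    intro h'
    exact hrs (eq_of_conn_of_fixed h'.symm hα (Setoid.symm' _ (h.conn s)))
  have hs : sc (σ * α) s (σ s) := by
    have := sc_step (σ * α) s
    rwa [Perm.mul_apply, hα] at this
  have hf := sc_eq_glue_of_sc hne hs
  rw [← mul_assoc] at hf
  have := h.face
  rw [hf] at this
  rcases this with h' | ⟨h' | h', -⟩
  · exact absurd h' h2.not_face
  · exact absurd h' h2.not_face
  · exact h'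

theorem inv_eq_of_invol {α : Perm D} (h : ∀ x, α (α x) = x) : α⁻¹ = α :=
  inv_eq_of_mul_eq_one_left (Equiv.ext h)

theorem swap_mul_comm_of {α : Perm D} {d d' : D} (h : α d = d') (h' : α d' = d) :
    swap d d' * α = α * swap d d' := by
  rw [mul_swap_eq_swap_mul, h, h', swap_comm]

theorem swap_mul_comm_of_fixed {α : Perm D} {d d' : D} (h : α d = d) (h' : α d' = d') :
    swap d d' * α = α * swap d d' := by
  rw [mul_swap_eq_swap_mul, h, h']

/-- The involution after the edge `{d, d'}` is cut into two legs, or the legs are glued. -/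
theorem swap_mul_invol {α : Perm D} {d d' : D} (h : ∀ x, α (α x) = x)
    (hc : swap d d' * α = α * swap d d') (x : D) : (swap d d' * α) ((swap d d' * α) x) = x := by
  rw [← Perm.mul_apply]
  have : swap d d' * α * (swap d d' * α) = α * α := by
    nth_rewrite 1 [hc]
    rw [mul_assoc, swap_mul_self_mul]
  rw [this]
  exact h x

/-- The face permutation of the map `(α, σ⁻¹)` has the cycles of that of `(σ, α)`. Through this
exchange, the facts on products `swap a b * σ` apply to the edge permutation as well. -/
theorem sc_face_inv {σ α : Perm D} (h : ∀ x, α (α x) = x) : sc (α * σ⁻¹) = sc (σ * α) := by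
  rw [← sc_inv, mul_inv_rev, inv_inv, inv_eq_of_invol h]

theorem conn_edge_inv (σ α : Perm D) : conn α σ⁻¹ = conn σ α := by
  rw [conn, conn, sc_inv, sup_comm]

theorem planar_edge_inv {σ α : Perm D} (h : ∀ x, α (α x) = x) : Planar α σ⁻¹ ↔ Planar σ α := by
  constructor
  · intro h'
    have := h'.inv
    rwa [inv_inv, inv_eq_of_invol h] at this
  · intro h'
    have := h'.inv
    rwa [inv_eq_of_invol h] at this

section Cut

variable {σ α : Perm D} {d d' : D}

theorem IsMap.cut_fixed (h : IsMap σ α d) (hd : α d = d') (x : D) :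
    (swap d d' * α) x = x ↔ x = d ∨ x = d' := by
  have hd' : α d' = d := by rw [← hd, h.invol]
  rw [Perm.mul_apply]
  constructor
  · intro hx
    by_contra hne
    rw [not_or] at hne
    have h1 : α x ≠ d := fun h1 => hne.2 (by rw [← hd, ← h1, h.invol])
    have h2 : α x ≠ d' := fun h2 => hne.1 (by rw [← hd', ← h2, h.invol])
    rw [swap_apply_of_ne_of_ne h1 h2] at hx
    exact h.fixed x hx
  · rintro (rfl | rfl)
    · rw [hd, swap_apply_right]
    · rw [hd', swap_apply_left]

theorem IsMap.comm (h : IsMap σ α d) (hd : α d = d') : swap d d' * α = α * swap d d' :=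
  swap_mul_comm_of hd (by rw [← hd, h.invol])

theorem IsMap.ne (h : IsMap σ α d) (hd : α d = d') : d ≠ d' := fun h' =>
  h.fixed d (hd.trans h'.symm)

/-- An edge with the boundary on both sides is a bridge. Cutting it leaves two triangulations, with
the halves of the edge as legs. -/
theorem IsMap.cut_bridge (h : IsMap σ α d) (hd : α d = d') (hf : sc (σ * α) d d') :
    IsTwo σ (swap d d' * α) d d' ∧
      sc (σ * α) = glue (sc (σ * (swap d d' * α))) d d' := by
  have hne := h.ne hd
  have hα : sc α d d' := hd ▸ sc_step α d
  have hinv := swap_mul_invol h.invol (h.comm hd)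
  have hf' : sc (α * σ⁻¹) d d' := by rwa [sc_face_inv h.invol]
  obtain ⟨h1, h2⟩ := ((planar_edge_inv h.invol).2 h.planar).split hne hα hf'
  have h3 := conn_eq_glue_of_sc (α := σ⁻¹) hne hα
  have h4 := sc_eq_glue_of_sc hne hf'
  rw [conn_edge_inv] at h2 h3
  rw [conn_edge_inv] at h3
  rw [← mul_assoc, sc_face_inv hinv, sc_face_inv h.invol] at h4
  refine ⟨⟨hinv, h.cut_fixed hd, fun x => ?_, h2, (planar_edge_inv hinv).1 h1,
    fun x hx hx' => ?_⟩, h4⟩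
  · have := h.conn x
    rw [h3] at this
    rcases this with h' | ⟨-, h' | h'⟩
    · exact Or.inl h'
    · exact Or.inl (Setoid.symm' _ h')
    · exact Or.inr (Setoid.symm' _ h')
  · have e1 : ¬ sc (σ * (swap d d' * α)) x d := fun h' => hx (Setoid.symm' _ h')
    have e2 : ¬ sc (σ * (swap d d' * α)) x d' := fun h' => hx' (Setoid.symm' _ h')
    rw [← cyc_eq_of_sc_eq_glue h4 e1 e2]
    refine h.faces x fun h' => ?_
    rw [h4] at h'
    rcases h' with h' | ⟨-, h' | h'⟩
    · exact hx h'
    · exact e1 h'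
    · exact e2 h'

theorem glue_edge_fixed {α : Perm D} {d d' : D} (hfix : ∀ x, α x = x ↔ x = d ∨ x = d')
    (hne : d ≠ d') (x : D) : (swap d d' * α) x ≠ x := by
  rw [Perm.mul_apply]
  by_cases h1 : x = d
  · subst h1
    rw [(hfix x).2 (Or.inl rfl), swap_apply_left]
    exact hne.symm
  by_cases h2 : x = d'
  · subst h2
    rw [(hfix x).2 (Or.inr rfl), swap_apply_right]
    exact hne
  · have e1 : α x ≠ d := fun h => h1 (α.injective (h.trans ((hfix d).2 (Or.inl rfl)).symm))
    have e2 : α x ≠ d' := fun h => h2 (α.injective (h.trans ((hfix d').2 (Or.inr rfl)).symm))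
    rw [swap_apply_of_ne_of_ne e1 e2]
    exact fun h => not_or.2 ⟨h1, h2⟩ ((hfix x).1 h)

/-- Gluing the legs of two triangulations yields a bridge. -/
theorem IsTwo.bridge (h : IsTwo σ α d d') :
    IsMap σ (swap d d' * α) d ∧ sc (σ * (swap d d' * α)) d d' := by
  have hd : α d = d := (h.fixed d).2 (Or.inl rfl)
  have hd' : α d' = d' := (h.fixed d').2 (Or.inr rfl)
  have hinv := swap_mul_invol h.invol (swap_mul_comm_of_fixed hd hd')
  have hα : ¬ sc α d d' := fun h' => h.ne (eq_of_sc_of_fixed hd h').symm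
  have hc : ¬ PercMaps.conn α σ⁻¹ d d' := by
    rw [conn_edge_inv]
    exact h.disj
  have h1 := ((planar_edge_inv h.invol).2 h.planar).merge hc
  have h3 := conn_swap_mul_of_not (α := σ⁻¹) hα
  have hf' : ¬ sc (α * σ⁻¹) d d' := by
    rw [sc_face_inv h.invol]
    exact h.not_face
  have h4 := sc_swap_mul_of_not hf'
  rw [conn_edge_inv, conn_edge_inv] at h3
  rw [← mul_assoc, sc_face_inv hinv, sc_face_inv h.invol] at h4
  refine ⟨⟨hinv, glue_edge_fixed h.fixed h.ne, fun x => ?_, (planar_edge_inv hinv).1 h1,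
    fun x hx => ?_⟩, ?_⟩
  · rw [h3]
    rcases h.conn x with h' | h'
    · exact Or.inl h'
    · exact Or.inr ⟨Or.inl (Setoid.refl' _ _), Or.inr (Setoid.symm' _ h')⟩
  · rw [h4] at hx
    have e1 : ¬ sc (σ * α) x d := fun h' => hx (Or.inl (Setoid.symm' _ h'))
    have e2 : ¬ sc (σ * α) x d' := fun h' => hx (Or.inr ⟨Or.inl (Setoid.refl' _ _), Or.inr h'⟩)
    rw [cyc_eq_of_sc_eq_glue h4 e1 e2]
    exact h.faces x (fun h' => e1 (Setoid.symm' _ h')) fun h' => e2 (Setoid.symm' _ h')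
  · rw [h4]
    exact glue_rel _ d d'

/-- Cutting an edge between the boundary and an inner face merges these faces and leaves the map
connected. -/
theorem IsMap.cut_triangle (h : IsMap σ α d) (hd : α d = d') (hf : ¬ sc (σ * α) d d') :
    IsJoined σ (swap d d' * α) d d' ∧
      sc (σ * (swap d d' * α)) = glue (sc (σ * α)) d d' := by
  have hne := h.ne hd
  have hα : sc α d d' := hd ▸ sc_step α d
  have hinv := swap_mul_invol h.invol (h.comm hd)
  have hf' : ¬ sc (α * σ⁻¹) d d' := by rwa [sc_face_inv h.invol]
  obtain ⟨h1, h2⟩ := ((planar_edge_inv h.invol).2 h.planar).split_of_not hne hα hf'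
  have h4 := sc_swap_mul_of_not hf'
  rw [conn_edge_inv, conn_edge_inv] at h2
  rw [← mul_assoc, sc_face_inv hinv, sc_face_inv h.invol] at h4
  refine ⟨⟨hinv, h.cut_fixed hd, fun x => ?_, (planar_edge_inv hinv).1 h1, ?_,
    fun x hx => ?_⟩, h4⟩
  · rw [h2]
    exact h.conn x
  · rw [h4]
    exact glue_rel _ d d'
  · rw [h4] at hx
    have e1 : ¬ sc (σ * α) x d := fun h' => hx (Or.inl (Setoid.symm' _ h'))
    have e2 : ¬ sc (σ * α) x d' := fun h' => hx (Or.inr ⟨Or.inl (Setoid.refl' _ _), Or.inr h'⟩)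
    rw [cyc_eq_of_sc_eq_glue h4 e1 e2]
    exact h.faces x fun h' => e1 (Setoid.symm' _ h')

/-- If `d'` is the third dart after `d`, multiplying by `swap d d'` cuts off a triangle. -/
theorem ncard_cyc_mul_swap {φ : Perm D} {d d' : D} (h1 : φ d ≠ d') (h2 : (φ ^ 2) d ≠ d')
    (h3 : (φ ^ 3) d = d') : cyc (φ * swap d d') d' = {d', φ d, φ (φ d)} ∧
      (cyc (φ * swap d d') d').ncard = 3 := by
  have e2 : (φ ^ 2) d = φ (φ d) := by rw [pow_two, Perm.mul_apply]
  have e3 : (φ ^ 3) d = φ (φ (φ d)) := by rw [pow_succ, pow_two, Perm.mul_apply, Perm.mul_apply]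
  rw [e2] at h2
  rw [e3] at h3
  have hdd : φ d ≠ d := fun h' => h1 (by rw [← h3, h', h', h'])
  have hdd2 : φ (φ d) ≠ d := fun h' => h1 (by rw [← h3, h'])
  have q0 : (φ * swap d d') d' = φ d := by simp
  have q1 : (φ * swap d d') (φ d) = φ (φ d) := by
    rw [Perm.mul_apply, swap_apply_of_ne_of_ne hdd h1]
  have q2 : (φ * swap d d') (φ (φ d)) = d' := by
    rw [Perm.mul_apply, swap_apply_of_ne_of_ne hdd2 h2, h3]
  have p2 : ((φ * swap d d') ^ 2) d' = φ (φ d) := by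
    rw [pow_two, Perm.mul_apply _ _ d', q0, q1]
  have hcyc : cyc (φ * swap d d') d' = {d', φ d, φ (φ d)} := by
    ext x
    rw [mem_cyc, sc_apply, sameCycle_iff_of_pow_eq (j := 3) (by norm_num)
      (by rw [pow_succ', Perm.mul_apply, p2, q2])]
    constructor
    · rintro ⟨i, hi, rfl⟩
      interval_cases i
      · simp
      · simp
      · exact Or.inr (Or.inr p2)
    · rintro (rfl | rfl | rfl)
      · exact ⟨0, by norm_num, rfl⟩
      · exact ⟨1, by norm_num, by rw [pow_one, q0]⟩
      · exact ⟨2, by norm_num, p2⟩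
  refine ⟨hcyc, ?_⟩
  rw [hcyc, Set.ncard_eq_three]
  exact ⟨_, _, _, h1.symm, h2.symm, fun h' => hdd (φ.injective h').symm, rfl⟩

/-- Gluing two legs that are three steps apart on the boundary cuts off a triangle. -/
theorem IsJoined.close (h : IsJoined σ α d d') (hne : d ≠ d')
    (h3 : ((σ * α) ^ 3) d = d') (h1 : (σ * α) d ≠ d') (h2 : ((σ * α) ^ 2) d ≠ d') :
    IsMap σ (swap d d' * α) d ∧ ¬ sc (σ * (swap d d' * α)) d d' := by
  have hd : α d = d := (h.fixed d).2 (Or.inl rfl)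
  have hd' : α d' = d' := (h.fixed d').2 (Or.inr rfl)
  have hinv := swap_mul_invol h.invol (swap_mul_comm_of_fixed hd hd')
  have hα : ¬ sc α d d' := fun h' => hne (eq_of_sc_of_fixed hd h').symm
  have hf' : sc (α * σ⁻¹) d d' := by
    rw [sc_face_inv h.invol]
    exact h.face
  obtain ⟨p1, p2⟩ := ((planar_edge_inv h.invol).2 h.planar).merge_of_sc hne hα hf'
  have h4 := sc_eq_glue_of_sc hne hf'
  have h5 := not_sc_swap_mul hne hf'
  -- the new face of `d'` consists of the last three darts before `d'`
  have hφ : σ * (swap d d' * α) = σ * α * swap d d' := by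
    rw [swap_mul_comm_of_fixed hd hd', mul_assoc]
  have hcard := (ncard_cyc_mul_swap h1 h2 h3).2
  rw [conn_edge_inv, conn_edge_inv] at p2
  rw [← mul_assoc, sc_face_inv hinv, sc_face_inv h.invol] at h4
  rw [← mul_assoc, sc_face_inv hinv] at h5
  refine ⟨⟨hinv, glue_edge_fixed h.fixed hne, fun x => ?_, (planar_edge_inv hinv).1 p1,
    fun x hx => ?_⟩, h5⟩
  · rw [p2]
    exact h.conn x
  · by_cases hx' : sc (σ * (swap d d' * α)) d' x
    · rw [← cyc_eq_of_sc hx', hφ]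
      exact hcard
    · have e1 : ¬ sc (σ * (swap d d' * α)) x d := fun h' => hx (Setoid.symm' _ h')
      have e2 : ¬ sc (σ * (swap d d' * α)) x d' := fun h' => hx' (Setoid.symm' _ h')
      rw [← cyc_eq_of_sc_eq_glue h4 e1 e2]
      refine h.faces x fun h' => ?_
      rw [h4] at h'
      rcases h' with h' | ⟨-, h' | h'⟩
      · exact hx h'
      · exact e1 h'
      · exact e2 h'

end Cut

end Transitions

/-! ### Weights of triangulations -/

section Weights

variable {R : Type*} [CommRing R]

/-- A property that depends only on the connected component of the leg. -/
def IsLocalProp (Q : ∀ D : Type, Perm D → Perm D → D → Prop) : Prop :=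
  ∀ (D D' : Type) [Finite D] [Finite D'] (i : D → D') (σ α : Perm D) (σ' α' : Perm D'),
    IsEmb i σ α σ' α' → ∀ r, Q D' σ' α' (i r) ↔ Q D σ α r

open Classical in
/-- The weight `f` restricted to the maps with the property `Q`. -/
def restrict (Q : ∀ D : Type, Perm D → Perm D → D → Prop)
    (f : ∀ D : Type, Perm D → Perm D → D → R) : ∀ D : Type, Perm D → Perm D → D → R :=
  fun D σ α r => if Q D σ α r then f D σ α r else 0

theorem IsLocalProp.restrict {Q : ∀ D : Type, Perm D → Perm D → D → Prop}
    {f : ∀ D : Type, Perm D → Perm D → D → R} (hQ : IsLocalProp Q) (hf : IsLocal f) :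
    IsLocal (restrict Q f) := by
  intro D D' _ _ i σ α σ' α' h r
  classical
  simp only [PercMaps.restrict, hf _ _ _ _ _ _ _ h]
  exact if_congr (hQ _ _ _ _ _ _ _ h r) rfl rfl

/-- The weight `Y ^ k * P ^ v` of a triangulation with a boundary of length `k` that visits
`v` vertices. The leg belongs to the contour of the boundary face, whence the subtraction. -/
def wt (P Y : R) : ∀ D : Type, Perm D → Perm D → D → R := fun _ σ α r =>
  Y ^ ((cyc (σ * α) r).ncard - 1) * P ^ numClasses (sc σ) (cyc (σ * α) r)

theorem isLocal_wt (P Y : R) : IsLocal (wt P Y) := by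
  intro D D' _ _ i σ α σ' α' h r
  rw [wt, wt, h.mul.ncard_cyc, ← h.mul.image_cyc, h.numClasses_image]

theorem isLocal_const (a : R) : IsLocal (fun _ _ _ _ => a) := fun _ _ _ _ _ _ _ _ _ _ _ => rfl

/-- The map is reduced to a vertex: the leg is alone at its vertex. -/
def IsTrivial : ∀ D : Type, Perm D → Perm D → D → Prop := fun _ σ _ r => σ r = r

/-- The boundary visits the root vertex only once. The leg takes up one corner of the boundary and
`σ r` the next one, whence the two exceptions; the map reduced to a vertex is excluded. -/
def IsSimpleAt : ∀ D : Type, Perm D → Perm D → D → Prop := fun _ σ α r =>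
  σ r ≠ r ∧ ∀ z, sc (σ * α) r z → sc σ r z → z = r ∨ z = σ r

theorem isLocalProp_isTrivial : IsLocalProp IsTrivial := by
  intro D D' _ _ i σ α σ' α' h r
  rw [IsTrivial, IsTrivial, ← h.left, h.inj.eq_iff]

theorem isLocalProp_not {Q : ∀ D : Type, Perm D → Perm D → D → Prop} (h : IsLocalProp Q) :
    IsLocalProp fun D σ α r => ¬ Q D σ α r :=
  fun D D' _ _ i σ α σ' α' he r => not_congr (h D D' i σ α σ' α' he r)

theorem isLocalProp_and {Q Q' : ∀ D : Type, Perm D → Perm D → D → Prop} (h : IsLocalProp Q)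
    (h' : IsLocalProp Q') : IsLocalProp fun D σ α r => Q D σ α r ∧ Q' D σ α r :=
  fun D D' _ _ i σ α σ' α' he r =>
    and_congr (h D D' i σ α σ' α' he r) (h' D D' i σ α σ' α' he r)

theorem isLocalProp_isSimpleAt : IsLocalProp IsSimpleAt := by
  intro D D' _ _ i σ α σ' α' h r
  rw [IsSimpleAt, IsSimpleAt, ← h.left, h.inj.ne_iff]
  refine and_congr Iff.rfl ⟨fun H z hz hz' => ?_, fun H z hz hz' => ?_⟩
  · have := H (i z) (h.mul.sc_iff'.2 hz) (h.sc_iff'.2 hz')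
    rwa [h.inj.eq_iff, h.inj.eq_iff] at this
  · obtain ⟨b, rfl, hb⟩ := h.sc_iff.1 hz'
    rw [h.inj.eq_iff, h.inj.eq_iff]
    exact H b (h.mul.sc_iff'.1 hz) hb

theorem finsum_mem_ite {X : Type*} (S : Set X) (Q : X → Prop) [DecidablePred Q] (f : X → R) :
    ∑ᶠ x ∈ S, (if Q x then f x else 0) = ∑ᶠ x ∈ {x | x ∈ S ∧ Q x}, f x := by
  refine finsum_congr fun x => ?_
  by_cases hQ : Q x <;> by_cases hS : x ∈ S <;> simp [hQ, hS]

end Weights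

/-! ### The first return of the boundary to the root vertex -/

section FirstReturn

variable {D : Type} [Finite D] [DecidableEq D]

/-- If the boundary is glued back to the root vertex at its first visit of the corner `c`, it closes
up at that moment. -/
theorem pow_apply_first {π : Perm D} {r s c : D} (hs : π s = s) (hrs : r ≠ s) {j : ℕ} (hj : 0 < j)
    (hc : (π ^ j) r = c) (hmin : ∀ i, 0 < i → i < j → (π ^ i) r ≠ c) :
    (∀ i < j, ((swap r s * (swap s c * π)) ^ i) r = (π ^ i) r) ∧
      ((swap r s * (swap s c * π)) ^ j) r = r := by
  have hns : ∀ i : ℕ, (π ^ i) r ≠ s := fun i h => by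
    have h' : (π ^ i) s = s := Perm.pow_apply_eq_self_of_apply_eq_self hs i
    exact hrs ((π ^ i).injective (h.trans h'.symm))
  have hnr : ∀ i, 0 < i → i < j → (π ^ i) r ≠ r := fun i h0 h1 h => by
    refine hmin (j - i) (by omega) (by omega) ?_
    rw [← hc, show j = (j - i) + i by omega, pow_add, Perm.mul_apply, h]
    congr 2
    omega
  have h1 := swap_mul_pow_apply (π := π) (a := s) (b := c) (r := r) (j := j)
    fun i h0 h1 => ⟨hns i, hmin i h0 h1⟩
  have h2 := swap_mul_pow_apply (π := swap s c * π) (a := r) (b := s) (r := r) (j := j)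
    fun i h0 h' => by
      rw [h1 i h']
      exact ⟨hnr i h0 h', hns i⟩
  refine ⟨fun i hi => (h2 i hi).trans (h1 i hi), ?_⟩
  obtain ⟨m, rfl⟩ : ∃ m, j = m + 1 := ⟨j - 1, by omega⟩
  rw [pow_succ', Perm.mul_apply, h2 m (by omega), h1 m (by omega), Perm.mul_apply,
    Perm.mul_apply, ← Perm.mul_apply π, ← pow_succ', hc, swap_apply_right, swap_apply_right]

variable {R : Type*} [CommRing R]

/-- The weights of two triangulations in terms of the boundary of the glued map: two darts of the
latter are legs, and one vertex is counted twice. -/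
theorem IsTwo.wt_mul_wt {σ α : Perm D} {r s a b : D} (h : IsTwo σ α r s) (ha : sc (σ * α) r a)
    (hb : sc (σ * α) s b) (P Y : R) :
    wt P Y D σ α r * wt P Y D σ α s =
      Y ^ ((cyc (swap a b * σ * α) r).ncard - 2) *
        P ^ (numClasses (sc (swap a b * σ)) (cyc (swap a b * σ * α) r) + 1) := by
  have hcyc : cyc (swap a b * σ * α) r = cyc (σ * α) r ∪ cyc (σ * α) s := by
    have h1 := h.sc_face_merge ha hb
    have h2 : sc (swap a b * σ * α) r a := by
      rw [h1]
      exact Or.inl ha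
    rw [cyc_eq_of_sc h2, cyc_eq_union_of_sc_eq_glue h1, cyc_eq_of_sc ha, cyc_eq_of_sc hb]
  have hdisj : Disjoint (cyc (σ * α) r) (cyc (σ * α) s) := by
    rw [Set.disjoint_left]
    intro x hx hx'
    exact h.not_face (Setoid.trans' _ hx (Setoid.symm' _ hx'))
  have hr : 0 < (cyc (σ * α) r).ncard := (Set.ncard_pos).2 ⟨r, self_mem_cyc _ r⟩
  have hs : 0 < (cyc (σ * α) s).ncard := (Set.ncard_pos).2 ⟨s, self_mem_cyc _ s⟩
  rw [hcyc, h.sc_merge ha hb, numClasses_glue (show a ∈ _ ∪ _ from Or.inl ha)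
    (show b ∈ _ ∪ _ from Or.inr hb) (fun h' => h.not_conn ha hb (sc_le_conn_left σ α h')), numClasses_union,
    Set.ncard_union_eq hdisj, wt, wt,
    show (cyc (σ * α) r).ncard + (cyc (σ * α) s).ncard - 2 =
      ((cyc (σ * α) r).ncard - 1) + ((cyc (σ * α) s).ncard - 1) by omega]
  · ring
  · intro x hx y hy hxy
    exact h.not_conn hx hy (sc_le_conn_left σ α hxy)

theorem wt_of_trivial {σ α : Perm D} {s : D} (h : σ s = s) (h' : α s = s) (P Y : R) :
    wt P Y D σ α s = P := by
  have : cyc (σ * α) s = {s} := by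
    ext x
    rw [mem_cyc, Set.mem_singleton_iff]
    refine ⟨fun hx => eq_of_sc_of_fixed ?_ hx, fun hx => hx ▸ self_mem_cyc _ _⟩
    rw [Perm.mul_apply, h', h]
  rw [wt, this, numClasses, Set.image_singleton, Set.ncard_singleton, Set.ncard_singleton]
  simp

/-- Facts on a pair of triangulations glued at their root vertices, whose second leg is then
removed. -/
theorem IsTwo.glue_detach {σ α : Perm D} {r s : D} (h : IsTwo σ α r s) :
    ∃ τ c, τ = swap s ((swap r s * σ) s) * (swap r s * σ) ∧ c = (swap r s * σ) s ∧
      σ = swap r s * (swap s c * τ) ∧ IsTwo τ α r s ∧ τ s = s ∧ sc (τ * α) r c ∧ sc τ r c := by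
  have h1 := h.merge (Setoid.refl' _ r) (Setoid.refl' _ s)
  obtain ⟨h2, h3⟩ := h1.detach h.ne
  have h4 := h1.detach_face h.ne
  refine ⟨_, _, rfl, rfl, ?_, h2, h3, h4, ?_⟩
  · rw [swap_mul_self_mul, swap_mul_self_mul]
  · have hne : s ≠ (swap r s * σ) s := by
      intro h'
      rw [← h'] at h4
      exact h2.not_face (by rwa [← h'])
    have e1 := sc_eq_glue_of_sc hne (sc_step _ s)
    have e2 : sc (swap r s * σ) r s := by
      rw [h.sc_merge (Setoid.refl' _ r) (Setoid.refl' _ s)]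
      exact glue_rel _ r s
    rw [e1] at e2
    have e3 : ∀ x, sc (swap s ((swap r s * σ) s) * (swap r s * σ)) x s → x = s := fun x hx =>
      eq_of_sc_of_fixed h3 (Setoid.symm' _ hx)
    rcases e2 with e2 | ⟨e2 | e2, -⟩
    · exact absurd (e3 _ e2) h.ne
    · exact absurd (e3 _ e2) h.ne
    · exact e2

/-- Decomposition of a triangulation at the first return of its boundary to the root vertex. -/
theorem sum_first_return (P Y : R) (r s : D) :
    ∑ᶠ M ∈ {M : Perm D × Perm D | IsTwo M.1 M.2 r s},
      restrict (fun D σ α r => ¬ IsTrivial D σ α r) (wt P Y) D M.1 M.2 r *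
        restrict IsTrivial (fun _ _ _ _ => P) D M.1 M.2 s =
    ∑ᶠ M ∈ {M : Perm D × Perm D | IsTwo M.1 M.2 r s},
      restrict IsSimpleAt (wt P Y) D M.1 M.2 r * wt P Y D M.1 M.2 s := by
  classical
  simp only [restrict, ite_mul, zero_mul, mul_ite, mul_zero, ← ite_and]
  rw [finsum_mem_ite, finsum_mem_ite]
  symm
  refine finsum_mem_eq_of_bijOn
    (fun M => (swap s ((swap r s * M.1) s) * (swap r s * M.1), M.2)) ⟨?_, ?_, ?_⟩ ?_
  · rintro ⟨σ, α⟩ ⟨h, hne, hsimple⟩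
    obtain ⟨τ, c, hτ, hc, hσ, h2, hs, hf, hv⟩ := h.glue_detach
    change IsTwo σ α r s at h
    change σ = _ at hσ
    change τ = swap s ((swap r s * σ) s) * (swap r s * σ) at hτ
    change (swap s ((swap r s * σ) s) * (swap r s * σ), α) ∈ _
    rw [← hτ]
    refine ⟨h2, hs, fun hr => ?_⟩
    change τ r = r at hr
    change σ r ≠ r at hne
    change sc (τ * α) r c at hf
    have hα : α r = r := (h.fixed r).2 (Or.inl rfl)
    have hrr : (τ * α) r = r := by rw [Perm.mul_apply, hα, hr]
    have hcr : c = r := eq_of_sc_of_fixed hrr hf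
    rw [hcr, swap_comm s r, swap_mul_self_mul] at hσ
    exact hne (hσ ▸ hr)
  · -- the gluing point is recovered as the first return of the boundary to the root vertex
    have key : ∀ σ σ' τ α : Perm D, ∀ c c' : D, ∀ j j' : ℕ, IsTwo σ α r s → IsTwo σ' α r s →
        σ r ≠ r → IsSimpleAt D σ' α r → σ = swap r s * (swap s c * τ) →
        σ' = swap r s * (swap s c' * τ) → τ s = s → sc τ r c →
        0 < j → ((τ * α) ^ j) r = c → (∀ i, 0 < i → i < j → ((τ * α) ^ i) r ≠ c) →
        0 < j' → ((τ * α) ^ j') r = c' → (∀ i, 0 < i → i < j' → ((τ * α) ^ i) r ≠ c') →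
        j < j' → False := by
      intro σ σ' τ α c c' j j' h h' hne hsimple hσ hσ' hs hv hj hjc hjmin hj' hjc' hjmin' hlt
      have hα : α r = r := (h.fixed r).2 (Or.inl rfl)
      have hαs : α s = s := (h.fixed s).2 (Or.inr rfl)
      have hfs : (τ * α) s = s := by rw [Perm.mul_apply, hαs, hs]
      have hφ : σ * α = swap r s * (swap s c * (τ * α)) := by rw [hσ]; simp only [mul_assoc]
      have hφ' : σ' * α = swap r s * (swap s c' * (τ * α)) := by rw [hσ']; simp only [mul_assoc]
      obtain ⟨q1, q2⟩ := pow_apply_first hfs h.ne hj hjc hjmin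
      obtain ⟨q1', q2'⟩ := pow_apply_first hfs h.ne hj' hjc' hjmin'
      rw [← hφ] at q1 q2
      rw [← hφ'] at q1' q2'
      have hcF : sc (σ' * α) r c := ⟨j, by rw [zpow_natCast, q1' j hlt, hjc]⟩
      have hcV : sc σ' r c := by
        have e1 : sc (swap r s * σ') r c := by
          rw [hσ', swap_mul_self_mul]
          by_cases hsc' : sc τ s c'
          · have : c' = s := eq_of_sc_of_fixed hs hsc'
            rw [this, swap_self]
            exact hv
          · rw [sc_swap_mul_of_not hsc']
            exact Or.inl hv
        rw [h'.sc_merge (Setoid.refl' _ r) (Setoid.refl' _ s)] at e1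
        rcases e1 with e1 | ⟨-, e1 | e1⟩
        · exact e1
        · exact Setoid.symm' _ e1
        · exact absurd (sc_le_conn_left _ α (Setoid.symm' _ e1))
            (fun h0 => h'.not_conn hcF (Setoid.refl' _ s) (Setoid.symm' _ h0))
      rcases hsimple.2 c hcF hcV with hcr | hcr
      · refine hjmin' (j' - j) (by omega) (by omega) ?_
        conv_rhs => rw [← hjc', show j' = (j' - j) + j by omega, pow_add, Perm.mul_apply, hjc, hcr]
      · have e1 : (σ' * α) r = (τ * α) r := by simpa using q1' 1 (by omega)
        have e2 : (τ * α) r = c := by rw [← e1, hcr, Perm.mul_apply, hα]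
        have hj1 : j = 1 := by
          by_contra hj1
          exact hjmin 1 one_pos (by omega) (by rw [pow_one, e2])
        rw [hj1, pow_one, Perm.mul_apply, hα] at q2
        exact hne q2
    rintro ⟨σ, α⟩ ⟨h, hne, hsimple⟩ ⟨σ', α'⟩ ⟨h', hne', hsimple'⟩ heq
    simp only [Prod.mk.injEq] at heq
    obtain ⟨heq, rfl⟩ := heq
    change IsTwo σ α r s at h
    change IsTwo σ' α r s at h'
    obtain ⟨τ, c, hτ, hc, hσ, h2, hs, hf, hv⟩ := h.glue_detach
    obtain ⟨τ', c', hτ', hc', hσ', h2', hs', hf', hv'⟩ := h'.glue_detach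
    obtain rfl : τ = τ' := by rw [hτ, hτ', heq]
    obtain ⟨j, hj, hjc, hjmin⟩ := exists_pow_first hf
    obtain ⟨j', hj', hjc', hjmin'⟩ := exists_pow_first hf'
    have hjj : j = j' := by
      rcases lt_trichotomy j j' with hlt | heq' | hlt
      · exact (key σ σ' τ α c c' j j' h h' hne ⟨hne', hsimple'⟩ hσ hσ' hs hv hj hjc hjmin hj' hjc'
          hjmin' hlt).elim
      · exact heq'
      · exact (key σ' σ τ α c' c j' j h' h hne' ⟨hne, hsimple⟩ hσ' hσ hs hv' hj' hjc' hjmin' hj hjc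
          hjmin hlt).elim
    have hcc : c = c' := by rw [← hjc, ← hjc', hjj]
    rw [hσ, hσ', hcc]
  -- Surjectivity: `c` is the first corner of the root vertex that the boundary meets after it has
  -- left this vertex; the map is cut there, and the leg `s` marks the second part.
  · rintro ⟨τ, α⟩ ⟨h, hs, hne⟩
    change IsTwo τ α r s at h
    change τ s = s at hs
    change ¬ τ r = r at hne
    have hα : α r = r := (h.fixed r).2 (Or.inl rfl)
    have hαs : α s = s := (h.fixed s).2 (Or.inr rfl)
    have hfs : (τ * α) s = s := by rw [Perm.mul_apply, hαs, hs]
    have hfr : (τ * α) r = τ r := by rw [Perm.mul_apply, hα]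
    have hex : ∃ j, 2 ≤ j ∧ sc τ r (((τ * α) ^ j) r) := by
      obtain ⟨N, hN, hNr, -⟩ := exists_pow_first (Perm.SameCycle.refl (τ * α) r)
      refine ⟨N, ?_, by rw [hNr]⟩
      by_contra hlt
      have hN1 : N = 1 := by omega
      rw [hN1, pow_one, hfr] at hNr
      exact hne hNr
    set j := Nat.find hex with hjdef
    obtain ⟨hj2, hjV⟩ := Nat.find_spec hex
    have hmin2 : ∀ i, 2 ≤ i → i < j → ¬ sc τ r (((τ * α) ^ i) r) := fun i hi hlt hv =>
      Nat.find_min hex hlt ⟨hi, hv⟩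
    rw [← hjdef] at hj2 hjV
    obtain ⟨c, hc⟩ : ∃ c, ((τ * α) ^ j) r = c := ⟨_, rfl⟩
    rw [hc] at hjV
    have hmin : ∀ i, 0 < i → i < j → ((τ * α) ^ i) r ≠ c := by
      intro i h0 hij hic
      rcases Nat.lt_or_ge i 2 with hi | hi
      · obtain rfl : i = 1 := by omega
        have e : ((τ * α) ^ (j - 1)) r = r := by
          refine (τ * α).injective ?_
          rw [← Perm.mul_apply, ← pow_succ', show j - 1 + 1 = j by omega, hc, ← hic, pow_one]
        rcases Nat.lt_or_ge (j - 1) 2 with h1 | h1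
        · have : j - 1 = 1 := by omega
          rw [this, pow_one, hfr] at e
          exact hne e
        · exact hmin2 (j - 1) h1 (by omega) (by rw [e])
      · exact hmin2 i hi hij (hic ▸ hjV)
    have hcF : sc (τ * α) r c := ⟨j, by rw [zpow_natCast, hc]⟩
    have hm := h.merge hcF (Setoid.refl' _ s)
    have hmV : sc (swap c s * τ) r s := by
      rw [h.sc_merge hcF (Setoid.refl' _ s)]
      exact Or.inr ⟨Or.inl hjV, Or.inr (Setoid.refl' _ s)⟩
    have hσ2 := hm.split h.ne hmV (Setoid.refl' _ r) hm.face (hm.planar.split h.ne hmV hm.face).2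
    rw [swap_comm c s] at hσ2 hm
    obtain ⟨q1, q2⟩ := pow_apply_first hfs h.ne (by omega) hc hmin
    have hφ : swap r s * (swap s c * τ) * α = swap r s * (swap s c * (τ * α)) := by
      simp only [mul_assoc]
    rw [← hφ] at q1 q2
    have hσr : (swap r s * (swap s c * τ)) r = (τ * α) r := by
      have := q1 1 (by omega)
      rwa [pow_one, pow_one, Perm.mul_apply _ α, hα] at this
    refine ⟨(swap r s * (swap s c * τ), α), ⟨hσ2, ?_, ?_⟩, ?_⟩
    · change (swap r s * (swap s c * τ)) r ≠ r
      rw [hσr, hfr]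
      exact hne
    · intro z hz hzV
      change z = r ∨ z = (swap r s * (swap s c * τ)) r
      change sc (swap r s * (swap s c * τ)) r z at hzV
      change sc (swap r s * (swap s c * τ) * α) r z at hz
      obtain ⟨i, hi, hiz⟩ := (sameCycle_iff_of_pow_eq (by omega) q2).1 hz
      rw [q1 i hi] at hiz
      have hzF : sc (τ * α) r z := ⟨i, by rw [zpow_natCast, hiz]⟩
      have hzV' : sc τ r z := by
        have e1 : sc (swap r s * (swap r s * (swap s c * τ))) r z := by
          rw [hσ2.sc_merge (Setoid.refl' _ r) (Setoid.refl' _ s)]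
          exact Or.inl hzV
        rw [swap_mul_self_mul, swap_comm, h.sc_merge hcF (Setoid.refl' _ s)] at e1
        rcases e1 with e1 | ⟨-, e1 | e1⟩
        · exact e1
        · exact Setoid.trans' _ hjV (Setoid.symm' _ e1)
        · exact absurd (sc_le_conn_left _ α e1) (h.not_conn hzF (Setoid.refl' _ s))
      rcases Nat.lt_or_ge i 2 with hi2 | hi2
      · interval_cases i
        · exact Or.inl (by simpa using hiz.symm)
        · right
          rw [hσr, ← hiz, pow_one]
      · exact absurd (hiz ▸ hzV') (hmin2 i hi2 hi)
    · simp only [swap_mul_self_mul, Prod.mk.injEq, and_true]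
      rw [show (swap s c * τ) s = c by simp [hs], swap_mul_self_mul]
  · rintro ⟨σ, α⟩ ⟨h, -⟩
    change IsTwo σ α r s at h
    change wt P Y D σ α r * wt P Y D σ α s =
      wt P Y D (swap s ((swap r s * σ) s) * (swap r s * σ)) α r * P
    obtain ⟨τ, c, hτ, hc, hσ, h2, hs, hf, hv⟩ := h.glue_detach
    have hP := wt_of_trivial hs ((h2.fixed s).2 (Or.inr rfl)) P Y
    have e := h2.wt_mul_wt hf (Setoid.refl' _ s) P Y
    have : swap c s * τ = swap r s * σ := by rw [hσ, swap_mul_self_mul, swap_comm]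
    rw [hP, this] at e
    rw [← hτ, e, h.wt_mul_wt (Setoid.refl' _ r) (Setoid.refl' _ s)]

end FirstReturn

/-! ### The removal of the root edge -/

section Tutte

variable {R : Type*} [CommRing R]

/-- The boundary has length at least two; its contour has one dart more, the leg. -/
def IsLong : ∀ D : Type, Perm D → Perm D → D → Prop := fun _ σ α r =>
  3 ≤ (cyc (σ * α) r).ncard

/-- The boundary visits the end of the root edge only once. On the boundary the leg `r` is followed
by the root dart, and the latter by a dart that starts at the end of the root edge. -/
def IsSimpleNext : ∀ D : Type, Perm D → Perm D → D → Prop := fun _ σ α r =>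
  ∀ z, sc (σ * α) r z → sc σ ((σ * α) ((σ * α) r)) z → z = (σ * α) ((σ * α) r)

theorem isLocalProp_isLong : IsLocalProp IsLong := by
  intro D D' _ _ i σ α σ' α' h r
  rw [IsLong, IsLong, h.mul.ncard_cyc]

theorem isLocalProp_isSimpleNext : IsLocalProp IsSimpleNext := by
  intro D D' _ _ i σ α σ' α' h r
  rw [IsSimpleNext, IsSimpleNext, ← h.mul.left, ← h.mul.left]
  refine ⟨fun H z hz hz' => ?_, fun H z hz hz' => ?_⟩
  · have := H (i z) (h.mul.sc_iff'.2 hz) (h.sc_iff'.2 hz')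
    rwa [h.inj.eq_iff] at this
  · obtain ⟨b, rfl, hb⟩ := h.sc_iff.1 hz'
    rw [h.inj.eq_iff]
    exact H b (h.mul.sc_iff'.1 hz) hb

/-- The weight of a triangulation with root `d` and without leg. -/
def mapWt {D : Type} (P Y : R) (σ α : Perm D) (d : D) : R :=
  Y ^ (cyc (σ * α) d).ncard * P ^ numClasses (sc σ) (cyc (σ * α) d)

variable {D : Type} [Finite D] [DecidableEq D]

theorem numClasses_eq_of {s : Setoid D} {A B : Set D} (h : ∀ a ∈ A, ∃ b ∈ B, s a b)
    (h' : ∀ b ∈ B, ∃ a ∈ A, s a b) : numClasses s A = numClasses s B :=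
  numClasses_congr (fun a b => s a b) h h' fun _ _ _ _ ha hb =>
    ⟨fun hab => s.trans (s.symm ha) (s.trans hab hb), fun hab => s.trans ha (s.trans hab (s.symm hb))⟩

theorem numClasses_singleton (s : Setoid D) (a : D) : numClasses s {a} = 1 := by
  rw [numClasses, Set.image_singleton, Set.ncard_singleton]

/-- Triangulations whose root edge `{d, d'}` is a bridge: it is cut into two legs. -/
theorem sum_bridge (P Y : R) (d d' : D) :
    ∑ᶠ M ∈ {M : Perm D × Perm D | (IsMap M.1 M.2 d ∧ M.2 d = d') ∧ sc (M.1 * M.2) d d'},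
      mapWt P Y M.1 M.2 d =
    ∑ᶠ M ∈ {M : Perm D × Perm D | IsTwo M.1 M.2 d d'},
      Y ^ 2 * (wt P Y D M.1 M.2 d * wt P Y D M.1 M.2 d') := by
  refine finsum_mem_eq_of_bijOn (fun M => (M.1, swap d d' * M.2)) ⟨?_, ?_, ?_⟩ ?_
  · rintro ⟨σ, α⟩ ⟨⟨h, hd⟩, hf⟩
    exact (IsMap.cut_bridge h hd hf).1
  · rintro ⟨σ, α⟩ _ ⟨σ', α'⟩ _ heq
    simpa using heq
  · rintro ⟨σ, α⟩ h
    change IsTwo σ α d d' at h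
    obtain ⟨h1, h2⟩ := h.bridge
    refine ⟨(σ, swap d d' * α), ⟨⟨h1, ?_⟩, h2⟩, ?_⟩
    · change (swap d d' * α) d = d'
      rw [Perm.mul_apply, (h.fixed d).2 (Or.inl rfl), swap_apply_left]
    · simp only [swap_mul_self_mul]
  · rintro ⟨σ, α⟩ ⟨⟨h, hd⟩, hf⟩
    change IsMap σ α d at h
    change mapWt P Y σ α d = Y ^ 2 * (wt P Y D σ (swap d d' * α) d * wt P Y D σ (swap d d' * α) d')
    obtain ⟨h1, h2⟩ := h.cut_bridge hd hf
    set φ' := σ * (swap d d' * α) with hφ'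
    have hdisj : Disjoint (cyc φ' d) (cyc φ' d') := by
      rw [Set.disjoint_left]
      intro x hx hx'
      exact h1.not_face (Setoid.trans' _ hx (Setoid.symm' _ hx'))
    have hr : 0 < (cyc φ' d).ncard := (Set.ncard_pos).2 ⟨d, self_mem_cyc _ d⟩
    have hs : 0 < (cyc φ' d').ncard := (Set.ncard_pos).2 ⟨d', self_mem_cyc _ d'⟩
    rw [mapWt, wt, wt, ← hφ', cyc_eq_union_of_sc_eq_glue h2, Set.ncard_union_eq hdisj,
      numClasses_union]
    · obtain ⟨a, ha⟩ : ∃ a, (cyc φ' d).ncard = a + 1 :=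
        ⟨(cyc φ' d).ncard - 1, by omega⟩
      obtain ⟨b, hb⟩ : ∃ b, (cyc φ' d').ncard = b + 1 :=
        ⟨(cyc φ' d').ncard - 1, by omega⟩
      rw [ha, hb]
      simp only [Nat.add_sub_cancel]
      ring
    · intro x hx y hy hxy
      exact h1.not_conn hx hy (sc_le_conn_left _ _ hxy)

open Classical in
/-- Triangulations whose root edge is incident to an inner triangle: the triangle is opened, and
one of the two halves of the root edge is removed. -/
theorem sum_triangle (P Y : R) {d d' : D} (hne : d ≠ d') :
    ∑ᶠ M ∈ {M : Perm D × Perm D | (IsMap M.1 M.2 d ∧ M.2 d = d') ∧ ¬ sc (M.1 * M.2) d d'},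
      P * Y * mapWt P Y M.1 M.2 d =
    ∑ᶠ M ∈ {M : Perm D × Perm D | IsTwo M.1 M.2 d d' ∧ IsTrivial D M.1 M.2 d' ∧
        IsLong D M.1 M.2 d},
      (if IsSimpleNext D M.1 M.2 d then 1 else P) * wt P Y D M.1 M.2 d := by
  -- the opened map, and the map from which the leg `d'` is removed
  have fwd : ∀ σ α : Perm D, IsMap σ α d → α d = d' → ¬ sc (σ * α) d d' →
      ∃ τ β, τ = swap d' (σ d') * σ ∧ β = swap d d' * α ∧ σ = swap d' (σ d') * τ ∧
        IsTwo τ β d d' ∧ τ d' = d' ∧ sc (τ * β) d (σ d') ∧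
        (τ * β) d ≠ d ∧ (τ * β) ((τ * β) d) ≠ d ∧
        (τ * β) ((τ * β) ((τ * β) d)) = σ d' ∧
        cyc (σ * α) d' = {d', (τ * β) d, (τ * β) ((τ * β) d)} ∧
        cyc (σ * α) d ∪ cyc (σ * α) d' = cyc (τ * β) d ∪ {d'} := by
    intro σ α h hd hf
    obtain ⟨h1, h2⟩ := h.cut_triangle hd hf
    obtain ⟨h3, h4⟩ := h1.detach hne
    have h5 := h1.detach_face hne
    have hd' : α d' = d := by rw [← hd, h.invol]
    set β := swap d d' * α with hβ
    have hβd : β d = d := (h1.fixed d).2 (Or.inl rfl)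
    have hβd' : β d' = d' := (h1.fixed d').2 (Or.inr rfl)
    set τ := swap d' (σ d') * σ with hτ
    have hσ : σ = swap d' (σ d') * τ := by rw [hτ, swap_mul_self_mul]
    set g := σ d' with hg
    set φ := σ * α with hφ
    set φ' := σ * β with hφ'
    -- the three darts of the triangle
    have hcard : (cyc φ d').ncard = 3 := h.faces d' hf
    have hx0 : φ d' ≠ d' := by
      intro h0
      have : cyc φ d' = {d'} := by
        ext z
        rw [mem_cyc, Set.mem_singleton_iff]
        exact ⟨fun hz => eq_of_sc_of_fixed h0 hz, fun hz => hz ▸ self_mem_cyc _ _⟩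
      rw [this, Set.ncard_singleton] at hcard
      omega
    have hpow : ∃ N, 0 < N ∧ (φ ^ N) d' = d' ∧ ∀ i, 0 < i → i < N → (φ ^ i) d' ≠ d' :=
      exists_pow_first (Perm.SameCycle.refl φ d')
    obtain ⟨N, hN, hNd, hNmin⟩ := hpow
    have hcycN : cyc φ d' = (fun i => (φ ^ i) d') '' Set.Iio N := by
      ext z
      rw [mem_cyc, sc_apply, sameCycle_iff_of_pow_eq hN hNd]
      rfl
    have hN3 : N = 3 := by
      rw [hcycN, Set.InjOn.ncard_image] at hcard
      · simpa using hcard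
      · have aux : ∀ i j, i < j → j < N → (φ ^ i) d' = (φ ^ j) d' → False := by
          intro i j hij hj he
          refine hNmin (j - i) (by omega) (by omega) ((φ ^ i).injective ?_)
          rw [← Perm.mul_apply, ← pow_add, he]
          congr 2
          omega
        intro i hi j hj he
        rcases lt_trichotomy i j with hlt | heq | hlt
        · exact (aux i j hlt hj he).elim
        · exact heq
        · exact (aux j i hlt hi he.symm).elim
    subst hN3
    have hy0 : φ (φ d') ≠ d' := by
      have := hNmin 2 (by norm_num) (by norm_num)
      rwa [pow_two, Perm.mul_apply] at this
    have h30 : φ (φ (φ d')) = d' := by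
      rwa [pow_succ, pow_two, Perm.mul_apply, Perm.mul_apply] at hNd
    have hnd : ∀ z, sc φ d' z → z ≠ d := fun z hz hzd => hf (Setoid.symm' _ (hzd ▸ hz))
    have sx : sc φ d' (φ d') := sc_step φ d'
    have sy : sc φ d' (φ (φ d')) := Setoid.trans' _ sx (sc_step φ _)
    have hφφ : φ' = φ * swap d d' := by
      rw [hφ', hβ, h.comm hd, ← mul_assoc]
    have e1 : φ' d = φ d' := by rw [hφφ, Perm.mul_apply, swap_apply_left]
    have e2 : φ' (φ d') = φ (φ d') := by
      rw [hφφ, Perm.mul_apply, swap_apply_of_ne_of_ne (hnd _ sx) hx0]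
    have e3 : φ' (φ (φ d')) = d' := by
      rw [hφφ, Perm.mul_apply, swap_apply_of_ne_of_ne (hnd _ sy) hy0, h30]
    have e4 : φ' d' = g := by rw [hφ', Perm.mul_apply, hβd']
    have hφ'' : τ * β = swap d' g * φ' := by rw [hτ, mul_assoc]
    have hxg : φ d' ≠ g := fun h0 => hne (φ'.injective (by rw [e1, e4, h0]))
    have hyg : φ (φ d') ≠ g := fun h0 => hx0 (φ'.injective (by rw [e2, e4, h0]))
    have f1 : (τ * β) d = φ d' := by
      rw [hφ'', Perm.mul_apply, e1, swap_apply_of_ne_of_ne hx0 hxg]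
    have f2 : (τ * β) (φ d') = φ (φ d') := by
      rw [hφ'', Perm.mul_apply, e2, swap_apply_of_ne_of_ne hy0 hyg]
    have f3 : (τ * β) (φ (φ d')) = g := by
      rw [hφ'', Perm.mul_apply, e3, swap_apply_left]
    refine ⟨τ, β, rfl, rfl, hσ, h3, h4, h5, ?_, ?_, ?_, ?_, ?_⟩
    · rw [f1]
      exact hnd _ sx
    · rw [f1, f2]
      exact hnd _ sy
    · rw [f1, f2, f3]
    · rw [f1, f2, hcycN]
      ext z
      constructor
      · rintro ⟨i, hi, rfl⟩
        have : i < 3 := hi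
        interval_cases i
        · simp
        · simp
        · right
          right
          simp only [pow_two, Perm.mul_apply]
          rfl
      · rintro (rfl | rfl | rfl)
        · exact ⟨0, by simp, rfl⟩
        · exact ⟨1, by simp, by simp⟩
        · exact ⟨2, by simp, by simp only [pow_two, Perm.mul_apply]⟩
    · rw [← cyc_eq_union_of_sc_eq_glue h2]
      have hm := h3.sc_face_merge h5 (Setoid.refl' _ d')
      rw [swap_comm, ← hσ] at hm
      have : cyc (τ * β) d' = {d'} := by
        ext z
        rw [mem_cyc, Set.mem_singleton_iff]
        refine ⟨fun hz => eq_of_sc_of_fixed ?_ hz, fun hz => hz ▸ self_mem_cyc _ _⟩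
        rw [Perm.mul_apply, hβd', h4]
      rw [cyc_eq_of_sc (a := d) (b := g), cyc_eq_union_of_sc_eq_glue hm, this, cyc_eq_of_sc h5]
      rw [hm]
      exact Or.inl h5
  refine finsum_mem_eq_of_bijOn
    (fun M => (swap d' (M.1 d') * M.1, swap d d' * M.2)) ⟨?_, ?_, ?_⟩ ?_
  · rintro ⟨σ, α⟩ ⟨⟨h, hd⟩, hf⟩
    obtain ⟨τ, β, hτ, hβ, hσ, h2, ht, hg, n1, n2, n3, -, -⟩ := fwd σ α h hd hf
    change (swap d' (σ d') * σ, swap d d' * α) ∈ _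
    rw [← hτ, ← hβ]
    refine ⟨h2, ht, ?_⟩
    have hsub : ({d, (τ * β) d, (τ * β) ((τ * β) d)} : Set D) ⊆ cyc (τ * β) d := by
      rintro z (rfl | rfl | rfl)
      · exact self_mem_cyc _ _
      · exact sc_step _ _
      · exact Setoid.trans' _ (sc_step _ _) (sc_step _ _)
    have h3 : ({d, (τ * β) d, (τ * β) ((τ * β) d)} : Set D).ncard = 3 :=
      Set.ncard_eq_three.2 ⟨_, _, _, n1.symm, n2.symm,
        fun h' => n1 ((τ * β).injective h').symm, rfl⟩
    have := Set.ncard_le_ncard hsub (Set.toFinite _)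
    rw [h3] at this
    exact this
  · rintro ⟨σ, α⟩ ⟨⟨h, hd⟩, hf⟩ ⟨σ', α'⟩ ⟨⟨h', hd'⟩, hf'⟩ heq
    obtain ⟨τ, β, hτ, hβ, hσ, -, -, -, -, -, n3, -⟩ := fwd σ α h hd hf
    obtain ⟨τ', β', hτ', hβ', hσ', -, -, -, -, -, n3', -⟩ := fwd σ' α' h' hd' hf'
    simp only [Prod.mk.injEq] at heq
    obtain ⟨q1, q2⟩ := heq
    rw [← hτ, ← hτ'] at q1
    subst q1
    have hα : α = α' := mul_left_cancel q2
    have hββ : β = β' := by rw [hβ, hβ', hα]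
    subst hββ
    rw [Prod.mk.injEq]
    refine ⟨?_, hα⟩
    rw [hσ, hσ', ← n3, ← n3']
  · rintro ⟨τ, β⟩ ⟨h, ht, hl⟩
    change IsTwo τ β d d' at h
    change τ d' = d' at ht
    change 3 ≤ (cyc (τ * β) d).ncard at hl
    have hβd : β d = d := (h.fixed d).2 (Or.inl rfl)
    have hβd' : β d' = d' := (h.fixed d').2 (Or.inr rfl)
    have n1 : (τ * β) d ≠ d := by
      intro h0
      have : cyc (τ * β) d ⊆ {d} := fun z hz => eq_of_sc_of_fixed h0 hz
      have := Set.ncard_le_ncard this (Set.toFinite _)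
      rw [Set.ncard_singleton] at this
      omega
    have n2 : (τ * β) ((τ * β) d) ≠ d := by
      intro h0
      have : cyc (τ * β) d ⊆ {d, (τ * β) d} := by
        intro z hz
        obtain ⟨i, hi, rfl⟩ := (sameCycle_iff_of_pow_eq (j := 2) (by norm_num)
          (by rw [pow_two, Perm.mul_apply, h0])).1 hz
        interval_cases i <;> simp
      have h2 := Set.ncard_le_ncard this (Set.toFinite _)
      have := Set.ncard_insert_le d ({(τ * β) d} : Set D)
      rw [Set.ncard_singleton] at this
      omega
    set g := (τ * β) ((τ * β) ((τ * β) d)) with hg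
    have hgF : sc (τ * β) d g := Setoid.trans' _ (sc_step _ _)
      (Setoid.trans' _ (sc_step _ _) (sc_step _ _))
    have hj := h.merge hgF (Setoid.refl' _ d')
    have hF : ∀ z, sc (τ * β) d z → z ≠ d' := fun z hz h0 => h.not_face (h0 ▸ hz)
    have s1 : sc (τ * β) d ((τ * β) d) := sc_step _ _
    have s2 : sc (τ * β) d ((τ * β) ((τ * β) d)) := Setoid.trans' _ s1 (sc_step _ _)
    have e1 : (swap g d' * τ * β) d = (τ * β) d := by
      rw [mul_assoc, Perm.mul_apply, swap_apply_of_ne_of_ne _ (hF _ s1)]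
      intro h0
      exact n2 ((τ * β).injective h0).symm
    have e2 : (swap g d' * τ * β) ((τ * β) d) = (τ * β) ((τ * β) d) := by
      rw [mul_assoc, Perm.mul_apply, swap_apply_of_ne_of_ne _ (hF _ s2)]
      intro h0
      exact n1 ((τ * β).injective ((τ * β).injective h0)).symm
    have e3 : (swap g d' * τ * β) ((τ * β) ((τ * β) d)) = d' := by
      rw [mul_assoc, Perm.mul_apply, ← hg, swap_apply_left]
    obtain ⟨hM, hMf⟩ := hj.close hne
      (by rw [pow_succ, pow_two, Perm.mul_apply, Perm.mul_apply, e1, e2, e3])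
      (by rw [e1]; exact hF _ s1)
      (by rw [pow_two, Perm.mul_apply, e1, e2]; exact hF _ s2)
    refine ⟨(swap g d' * τ, swap d d' * β), ⟨⟨hM, ?_⟩, hMf⟩, ?_⟩
    · change (swap d d' * β) d = d'
      rw [Perm.mul_apply, hβd, swap_apply_left]
    · simp only [swap_mul_self_mul, Prod.mk.injEq, and_true]
      rw [Perm.mul_apply, ht, swap_apply_right, swap_comm d' g, swap_mul_self_mul]
  · rintro ⟨σ, α⟩ ⟨⟨h, hd⟩, hf⟩
    change IsMap σ α d at h
    change ¬ sc (σ * α) d d' at hf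
    change P * Y * mapWt P Y σ α d = (if IsSimpleNext D (swap d' (σ d') * σ) (swap d d' * α) d
      then 1 else P) * wt P Y D (swap d' (σ d') * σ) (swap d d' * α) d
    obtain ⟨τ, β, hτ, hβ, hσ, h2, ht, hg, n1, n2, n3, hc, hU⟩ := fwd σ α h hd hf
    rw [← hτ, ← hβ]
    set x := (τ * β) d with hx
    set y := (τ * β) x with hy
    set F := cyc (σ * α) d with hFdef
    set F' := cyc (τ * β) d with hF'def
    have hd'F' : d' ∉ F' := h2.not_face
    have hd'F : d' ∉ F := hf
    have hyF : y ∉ F := by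
      intro h0
      have : y ∈ cyc (σ * α) d' := by rw [hc]; simp
      exact hf (Setoid.trans' _ h0 (Setoid.symm' _ this))
    have hxy : x ≠ y := fun h0 => n1 ((τ * β).injective (hy ▸ h0)).symm
    have hyF' : y ∈ F' := Setoid.trans' _ (sc_step _ _) (sc_step _ _)
    have hsub : F ⊆ F' := by
      intro z hz
      have : z ∈ F' ∪ {d'} := hU ▸ Or.inl hz
      exact this.resolve_right fun h0 => hd'F (by rwa [← Set.mem_singleton_iff.1 h0])
    have hsub' : ∀ z ∈ F', z ∈ F ∨ z = x ∨ z = y := by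
      intro z hz
      have : z ∈ F ∪ cyc (σ * α) d' := hU ▸ Or.inl hz
      rw [hc] at this
      rcases this with h0 | h0 | h0 | h0
      · exact Or.inl h0
      · exact absurd (h0 ▸ hz) hd'F'
      · exact Or.inr (Or.inl h0)
      · exact Or.inr (Or.inr h0)
    have hcardF : F'.ncard = F.ncard + 2 := by
      have e1 : (F ∪ cyc (σ * α) d').ncard = F.ncard + 3 := by
        rw [Set.ncard_union_eq, h.faces d' hf]
        rw [Set.disjoint_left]
        intro z hz hz'
        exact hf (Setoid.trans' _ hz (Setoid.symm' _ hz'))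
      have e2 : (F' ∪ {d'}).ncard = F'.ncard + 1 := by
        rw [Set.ncard_union_eq, Set.ncard_singleton]
        rw [Set.disjoint_singleton_right]
        exact hd'F'
      rw [hU, e2] at e1
      omega
    have hxd : sc τ d x := by
      have := sc_step τ d
      rwa [← (h2.fixed d).2 (Or.inl rfl), ← Perm.mul_apply, (h2.fixed d).2 (Or.inl rfl)] at this
    -- The triangle adds its sides to the boundary, and its third vertex, the origin of `y`, is new
    -- on the boundary exactly if `IsSimpleNext` holds.
    have hnum : numClasses (sc σ) F = numClasses (sc τ) F := by
      have hsc := h2.sc_merge hg (Setoid.refl' _ d')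
      rw [swap_comm, ← hσ] at hsc
      have hne' : ∀ z ∈ F, ¬ sc τ z d' := fun z hz h0 =>
        hd'F ((eq_of_sc_of_fixed ht (Setoid.symm' _ h0)) ▸ hz)
      refine numClasses_congr (fun a b => a = b ∧ a ∈ F) (fun a ha => ⟨a, ha, rfl, ha⟩)
        (fun a ha => ⟨a, ha, rfl, ha⟩) ?_
      rintro a _ b _ ⟨rfl, ha⟩ ⟨rfl, hb⟩
      rw [hsc, glue_apply]
      constructor
      · rintro (h0 | ⟨h0, h1⟩)
        · exact h0
        · exact Setoid.trans' _ (h0.resolve_right (hne' a ha))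
            (Setoid.symm' _ (h1.resolve_right (hne' b hb)))
      · exact Or.inl
    have hdF : d ∈ F := self_mem_cyc _ _
    split_ifs with hs
    · have hnum' : numClasses (sc τ) F' = numClasses (sc τ) F + 1 := by
        have e1 : F' = (F' \ {y}) ∪ {y} := by
          rw [Set.sdiff_union_self, Set.union_eq_left.2 (Set.singleton_subset_iff.2 hyF')]
        rw [e1, numClasses_union, numClasses_singleton]
        · congr 1
          refine numClasses_eq_of ?_ ?_
          · rintro z ⟨hz, hzy⟩
            rcases hsub' z hz with h0 | h0 | h0
            · exact ⟨z, h0, Setoid.refl' _ z⟩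
            · exact ⟨d, hdF, h0 ▸ Setoid.symm' _ hxd⟩
            · exact absurd h0 hzy
          · intro z hz
            exact ⟨z, ⟨hsub hz, fun h0 => hyF (h0 ▸ hz)⟩, Setoid.refl' _ z⟩
        · rintro z ⟨hz, hzy⟩ w hw hzw
          rw [Set.mem_singleton_iff.1 hw] at hzw
          exact hzy (hs z hz (Setoid.symm' _ hzw))
      rw [mapWt, wt, ← hFdef, ← hF'def, hnum, hnum', hcardF,
        show F.ncard + 2 - 1 = F.ncard + 1 by omega]
      ring
    · have hnum' : numClasses (sc τ) F' = numClasses (sc τ) F := by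
        rw [IsSimpleNext] at hs
        push Not at hs
        obtain ⟨z, hz, hzy, hne'⟩ := hs
        refine numClasses_eq_of ?_ fun z hz => ⟨z, hsub hz, Setoid.refl' _ z⟩
        intro w hw
        rcases hsub' w hw with h0 | h0 | h0
        · exact ⟨w, h0, Setoid.refl' _ w⟩
        · exact ⟨d, hdF, h0 ▸ Setoid.symm' _ hxd⟩
        · rcases hsub' z hz with h1 | h1 | h1
          · exact ⟨z, h1, h0 ▸ hzy⟩
          · exact ⟨d, hdF, Setoid.trans' _ (h0 ▸ h1 ▸ hzy) (Setoid.symm' _ hxd)⟩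
          · exact absurd h1 hne'
      rw [mapWt, wt, ← hFdef, ← hF'def, hnum, hnum', hcardF,
        show F.ncard + 2 - 1 = F.ncard + 1 by omega]
      ring

end Tutte

/-! ### Legs and roots -/

section Link

theorem total_restrict {R : Type*} [CommRing R] (Q : ∀ D : Type, Perm D → Perm D → D → Prop)
    (f : ∀ D : Type, Perm D → Perm D → D → R) (D : Type) (r : D) :
    total (restrict Q f) D r =
      ∑ᶠ M ∈ {M : Perm D × Perm D | IsOne M.1 M.2 r ∧ Q D M.1 M.2 r}, f D M.1 M.2 r := by
  classical
  exact finsum_mem_ite {M : Perm D × Perm D | IsOne M.1 M.2 r} (fun M => Q D M.1 M.2 r)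
    fun M => f D M.1 M.2 r

/-- The vertex permutation after a leg is attached in front of the root `d`. -/
def addLeg {D : Type} [DecidableEq D] (σ : Perm D) (d : D) : Perm (D ⊕ Unit) :=
  swap (Sum.inr ()) (Sum.inl d) * join (Equiv.refl _) σ 1

/-- The edge permutation after a leg is attached. -/
def addFixed {D : Type} (α : Perm D) : Perm (D ⊕ Unit) := join (Equiv.refl _) α 1

variable {D : Type} [Finite D] [DecidableEq D] {σ α : Perm D} {d : D}

theorem join_refl_inl (π : Perm D) (x : D) :
    join (Equiv.refl (D ⊕ Unit)) π 1 (Sum.inl x) = Sum.inl (π x) :=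
  join_inl (Equiv.refl (D ⊕ Unit)) π 1 x

theorem join_refl_inr (π : Perm D) (u : Unit) :
    join (Equiv.refl (D ⊕ Unit)) π 1 (Sum.inr u) = Sum.inr u :=
  join_inr (Equiv.refl (D ⊕ Unit)) π 1 u

theorem isEmb_inl_refl : IsEmb (Sum.inl : D → D ⊕ Unit) σ α (join (Equiv.refl _) σ 1)
    (join (Equiv.refl _) α 1) :=
  isEmb_inl (e := Equiv.refl (D ⊕ Unit))

theorem not_conn_inr_inl {x : D} : ¬ conn (join (Equiv.refl (D ⊕ Unit)) σ 1)
    (join (Equiv.refl (D ⊕ Unit)) α 1) (Sum.inr ()) (Sum.inl x) := fun h =>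
  not_conn_join (e := Equiv.refl (D ⊕ Unit)) (Setoid.symm' _ h)

theorem not_sc_inr_inl {x : D} : ¬ sc (join (Equiv.refl (D ⊕ Unit)) σ 1)
    (Sum.inr ()) (Sum.inl x) := fun h =>
  not_conn_inr_inl (α := 1) (sc_le_conn_left _ _ h)

theorem addLeg_mul_addFixed (σ α : Perm D) (d : D) :
    addLeg σ d * addFixed α = addLeg (σ * α) d := by
  rw [addLeg, addLeg, addFixed, mul_assoc, ← join_mul, one_mul]

theorem sc_addLeg (σ : Perm D) (d : D) :
    sc (addLeg σ d) = glue (sc (join (Equiv.refl (D ⊕ Unit)) σ 1)) (Sum.inr ()) (Sum.inl d) :=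
  sc_swap_mul_of_not not_sc_inr_inl

theorem sc_addLeg_inl {a b : D} : sc (addLeg σ d) (Sum.inl a) (Sum.inl b) ↔ sc σ a b := by
  have hE : IsEmb (Sum.inl : D → D ⊕ Unit) σ σ _ _ := isEmb_inl_refl
  rw [sc_addLeg, glue_apply, hE.sc_iff', hE.sc_iff', hE.sc_iff']
  have h1 : ∀ x : D, ¬ sc (join (Equiv.refl (D ⊕ Unit)) σ 1) (Sum.inl x) (Sum.inr ()) :=
    fun x h => not_sc_inr_inl (Setoid.symm' _ h)
  simp only [h1, false_or]
  exact ⟨fun h => h.elim id fun h => Setoid.trans' _ h.1 (Setoid.symm' _ h.2), Or.inl⟩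

theorem sc_addLeg_inr {a : D} : sc (addLeg σ d) (Sum.inr ()) (Sum.inl a) ↔ sc σ d a := by
  have h : sc (addLeg σ d) (Sum.inr ()) (Sum.inl d) := by
    rw [sc_addLeg]
    exact glue_rel _ _ _
  rw [← sc_addLeg_inl (d := d)]
  exact ⟨fun h' => Setoid.trans' _ (Setoid.symm' _ h) h', fun h' => Setoid.trans' _ h h'⟩

theorem cyc_addLeg : cyc (addLeg σ d) (Sum.inr ()) = insert (Sum.inr ()) (Sum.inl '' cyc σ d) := by
  ext x
  rcases x with x | x
  · rw [mem_cyc, sc_addLeg_inr, Set.mem_insert_iff, Set.mem_image]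
    constructor
    · intro h
      exact Or.inr ⟨x, h, rfl⟩
    · rintro (h | ⟨y, hy, h⟩)
      · cases h
      · rwa [← Sum.inl_injective h]
  · exact iff_of_true (self_mem_cyc _ _) (Or.inl rfl)

theorem ncard_cyc_addLeg : (cyc (addLeg σ d) (Sum.inr ())).ncard = (cyc σ d).ncard + 1 := by
  rw [cyc_addLeg, Set.ncard_insert_of_notMem, Set.ncard_image_of_injective _ Sum.inl_injective]
  rintro ⟨x, -, h⟩
  cases h

theorem addLeg_inr : addLeg σ d (Sum.inr ()) = Sum.inl d := by
  rw [addLeg, Perm.mul_apply, join_refl_inr, swap_apply_left]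

theorem wt_addLeg {R : Type*} [CommRing R] (P Y : R) :
    wt P Y (D ⊕ Unit) (addLeg σ d) (addFixed α) (Sum.inr ()) = mapWt P Y σ α d := by
  rw [wt, addLeg_mul_addFixed, ncard_cyc_addLeg, mapWt, Nat.add_sub_cancel]
  congr 2
  rw [cyc_addLeg]
  refine numClasses_congr (fun x a => sc (addLeg σ d) x (Sum.inl a)) ?_ ?_ ?_
  · rintro _ (rfl | ⟨a, ha, rfl⟩)
    · exact ⟨d, self_mem_cyc _ _, sc_addLeg_inr.2 (Setoid.refl' _ d)⟩
    · exact ⟨a, ha, Setoid.refl' _ _⟩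
  · intro a ha
    exact ⟨Sum.inl a, Or.inr ⟨a, ha, rfl⟩, Setoid.refl' _ _⟩
  · intro x a y b hx hy
    rw [← sc_addLeg_inl (d := d)]
    exact ⟨fun h => Setoid.trans' _ (Setoid.symm' _ hx) (Setoid.trans' _ h hy),
      fun h => Setoid.trans' _ hx (Setoid.trans' _ h (Setoid.symm' _ hy))⟩

theorem isOne_unit : IsOne (1 : Perm Unit) 1 () := by
  have h : ∀ s : Setoid Unit, numClasses s Set.univ = 1 := fun s => by
    rw [show (Set.univ : Set Unit) = {()} from Set.ext fun _ => iff_of_true trivial rfl]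
    exact numClasses_singleton s ()
  refine ⟨fun _ => rfl, fun _ => iff_of_true rfl rfl, fun _ => Setoid.refl' _ _, ?_,
    fun x hx => absurd (Setoid.refl' _ x) hx⟩
  unfold Planar numCycles numComps
  simp only [h]
  simp

theorem IsMap.addLeg (h : IsMap σ α d) : IsOne (addLeg σ d) (addFixed α) (Sum.inr ()) := by
  have hE : IsEmb (Sum.inl : D → D ⊕ Unit) σ α _ _ := isEmb_inl_refl
  refine ⟨?_, ?_, ?_, ?_, ?_⟩
  · rintro (x | x)
    · rw [addFixed, join_refl_inl, join_refl_inl, h.invol]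
    · rw [addFixed, join_refl_inr, join_refl_inr]
  · rintro (x | x)
    · rw [addFixed, join_refl_inl]
      simpa using h.fixed x
    · rw [addFixed, join_refl_inr]
  · rintro (x | x)
    · rw [PercMaps.addLeg, conn_swap_mul_of_not not_sc_inr_inl]
      refine Or.inr ⟨Or.inl (Setoid.refl' _ _), Or.inr ?_⟩
      exact hE.conn_iff'.2 (Setoid.symm' _ (h.conn x))
    · exact Setoid.refl' _ _
  · exact Planar.merge (planar_join.2 ⟨h.planar, isOne_unit.planar⟩) not_conn_inr_inl
  · rintro (x | x) hx
    · rw [addLeg_mul_addFixed] at hx ⊢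
      rw [sc_addLeg_inr] at hx
      have hc : cyc (PercMaps.addLeg (σ * α) d) (Sum.inl x) = Sum.inl '' cyc (σ * α) x := by
        ext y
        rcases y with y | y
        · rw [mem_cyc, sc_addLeg_inl]
          exact ⟨fun h => ⟨y, h, rfl⟩, fun ⟨z, hz, h⟩ => Sum.inl_injective h ▸ hz⟩
        · refine iff_of_false (fun h' => hx ?_) (by rintro ⟨z, -, h⟩; cases h)
          exact sc_addLeg_inr.1 (Setoid.symm' _ h')
      rw [hc, Set.ncard_image_of_injective _ Sum.inl_injective, h.faces x hx]
    · exact absurd (Setoid.refl' _ _) hx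

/-- A triangulation with a leg that is not reduced to a vertex comes from a rooted one. -/
theorem exists_addLeg {τ β : Perm (D ⊕ Unit)} (h : IsOne τ β (Sum.inr ()))
    (hne : τ (Sum.inr ()) ≠ Sum.inr ()) :
    ∃ σ α d, IsMap σ α d ∧ addLeg σ d = τ ∧ addFixed α = β := by
  obtain ⟨d, hd⟩ : ∃ d, τ (Sum.inr ()) = Sum.inl d := by
    rcases hτ : τ (Sum.inr ()) with d | u
    · exact ⟨d, rfl⟩
    · exact absurd hτ hne
  have hr : β (Sum.inr ()) = Sum.inr () := (h.fixed _).2 rfl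
  have key : ∀ π : Perm (D ⊕ Unit), π (Sum.inr ()) = Sum.inr () →
      ∃ ρ : Perm D, join (Equiv.refl _) ρ 1 = π := by
    intro π hπ
    obtain ⟨ρ, ρ', hρ⟩ := exists_join (Equiv.refl (D ⊕ Unit)) (π := π) fun x => by
      rcases hx : π (Sum.inl x) with y | y
      · exact ⟨y, hx⟩
      · have := π.injective (hx.trans hπ.symm)
        cases this
    exact ⟨ρ, by rw [← hρ, Subsingleton.elim ρ' 1]⟩
  obtain ⟨α, hα⟩ := key β hr
  obtain ⟨σ, hσ⟩ := key (swap (Sum.inr ()) (Sum.inl d) * τ) (by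
    rw [Perm.mul_apply, hd, swap_apply_right])
  have hτ : addLeg σ d = τ := by rw [addLeg, hσ, swap_mul_self_mul]
  have hE : IsEmb (Sum.inl : D → D ⊕ Unit) σ α _ _ := isEmb_inl_refl
  refine ⟨σ, α, d, ⟨fun x => ?_, fun x => ?_, fun x => ?_, ?_, fun x hx => ?_⟩, hτ, hα⟩
  · have := h.invol (Sum.inl x)
    rw [← hα, join_refl_inl, join_refl_inl] at this
    exact Sum.inl_injective this
  · have := h.fixed (Sum.inl x)
    rw [← hα, join_refl_inl] at this
    simpa using this
  · have := h.conn (Sum.inl x)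
    rw [← hτ, ← hα, addLeg, conn_swap_mul_of_not not_sc_inr_inl] at this
    rcases this with h' | ⟨-, h' | h'⟩
    · exact absurd h' not_conn_inr_inl
    · exact absurd (Setoid.symm' _ h') not_conn_inr_inl
    · exact Setoid.symm' _ (hE.conn_iff'.1 h')
  · have hsc : sc τ (Sum.inr ()) (Sum.inl d) := hd ▸ sc_step τ _
    have hφ : sc (τ * β) (Sum.inr ()) (Sum.inl d) := by
      have := sc_step (τ * β) (Sum.inr ())
      rwa [Perm.mul_apply, hr, hd] at this
    have := (h.planar.split (by simp) hsc hφ).1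
    rw [← hσ, ← hα] at this
    exact (planar_join.1 this).1
  · have e := addLeg_mul_addFixed σ α d
    rw [hτ, addFixed, hα] at e
    have h1 : ¬ sc (τ * β) (Sum.inr ()) (Sum.inl x) := by
      rw [e, sc_addLeg_inr]
      exact hx
    rw [← h.faces _ h1, ← Set.ncard_image_of_injective _ (Sum.inl_injective (β := Unit))]
    congr 1
    ext y
    rw [e] at h1 ⊢
    rcases y with y | y
    · rw [mem_cyc, sc_addLeg_inl]
      exact ⟨fun ⟨z, hz, h⟩ => Sum.inl_injective h ▸ hz, fun h => ⟨y, h, rfl⟩⟩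
    · exact iff_of_false (by rintro ⟨z, -, h⟩; cases h) fun h' => h1 (Setoid.symm' _ h')

theorem join_one_injective : Function.Injective fun π : Perm D => join (Equiv.refl (D ⊕ Unit)) π 1 :=
  fun _ _ h => (join_inj.1 h).1

variable {R : Type*} [CommRing R]

theorem finsum_addLeg (g : Perm (D ⊕ Unit) × Perm (D ⊕ Unit) → R) :
    ∑ᶠ M ∈ {M : Perm (D ⊕ Unit) × Perm (D ⊕ Unit) |
        IsOne M.1 M.2 (Sum.inr ()) ∧ ¬ IsTrivial _ M.1 M.2 (Sum.inr ())}, g M =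
      ∑ᶠ M ∈ {M : (Perm D × Perm D) × D | IsMap M.1.1 M.1.2 M.2},
        g (addLeg M.1.1 M.2, addFixed M.1.2) := by
  symm
  refine finsum_mem_eq_of_bijOn (fun M => (addLeg M.1.1 M.2, addFixed M.1.2)) ⟨?_, ?_, ?_⟩
    fun _ _ => rfl
  · rintro ⟨⟨σ, α⟩, d⟩ h
    refine ⟨h.addLeg, ?_⟩
    change ¬ addLeg σ d (Sum.inr ()) = Sum.inr ()
    rw [addLeg_inr]
    simp
  · rintro ⟨⟨σ, α⟩, d⟩ _ ⟨⟨σ', α'⟩, d'⟩ _ h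
    simp only [Prod.mk.injEq] at h ⊢
    obtain ⟨h1, h2⟩ := h
    have hd : d = d' := by
      have := congrArg (fun f : Perm (D ⊕ Unit) => f (Sum.inr ())) h1
      simp only [addLeg_inr] at this
      exact Sum.inl_injective this
    subst hd
    exact ⟨⟨join_one_injective (mul_left_cancel h1), join_one_injective h2⟩, rfl⟩
  · rintro ⟨τ, β⟩ ⟨h, hne⟩
    obtain ⟨σ, α, d, hM, h1, h2⟩ := exists_addLeg h hne
    exact ⟨((σ, α), d), hM, Prod.ext h1 h2⟩

/-- The total weight of rooted triangulations without leg. -/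
def mapTotal (D : Type) (P Y : R) : R :=
  ∑ᶠ M ∈ {M : (Perm D × Perm D) × D | IsMap M.1.1 M.1.2 M.2}, mapWt P Y M.1.1 M.1.2 M.2

theorem total_restrict_not_trivial (P Y : R) :
    total (restrict (fun D σ α r => ¬ IsTrivial D σ α r) (wt P Y)) (D ⊕ Unit) (Sum.inr ()) =
      mapTotal D P Y := by
  rw [total_restrict]
  refine (finsum_addLeg (fun M => wt P Y (D ⊕ Unit) M.1 M.2 (Sum.inr ()))).trans ?_
  exact finsum_mem_congr rfl fun M _ => wt_addLeg P Y

theorem IsMap.reroot (h : IsMap σ α d) {d' : D} (hd : sc (σ * α) d d') : IsMap σ α d' where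
  invol := h.invol
  fixed := h.fixed
  conn x := Setoid.trans' _ (sc_mul_le_conn σ α (Setoid.symm' _ hd)) (h.conn x)
  planar := h.planar
  faces x hx := h.faces x fun h' => hx (Setoid.trans' _ (Setoid.symm' _ hd) h')

theorem isLong_addLeg : IsLong _ (addLeg σ d) (addFixed α) (Sum.inr ()) ↔
    2 ≤ (cyc (σ * α) d).ncard := by
  rw [IsLong, addLeg_mul_addFixed, ncard_cyc_addLeg]
  omega

theorem isSimpleAt_addLeg : IsSimpleAt _ (addLeg σ d) (addFixed α) (Sum.inr ()) ↔
    ∀ z, sc (σ * α) d z → sc σ d z → z = d := by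
  rw [IsSimpleAt, addLeg_mul_addFixed, addLeg_inr]
  constructor
  · rintro ⟨-, h⟩ z hz hz'
    have := h (Sum.inl z) (sc_addLeg_inr.2 hz) (sc_addLeg_inr.2 hz')
    simpa using this
  · intro h
    refine ⟨by simp, ?_⟩
    rintro (z | z) hz hz'
    · rw [h z (sc_addLeg_inr.1 hz) (sc_addLeg_inr.1 hz')]
      exact Or.inr rfl
    · exact Or.inl rfl

theorem isSimpleNext_addLeg (hl : 2 ≤ (cyc (σ * α) d).ncard) :
    IsSimpleNext _ (addLeg σ d) (addFixed α) (Sum.inr ()) ↔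
      ∀ z, sc (σ * α) d z → sc σ ((σ * α) d) z → z = (σ * α) d := by
  have hne : (σ * α) d ≠ d := by
    intro h0
    have : cyc (σ * α) d ⊆ {d} := fun z hz => eq_of_sc_of_fixed h0 hz
    have := Set.ncard_le_ncard this (Set.toFinite _)
    rw [Set.ncard_singleton] at this
    omega
  have h2 : addLeg (σ * α) d (Sum.inl d) = Sum.inl ((σ * α) d) := by
    rw [addLeg, Perm.mul_apply, join_refl_inl, swap_apply_of_ne_of_ne (by simp)]
    simpa using hne
  rw [IsSimpleNext, addLeg_mul_addFixed, addLeg_inr, h2]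
  constructor
  · intro h z hz hz'
    have := h (Sum.inl z) (sc_addLeg_inr.2 hz) (sc_addLeg_inl.2 hz')
    simpa using this
  · rintro h (z | z) hz hz'
    · rw [h z (sc_addLeg_inr.1 hz) (sc_addLeg_inl.1 hz')]
    · have h0 : sc σ d ((σ * α) d) := sc_addLeg_inr.1 (Setoid.symm' _ hz')
      exact absurd (h d (Setoid.refl' _ d) (Setoid.symm' _ h0)).symm hne

/-- Moving the root by one step along the boundary. -/
theorem total_isSimpleNext (P Y : R) :
    total (restrict (fun D σ α r => IsLong D σ α r ∧ IsSimpleNext D σ α r) (wt P Y)) (D ⊕ Unit)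
      (Sum.inr ()) =
    total (restrict (fun D σ α r => IsLong D σ α r ∧ IsSimpleAt D σ α r) (wt P Y)) (D ⊕ Unit)
      (Sum.inr ()) := by
  classical
  have key : ∀ Q : ∀ D : Type, Perm D → Perm D → D → Prop,
      total (restrict (fun D σ α r => IsLong D σ α r ∧ Q D σ α r) (wt P Y)) (D ⊕ Unit)
        (Sum.inr ()) =
      ∑ᶠ M ∈ {M : (Perm D × Perm D) × D | IsMap M.1.1 M.1.2 M.2 ∧
        2 ≤ (cyc (M.1.1 * M.1.2) M.2).ncard ∧
          Q _ (addLeg M.1.1 M.2) (addFixed M.1.2) (Sum.inr ())},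
        mapWt P Y M.1.1 M.1.2 M.2 := by
    intro Q
    have h1 : total (restrict (fun D σ α r => IsLong D σ α r ∧ Q D σ α r) (wt P Y)) (D ⊕ Unit)
        (Sum.inr ()) = ∑ᶠ M ∈ {M : Perm (D ⊕ Unit) × Perm (D ⊕ Unit) |
          IsOne M.1 M.2 (Sum.inr ()) ∧ ¬ IsTrivial _ M.1 M.2 (Sum.inr ())},
          if IsLong _ M.1 M.2 (Sum.inr ()) ∧ Q _ M.1 M.2 (Sum.inr ()) then
            wt P Y _ M.1 M.2 (Sum.inr ()) else 0 := by
      rw [total_restrict, finsum_mem_ite]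
      refine finsum_mem_congr (Set.ext fun M => ?_) fun _ _ => rfl
      refine ⟨fun ⟨hM, hl, hQ⟩ => ⟨⟨hM, fun ht => ?_⟩, hl, hQ⟩, fun ⟨⟨hM, _⟩, h⟩ => ⟨hM, h⟩⟩
      have hα : M.2 (Sum.inr ()) = Sum.inr () := (hM.fixed _).2 rfl
      have : cyc (M.1 * M.2) (Sum.inr ()) ⊆ {Sum.inr ()} := fun z hz =>
        eq_of_sc_of_fixed (by rw [Perm.mul_apply, hα]; exact ht) hz
      have := Set.ncard_le_ncard this (Set.toFinite _)
      rw [Set.ncard_singleton] at this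
      rw [IsLong] at hl
      omega
    rw [h1, finsum_addLeg, finsum_mem_ite]
    refine finsum_mem_congr (Set.ext fun M => ?_) fun M _ => wt_addLeg P Y
    simp only [isLong_addLeg, Set.mem_ofPred_eq]
  rw [key, key]
  refine finsum_mem_eq_of_bijOn (fun M => (M.1, (M.1.1 * M.1.2) M.2)) ⟨?_, ?_, ?_⟩ ?_
  · rintro ⟨⟨σ, α⟩, d⟩ ⟨h, hl, hQ⟩
    have hd := sc_step (σ * α) d
    change 2 ≤ (cyc (σ * α) d).ncard at hl
    refine ⟨h.reroot hd, ?_, isSimpleAt_addLeg.2 fun z hz hz' => ?_⟩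
    · rw [cyc_eq_of_sc hd] at hl
      exact hl
    · exact (isSimpleNext_addLeg hl).1 hQ z (Setoid.trans' _ hd hz) hz'
  · rintro ⟨⟨σ, α⟩, d⟩ _ ⟨⟨σ', α'⟩, d'⟩ _ heq
    simp only [Prod.mk.injEq] at heq
    obtain ⟨⟨rfl, rfl⟩, heq⟩ := heq
    rw [(σ * α).injective heq]
  · rintro ⟨⟨σ, α⟩, d⟩ ⟨h, hl, hQ⟩
    obtain ⟨c, rfl⟩ := (σ * α).surjective d
    have hd := sc_step (σ * α) c
    change 2 ≤ (cyc (σ * α) ((σ * α) c)).ncard at hl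
    rw [← cyc_eq_of_sc hd] at hl
    refine ⟨((σ, α), c), ⟨h.reroot (Setoid.symm' _ hd), hl, (isSimpleNext_addLeg hl).2 ?_⟩, rfl⟩
    intro z hz hz'
    exact isSimpleAt_addLeg.1 hQ z (Setoid.trans' _ (Setoid.symm' _ hd) hz) hz'
  · rintro ⟨⟨σ, α⟩, d⟩ _
    simp only [mapWt]
    rw [← cyc_eq_of_sc (sc_step (σ * α) d)]

end Link

/-! ### Recurrences for the numbers of triangulations -/

section Recurrences

variable {R : Type*} [CommRing R]

theorem total_restrict_add (Q : ∀ D : Type, Perm D → Perm D → D → Prop)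
    (f : ∀ D : Type, Perm D → Perm D → D → R) (D : Type) [Finite D] (r : D) :
    total (restrict Q f) D r + total (restrict (fun D σ α r => ¬ Q D σ α r) f) D r =
      total f D r := by
  classical
  rw [total, total, total, ← finsum_mem_add_distrib (Set.toFinite _)]
  refine finsum_mem_congr rfl fun M _ => ?_
  simp only [restrict]
  split_ifs <;> simp_all

/-- An involution with exactly one fixed point lives on an odd number of points. -/
theorem total_eq_zero_of_even (f : ∀ D : Type, Perm D → Perm D → D → R) {D : Type} [Finite D]
    (r : D) (h : Even (Nat.card D)) : total f D r = 0 := by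
  classical
  have := Fintype.ofFinite D
  have he : {M : Perm D × Perm D | IsOne M.1 M.2 r} = ∅ := by
    refine Set.eq_empty_of_forall_notMem fun M hM => ?_
    have h2 : M.2 ^ 2 ^ 1 = 1 := by
      ext x
      simp [pow_two, hM.invol]
    have := Equiv.Perm.card_compl_support_modEq (p := 2) (n := 1) (σ := M.2) h2
    have h1 : M.2.supportᶜ = {r} := by
      ext x
      simp [hM.fixed]
    rw [h1, Finset.card_singleton, ← Nat.card_eq_fintype_card] at this
    rw [Nat.even_iff] at h
    rw [Nat.ModEq] at this
    omega
  rw [total, he, finsum_mem_empty]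

theorem IsOne.card_of_trivial {D : Type} {σ α : Perm D} {r : D} (h : IsOne σ α r)
    (hr : σ r = r) : ∀ x, x = r := fun x =>
  eq_of_conn_of_fixed hr ((h.fixed r).2 rfl) (h.conn x)

variable [Algebra ℚ R]

theorem isUnit_factorial (n : ℕ) : IsUnit (algebraMap ℚ R n.factorial) :=
  (IsUnit.mk0 (n.factorial : ℚ) (by exact_mod_cast n.factorial_ne_zero)).map _

theorem rootedTotal_congr {f g : ∀ D : Type, Perm D → Perm D → D → R} {n : ℕ}
    (h : total f (Fin (n + 1)) 0 = total g (Fin (n + 1)) 0) :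
    rootedTotal f n = rootedTotal g n := by
  rw [rootedTotal, rootedTotal, h]

theorem rootedTotal_restrict_add (Q : ∀ D : Type, Perm D → Perm D → D → Prop)
    (f : ∀ D : Type, Perm D → Perm D → D → R) (n : ℕ) :
    rootedTotal (restrict Q f) n + rootedTotal (restrict (fun D σ α r => ¬ Q D σ α r) f) n =
      rootedTotal f n := by
  rw [rootedTotal, rootedTotal, ← mul_add, total_restrict_add, rootedTotal]

theorem rootedTotal_eq_zero_of_odd (f : ∀ D : Type, Perm D → Perm D → D → R) {n : ℕ}
    (h : Odd n) : rootedTotal f n = 0 := by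
  rw [rootedTotal, total_eq_zero_of_even f 0 (by simpa using h.add_one), mul_zero]

theorem rootedTotal_trivial {f : ∀ D : Type, Perm D → Perm D → D → R} {a : R}
    (h : ∀ (D : Type) [Finite D] σ α r, IsOne σ α r → σ r = r → f D σ α r = a) (n : ℕ) :
    rootedTotal (restrict IsTrivial f) n = if n = 0 then a else 0 := by
  rw [rootedTotal, total_restrict]
  split_ifs with hn
  · subst hn
    have h1 : IsOne (1 : Perm (Fin (0 + 1))) 1 0 := by
      have := isOne_unit.permCongr (Equiv.ofUnique Unit (Fin 1))
      rwa [show (Equiv.ofUnique Unit (Fin 1)).permCongr 1 = 1 from Subsingleton.elim _ _] at this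
    have : {M : Perm (Fin (0 + 1)) × Perm (Fin (0 + 1)) | IsOne M.1 M.2 0 ∧ IsTrivial _ M.1 M.2 0} =
        {(1, 1)} := by
      ext M
      refine ⟨fun _ => Subsingleton.elim (α := Perm (Fin 1) × Perm (Fin 1)) _ _, ?_⟩
      rintro rfl
      exact ⟨h1, rfl⟩
    rw [this, finsum_mem_singleton, h _ _ _ _ h1 rfl]
    simp
  · have : {M : Perm (Fin (n + 1)) × Perm (Fin (n + 1)) |
        IsOne M.1 M.2 0 ∧ IsTrivial _ M.1 M.2 0} = ∅ := by
      refine Set.eq_empty_of_forall_notMem fun M hM => ?_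
      have := congrArg Fin.val (hM.1.card_of_trivial hM.2 (Fin.last n))
      simp at this
      omega
    rw [this, finsum_mem_empty, mul_zero]

/-- The map reduced to a vertex has weight `P`, and no dart apart from the leg. -/
theorem rootedTotal_wt (P Y : R) (n : ℕ) :
    rootedTotal (wt P Y) n = (if n = 0 then P else 0) +
      rootedTotal (restrict (fun D σ α r => ¬ IsTrivial D σ α r) (wt P Y)) n := by
  rw [← rootedTotal_restrict_add IsTrivial, rootedTotal_trivial (a := P)]
  intro D _ σ α r h hr
  classical
  exact wt_of_trivial hr ((h.fixed r).2 rfl) P Y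

/-- The decomposition of the boundary at its first return to the root vertex. -/
theorem rootedTotal_first_return (P Y : R) (n : ℕ) :
    P * rootedTotal (restrict (fun D σ α r => ¬ IsTrivial D σ α r) (wt P Y)) n =
      ∑ ij ∈ Finset.HasAntidiagonal.antidiagonal n,
        rootedTotal (restrict IsSimpleAt (wt P Y)) ij.1 * rootedTotal (wt P Y) ij.2 := by
  have h := sum_first_return P Y (0 : Fin (n + 2)) 1
  rw [sum_isTwo_eq ((isLocalProp_not isLocalProp_isTrivial).restrict (isLocal_wt P Y))
    (isLocalProp_isTrivial.restrict (isLocal_const P)) (by simp) (n := n) (by simp),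
    sum_isTwo_eq (isLocalProp_isSimpleAt.restrict (isLocal_wt P Y)) (isLocal_wt P Y)
    (by simp) (n := n) (by simp)] at h
  rw [← (isUnit_factorial n).mul_left_cancel h, Finset.sum_eq_single (n, 0)]
  · rw [rootedTotal_trivial (a := P) fun _ _ _ _ _ _ _ => rfl, if_pos rfl, mul_comm]
  · intro b hb hne
    rw [rootedTotal_trivial (a := P) fun _ _ _ _ _ _ _ => rfl, if_neg, mul_zero]
    rintro h0
    have hb := Finset.HasAntidiagonal.mem_antidiagonal.1 hb
    exact hne (Prod.ext (by omega) h0)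
  · intro h'
    simp at h'

theorem mapTotal_eq (P Y : R) {D : Type} [Finite D] [DecidableEq D] {n : ℕ}
    (hD : Nat.card D = n) :
    mapTotal D P Y = algebraMap ℚ R n.factorial *
      rootedTotal (restrict (fun D σ α r => ¬ IsTrivial D σ α r) (wt P Y)) n := by
  rw [← total_restrict_not_trivial, total_eq
    ((isLocalProp_not isLocalProp_isTrivial).restrict (isLocal_wt P Y))]
  rw [Nat.card_sum, hD, Nat.card_unique]

/-- Rooted maps sorted by the two darts of the root edge. -/
theorem mapTotal_eq_sum (P Y : R) {D : Type} [Fintype D] [DecidableEq D] :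
    mapTotal D P Y = ∑ d : D, ∑ d' ∈ Finset.univ.erase d,
      ∑ᶠ M ∈ {M : Perm D × Perm D | IsMap M.1 M.2 d ∧ M.2 d = d'}, mapWt P Y M.1 M.2 d := by
  classical
  rw [mapTotal]
  have h1 : ∀ d : D, ∀ d' : D, ∑ᶠ M ∈ {M : Perm D × Perm D | IsMap M.1 M.2 d ∧ M.2 d = d'},
      mapWt P Y M.1 M.2 d = ∑ M : Perm D × Perm D,
        if IsMap M.1 M.2 d ∧ M.2 d = d' then mapWt P Y M.1 M.2 d else 0 := by
    intro d d'
    rw [finsum_mem_eq_finite_toFinset_sum _ (Set.toFinite _), ← Finset.sum_filter]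
    refine Finset.sum_congr (Finset.ext fun M => ?_) fun _ _ => rfl
    simp
  simp only [h1]
  rw [finsum_mem_eq_finite_toFinset_sum _ (Set.toFinite _)]
  have h2 : (Set.toFinite {M : (Perm D × Perm D) × D | IsMap M.1.1 M.1.2 M.2}).toFinset =
      Finset.univ.filter fun M : (Perm D × Perm D) × D => IsMap M.1.1 M.1.2 M.2 := by
    ext; simp
  rw [h2, Finset.sum_filter, Fintype.sum_prod_type, Finset.sum_comm]
  refine Finset.sum_congr rfl fun d _ => ?_
  rw [Finset.sum_comm]
  refine Finset.sum_congr rfl fun M _ => ?_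
  by_cases hM : IsMap M.1 M.2 d
  · rw [Finset.sum_eq_single_of_mem (M.2 d) (by simpa using hM.fixed d)]
    · simp [hM]
    · intro b _ hb
      rw [if_neg fun h => hb h.2.symm]
  · simp [hM]

open Classical in
/-- The weight of the map from which a triangle was removed, relative to its own. -/
def peelWt (P Y : R) : ∀ D : Type, Perm D → Perm D → D → R :=
  restrict IsLong fun D σ α r => (if IsSimpleNext D σ α r then 1 else P) * wt P Y D σ α r

theorem isLocal_peelWt (P Y : R) : IsLocal (peelWt P Y) := by
  classical
  refine isLocalProp_isLong.restrict fun D D' _ _ i σ α σ' α' h r => ?_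
  simp only [isLocal_wt P Y D D' i σ α σ' α' h r,
    isLocalProp_isSimpleNext D D' i σ α σ' α' h r]

/-- Tutte's decomposition by removal of the root edge. -/
theorem rootedTotal_peel (P Y : R) (n : ℕ) :
    P * Y * rootedTotal (restrict (fun D σ α r => ¬ IsTrivial D σ α r) (wt P Y)) (n + 2) =
      P * Y ^ 3 * ∑ ij ∈ Finset.HasAntidiagonal.antidiagonal n,
        rootedTotal (wt P Y) ij.1 * rootedTotal (wt P Y) ij.2 +
      rootedTotal (peelWt P Y) n := by
  classical
  refine (isUnit_factorial (R := R) (n + 2)).mul_left_cancel ?_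
  have h0 := mapTotal_eq P Y (D := Fin (n + 2)) (n := n + 2) (by simp)
  rw [mul_left_comm, ← h0, mapTotal_eq_sum]
  have key : ∀ d d' : Fin (n + 2), d ≠ d' → P * Y *
      ∑ᶠ M ∈ {M : Perm (Fin (n + 2)) × Perm (Fin (n + 2)) | IsMap M.1 M.2 d ∧ M.2 d = d'},
        mapWt P Y M.1 M.2 d = algebraMap ℚ R n.factorial *
          (P * Y ^ 3 * ∑ ij ∈ Finset.HasAntidiagonal.antidiagonal n,
            rootedTotal (wt P Y) ij.1 * rootedTotal (wt P Y) ij.2 +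
            rootedTotal (peelWt P Y) n) := by
    intro d d' hne
    have hsplit : {M : Perm (Fin (n + 2)) × Perm (Fin (n + 2)) | IsMap M.1 M.2 d ∧ M.2 d = d'} =
        {M | (IsMap M.1 M.2 d ∧ M.2 d = d') ∧ sc (M.1 * M.2) d d'} ∪
        {M | (IsMap M.1 M.2 d ∧ M.2 d = d') ∧ ¬ sc (M.1 * M.2) d d'} := by
      ext M
      simp only [Set.mem_union, Set.mem_ofPred_eq]
      tauto
    rw [hsplit, finsum_mem_union (Set.disjoint_left.2 fun M h1 h2 => h2.2 h1.2)
      (Set.toFinite _) (Set.toFinite _), mul_add, sum_bridge,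
      mul_finsum_mem' _ _ (Set.toFinite _), mul_finsum_mem' _ _ (Set.toFinite _), sum_triangle P Y hne,
      mul_add]
    congr 1
    · rw [← mul_assoc, mul_comm (algebraMap ℚ R _), mul_assoc, ← sum_isTwo_eq (isLocal_wt P Y)
        (isLocal_wt P Y) hne (by simp : Nat.card (Fin (n + 2)) = n + 2),
        mul_finsum_mem' _ _ (Set.toFinite _)]
      exact finsum_mem_congr rfl fun M _ => by ring
    · have h1 := sum_isTwo_eq (isLocal_peelWt P Y)
        (isLocalProp_isTrivial.restrict (isLocal_const (1 : R))) hne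
        (by simp : Nat.card (Fin (n + 2)) = n + 2)
      rw [Finset.sum_eq_single (n, 0)] at h1
      · rw [rootedTotal_trivial (a := (1 : R)) fun _ _ _ _ _ _ _ => rfl, if_pos rfl, mul_one] at h1
        rw [← h1]
        simp only [peelWt, restrict, ite_mul, mul_ite, mul_zero, mul_one, ← ite_and]
        rw [finsum_mem_ite]
        rfl
      · intro b hb hbne
        rw [rootedTotal_trivial (a := (1 : R)) fun _ _ _ _ _ _ _ => rfl, if_neg, mul_zero]
        rintro hb0
        have hb := Finset.HasAntidiagonal.mem_antidiagonal.1 hb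
        exact hbne (Prod.ext (by omega) hb0)
      · intro h'
        simp at h'
  rw [Finset.mul_sum, Finset.sum_congr rfl fun d _ => (Finset.mul_sum _ _ _).trans
    (Finset.sum_congr rfl fun d' hd' => key d d' (Finset.ne_of_mem_erase hd').symm)]
  simp only [Finset.sum_const, Finset.card_erase_of_mem (Finset.mem_univ _), Finset.card_univ,
    Fintype.card_fin, nsmul_eq_mul, Nat.factorial_succ, Nat.cast_mul, map_mul, map_natCast]
  push_cast
  ring

/-- By invariance under a step of the root along the boundary, the condition on the end of the root
edge is replaced by the same condition on the root vertex. -/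
theorem rootedTotal_peelWt (P Y : R) (n : ℕ) :
    rootedTotal (peelWt P Y) n = P * rootedTotal (restrict IsLong (wt P Y)) n +
      (1 - P) * rootedTotal (restrict (fun D σ α r => IsLong D σ α r ∧ IsSimpleAt D σ α r)
        (wt P Y)) n := by
  classical
  have h1 : rootedTotal (restrict (fun D σ α r => IsLong D σ α r ∧ IsSimpleAt D σ α r)
      (wt P Y)) n = rootedTotal (restrict (fun D σ α r => IsLong D σ α r ∧ IsSimpleNext D σ α r)
      (wt P Y)) n := by
    have h := total_isSimpleNext (D := Fin n) P Y
    rw [total_eq ((isLocalProp_and isLocalProp_isLong isLocalProp_isSimpleNext).restrict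
      (isLocal_wt P Y)) (n := n) _ (by simp), total_eq ((isLocalProp_and isLocalProp_isLong
      isLocalProp_isSimpleAt).restrict (isLocal_wt P Y)) (n := n) _ (by simp)] at h
    exact ((isUnit_factorial n).mul_left_cancel h).symm
  rw [h1, rootedTotal, rootedTotal, rootedTotal, mul_left_comm P, mul_left_comm (1 - P), ← mul_add]
  congr 1
  rw [total, total, total, mul_finsum_mem' _ _ (Set.toFinite _), mul_finsum_mem' _ _ (Set.toFinite _),
    ← finsum_mem_add_distrib (Set.toFinite _)]
  refine finsum_mem_congr rfl fun M _ => ?_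
  simp only [peelWt, restrict]
  by_cases hl : IsLong _ M.1 M.2 0 <;> by_cases hs : IsSimpleNext _ M.1 M.2 0 <;>
    simp [hl, hs] <;> ring

/-- There is no rooted map with at most one dart. -/
theorem rootedTotal_not_trivial_of_le_one (P Y : R) {n : ℕ} (hn : n ≤ 1) :
    rootedTotal (restrict (fun D σ α r => ¬ IsTrivial D σ α r) (wt P Y)) n = 0 := by
  refine (isUnit_factorial (R := R) n).mul_left_cancel ?_
  rw [← mapTotal_eq P Y (D := Fin n) (by simp), mapTotal_eq_sum, mul_zero]
  refine Finset.sum_eq_zero fun d _ => Finset.sum_eq_zero fun d' hd' => ?_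
  refine absurd (Finset.ne_of_mem_erase hd') ?_
  have := d.2
  have := d'.2
  simp only [ne_eq, not_not]
  exact Fin.ext (by omega)

end Recurrences

/-! ### The exchange of two variables -/

section Swap

variable {B : Type*} [CommRing B]

/-- The exchange of the two variables of a double power series. -/
def swapVars : PowerSeries (PowerSeries B) →+* PowerSeries (PowerSeries B) where
  toFun F := PowerSeries.mk fun i => PowerSeries.mk fun j =>
    PowerSeries.coeff i (PowerSeries.coeff j F)
  map_one' := by
    ext i j
    simp only [PowerSeries.coeff_mk, PowerSeries.coeff_one]
    split_ifs <;> simp_all [PowerSeries.coeff_one]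
  map_zero' := by ext i j; simp
  map_add' F G := by ext i j; simp
  map_mul' F G := by
    ext i j
    simp only [PowerSeries.coeff_mk, PowerSeries.coeff_mul, map_sum]
    exact Finset.sum_comm

theorem coeff_coeff_swapVars (F : PowerSeries (PowerSeries B)) (i j : ℕ) :
    PowerSeries.coeff j (PowerSeries.coeff i (swapVars F)) =
      PowerSeries.coeff i (PowerSeries.coeff j F) := by
  simp [swapVars]

theorem swapVars_X : swapVars (PowerSeries.X : PowerSeries (PowerSeries B)) =
    PowerSeries.C PowerSeries.X := by
  ext i j
  rw [coeff_coeff_swapVars, PowerSeries.coeff_X, PowerSeries.coeff_C]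
  split_ifs <;> simp_all [PowerSeries.coeff_X, PowerSeries.coeff_one]

theorem swapVars_C_X : swapVars (PowerSeries.C PowerSeries.X : PowerSeries (PowerSeries B)) =
    PowerSeries.X := by
  ext i j
  rw [coeff_coeff_swapVars, PowerSeries.coeff_X, PowerSeries.coeff_C]
  split_ifs <;> simp_all [PowerSeries.coeff_X, PowerSeries.coeff_one]

theorem swapVars_C_C (b : B) : swapVars (PowerSeries.C (PowerSeries.C b)) =
    PowerSeries.C (PowerSeries.C b) := by
  ext i j
  rw [coeff_coeff_swapVars, PowerSeries.coeff_C, PowerSeries.coeff_C]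
  split_ifs <;> simp_all [PowerSeries.coeff_C]

theorem expand_two_injective :
    Function.Injective (PowerSeries.expand (R := B) 2 two_ne_zero) := by
  intro f g h
  ext n
  have := congrArg (PowerSeries.coeff (2 * n)) h
  rwa [PowerSeries.coeff_expand_mul, PowerSeries.coeff_expand_mul] at this

end Swap

/-! ### Equations between generating series by the number of edges -/

section Equations

/-- The generating series of the triangulations with a leg by the number of edges. -/
def legSeries {R : Type*} [CommRing R] [Algebra ℚ R]
    (f : ∀ D : Type, Perm D → Perm D → D → R) : PowerSeries R :=
  PowerSeries.mk fun e => rootedTotal f (2 * e)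

/-- Without its leg, a map with `e` edges has `2 * e` darts. -/
theorem mk_rootedTotal {R : Type*} [CommRing R] [Algebra ℚ R]
    (f : ∀ D : Type, Perm D → Perm D → D → R) :
    PowerSeries.mk (rootedTotal f) = PowerSeries.expand 2 two_ne_zero (legSeries f) := by
  ext n
  rw [PowerSeries.coeff_expand, PowerSeries.coeff_mk]
  split_ifs with h
  · rw [legSeries, PowerSeries.coeff_mk, Nat.mul_div_cancel' h]
  · exact rootedTotal_eq_zero_of_odd f (by rwa [← Nat.not_even_iff_odd, even_iff_two_dvd])

variable {R : Type*} [CommRing R] [Algebra ℚ R]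

theorem legSeries_first_return (P Y : R) :
    PowerSeries.C P * (legSeries (wt P Y) - PowerSeries.C P) =
      legSeries (restrict IsSimpleAt (wt P Y)) * legSeries (wt P Y) := by
  apply expand_two_injective
  rw [map_mul, map_mul, map_sub, PowerSeries.expand_C, ← mk_rootedTotal, ← mk_rootedTotal]
  ext n
  rw [PowerSeries.coeff_C_mul, PowerSeries.coeff_mul, map_sub, PowerSeries.coeff_mk,
    rootedTotal_wt, PowerSeries.coeff_C, add_sub_cancel_left, rootedTotal_first_return]
  simp only [PowerSeries.coeff_mk]

theorem legSeries_peel (P Y : R) :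
    PowerSeries.C (P * Y) * (legSeries (wt P Y) - PowerSeries.C P) =
      PowerSeries.X * (PowerSeries.C (P * Y ^ 3) * (legSeries (wt P Y) * legSeries (wt P Y)) +
        (PowerSeries.C P * legSeries (restrict IsLong (wt P Y)) + PowerSeries.C (1 - P) *
          legSeries (restrict (fun D σ α r => IsLong D σ α r ∧ IsSimpleAt D σ α r)
            (wt P Y)))) := by
  apply expand_two_injective
  simp only [map_mul, map_sub, map_add, PowerSeries.expand_C, PowerSeries.expand_X,
    ← mk_rootedTotal]
  simp only [← map_mul, ← map_sub]
  ext n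
  rw [PowerSeries.coeff_C_mul, map_sub, PowerSeries.coeff_mk,
    rootedTotal_wt, PowerSeries.coeff_C, add_sub_cancel_left, PowerSeries.coeff_X_pow_mul']
  split_ifs with h
  · obtain ⟨m, rfl⟩ := Nat.exists_eq_add_of_le' h
    rw [rootedTotal_peel, rootedTotal_peelWt, Nat.add_sub_cancel]
    simp only [map_add, PowerSeries.coeff_C_mul]
    simp only [PowerSeries.coeff_mul, PowerSeries.coeff_mk]
  · rw [rootedTotal_not_trivial_of_le_one P Y (by omega), mul_zero]

end Equations

/-! ### The coefficients by boundary length -/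

section Weights

variable {A : Type*} [CommRing A] [Algebra ℚ A]

theorem coeff_wt (q : A) {D : Type} (σ α : Perm D) (r : D) (k : ℕ) :
    PowerSeries.coeff k (wt (PowerSeries.C q) PowerSeries.X D σ α r) =
      if k = (cyc (σ * α) r).ncard - 1 then q ^ numClasses (sc σ) (cyc (σ * α) r) else 0 := by
  rw [wt, ← map_pow, PowerSeries.coeff_mul_C, PowerSeries.coeff_X_pow]
  split_ifs <;> simp

theorem coeff_rootedTotal (f : ∀ D : Type, Perm D → Perm D → D → PowerSeries A) (n k : ℕ) :
    PowerSeries.coeff k (rootedTotal f n) =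
      rootedTotal (fun D σ α r => PowerSeries.coeff k (f D σ α r)) n := by
  rw [rootedTotal, rootedTotal, PowerSeries.algebraMap_apply, PowerSeries.coeff_C_mul]
  congr 1
  exact (PowerSeries.coeff (R := A) k).toAddMonoidHom.map_finsum_mem _ (Set.toFinite _)

/-- The restriction to boundaries of length at least two removes the first two coefficients. -/
theorem coeff_rootedTotal_isLong (q : A) (Q : ∀ D : Type, Perm D → Perm D → D → Prop) (n k : ℕ) :
    PowerSeries.coeff k (rootedTotal (restrict (fun D σ α r => IsLong D σ α r ∧ Q D σ α r)
      (wt (PowerSeries.C q) PowerSeries.X)) n) =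
    if 2 ≤ k then PowerSeries.coeff k (rootedTotal (restrict Q
      (wt (PowerSeries.C q) PowerSeries.X)) n) else 0 := by
  classical
  rw [coeff_rootedTotal, coeff_rootedTotal]
  split_ifs with hk
  · refine rootedTotal_congr (finsum_mem_congr rfl fun M _ => ?_)
    simp only [restrict]
    by_cases hQ : Q _ M.1 M.2 0
    · by_cases hl : IsLong _ M.1 M.2 0
      · rw [if_pos ⟨hl, hQ⟩, if_pos hQ]
      · rw [if_neg fun h => hl h.1, if_pos hQ, map_zero, coeff_wt, if_neg]
        rw [IsLong] at hl
        omega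
    · rw [if_neg fun h => hQ h.2, if_neg hQ]
  · rw [rootedTotal, total, finsum_mem_congr rfl fun M _ => ?_, finsum_mem_zero, mul_zero]
    simp only [restrict]
    split_ifs with h
    · rw [coeff_wt, if_neg]
      have := h.1
      rw [IsLong] at this
      omega
    · exact map_zero _

theorem restrict_true {R : Type*} [CommRing R] (f : ∀ D : Type, Perm D → Perm D → D → R) :
    restrict (fun _ _ _ _ => True) f = f := by
  funext D σ α r
  exact if_pos trivial

theorem coeff_zero_rootedTotal (q : A) (n : ℕ) :
    PowerSeries.coeff 0 (rootedTotal (restrict (fun D σ α r => ¬ IsTrivial D σ α r)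
      (wt (PowerSeries.C q) PowerSeries.X)) n) = 0 := by
  have h := mapTotal_eq (PowerSeries.C q) (PowerSeries.X : PowerSeries A) (D := Fin n)
    (n := n) (by simp)
  have h0 : PowerSeries.coeff 0 (mapTotal (Fin n) (PowerSeries.C q) (PowerSeries.X)) = 0 := by
    refine ((PowerSeries.coeff (R := A) 0).toAddMonoidHom.map_finsum_mem _
      (Set.toFinite _)).trans ?_
    rw [finsum_mem_congr rfl fun M _ => ?_, finsum_mem_zero]
    have : (cyc (M.1.1 * M.1.2) M.2).ncard ≠ 0 :=
      Set.ncard_ne_zero_of_mem (self_mem_cyc _ _) (Set.toFinite _)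
    simp [mapWt, this]
  rw [h, PowerSeries.algebraMap_apply, PowerSeries.coeff_C_mul] at h0
  exact (isUnit_factorial n).mul_right_eq_zero.1 h0

end Weights

/-! ### Tutte's equations -/

section Series

/-- The generating series of rooted triangulations, from labelled permutations. -/
def mapSeries : SeriesRing := swapVars (legSeries (wt (PowerSeries.C Polynomial.X) PowerSeries.X))

/-- The generating series of the triangulations whose boundary visits the root vertex once. -/
def simpleSeries : SeriesRing :=
  swapVars (legSeries (restrict IsSimpleAt (wt (PowerSeries.C Polynomial.X) PowerSeries.X)))

/-- The equation of the first return of the boundary to the root vertex: the factor `p` accounts for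
this vertex, which is counted twice on the right-hand side. -/
theorem mapSeries_first_return : pVar * (mapSeries - pVar) = simpleSeries * mapSeries := by
  have h := congrArg swapVars (legSeries_first_return
    (PowerSeries.C (Polynomial.X : Polynomial ℚ)) PowerSeries.X)
  rwa [map_mul, map_mul, map_sub, swapVars_C_C] at h

theorem coeff_zero_mapSeries : PowerSeries.coeff 0 mapSeries = PowerSeries.C Polynomial.X := by
  ext1 e
  rw [mapSeries, coeff_coeff_swapVars, legSeries, PowerSeries.coeff_mk, rootedTotal_wt, map_add,
    coeff_zero_rootedTotal, add_zero, PowerSeries.coeff_C]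
  by_cases he : e = 0 <;> simp [he]

theorem C_X_ne_zero : (PowerSeries.C Polynomial.X : PowerSeries (Polynomial ℚ)) ≠ 0 := fun h =>
  Polynomial.X_ne_zero (PowerSeries.C_injective (h.trans (map_zero _).symm))

theorem coeff_zero_simpleSeries : PowerSeries.coeff 0 simpleSeries = 0 := by
  have h := congrArg PowerSeries.constantCoeff mapSeries_first_return
  have h0 := coeff_zero_mapSeries
  rw [PowerSeries.coeff_zero_eq_constantCoeff_apply] at h0 ⊢
  rw [map_mul, map_sub, map_mul, h0, pVar, PowerSeries.constantCoeff_C, sub_self, mul_zero] at h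
  exact (mul_eq_zero.1 h.symm).resolve_right C_X_ne_zero

/-- A boundary of length one visits its only vertex once. -/
theorem coeff_one_simpleSeries :
    PowerSeries.coeff 1 simpleSeries = PowerSeries.coeff 1 mapSeries := by
  have h := congrArg (PowerSeries.coeff 1) mapSeries_first_return
  have h0 := coeff_zero_mapSeries
  have h1 := coeff_zero_simpleSeries
  rw [PowerSeries.coeff_zero_eq_constantCoeff_apply] at h0 h1
  rw [pVar, PowerSeries.coeff_C_mul, map_sub, PowerSeries.coeff_one_mul, h0, h1, mul_zero,
    add_zero, PowerSeries.coeff_C, if_neg one_ne_zero, sub_zero, mul_comm] at h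
  exact (mul_right_cancel₀ C_X_ne_zero h).symm

theorem coeff_sub_trunc {B : Type*} [CommRing B] (F : PowerSeries B) (k : ℕ) :
    PowerSeries.coeff k (F - PowerSeries.C (PowerSeries.coeff 0 F) -
      PowerSeries.X * PowerSeries.C (PowerSeries.coeff 1 F)) =
      if 2 ≤ k then PowerSeries.coeff k F else 0 := by
  rw [map_sub, map_sub, PowerSeries.coeff_C, PowerSeries.coeff_mul_C, PowerSeries.coeff_X]
  rcases k with _ | _ | k <;> simp

/-- The equation of the removal of the root edge. The factors `p` and `1 - p` arise from `p + (1 -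
p) = 1` for the maps whose boundary visits the root vertex once, and from `p` for the others. -/
theorem mapSeries_peel : pVar * yVar * (mapSeries - pVar) =
    xVar * (pVar * yVar ^ 3 * mapSeries ^ 2 +
      (pVar * (mapSeries - pVar - yVar * PowerSeries.C (PowerSeries.coeff 1 mapSeries)) +
        (1 - pVar) * (simpleSeries - yVar * PowerSeries.C (PowerSeries.coeff 1 mapSeries)))) := by
  have h := congrArg swapVars (legSeries_peel
    (PowerSeries.C (Polynomial.X : Polynomial ℚ)) PowerSeries.X)
  have h1 : swapVars (legSeries (restrict IsLong (wt (PowerSeries.C (Polynomial.X : Polynomial ℚ))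
      PowerSeries.X))) =
      mapSeries - pVar - yVar * PowerSeries.C (PowerSeries.coeff 1 mapSeries) := by
    have h2 : restrict IsLong (wt (PowerSeries.C (Polynomial.X : Polynomial ℚ)) PowerSeries.X) =
        restrict (fun D σ α r => IsLong D σ α r ∧ True)
          (wt (PowerSeries.C (Polynomial.X : Polynomial ℚ)) PowerSeries.X) := by
      simp only [and_true]
    have h4 := coeff_sub_trunc mapSeries
    rw [coeff_zero_mapSeries] at h4
    ext1 k
    ext1 e
    rw [coeff_coeff_swapVars, legSeries, PowerSeries.coeff_mk, h2,
      coeff_rootedTotal_isLong _ (fun _ _ _ _ => True), restrict_true, pVar, yVar, h4]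
    split_ifs
    · rw [mapSeries, coeff_coeff_swapVars, legSeries, PowerSeries.coeff_mk]
    · rfl
  have h3 : swapVars (legSeries (restrict (fun D σ α r => IsLong D σ α r ∧ IsSimpleAt D σ α r)
      (wt (PowerSeries.C (Polynomial.X : Polynomial ℚ)) PowerSeries.X))) =
      simpleSeries - yVar * PowerSeries.C (PowerSeries.coeff 1 mapSeries) := by
    have h4 := coeff_sub_trunc simpleSeries
    rw [coeff_zero_simpleSeries, map_zero, sub_zero, coeff_one_simpleSeries] at h4
    ext1 k
    ext1 e
    rw [coeff_coeff_swapVars, legSeries, PowerSeries.coeff_mk, coeff_rootedTotal_isLong, yVar, h4]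
    split_ifs
    · rw [simpleSeries, coeff_coeff_swapVars, legSeries, PowerSeries.coeff_mk]
    · rfl
  simp only [map_mul, map_add, map_sub, map_pow, map_one, h1, h3, swapVars_X, swapVars_C_C,
    swapVars_C_X] at h
  rw [← pow_two] at h
  exact h

end Series

/-! ### Labelled maps and maps up to isomorphism -/

section Labelled

variable {D : Type} [Finite D]

/-- Connectedness as transitivity of the group generated by both permutations. -/
theorem conn_iff_exists_closure {σ α : Perm D} {a b : D} :
    conn σ α a b ↔ ∃ g ∈ Subgroup.closure {σ, α}, g a = b := by
  constructor
  · intro h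
    have hle : conn σ α ≤ (MulAction.orbitRel (Subgroup.closure {σ, α}) D) := by
      rw [conn_le_iff]
      refine ⟨fun x => Setoid.symm' _ ?_, fun x => Setoid.symm' _ ?_⟩
      · exact ⟨⟨σ, Subgroup.subset_closure (Or.inl rfl)⟩, rfl⟩
      · exact ⟨⟨α, Subgroup.subset_closure (Or.inr rfl)⟩, rfl⟩
    obtain ⟨g, hg⟩ := (Setoid.symm' _ (hle h) : MulAction.orbitRel _ D b a)
    exact ⟨g.1, g.2, hg⟩
  · rintro ⟨g, hg, rfl⟩
    induction hg using Subgroup.closure_induction generalizing a with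
    | mem x hx =>
      rcases hx with rfl | rfl
      · exact sc_le_conn_left _ _ (sc_step _ a)
      · exact sc_le_conn_right _ _ (sc_step _ a)
    | one => exact Setoid.refl' _ _
    | mul x y _ _ hx hy => exact Setoid.trans' _ hy hx
    | inv x _ hx =>
      have := hx (a := x⁻¹ a)
      rw [Equiv.Perm.inv_def, Equiv.apply_symm_apply] at this
      exact Setoid.symm' _ this

/-- An involution without fixed point has half as many cycles as points. -/
theorem card_eq_two_mul_numCycles {α : Perm D} (h : ∀ x, α (α x) = x) (h' : ∀ x, α x ≠ x) :
    Nat.card D = 2 * numCycles α := by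
  classical
  have := Fintype.ofFinite D
  have := Fintype.ofFinite (Quotient (sc α))
  rw [numCycles, numClasses_univ, Nat.card_eq_fintype_card, Nat.card_eq_fintype_card,
    ← Finset.card_univ, Finset.card_eq_sum_card_fiberwise (f := Quotient.mk (sc α))
      (t := Finset.univ) (fun _ _ => Finset.mem_coe.2 (Finset.mem_univ _)),
    Finset.sum_congr rfl (g := fun _ => 2), Finset.sum_const, smul_eq_mul, mul_comm,
    Finset.card_univ]
  rintro q -
  obtain ⟨d, rfl⟩ := Quotient.mk_surjective q
  rw [show Finset.univ.filter (fun x => Quotient.mk (sc α) x = Quotient.mk (sc α) d) =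
    {d, α d} from ?_, Finset.card_pair (h' d).symm]
  ext x
  simp only [Finset.mem_filter, Finset.mem_univ, true_and, Finset.mem_insert,
    Finset.mem_singleton, Quotient.eq]
  constructor
  · intro hx
    -- the pair `{d, α d}` is invariant
    have : ∀ n : ℕ, (α ^ n) d = d ∨ (α ^ n) d = α d := by
      intro n
      induction n with
      | zero => exact Or.inl rfl
      | succ n ih =>
        rw [pow_succ', Perm.mul_apply]
        rcases ih with ih | ih <;> rw [ih]
        · exact Or.inr rfl
        · exact Or.inl (h d)
    obtain ⟨n, -, hn⟩ := (show α.SameCycle d x from Setoid.symm' _ hx).exists_pow_eq'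
    rw [← hn]
    exact this n
  · rintro (rfl | rfl)
    · exact Setoid.refl' _ _
    · exact Setoid.symm' _ (sc_step α d)

theorem numComps_eq_one {σ α : Perm D} {d : D} (h : ∀ x, conn σ α d x) : numComps σ α = 1 := by
  rw [numComps, numClasses_univ, Nat.card_eq_one_iff_unique]
  refine ⟨⟨fun a b => ?_⟩, ⟨Quotient.mk _ d⟩⟩
  induction a using Quotient.inductionOn with | _ a => ?_
  induction b using Quotient.inductionOn with | _ b => ?_
  exact Quotient.sound (Setoid.trans' _ (Setoid.symm' _ (h a)) (h b))

theorem RootedMap.isPlanar_iff (m : RootedMap D) :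
    m.IsPlanar ↔ Planar m.vertexPerm m.edgePerm := by
  have h1 := card_eq_two_mul_numCycles m.edgePerm_edgePerm m.edgePerm_ne
  have h2 : numComps m.vertexPerm m.edgePerm = 1 :=
    numComps_eq_one (d := m.root) fun x => conn_iff_exists_closure.2 (m.connected _ x)
  have e1 : Nat.card m.Vertex = numCycles m.vertexPerm := (numClasses_univ _).symm
  have e2 : Nat.card m.Edge = numCycles m.edgePerm := (numClasses_univ _).symm
  have e3 : Nat.card m.Face = numCycles (m.vertexPerm * m.edgePerm) := (numClasses_univ _).symm
  rw [RootedMap.IsPlanar, Planar, e1, e2, e3, h1, h2]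
  omega

/-- `IsMap` codes the boundary triangulations. -/
theorem RootedMap.isMap_iff (m : RootedMap D) :
    IsMap m.vertexPerm m.edgePerm m.root ↔ m.IsBoundaryTriangulation := by
  constructor
  · intro h
    exact ⟨m.isPlanar_iff.2 h.planar, fun d hd => h.faces d hd⟩
  · rintro ⟨h, hf⟩
    exact ⟨m.edgePerm_edgePerm, m.edgePerm_ne,
      fun x => conn_iff_exists_closure.2 (m.connected _ x), m.isPlanar_iff.1 h, hf⟩

/-- The permutations of a rooted map and its root. -/
def RootedMap.toTriple (m : RootedMap D) : (Perm D × Perm D) × D :=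
  ((m.vertexPerm, m.edgePerm), m.root)

theorem RootedMap.toTriple_injective :
    Function.Injective (RootedMap.toTriple : RootedMap D → (Perm D × Perm D) × D) := by
  rintro ⟨σ, α, _, _, _, d⟩ ⟨σ', α', _, _, _, d'⟩ h
  simp only [RootedMap.toTriple, Prod.mk.injEq] at h
  obtain ⟨⟨rfl, rfl⟩, rfl⟩ := h
  rfl

theorem IsMap.exists_rootedMap {σ α : Perm D} {d : D} (h : IsMap σ α d) :
    ∃ m : RootedMap D, m.toTriple = ((σ, α), d) :=
  ⟨⟨σ, α, h.invol, h.fixed, fun x y => conn_iff_exists_closure.1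
    (Setoid.trans' _ (Setoid.symm' _ (h.conn x)) (h.conn y)), d⟩, rfl⟩

/-- The relabelling of a rooted map. -/
def RootedMap.relabel (f : Perm D) (m : RootedMap D) : RootedMap D where
  vertexPerm := f * m.vertexPerm * f⁻¹
  edgePerm := f * m.edgePerm * f⁻¹
  edgePerm_edgePerm d := by simp [Perm.mul_apply, m.edgePerm_edgePerm]
  edgePerm_ne d h := m.edgePerm_ne (f⁻¹ d) (by
    rw [Perm.mul_apply, Perm.mul_apply] at h
    exact f.injective (h.trans (f.apply_symm_apply d).symm))
  connected d d' := by
    have key : ∀ x y, conn m.vertexPerm m.edgePerm x y →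
        conn (f * m.vertexPerm * f⁻¹) (f * m.edgePerm * f⁻¹) (f x) (f y) := by
      intro x y h
      have : conn m.vertexPerm m.edgePerm ≤
          (conn (f * m.vertexPerm * f⁻¹) (f * m.edgePerm * f⁻¹)).comap f := by
        rw [conn_le_iff]
        refine ⟨fun x => ?_, fun x => ?_⟩
        · have := sc_le_conn_left _ (f * m.edgePerm * f⁻¹) (sc_step (f * m.vertexPerm * f⁻¹) (f x))
          simpa [Perm.mul_apply, Setoid.comap_rel] using this
        · have := sc_le_conn_right (f * m.vertexPerm * f⁻¹) _ (sc_step (f * m.edgePerm * f⁻¹) (f x))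
          simpa [Perm.mul_apply, Setoid.comap_rel] using this
      exact this h
    obtain ⟨x, rfl⟩ := f.surjective d
    obtain ⟨y, rfl⟩ := f.surjective d'
    exact conn_iff_exists_closure.1 (key x y (conn_iff_exists_closure.2 (m.connected x y)))
  root := f m.root

theorem RootedMap.iso_relabel (f : Perm D) (m : RootedMap D) : m.Iso (m.relabel f) :=
  ⟨f, fun d => by simp [RootedMap.relabel, Perm.mul_apply],
    fun d => by simp [RootedMap.relabel, Perm.mul_apply], rfl⟩

theorem RootedMap.Iso.exists_relabel {m m' : RootedMap D} (h : m.Iso m') :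
    ∃ f : Perm D, m.relabel f = m' := by
  obtain ⟨f, h1, h2, h3⟩ := h
  refine ⟨f, RootedMap.toTriple_injective ?_⟩
  refine Prod.ext (Prod.ext (Equiv.ext fun x => ?_) (Equiv.ext fun x => ?_)) h3
  · obtain ⟨y, rfl⟩ := f.surjective x
    simp [RootedMap.toTriple, RootedMap.relabel, Perm.mul_apply, h1]
  · obtain ⟨y, rfl⟩ := f.surjective x
    simp [RootedMap.toTriple, RootedMap.relabel, Perm.mul_apply, h2]

/-- Rooted maps have no symmetries. -/
theorem RootedMap.relabel_injective (m : RootedMap D) :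
    Function.Injective fun f : Perm D => m.relabel f := by
  intro f g h
  have h := congrArg RootedMap.toTriple h
  simp only [RootedMap.toTriple, RootedMap.relabel, Prod.mk.injEq] at h
  obtain ⟨⟨h1, h2⟩, h3⟩ := h
  let s : Setoid D := (⊥ : Setoid (Unit → Prop)).comap fun x _ => f x = g x
  have hle : conn m.vertexPerm m.edgePerm ≤ s := by
    rw [conn_le_iff]
    have key : ∀ π : Perm D, f * π * f⁻¹ = g * π * g⁻¹ → ∀ x, f x = g x ↔ f (π x) = g (π x) := by
      intro π hπ x
      have h4 : f (π x) = (g * π * g⁻¹) (f x) := by rw [← hπ]; simp [Perm.mul_apply]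
      rw [h4]
      simp only [Perm.mul_apply, EmbeddingLike.apply_eq_iff_eq]
      rw [Perm.inv_def, Equiv.symm_apply_eq]
    exact ⟨fun x => funext fun _ => propext (key _ h1 x),
      fun x => funext fun _ => propext (key _ h2 x)⟩
  ext x
  have : s m.root x := hle (conn_iff_exists_closure.2 (m.connected _ x))
  exact (congrFun (show (fun _ : Unit => f m.root = g m.root) = fun _ => f x = g x from this)
    ()).mp h3

/-- The number of labelled maps with an isomorphism invariant property. -/
theorem card_labelled {Q : RootedMap D → Prop} (hQ : ∀ m m' : RootedMap D, m.Iso m' → Q m → Q m') :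
    Nat.card {m // Q m} = Nat.card {c : Quotient (RootedMap.isoSetoid D) //
      ∃ m : RootedMap D, Quotient.mk _ m = c ∧ Q m} * (Nat.card D).factorial := by
  rw [← Nat.card_perm, ← Nat.card_prod]
  symm
  have hout : ∀ c : {c : Quotient (RootedMap.isoSetoid D) //
      ∃ m : RootedMap D, Quotient.mk _ m = c ∧ Q m}, Q c.1.out := by
    rintro ⟨c, m, rfl, hm⟩
    exact hQ _ _ ((RootedMap.isoSetoid D).symm (Quotient.mk_out m)) hm
  refine Nat.card_eq_of_bijective
    (fun cf => (⟨cf.1.1.out.relabel cf.2, hQ _ _ (RootedMap.iso_relabel _ _) (hout cf.1)⟩ :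
      {m // Q m})) ⟨?_, ?_⟩
  · rintro ⟨c, f⟩ ⟨c', f'⟩ h
    have h : c.1.out.relabel f = c'.1.out.relabel f' := congrArg Subtype.val h
    have hc : c.1 = c'.1 := by
      rw [← c.1.out_eq, ← c'.1.out_eq]
      refine Quotient.sound ((RootedMap.isoSetoid D).trans (RootedMap.iso_relabel f _) ?_)
      rw [h]
      exact (RootedMap.isoSetoid D).symm (RootedMap.iso_relabel f' _)
    have hc := Subtype.ext hc
    subst hc
    rw [(RootedMap.relabel_injective _) h]
  · rintro ⟨m, hm⟩
    have h1 : (Quotient.mk (RootedMap.isoSetoid D) m).out.Iso m :=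
      Quotient.mk_out (s := RootedMap.isoSetoid D) m
    obtain ⟨f, hf⟩ := h1.exists_relabel
    exact ⟨(⟨_, m, rfl, hm⟩, f), Subtype.ext hf⟩

end Labelled

/-! ### The generating series of rooted triangulations -/

section Count

variable {D : Type} [Finite D]

theorem RootedMap.Iso.invariants {m m' : RootedMap D} (h : m.Iso m') :
    (m.IsBoundaryTriangulation → m'.IsBoundaryTriangulation) ∧
      m'.boundaryLength = m.boundaryLength ∧ m'.numOuterVertices = m.numOuterVertices := by
  obtain ⟨f, h1, h2, h3⟩ := h
  have hE : IsEmb f m.vertexPerm m.edgePerm m'.vertexPerm m'.edgePerm := ⟨f.injective, h1, h2⟩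
  have hl : m'.boundaryLength = m.boundaryLength := by
    change (cyc (m'.vertexPerm * m'.edgePerm) m'.root).ncard = _
    rw [← h3, hE.mul.ncard_cyc]
    rfl
  have hv : m'.numOuterVertices = m.numOuterVertices := by
    change numClasses (sc m'.vertexPerm) (cyc (m'.vertexPerm * m'.edgePerm) m'.root) = _
    rw [← h3, ← hE.mul.image_cyc, hE.numClasses_image]
    rfl
  refine ⟨fun h => ?_, hl, hv⟩
  have e1 : m'.vertexPerm = f.permCongr m.vertexPerm := by
    ext x
    simp [h1]
  have e2 : m'.edgePerm = f.permCongr m.edgePerm := by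
    ext x
    simp [h2]
  refine ⟨?_, fun d hd => ?_⟩
  · rw [RootedMap.isPlanar_iff, e1, e2]
    exact planar_permCongr f (m.isPlanar_iff.1 h.1)
  · obtain ⟨x, rfl⟩ := f.surjective d
    change (cyc (m'.vertexPerm * m'.edgePerm) (f x)).ncard = 3
    rw [hE.mul.ncard_cyc]
    refine h.2 x fun hx => hd ?_
    rw [← h3]
    exact hE.mul.sc_iff'.2 hx

/-- The labelled triangulations with given boundary length and number of boundary vertices. -/
theorem ncard_isMap (k e v : ℕ) :
    {M : (Perm (Fin (2 * e)) × Perm (Fin (2 * e))) × Fin (2 * e) | IsMap M.1.1 M.1.2 M.2 ∧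
      (cyc (M.1.1 * M.1.2) M.2).ncard = k ∧
        numClasses (sc M.1.1) (cyc (M.1.1 * M.1.2) M.2) = v}.ncard =
      numTriangulations k e v * (2 * e).factorial := by
  have h := card_labelled (D := Fin (2 * e)) (Q := fun m => m.IsBoundaryTriangulation ∧
    m.boundaryLength = k ∧ m.numOuterVertices = v) fun m m' hm ⟨h1, h2, h3⟩ =>
      ⟨hm.invariants.1 h1, hm.invariants.2.1.trans h2, hm.invariants.2.2.trans h3⟩
  rw [Nat.card_eq_fintype_card (α := Fin (2 * e)), Fintype.card_fin] at h
  rw [numTriangulations, ← h]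
  refine (Nat.card_eq_of_bijective (fun m => ⟨m.1.toTriple, m.1.isMap_iff.2 m.2.1, m.2.2⟩) ⟨?_, ?_⟩).symm
  · intro m m' hm
    exact Subtype.ext (RootedMap.toTriple_injective (congrArg Subtype.val hm))
  · rintro ⟨M, hM, hM'⟩
    obtain ⟨m, hm⟩ := hM.exists_rootedMap
    obtain rfl : m.toTriple = M := hm
    exact ⟨⟨m, m.isMap_iff.1 hM, hM'⟩, rfl⟩

/-- Counting by isomorphism classes agrees with counting labelled maps up to the factor `(2 * e)!`.
-/
theorem triangulationPoly_eq (k e : ℕ) : triangulationPoly k e =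
    PowerSeries.coeff k (rootedTotal (wt (PowerSeries.C Polynomial.X) PowerSeries.X) (2 * e)) := by
  classical
  rw [rootedTotal_wt, map_add, triangulationPoly]
  congr 1
  · by_cases he : e = 0
    · simp [he, PowerSeries.coeff_C]
    · simp [he]
  · refine (isUnit_factorial (R := Polynomial ℚ) (2 * e)).mul_left_cancel ?_
    rw [← PowerSeries.coeff_C_mul, ← PowerSeries.algebraMap_apply,
      ← mapTotal_eq _ _ (D := Fin (2 * e)) (by simp)]
    refine Eq.trans ?_ ((PowerSeries.coeff (R := Polynomial ℚ) k).toAddMonoidHom.map_finsum_mem _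
      (Set.toFinite _)).symm
    have h1 : ∀ M ∈ {M : (Perm (Fin (2 * e)) × Perm (Fin (2 * e))) × Fin (2 * e) |
        IsMap M.1.1 M.1.2 M.2}, (PowerSeries.coeff (R := Polynomial ℚ) k).toAddMonoidHom
          (mapWt (PowerSeries.C Polynomial.X) PowerSeries.X M.1.1 M.1.2 M.2) =
        ∑ v ∈ Finset.range (k + 1), if (cyc (M.1.1 * M.1.2) M.2).ncard = k ∧
          numClasses (sc M.1.1) (cyc (M.1.1 * M.1.2) M.2) = v then Polynomial.X ^ v else 0 := by
      intro M _
      change PowerSeries.coeff k (mapWt _ _ _ _ _) = _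
      rw [mapWt, ← map_pow, PowerSeries.coeff_mul_C, PowerSeries.coeff_X_pow]
      have hle := numClasses_le_ncard (sc M.1.1) (cyc (M.1.1 * M.1.2) M.2)
      by_cases hk : (cyc (M.1.1 * M.1.2) M.2).ncard = k
      · rw [if_pos hk.symm, one_mul, Finset.sum_eq_single_of_mem _ (Finset.mem_range.2
          (Nat.lt_succ_of_le (hle.trans hk.le))), if_pos ⟨hk, rfl⟩]
        intro v _ hv
        rw [if_neg fun h => hv h.2.symm]
      · rw [if_neg (Ne.symm hk), zero_mul]
        refine (Finset.sum_eq_zero fun v _ => ?_).symm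
        rw [if_neg fun h => hk h.1]
    rw [finsum_mem_congr rfl h1, finsum_mem_eq_finite_toFinset_sum _ (Set.toFinite _),
      Finset.sum_comm, Finset.mul_sum]
    refine Finset.sum_congr rfl fun v _ => ?_
    rw [← Finset.sum_filter, Finset.sum_const, nsmul_eq_mul, ← mul_assoc]
    congr 1
    rw [map_natCast, mul_comm, ← Nat.cast_mul, ← ncard_isMap, Set.ncard_eq_toFinset_card _
      (Set.toFinite _)]
    refine congrArg (fun F : Finset _ => (F.card : Polynomial ℚ)) (Finset.ext fun M => ?_)
    simp

theorem triangulationSeries_eq : triangulationSeries = mapSeries := by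
  ext1 k
  ext1 e
  rw [triangulationSeries, PowerSeries.coeff_mk, PowerSeries.coeff_mk, triangulationPoly_eq,
    mapSeries, coeff_coeff_swapVars, legSeries, PowerSeries.coeff_mk]

end Count

/-! ### Uniqueness of the solution of Tutte's equations -/

section Uniqueness

/-- The reduction at `x = 0`. -/
def reduceX : SeriesRing →+* PowerSeries (Polynomial ℚ) :=
  PowerSeries.map PowerSeries.constantCoeff

theorem xVar_dvd_iff {F : SeriesRing} : xVar ∣ F ↔ reduceX F = 0 := by
  constructor
  · rintro ⟨G, rfl⟩
    rw [map_mul]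
    simp [reduceX, xVar]
  · intro h
    have : ∀ k, ∃ c, PowerSeries.coeff k F = PowerSeries.X * c := fun k => by
      have := congrArg (PowerSeries.coeff k) h
      rw [reduceX, PowerSeries.coeff_map, map_zero] at this
      exact PowerSeries.X_dvd_iff.2 this
    choose c hc using this
    refine ⟨PowerSeries.mk c, ?_⟩
    ext1 k
    rw [xVar, PowerSeries.coeff_C_mul, PowerSeries.coeff_mk, hc]

theorem prime_xVar : Prime xVar := by
  refine ⟨?_, ?_, ?_⟩
  · intro h
    have := PowerSeries.C_injective (h.trans (map_zero _).symm)
    exact PowerSeries.X_ne_zero this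
  · intro h
    have h1 := xVar_dvd_iff.1 (h.dvd (a := 1))
    rw [map_one] at h1
    exact one_ne_zero h1
  · intro F G h
    rw [xVar_dvd_iff, map_mul, mul_eq_zero] at h
    rwa [xVar_dvd_iff, xVar_dvd_iff]

theorem xVar_pow_dvd_C_coeff {F : SeriesRing} {n : ℕ} (h : xVar ^ n ∣ F) (k : ℕ) :
    xVar ^ n ∣ PowerSeries.C (PowerSeries.coeff k F) := by
  obtain ⟨G, rfl⟩ := h
  refine ⟨PowerSeries.C (PowerSeries.coeff k G), ?_⟩
  rw [xVar, ← map_pow, PowerSeries.coeff_C_mul, map_mul]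

theorem eq_zero_of_xVar_pow_dvd {F : SeriesRing} (h : ∀ n : ℕ, xVar ^ n ∣ F) : F = 0 := by
  ext1 k
  ext1 n
  obtain ⟨G, hG⟩ := h (n + 1)
  rw [hG, xVar, ← map_pow, PowerSeries.coeff_C_mul, PowerSeries.coeff_X_pow_mul', if_neg (by omega)]
  simp

theorem reduceX_pVar : reduceX pVar = PowerSeries.C Polynomial.X := by
  simp [reduceX, pVar]

theorem reduceX_yVar : reduceX yVar = PowerSeries.X := by
  simp [reduceX, yVar]

theorem not_xVar_dvd_pVar : ¬ xVar ∣ pVar := by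
  rw [xVar_dvd_iff, reduceX_pVar]
  exact C_X_ne_zero

theorem not_xVar_dvd_yVar : ¬ xVar ∣ yVar := by
  rw [xVar_dvd_iff, reduceX_yVar]
  exact PowerSeries.X_ne_zero

/-- Tutte's equation with its auxiliary series; the variable `x` stands for `t`. -/
structure IsTutte (T S : SeriesRing) : Prop where
  first : pVar * (T - pVar) = S * T
  peel : pVar * yVar * (T - pVar) = xVar * (pVar * yVar ^ 3 * T ^ 2 +
    (pVar * (T - pVar - yVar * PowerSeries.C (PowerSeries.coeff 1 T)) +
      (1 - pVar) * (S - yVar * PowerSeries.C (PowerSeries.coeff 1 T))))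

/-- At `t = 0` only the map reduced to a vertex remains. -/
theorem IsTutte.dvd_sub {T S : SeriesRing} (h : IsTutte T S) : xVar ∣ T - pVar := by
  have h1 : xVar ∣ pVar * yVar * (T - pVar) := ⟨_, h.peel⟩
  refine (prime_xVar.dvd_or_dvd h1).resolve_left fun h2 => ?_
  exact (prime_xVar.dvd_or_dvd h2).elim not_xVar_dvd_pVar not_xVar_dvd_yVar

theorem IsTutte.not_dvd {T S : SeriesRing} (h : IsTutte T S) : ¬ xVar ∣ T := fun h' =>
  not_xVar_dvd_pVar ((dvd_sub_right h').1 h.dvd_sub)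

/-- The solution is determined order by order in `t`. -/
theorem IsTutte.unique {T S T' S' : SeriesRing} (h : IsTutte T S) (h' : IsTutte T' S') :
    T = T' := by
  refine sub_eq_zero.1 (eq_zero_of_xVar_pow_dvd fun n => ?_)
  induction n with
  | zero => rw [pow_zero]; exact one_dvd _
  | succ n ih =>
    have hS : xVar ^ n ∣ S - S' := by
      have h1 : xVar ^ n ∣ (S - S') * T := by
        have : (S - S') * T = (pVar - S') * (T - T') := by
          linear_combination h'.first - h.first
        rw [this]
        exact ih.mul_left _
      exact prime_xVar.pow_dvd_of_dvd_mul_right n h.not_dvd h1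
    have h1 := xVar_pow_dvd_C_coeff ih 1
    have h2 : xVar ^ (n + 1) ∣ pVar * yVar * (T - T') := by
      have : pVar * yVar * (T - T') = xVar * (pVar * yVar ^ 3 * (T + T') * (T - T') +
          (pVar * (T - T') + (1 - pVar) * (S - S') -
            yVar * PowerSeries.C (PowerSeries.coeff 1 (T - T')))) := by
        rw [map_sub, map_sub]
        linear_combination h.peel - h'.peel
      rw [this, pow_succ']
      exact mul_dvd_mul_left _ (dvd_add (ih.mul_left _) (_root_.dvd_sub (dvd_add (ih.mul_left _)
        (hS.mul_left _)) (h1.mul_left _)))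
    refine prime_xVar.pow_dvd_of_dvd_mul_left _ (fun h3 => ?_) h2
    exact (prime_xVar.dvd_or_dvd h3).elim not_xVar_dvd_pVar not_xVar_dvd_yVar

theorem isTutte_triangulationSeries : IsTutte triangulationSeries simpleSeries := by
  rw [triangulationSeries_eq]
  exact ⟨mapSeries_first_return, mapSeries_peel⟩

end Uniqueness

/-! ### Cubic equations for power series -/

section FixedPoint

variable {B : Type*} [CommRing B]

/-- A contraction for the `X`-adic topology has a unique fixed point. -/
theorem existsUnique_fixedPoint (Φ : PowerSeries B → PowerSeries B)
    (h0 : ∀ h, PowerSeries.X ∣ h → PowerSeries.X ∣ Φ h)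
    (hΦ : ∀ n h h', PowerSeries.X ∣ h → PowerSeries.X ∣ h' → PowerSeries.X ^ n ∣ h - h' →
      PowerSeries.X ^ (n + 1) ∣ Φ h - Φ h') :
    ∃! h : PowerSeries B, PowerSeries.X ∣ h ∧ h = Φ h := by
  have hit : ∀ n, PowerSeries.X ∣ Φ^[n] 0 := fun n => by
    induction n with
    | zero => exact dvd_zero _
    | succ n ih => rw [Function.iterate_succ_apply']; exact h0 _ ih
  have hstep : ∀ n, PowerSeries.X ^ (n + 1) ∣ Φ^[n + 1] 0 - Φ^[n] 0 := fun n => by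
    induction n with
    | zero => simpa using h0 0 (dvd_zero _)
    | succ n ih =>
      rw [Function.iterate_succ_apply', Function.iterate_succ_apply' Φ n]
      exact hΦ _ _ _ (h0 _ (hit n)) (hit n) (by rwa [Function.iterate_succ_apply'] at ih)
  have hlt : ∀ n m, PowerSeries.X ^ (n + 1) ∣ Φ^[n + m] 0 - Φ^[n] 0 := fun n m => by
    induction m with
    | zero => simp
    | succ m ih =>
      rw [← sub_add_sub_cancel _ (Φ^[n + m] 0)]
      exact dvd_add ((pow_dvd_pow _ (by omega)).trans (hstep (n + m))) ih
  let h : PowerSeries B := PowerSeries.mk fun n => PowerSeries.coeff n (Φ^[n] 0)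
  have hlim : ∀ n, PowerSeries.X ^ (n + 1) ∣ h - Φ^[n] 0 := fun n => by
    rw [PowerSeries.X_pow_dvd_iff]
    intro k hk
    obtain ⟨m, rfl⟩ := Nat.exists_eq_add_of_le (Nat.lt_succ_iff.1 hk)
    have := PowerSeries.X_pow_dvd_iff.1 (hlt k m) k (Nat.lt_succ_self _)
    rw [map_sub, sub_eq_zero] at this
    rw [map_sub, PowerSeries.coeff_mk, this, sub_self]
  have hX : PowerSeries.X ∣ h := by
    have := hlim 0
    simpa using this
  have hfix : h = Φ h := by
    refine sub_eq_zero.1 ?_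
    ext n
    have h1 := hlim (n + 1)
    have h2 := hΦ _ _ _ hX (hit n) (hlim n)
    rw [Function.iterate_succ_apply'] at h1
    have h3 := _root_.dvd_sub h1 h2
    rw [sub_sub_sub_cancel_right] at h3
    exact PowerSeries.X_pow_dvd_iff.1 h3 n (by omega)
  refine ⟨h, ⟨hX, hfix⟩, ?_⟩
  rintro h' ⟨hX', he⟩
  have : ∀ n, PowerSeries.X ^ n ∣ h' - h := fun n => by
    induction n with
    | zero => simp
    | succ n ih =>
      rw [he, hfix]
      exact hΦ _ _ _ hX' hX ih
  refine sub_eq_zero.1 ?_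
  ext n
  exact PowerSeries.X_pow_dvd_iff.1 (this (n + 1)) n (Nat.lt_succ_self n)

/-- The right-hand side of a cubic equation for a power series without constant term. -/
def cubic (α γ : B) (β : Fin 4 → B) (h : PowerSeries B) : PowerSeries B :=
  PowerSeries.C α * h ^ 2 + PowerSeries.C γ * h ^ 3 + PowerSeries.X * (PowerSeries.C (β 0) +
    PowerSeries.C (β 1) * h + PowerSeries.C (β 2) * h ^ 2 + PowerSeries.C (β 3) * h ^ 3)

/-- The right-hand side is a contraction on the series without constant term. -/
theorem existsUnique_cubic (α γ : B) (β : Fin 4 → B) :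
    ∃! h : PowerSeries B, PowerSeries.X ∣ h ∧ h = cubic α γ β h := by
  apply existsUnique_fixedPoint
  · intro h hX
    exact dvd_add (dvd_add ((hX.trans (dvd_pow_self h two_ne_zero)).mul_left _)
      ((hX.trans (dvd_pow_self h three_ne_zero)).mul_left _)) (dvd_mul_right _ _)
  · intro n h h' hX hX' hn
    have : cubic α γ β h - cubic α γ β h' = (PowerSeries.C α * (h + h') +
        PowerSeries.C γ * (h * h + h * h' + h' * h') + PowerSeries.X * (PowerSeries.C (β 1) +
          PowerSeries.C (β 2) * (h + h') + PowerSeries.C (β 3) * (h * h + h * h' + h' * h'))) *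
        (h - h') := by
      unfold cubic; ring
    rw [this, pow_succ']
    refine mul_dvd_mul (dvd_add (dvd_add ((dvd_add hX hX').mul_left _) ?_) (dvd_mul_right _ _)) hn
    exact (dvd_add (dvd_add (hX.mul_left _) (hX.mul_right _)) (hX'.mul_left _)).mul_left _

theorem map_cubic {B' : Type*} [CommRing B'] (f : B →+* B') (α γ : B) (β : Fin 4 → B)
    (h : PowerSeries B) : PowerSeries.map f (cubic α γ β h) =
      cubic (f α) (f γ) (fun i => f (β i)) (PowerSeries.map f h) := by
  simp [cubic]

/-- The coefficients of the solution lie in every subring that contains those of the equation. -/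
theorem coeff_mem_of_cubic {k : Type*} [CommRing k] [Algebra k B] (C : Subalgebra k B) {α γ : B}
    {β : Fin 4 → B} (hα : α ∈ C) (hγ : γ ∈ C) (hβ : ∀ i, β i ∈ C) {h : PowerSeries B}
    (hX : PowerSeries.X ∣ h) (he : h = cubic α γ β h) (n : ℕ) : PowerSeries.coeff n h ∈ C := by
  obtain ⟨g, ⟨hgX, hg⟩, -⟩ := existsUnique_cubic (⟨α, hα⟩ : C) ⟨γ, hγ⟩ fun i => ⟨β i, hβ i⟩
  have h1 : PowerSeries.map (C.val : C →+* B) g = h := by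
    refine (existsUnique_cubic α γ β).unique ⟨?_, ?_⟩ ⟨hX, he⟩
    · have := map_dvd (PowerSeries.map (C.val : C →+* B)) hgX
      rwa [PowerSeries.map_X] at this
    · conv_lhs => rw [hg]
      exact map_cubic _ _ _ _ _
  rw [← h1, PowerSeries.coeff_map]
  exact (PowerSeries.coeff n g).2

end FixedPoint

/-! ### Cubic equations with a unit coefficient -/

section ScaledCubic

variable {B : Type*} [CommRing B]

theorem scaled_cubic_iff {c i α γ : B} {β : Fin 4 → B} (hi : c * i = 1) {h : PowerSeries B} :
    PowerSeries.C c * h = cubic α γ β h ↔ h = cubic (i * α) (i * γ) (fun k => i * β k) h := by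
  have h1 : cubic (i * α) (i * γ) (fun k => i * β k) h = PowerSeries.C i * cubic α γ β h := by
    simp only [cubic, map_mul]
    ring
  have h2 : PowerSeries.C c * PowerSeries.C i = (1 : PowerSeries B) := by
    rw [← map_mul, hi, map_one]
  rw [h1]
  constructor
  · intro h3
    rw [← h3]
    linear_combination -h * h2
  · intro h3
    conv_lhs => rw [h3]
    linear_combination cubic α γ β h * h2

theorem existsUnique_scaled_cubic {c : B} (hc : IsUnit c) (α γ : B) (β : Fin 4 → B) :
    ∃! h : PowerSeries B, PowerSeries.X ∣ h ∧ PowerSeries.C c * h = cubic α γ β h := by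
  obtain ⟨i, hi⟩ := hc.exists_right_inv
  simp only [scaled_cubic_iff hi]
  exact existsUnique_cubic _ _ _

end ScaledCubic

/-- A root of a cubic polynomial with algebraic coefficients is algebraic. The polynomial is nonzero
because its constant coefficient is. -/
theorem isAlgebraic_of_cubic {A S : Type*} [CommRing A] [IsDomain A] [CommRing S] [IsDomain S]
    [Algebra A S] {c₀ c₁ c₂ c₃ z : S} (h₀ : IsAlgebraic A c₀) (h₁ : IsAlgebraic A c₁)
    (h₂ : IsAlgebraic A c₂) (h₃ : IsAlgebraic A c₃) (hne : c₀ ≠ 0)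
    (h : c₀ + c₁ * z + c₂ * z ^ 2 + c₃ * z ^ 3 = 0) : IsAlgebraic A z := by
  let L := Subalgebra.algebraicClosure A S
  let a₀ : L := ⟨c₀, h₀⟩
  let a₁ : L := ⟨c₁, h₁⟩
  let a₂ : L := ⟨c₂, h₂⟩
  let a₃ : L := ⟨c₃, h₃⟩
  have : IsAlgebraic L z := by
    refine ⟨Polynomial.C a₀ + Polynomial.C a₁ * Polynomial.X + Polynomial.C a₂ * Polynomial.X ^ 2 +
      Polynomial.C a₃ * Polynomial.X ^ 3, fun h => ?_, ?_⟩
    · have h0 := congrArg (fun f => Polynomial.coeff f 0) h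
      simp at h0
      exact hne (congrArg Subtype.val h0)
    · simp only [map_add, map_mul, Polynomial.aeval_X, map_pow, Polynomial.aeval_C]
      exact h
  exact this.restrictScalars A

/-! ### The series `U` -/

section SeriesU

theorem isSeriesU_iff {U : PowerSeries ℚ} : IsSeriesU U ↔
    PowerSeries.X ∣ U ∧ 2 * PowerSeries.X = U * (1 - U) * (1 - 2 * U) := by
  have h2 : algebraMap ℚ (PowerSeries ℚ) (1 / 2) * 2 = 1 := by
    rw [← map_ofNat (algebraMap ℚ (PowerSeries ℚ)) 2, ← map_mul]
    norm_num
  rw [IsSeriesU, PowerSeries.X_dvd_iff, wHat]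
  refine and_congr Iff.rfl ⟨fun h => ?_, fun h => ?_⟩
  · rw [h]
    linear_combination U * (1 - U) * (1 - 2 * U) * h2
  · linear_combination algebraMap ℚ (PowerSeries ℚ) (1 / 2) * h - PowerSeries.X * h2

theorem existsUnique_isSeriesU : ∃! U : PowerSeries ℚ, IsSeriesU U := by
  have h := existsUnique_cubic (3 : ℚ) (-2) ![2, 0, 0, 0]
  have : ∀ U : PowerSeries ℚ, IsSeriesU U ↔
      PowerSeries.X ∣ U ∧ U = cubic (3 : ℚ) (-2) ![2, 0, 0, 0] U := by
    intro U
    rw [isSeriesU_iff]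
    refine and_congr Iff.rfl ?_
    simp only [cubic, map_neg, map_ofNat, Matrix.cons_val, map_zero, zero_mul, add_zero]
    constructor <;> intro h <;> linear_combination -h
  simp only [this]
  exact h

end SeriesU

/-! ### The series `V` -/

section SeriesV

variable {U : PowerSeries ℚ} (hU : IsSeriesU U)

include hU

theorem IsSeriesU.inclX_eq : 2 * PowerSeries.X = inclX U * (1 - inclX U) * (1 - 2 * inclX U) := by
  have := congrArg inclX (isSeriesU_iff.1 hU).2
  simp only [map_mul, map_sub, map_one, map_ofNat] at this
  rwa [inclX, PowerSeries.map_X] at this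

theorem IsSeriesU.mul_inv : (1 - 2 * U) * (1 - 2 * U)⁻¹ = 1 := by
  refine PowerSeries.mul_inv_cancel _ ?_
  rw [map_sub, map_mul, hU.1]
  simp

theorem IsSeriesU.inclX_mul_inv : (1 - 2 * inclX U) * inclX (1 - 2 * U)⁻¹ = 1 := by
  have := congrArg inclX hU.mul_inv
  simpa only [map_mul, map_sub, map_one, map_ofNat] using this

omit hU in
theorem algebraMap_inv_mul {R : Type*} [CommRing R] [Algebra ℚ R] (n : ℕ) [n.AtLeastTwo] :
    algebraMap ℚ R (1 / OfNat.ofNat n) * OfNat.ofNat n = 1 := by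
  rw [← map_ofNat (algebraMap ℚ R) n, ← map_mul, one_div_mul_cancel, map_one]
  exact OfNat.ofNat_ne_zero n

theorem IsSeriesU.mul_inv_four : (4 * (1 - 2 * inclX U)) *
    (algebraMap ℚ (PowerSeries (Polynomial ℚ)) (1 / 4) * inclX (1 - 2 * U)⁻¹) = 1 := by
  have h4 := algebraMap_inv_mul (R := PowerSeries (Polynomial ℚ)) 4
  linear_combination h4 * (1 - 2 * inclX U) * inclX (1 - 2 * U)⁻¹ + hU.inclX_mul_inv

omit hU in
/-- The numerator of `T̂`, with `4 U (1 - U) (1 - 2 U) = 8 x`. -/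
def numer (U : PowerSeries ℚ) (V : SeriesRing) : SeriesRing :=
  8 * pVar * xVar + 2 * PowerSeries.C (inclX U) * (1 - 3 * PowerSeries.C (inclX U)) * V +
    2 * (1 - 3 * PowerSeries.C (inclX U)) * V ^ 2 - V ^ 3

theorem IsSeriesU.C_inclX_eq : 2 * xVar = PowerSeries.C (inclX U) *
    (1 - PowerSeries.C (inclX U)) * (1 - 2 * PowerSeries.C (inclX U)) := by
  have := congrArg (PowerSeries.C (R := PowerSeries (Polynomial ℚ))) hU.inclX_eq
  rw [xVar]
  simpa only [map_mul, map_sub, map_one, map_ofNat] using this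

theorem IsSeriesU.toFrac_numer (V : SeriesRing) : toFrac (numer U V) =
    4 * toFrac pVar * toFrac (PowerSeries.C (inclX U)) * (1 - toFrac (PowerSeries.C (inclX U))) *
      (1 - 2 * toFrac (PowerSeries.C (inclX U))) + 2 * toFrac (PowerSeries.C (inclX U)) *
      (1 - 3 * toFrac (PowerSeries.C (inclX U))) * toFrac V +
      2 * (1 - 3 * toFrac (PowerSeries.C (inclX U))) * toFrac V ^ 2 - toFrac V ^ 3 := by
  have := congrArg toFrac hU.C_inclX_eq
  simp only [map_mul, map_sub, map_one, map_ofNat] at this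
  simp only [numer, map_mul, map_sub, map_one, map_ofNat, map_add, map_pow]
  linear_combination 4 * toFrac pVar * this

/-- The equation `y = ŷ(p, U, V)` without denominators. -/
theorem IsSeriesU.isSeriesV_iff {V : SeriesRing} : IsSeriesV U V ↔ PowerSeries.X ∣ V ∧
    yVar * numer U V = 2 * V * (2 - 4 * PowerSeries.C (inclX U) - V) := by
  rw [IsSeriesV, PowerSeries.X_dvd_iff]
  refine and_congr_right fun h0 => ?_
  have hne : numer U V ≠ 0 := by
    intro h
    have h1 := congrArg PowerSeries.constantCoeff h
    have := algebraRat.charZero (PowerSeries (Polynomial ℚ))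
    have h8 : PowerSeries.constantCoeff (8 : SeriesRing) = 8 := map_ofNat _ 8
    simp [numer, h0, pVar, xVar, PowerSeries.X_ne_zero, h8, C_X_ne_zero] at h1
  have hne' : toFrac (numer U V) ≠ 0 := fun h =>
    hne (IsFractionRing.injective SeriesRing (FractionRing SeriesRing) (h.trans (map_zero _).symm))
  rw [yHat, ← hU.toFrac_numer, eq_div_iff hne', ← map_mul]
  have h2 : 2 * toFrac V * (2 - 4 * toFrac (PowerSeries.C (inclX U)) - toFrac V) =
      toFrac (2 * V * (2 - 4 * PowerSeries.C (inclX U) - V)) := by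
    simp only [map_mul, map_sub, map_ofNat]
  rw [h2]
  exact (IsFractionRing.injective SeriesRing (FractionRing SeriesRing)).eq_iff

omit hU in
/-- The coefficients of the cubic equation for `V`. -/
def coeffV (U : PowerSeries ℚ) : Fin 4 → PowerSeries (Polynomial ℚ) :=
  ![8 * PowerSeries.C Polynomial.X * PowerSeries.X, 2 * inclX U * (1 - 3 * inclX U),
    2 * (1 - 3 * inclX U), -1]

omit hU in
/-- The equation of `V` is a cubic equation for a power series in `y`. -/
theorem numer_eq_iff {V : SeriesRing} :
    yVar * numer U V = 2 * V * (2 - 4 * PowerSeries.C (inclX U) - V) ↔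
      PowerSeries.C (4 * (1 - 2 * inclX U)) * V = cubic 2 0 (coeffV U) V := by
  simp only [cubic, coeffV, Matrix.cons_val, numer, pVar, xVar, yVar, map_mul, map_sub, map_ofNat,
    map_one, map_zero, map_neg]
  constructor <;> intro h <;> linear_combination -h

/-- The coefficient `4 (1 - 2 U)` of the linear term is a unit, and the series is determined by a
contraction. -/
theorem IsSeriesU.existsUnique_isSeriesV : ∃! V : SeriesRing, IsSeriesV U V := by
  simp only [hU.isSeriesV_iff, numer_eq_iff]
  exact existsUnique_scaled_cubic (IsUnit.of_mul_eq_one _ hU.mul_inv_four) _ _ _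

theorem IsSeriesU.coeff_mem {V : SeriesRing} (hV : IsSeriesV U V) (n : ℕ) :
    PowerSeries.coeff n V ∈ coeffRing U := by
  rw [hU.isSeriesV_iff, numer_eq_iff, scaled_cubic_iff hU.mul_inv_four] at hV
  have hp : PowerSeries.C Polynomial.X ∈ coeffRing U := Algebra.subset_adjoin (Or.inl rfl)
  have hu : inclX U ∈ coeffRing U := Algebra.subset_adjoin (Or.inr (Or.inl rfl))
  have hi : inclX (1 - 2 * U)⁻¹ ∈ coeffRing U := Algebra.subset_adjoin (Or.inr (Or.inr rfl))
  have hx : PowerSeries.X ∈ coeffRing U := by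
    have h2 := algebraMap_inv_mul (R := PowerSeries (Polynomial ℚ)) 2
    have : (PowerSeries.X : PowerSeries (Polynomial ℚ)) = algebraMap ℚ _ (1 / 2) *
        (inclX U * (1 - inclX U) * (1 - 2 * inclX U)) := by
      linear_combination algebraMap ℚ _ (1 / 2) * hU.inclX_eq - PowerSeries.X * h2
    rw [this]
    exact mul_mem (algebraMap_mem _ _) (mul_mem (mul_mem hu (sub_mem (one_mem _) hu))
      (sub_mem (one_mem _) (mul_mem (ofNat_mem _ 2) hu)))
  have h3 : 1 - 3 * inclX U ∈ coeffRing U := sub_mem (one_mem _) (mul_mem (ofNat_mem _ 3) hu)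
  have hi' := mul_mem (algebraMap_mem (coeffRing U) (1 / 4)) hi
  refine coeff_mem_of_cubic (coeffRing U) (mul_mem hi' (ofNat_mem _ 2)) (mul_mem hi' (zero_mem _))
    (fun k => mul_mem hi' ?_) hV.1 hV.2 n
  fin_cases k
  · exact mul_mem (mul_mem (ofNat_mem _ 8) hp) hx
  · exact mul_mem (mul_mem (ofNat_mem _ 2) hu) h3
  · exact mul_mem (ofNat_mem _ 2) h3
  · exact neg_mem (one_mem _)

/-- The series `V` is divisible by `x`. -/
theorem IsSeriesU.exists_eq_xVar_mul : ∃ Z : SeriesRing, PowerSeries.X ∣ Z ∧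
    (∀ V, IsSeriesV U V → V = xVar * Z) ∧
    4 * (1 - 2 * PowerSeries.C (inclX U)) * Z = 2 * xVar * Z ^ 2 + yVar * (8 * pVar +
      2 * PowerSeries.C (inclX U) * (1 - 3 * PowerSeries.C (inclX U)) * Z +
      2 * (1 - 3 * PowerSeries.C (inclX U)) * xVar * Z ^ 2 - xVar ^ 2 * Z ^ 3) := by
  obtain ⟨Z, ⟨hX, hZ⟩, -⟩ := existsUnique_scaled_cubic (IsUnit.of_mul_eq_one _ hU.mul_inv_four)
    (2 * PowerSeries.X) 0 ![8 * PowerSeries.C Polynomial.X, 2 * inclX U * (1 - 3 * inclX U),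
      2 * (1 - 3 * inclX U) * PowerSeries.X, -PowerSeries.X ^ 2]
  simp only [cubic, Matrix.cons_val, map_mul, map_sub, map_ofNat, map_one, map_zero, map_neg,
    map_pow] at hZ
  have hZ' : 4 * (1 - 2 * PowerSeries.C (inclX U)) * Z = 2 * xVar * Z ^ 2 + yVar * (8 * pVar +
      2 * PowerSeries.C (inclX U) * (1 - 3 * PowerSeries.C (inclX U)) * Z +
      2 * (1 - 3 * PowerSeries.C (inclX U)) * xVar * Z ^ 2 - xVar ^ 2 * Z ^ 3) := by
    rw [pVar, xVar, yVar]
    linear_combination hZ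
  refine ⟨Z, hX, fun V hV => hU.existsUnique_isSeriesV.unique hV ?_, hZ'⟩
  rw [hU.isSeriesV_iff]
  refine ⟨hX.mul_left _, ?_⟩
  rw [numer]
  linear_combination -xVar * hZ'

omit hU in
/-- The series `T(p, t, t y)` in the variables `x` and `y`, if `V = x Z`. -/
def quot (U : PowerSeries ℚ) (Z : SeriesRing) : SeriesRing :=
  pVar + algebraMap ℚ SeriesRing (1 / 8) *
    (2 * PowerSeries.C (inclX U) * (1 - 3 * PowerSeries.C (inclX U)) * Z +
      2 * (1 - 3 * PowerSeries.C (inclX U)) * xVar * Z ^ 2 - xVar ^ 2 * Z ^ 3)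

theorem IsSeriesU.numer_eq (Z : SeriesRing) : numer U (xVar * Z) = 8 * xVar * quot U Z := by
  have h8 := algebraMap_inv_mul (R := SeriesRing) 8
  rw [numer, quot]
  linear_combination -(xVar * (2 * PowerSeries.C (inclX U) * (1 - 3 * PowerSeries.C (inclX U)) * Z +
      2 * (1 - 3 * PowerSeries.C (inclX U)) * xVar * Z ^ 2 - xVar ^ 2 * Z ^ 3)) * h8

theorem IsSeriesU.toFrac_quot (Z : SeriesRing) : toFrac (quot U Z) = tHat (toFrac pVar)
    (toFrac (PowerSeries.C (inclX U))) (toFrac (xVar * Z)) := by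
  have hx : toFrac (8 * xVar) ≠ 0 := fun h => by
    have := IsFractionRing.injective SeriesRing (FractionRing SeriesRing) (h.trans (map_zero _).symm)
    have := algebraRat.charZero SeriesRing
    exact prime_xVar.ne_zero ((mul_eq_zero.1 ‹8 * xVar = 0›).resolve_left (OfNat.ofNat_ne_zero 8))
  have hd : 4 * toFrac (PowerSeries.C (inclX U)) * (1 - toFrac (PowerSeries.C (inclX U))) *
      (1 - 2 * toFrac (PowerSeries.C (inclX U))) = toFrac (8 * xVar) := by
    have := congrArg toFrac hU.C_inclX_eq
    simp only [map_mul, map_sub, map_one, map_ofNat] at this ⊢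
    linear_combination -4 * this
  rw [tHat, ← hU.toFrac_numer, hd, eq_div_iff hx, ← map_mul, hU.numer_eq, mul_comm]

theorem IsSeriesU.isAlgebraic_quot {Z : SeriesRing}
    (hZ : 4 * (1 - 2 * PowerSeries.C (inclX U)) * Z = 2 * xVar * Z ^ 2 + yVar * (8 * pVar +
      2 * PowerSeries.C (inclX U) * (1 - 3 * PowerSeries.C (inclX U)) * Z +
      2 * (1 - 3 * PowerSeries.C (inclX U)) * xVar * Z ^ 2 - xVar ^ 2 * Z ^ 3)) :
    IsAlgebraic (Algebra.adjoin ℚ ({pVar, xVar, yVar} : Set SeriesRing)) (quot U Z) := by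
  set A := Algebra.adjoin ℚ ({pVar, xVar, yVar} : Set SeriesRing) with hA
  have hp : pVar ∈ A := Algebra.subset_adjoin (Or.inl rfl)
  have hx : xVar ∈ A := Algebra.subset_adjoin (Or.inr (Or.inl rfl))
  have hy : yVar ∈ A := Algebra.subset_adjoin (Or.inr (Or.inr rfl))
  let L := Subalgebra.algebraicClosure A SeriesRing
  have hAL : ∀ {F}, F ∈ A → F ∈ L := fun {F} hF => isAlgebraic_algebraMap (⟨F, hF⟩ : A)
  have hu : PowerSeries.C (inclX U) ∈ L := by
    refine ⟨Polynomial.C 2 * Polynomial.X ^ 3 - Polynomial.C 3 * Polynomial.X ^ 2 + Polynomial.X -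
      Polynomial.C (2 * ⟨xVar, hx⟩), fun h => ?_, ?_⟩
    · have := congrArg (fun f => Polynomial.coeff f 1) h
      simp [Polynomial.coeff_X] at this
    · simp only [map_sub, map_add, map_mul, Polynomial.aeval_X, map_pow, map_ofNat,
        Polynomial.aeval_C]
      have : algebraMap A SeriesRing ⟨xVar, hx⟩ = xVar := rfl
      rw [this]
      linear_combination -hU.C_inclX_eq
  have h3 : 1 - 3 * PowerSeries.C (inclX U) ∈ L :=
    sub_mem (one_mem _) (mul_mem (ofNat_mem _ 3) hu)
  have hZL : Z ∈ L := by
    have h2 : (2 : SeriesRing) ∈ L := ofNat_mem _ 2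
    refine isAlgebraic_of_cubic (A := A) (c₀ := yVar * 8 * pVar)
      (c₁ := yVar * 2 * PowerSeries.C (inclX U) * (1 - 3 * PowerSeries.C (inclX U)) -
        4 * (1 - 2 * PowerSeries.C (inclX U)))
      (c₂ := 2 * xVar + yVar * 2 * (1 - 3 * PowerSeries.C (inclX U)) * xVar)
      (c₃ := -(yVar * xVar ^ 2))
      (mul_mem (mul_mem (hAL hy) (ofNat_mem L 8)) (hAL hp))
      (sub_mem (mul_mem (mul_mem (mul_mem (hAL hy) h2) hu) h3)
        (mul_mem (ofNat_mem L 4) (sub_mem (one_mem L) (mul_mem h2 hu))))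
      (add_mem (mul_mem h2 (hAL hx)) (mul_mem (mul_mem (mul_mem (hAL hy) h2) h3) (hAL hx)))
      (neg_mem (mul_mem (hAL hy) (pow_mem (hAL hx) 2))) ?_ ?_
    · have := algebraRat.charZero SeriesRing
      have hy0 : (yVar : SeriesRing) ≠ 0 := PowerSeries.X_ne_zero
      have hp0 : (pVar : SeriesRing) ≠ 0 := fun h => not_xVar_dvd_pVar (h ▸ dvd_zero _)
      exact mul_ne_zero (mul_ne_zero hy0 (OfNat.ofNat_ne_zero 8)) hp0
    · linear_combination -hZ
  have h8 : algebraMap ℚ SeriesRing (1 / 8) ∈ L := hAL (algebraMap_mem A (1 / 8))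
  exact add_mem (hAL hp) (mul_mem h8 (sub_mem (add_mem (mul_mem (mul_mem (mul_mem (ofNat_mem _ 2) hu)
    h3) hZL) (mul_mem (mul_mem (mul_mem (ofNat_mem _ 2) h3) (hAL hx)) (pow_mem hZL 2)))
    (mul_mem (pow_mem (hAL hx) 2) (pow_mem hZL 3))))

end SeriesV

/-! ### The solution of Tutte's equations -/

section Solution

theorem C_X_eq_xVar : (PowerSeries.C PowerSeries.X : SeriesRing) = xVar := rfl

theorem C_C_X_eq_pVar : (PowerSeries.C (PowerSeries.C Polynomial.X) : SeriesRing) = pVar := rfl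

theorem X_eq_yVar : (PowerSeries.X : SeriesRing) = yVar := rfl

/-- The polynomial identity behind the solution of Tutte's equation. -/
theorem tutte_identity {R : Type*} [CommRing R] {u t p H G e τ : R}
    (hu : u * (1 - t ^ 3 * u) * (1 - 2 * (t ^ 3 * u)) = 2)
    (hG : 8 * G = 2 * u * (1 - 3 * (t ^ 3 * u)) * t ^ 2 * H +
      2 * (1 - 3 * (t ^ 3 * u)) * t * p * H ^ 2 - t ^ 3 * p ^ 2 * H ^ 3)
    (he : 4 * e = H * (2 - 4 * (t ^ 3 * u) - t ^ 2 * p * H))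
    (hτ : 4 * τ = t ^ 2 * u ^ 2 * (1 - 3 * (t ^ 3 * u)) * (1 - t ^ 3 * u)) :
    64 * (p * G * e) = 64 * (t * (p ^ 2 * e ^ 3 + G + p * G ^ 2 - τ * e)) := by
  have h : 64 * (p * G * e) - 64 * (t * (p ^ 2 * e ^ 3 + G + p * G ^ 2 - τ * e)) =
      2 * p * (8 * G) * (4 * e) - t * (p ^ 2 * (4 * e) ^ 3 + 8 * (8 * G) + p * (8 * G) ^ 2 -
        4 * (4 * τ) * (4 * e)) := by ring
  rw [hG, he, hτ] at h
  linear_combination h + (-24 * u ^ 2 * t ^ 6 * H - 24 * u * t ^ 5 * p * H ^ 2 +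
    8 * u * t ^ 3 * H - 4 * t ^ 4 * p ^ 2 * H ^ 3 + 8 * t ^ 2 * p * H ^ 2) * hu

variable {u t : PowerSeries (Polynomial ℚ)}

/-- A solution of Tutte's equations. The series `t ^ 2 H` is `V` with `y` replaced by `y / t`, the
series `w` stands for `U`, and the last two equations are those of the rational parametrization. -/
theorem exists_isTutte {w : PowerSeries (Polynomial ℚ)} (hw : w = PowerSeries.X ^ 3 * u)
    (hu : u * (1 - w) * (1 - 2 * w) = 2) :
    ∃ H T S : SeriesRing, IsTutte T S ∧ PowerSeries.X ∣ H ∧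
      8 * yVar * T = 2 * H * (2 - 4 * PowerSeries.C w - xVar ^ 2 * H) ∧
      8 * xVar ^ 3 * T = 8 * pVar * xVar ^ 3 + 2 * PowerSeries.C w * (1 - 3 * PowerSeries.C w) *
        (xVar ^ 2 * H) + 2 * (1 - 3 * PowerSeries.C w) * (xVar ^ 2 * H) ^ 2 -
        (xVar ^ 2 * H) ^ 3 := by
  have h4 := algebraMap_inv_mul (R := PowerSeries (Polynomial ℚ)) 4
  have h2 := algebraMap_inv_mul (R := PowerSeries (Polynomial ℚ)) 2
  have h8 := algebraMap_inv_mul (R := SeriesRing) 8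
  have char := algebraRat.charZero SeriesRing
  have hunit : IsUnit (4 * (1 - 2 * w)) := IsUnit.of_mul_eq_one
    (algebraMap ℚ _ (1 / 4) * (algebraMap ℚ _ (1 / 2) * (u * (1 - w)))) (by
      linear_combination algebraMap ℚ _ (1 / 4) * 4 * algebraMap ℚ _ (1 / 2) * hu +
        algebraMap ℚ _ (1 / 4) * 4 * h2 + h4)
  obtain ⟨H, ⟨hX, hH⟩, -⟩ := existsUnique_scaled_cubic hunit
    (2 * PowerSeries.X ^ 2 * PowerSeries.C Polynomial.X) 0
    ![8, 2 * PowerSeries.X ^ 2 * u * (1 - 3 * w),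
      2 * (1 - 3 * w) * PowerSeries.X * PowerSeries.C Polynomial.X,
      -PowerSeries.X ^ 3 * PowerSeries.C Polynomial.X ^ 2]
  have hH1 := congrArg (PowerSeries.coeff 1) hH
  have hH0 := PowerSeries.X_dvd_iff.1 hX
  simp only [cubic, Matrix.cons_val, map_mul, map_sub, map_ofNat, map_one, map_zero, map_neg,
    map_pow, C_C_X_eq_pVar, C_X_eq_xVar, X_eq_yVar] at hH
  set a : SeriesRing := PowerSeries.C u with ha
  have hwa : PowerSeries.C w = xVar ^ 3 * a := by rw [hw, map_mul, map_pow, ← xVar]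
  have hua : a * (1 - xVar ^ 3 * a) * (1 - 2 * (xVar ^ 3 * a)) = 2 := by
    have := congrArg (PowerSeries.C (R := PowerSeries (Polynomial ℚ))) hu
    simpa only [map_mul, map_sub, map_one, map_ofNat, hwa] using this
  -- the coefficient of `y` in `H`
  have hc : PowerSeries.coeff 1 H = u * (1 - w) := by
    simp only [cubic, Matrix.cons_val, map_add, PowerSeries.coeff_C_mul, pow_succ, pow_zero,
      one_mul, PowerSeries.coeff_one_mul, hH0, map_mul, mul_zero, add_zero, map_zero,
      PowerSeries.coeff_one_X, PowerSeries.constantCoeff_C, PowerSeries.constantCoeff_X, zero_add]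
      at hH1
    refine hunit.mul_left_cancel ((mul_comm _ _).trans (hH1.trans ?_))
    linear_combination -4 * hu
  -- The series `G` is `T / p - 1`, and `τ` is its coefficient of `y`.
  set G : SeriesRing := algebraMap ℚ SeriesRing (1 / 8) * (2 * a * (1 - 3 * (xVar ^ 3 * a)) *
    xVar ^ 2 * H + 2 * (1 - 3 * (xVar ^ 3 * a)) * xVar * pVar * H ^ 2 -
      xVar ^ 3 * pVar ^ 2 * H ^ 3) with hGdef
  have hG : 8 * G = 2 * a * (1 - 3 * (xVar ^ 3 * a)) * xVar ^ 2 * H +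
      2 * (1 - 3 * (xVar ^ 3 * a)) * xVar * pVar * H ^ 2 - xVar ^ 3 * pVar ^ 2 * H ^ 3 := by
    rw [hGdef]
    linear_combination (2 * a * (1 - 3 * (xVar ^ 3 * a)) * xVar ^ 2 * H +
      2 * (1 - 3 * (xVar ^ 3 * a)) * xVar * pVar * H ^ 2 - xVar ^ 3 * pVar ^ 2 * H ^ 3) * h8
  have he : 4 * (yVar * (1 + G)) = H * (2 - 4 * (xVar ^ 3 * a) - xVar ^ 2 * pVar * H) := by
    refine mul_left_cancel₀ (OfNat.ofNat_ne_zero 2 : (2 : SeriesRing) ≠ 0) ?_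
    rw [hwa] at hH
    linear_combination yVar * hG - hH
  have hG0 : PowerSeries.constantCoeff G = 0 := by
    rw [hGdef]
    simp [hH0]
  set τ : SeriesRing := PowerSeries.C (PowerSeries.coeff 1 G) with hτdef
  have hτ : 4 * τ = xVar ^ 2 * a ^ 2 * (1 - 3 * (xVar ^ 3 * a)) * (1 - xVar ^ 3 * a) := by
    refine mul_left_cancel₀ (OfNat.ofNat_ne_zero 2 : (2 : SeriesRing) ≠ 0) ?_
    have h1 := congrArg (PowerSeries.coeff 1) hG
    have e1 : (8 : SeriesRing) = PowerSeries.C 8 := (map_ofNat _ 8).symm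
    have e2 : 2 * a * (1 - 3 * (xVar ^ 3 * a)) * xVar ^ 2 =
        PowerSeries.C (2 * u * (1 - 3 * w) * PowerSeries.X ^ 2) := by
      simp only [map_mul, map_sub, map_one, map_ofNat, map_pow, hwa, C_X_eq_xVar, ← ha]
    have h3 : PowerSeries.coeff 1 (H ^ 2) = 0 := by
      rw [pow_two, PowerSeries.coeff_one_mul, hH0, mul_zero, add_zero]
    have h4 : PowerSeries.coeff 1 (H ^ 3) = 0 := by
      rw [pow_succ, PowerSeries.coeff_one_mul, hH0, h3, map_pow, hH0]
      simp
    have e3 : 2 * (1 - 3 * (xVar ^ 3 * a)) * xVar * pVar =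
        PowerSeries.C (2 * (1 - 3 * w) * PowerSeries.X * PowerSeries.C Polynomial.X) := by
      simp only [map_mul, map_sub, map_one, map_ofNat, hwa, C_X_eq_xVar, C_C_X_eq_pVar]
    have e4 : xVar ^ 3 * pVar ^ 2 =
        PowerSeries.C (PowerSeries.X ^ 3 * PowerSeries.C Polynomial.X ^ 2) := by
      simp only [map_mul, map_pow, C_X_eq_xVar, C_C_X_eq_pVar]
    rw [e1, e2, e3, e4, PowerSeries.coeff_C_mul, map_sub, map_add, PowerSeries.coeff_C_mul,
      PowerSeries.coeff_C_mul, PowerSeries.coeff_C_mul, h3, h4, hc] at h1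
    have h5 := congrArg (PowerSeries.C (R := PowerSeries (Polynomial ℚ))) h1
    simp only [map_mul, map_sub, map_one, map_ofNat, map_pow, mul_zero, add_zero,
      sub_zero, hwa, C_X_eq_xVar, ← ha, ← hτdef] at h5
    linear_combination h5
  have hK := mul_left_cancel₀ (OfNat.ofNat_ne_zero 64 : (64 : SeriesRing) ≠ 0)
    (tutte_identity hua hG he hτ)
  have hunit' : IsUnit (1 + G) := by
    rw [PowerSeries.isUnit_iff_constantCoeff, map_add, hG0, add_zero, map_one]
    exact isUnit_one
  obtain ⟨I, hI⟩ := hunit'.exists_right_inv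
  have hcT : PowerSeries.C (PowerSeries.coeff 1 (pVar * (1 + G))) = pVar * τ := by
    rw [pVar, PowerSeries.coeff_C_mul, map_add, PowerSeries.coeff_one, if_neg one_ne_zero,
      zero_add, map_mul]
  clear_value τ G
  refine ⟨pVar * H, pVar * (1 + G), pVar * G * I, ⟨?_, ?_⟩, hX.mul_left _, ?_, ?_⟩
  · linear_combination -pVar ^ 2 * G * hI
  · rw [hcT]
    refine mul_right_cancel₀ hunit'.ne_zero ?_
    linear_combination pVar * hK - xVar * (1 - pVar) * pVar * G * hI
  · rw [hwa]
    linear_combination 2 * pVar * he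
  · rw [hwa]
    linear_combination xVar ^ 3 * pVar * hG

end Solution

/-! ### The rational parametrization -/

section Link

theorem expandCube_X : expandCube (Polynomial ℚ) PowerSeries.X = PowerSeries.X ^ 3 :=
  PowerSeries.expand_X 3 three_ne_zero

theorem expandCube_C (a : Polynomial ℚ) :
    expandCube (Polynomial ℚ) (PowerSeries.C a) = PowerSeries.C a :=
  PowerSeries.expand_C 3 three_ne_zero a

theorem substCube_yVar : substCube yVar = yVar := PowerSeries.map_X _

theorem substCube_C (b : PowerSeries (Polynomial ℚ)) :
    substCube (PowerSeries.C b) = PowerSeries.C (expandCube _ b) := PowerSeries.map_C _ _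

theorem substCube_pVar : substCube pVar = pVar := by
  rw [pVar, substCube_C, expandCube_C]

theorem substCube_xVar : substCube xVar = xVar ^ 3 := by
  rw [xVar, substCube_C, expandCube_X, map_pow]

theorem rescale_C' {R : Type*} [CommRing R] (a b : R) :
    PowerSeries.rescale a (PowerSeries.C b) = PowerSeries.C b := by
  ext n
  rw [PowerSeries.coeff_rescale, PowerSeries.coeff_C]
  split_ifs with h <;> simp [h]

/-- The parametrization of the series `T(p, t, t y)`. -/
theorem IsSeriesU.rescaledSeries_eq {U : PowerSeries ℚ} (hU : IsSeriesU U) {Z : SeriesRing}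
    (hV : IsSeriesV U (xVar * Z)) : rescaledSeries = substCube (quot U Z) := by
  have hX := (isSeriesU_iff.1 hU).1
  obtain ⟨u₀, hu₀⟩ := hX
  set w := expandCube (Polynomial ℚ) (inclX U) with hwdef
  set u := expandCube (Polynomial ℚ) (inclX u₀) with hudef
  have hw : w = PowerSeries.X ^ 3 * u := by
    rw [hwdef, hu₀, map_mul, map_mul, inclX, PowerSeries.map_X, expandCube_X]
    rfl
  have hw' : 2 * PowerSeries.X ^ 3 = w * (1 - w) * (1 - 2 * w) := by
    have := congrArg (expandCube (Polynomial ℚ)) hU.inclX_eq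
    simpa only [map_mul, map_sub, map_one, map_ofNat, expandCube_X] using this
  have hu : u * (1 - w) * (1 - 2 * w) = 2 := by
    refine mul_left_cancel₀ (pow_ne_zero 3 (PowerSeries.X_ne_zero (R := Polynomial ℚ))) ?_
    have h3 : w * (1 - w) * (1 - 2 * w) =
      PowerSeries.X ^ 3 * u * (1 - w) * (1 - 2 * w) := by rw [← hw]
    linear_combination -hw' - h3
  obtain ⟨H, T, S, hTS, hHX, h1, h2⟩ := exists_isTutte hw hu
  have hT : triangulationSeries = T := isTutte_triangulationSeries.unique hTS
  let r := PowerSeries.rescale (PowerSeries.X : PowerSeries (Polynomial ℚ))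
  have hry : r yVar = xVar * yVar := PowerSeries.rescale_X _
  have hrx : r xVar = xVar := rescale_C' _ _
  have hrp : r pVar = pVar := rescale_C' _ _
  have hrw : r (PowerSeries.C w) = PowerSeries.C w := rescale_C' _ _
  have hres : rescaledSeries = r T := by rw [rescaledSeries, hT]
  have h1' := congrArg r h1
  have h2' := congrArg r h2
  simp only [map_mul, map_sub, map_add, map_pow, map_ofNat, map_one, hry, hrx, hrp, hrw,
    ← hres] at h1' h2'
  -- both candidates for `V` solve the same cubic equation
  have hc : PowerSeries.C w = substCube (PowerSeries.C (inclX U)) := (substCube_C _).symm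
  have hV' := hU.isSeriesV_iff.1 hV
  have hn := congrArg substCube hV'.2
  rw [map_mul, substCube_yVar, numer] at hn
  simp only [map_mul, map_sub, map_add, map_pow, map_ofNat, map_one, substCube_pVar,
    substCube_xVar, ← hc] at hn
  have hunit : IsUnit (4 * (1 - 2 * w)) := by
    have := (IsUnit.of_mul_eq_one _ hU.mul_inv_four).map (expandCube (Polynomial ℚ))
    simpa only [map_mul, map_sub, map_one, map_ofNat] using this
  have key : xVar ^ 2 * r H = substCube xVar * substCube Z := by
    refine (existsUnique_scaled_cubic hunit 2 0 ![8 * PowerSeries.C Polynomial.X *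
      PowerSeries.X ^ 3, 2 * w * (1 - 3 * w), 2 * (1 - 3 * w), -1]).unique ⟨?_, ?_⟩ ⟨?_, ?_⟩
    · refine Dvd.dvd.mul_left ?_ _
      rw [PowerSeries.X_dvd_iff] at hHX ⊢
      rw [← PowerSeries.coeff_zero_eq_constantCoeff_apply, PowerSeries.coeff_rescale,
        PowerSeries.coeff_zero_eq_constantCoeff_apply, hHX, mul_zero]
    · simp only [cubic, Matrix.cons_val, map_mul, map_sub, map_ofNat, map_one, map_zero, map_neg,
        map_pow, C_C_X_eq_pVar, C_X_eq_xVar, X_eq_yVar]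
      linear_combination yVar * h2' - xVar ^ 2 * h1'
    · rw [← map_mul]
      have := map_dvd substCube hV'.1
      rwa [substCube, PowerSeries.map_X] at this
    · simp only [cubic, Matrix.cons_val, map_mul, map_sub, map_ofNat, map_one, map_zero, map_neg,
        map_pow, C_C_X_eq_pVar, C_X_eq_xVar, X_eq_yVar]
      rw [substCube_xVar]
      linear_combination -hn
  have h3 := congrArg substCube (hU.numer_eq Z)
  rw [numer] at h3
  simp only [map_mul, map_sub, map_add, map_pow, map_ofNat, map_one, substCube_pVar,
    substCube_xVar, ← hc] at h3
  rw [key, substCube_xVar] at h2'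
  have char := algebraRat.charZero SeriesRing
  refine mul_left_cancel₀ (mul_ne_zero (OfNat.ofNat_ne_zero 8 : (8 : SeriesRing) ≠ 0)
    (pow_ne_zero 3 prime_xVar.ne_zero)) ?_
  linear_combination h2' + h3

theorem exists_parametrization {U : PowerSeries ℚ} (hU : IsSeriesU U) {V : SeriesRing}
    (hV : IsSeriesV U V) : ∃ S : SeriesRing, rescaledSeries = substCube S ∧
      IsAlgebraic (Algebra.adjoin ℚ ({pVar, xVar, yVar} : Set SeriesRing)) S ∧
      toFrac S = tHat (toFrac pVar) (toFrac (PowerSeries.C (inclX U))) (toFrac V) := by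
  obtain ⟨Z, -, hVZ, hZ⟩ := hU.exists_eq_xVar_mul
  obtain rfl := hVZ V hV
  exact ⟨quot U Z, hU.rescaledSeries_eq hV, hU.isAlgebraic_quot hZ, hU.toFrac_quot Z⟩

end Link

/-! ### Properness of the parametrization -/

section Proper

theorem algebraMap_ne_zero_of_eval {f : MvPolynomial (Fin 3) ℚ} (v : Fin 3 → ℚ)
    (h : MvPolynomial.eval v f ≠ 0) : algebraMap (MvPolynomial (Fin 3) ℚ) RatFun3 f ≠ 0 := by
  intro h0
  have := IsFractionRing.injective (MvPolynomial (Fin 3) ℚ) RatFun3 (h0.trans (map_zero _).symm)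
  rw [this, map_zero] at h
  exact h rfl

theorem eq_top_of_indet_mem {K : IntermediateField ℚ RatFun3} (h : ∀ i, indet i ∈ K) : K = ⊤ := by
  have hpoly : ∀ f : MvPolynomial (Fin 3) ℚ, algebraMap _ RatFun3 f ∈ K := by
    intro f
    induction f using MvPolynomial.induction_on with
    | C a =>
      have : algebraMap (MvPolynomial (Fin 3) ℚ) RatFun3 (MvPolynomial.C a) =
        algebraMap ℚ RatFun3 a := (IsScalarTower.algebraMap_apply ℚ _ RatFun3 a).symm
      rw [this]
      exact K.algebraMap_mem a
    | add f g hf hg => rw [map_add]; exact add_mem hf hg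
    | mul_X f i hf => rw [map_mul]; exact mul_mem hf (h i)
  refine eq_top_iff.2 fun x _ => ?_
  obtain ⟨a, b, -, rfl⟩ := IsFractionRing.div_surjective (A := MvPolynomial (Fin 3) ℚ) x
  exact div_mem (hpoly a) (hpoly b)

/-- The quantities `c = U (1 - U) (1 - 2 U)`, `q = V (2 - 4 U - V)` and `M = T̂` up to simple
operations determine `U`, through a linear equation, and then `V`. -/
theorem parametrizationIsProper : ParametrizationIsProper := by
  rw [ParametrizationIsProper]
  set p := indet 0 with hp
  set U := indet 1 with hU
  set V := indet 2 with hV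
  set K := IntermediateField.adjoin ℚ ({p, wHat U, yHat p U V, tHat p U V} : Set RatFun3) with hK
  have hpK : p ∈ K := IntermediateField.subset_adjoin _ _ (by simp)
  have hwK : wHat U ∈ K := IntermediateField.subset_adjoin _ _ (by simp)
  have hyK : yHat p U V ∈ K := IntermediateField.subset_adjoin _ _ (by simp)
  have hTK : tHat p U V ∈ K := IntermediateField.subset_adjoin _ _ (by simp)
  set c := U * (1 - U) * (1 - 2 * U) with hc
  set q := V * (2 - 4 * U - V) with hq
  set M := 2 * U * (1 - 3 * U) * V + 2 * (1 - 3 * U) * V ^ 2 - V ^ 3 with hM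
  have hN0 : 4 * p * U * (1 - U) * (1 - 2 * U) + 2 * U * (1 - 3 * U) * V +
      2 * (1 - 3 * U) * V ^ 2 - V ^ 3 ≠ 0 := by
    have := algebraMap_ne_zero_of_eval (f := 4 * MvPolynomial.X 0 * MvPolynomial.X 1 *
      (1 - MvPolynomial.X 1) * (1 - 2 * MvPolynomial.X 1) + 2 * MvPolynomial.X 1 *
      (1 - 3 * MvPolynomial.X 1) * MvPolynomial.X 2 + 2 * (1 - 3 * MvPolynomial.X 1) *
      MvPolynomial.X 2 ^ 2 - MvPolynomial.X 2 ^ 3) ![0, 0, 1] (by simp; norm_num)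
    simp only [map_add, map_sub, map_mul, map_pow, map_one, map_ofNat] at this
    exact this
  have hd0 : 4 * U * (1 - U) * (1 - 2 * U) ≠ 0 := by
    have := algebraMap_ne_zero_of_eval (f := 4 * MvPolynomial.X 1 *
      (1 - MvPolynomial.X 1) * (1 - 2 * MvPolynomial.X 1)) ![0, 2, 0] (by simp; norm_num)
    simp only [map_sub, map_mul, map_one, map_ofNat] at this
    exact this
  have hq0 : q ≠ 0 := by
    have := algebraMap_ne_zero_of_eval (f := MvPolynomial.X 2 * (2 - 4 * MvPolynomial.X 1 -
      MvPolynomial.X 2)) ![0, 0, 1] (by simp; norm_num)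
    simp only [map_sub, map_mul, map_ofNat] at this
    exact this
  have hs0 : q - 2 * U * (1 - U) ≠ 0 := by
    have := algebraMap_ne_zero_of_eval (f := MvPolynomial.X 2 * (2 - 4 * MvPolynomial.X 1 -
      MvPolynomial.X 2) - 2 * MvPolynomial.X 1 * (1 - MvPolynomial.X 1)) ![0, 0, 1]
      (by simp; norm_num)
    simp only [map_sub, map_mul, map_one, map_ofNat] at this
    exact this
  have ha0 : U ^ 2 - (1 - 6 * c) * U - 3 * c + 36 * c ^ 2 ≠ 0 := by
    have := algebraMap_ne_zero_of_eval (f := MvPolynomial.X 1 ^ 2 - (1 - 6 * (MvPolynomial.X 1 *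
      (1 - MvPolynomial.X 1) * (1 - 2 * MvPolynomial.X 1))) * MvPolynomial.X 1 -
      3 * (MvPolynomial.X 1 * (1 - MvPolynomial.X 1) * (1 - 2 * MvPolynomial.X 1)) +
      36 * (MvPolynomial.X 1 * (1 - MvPolynomial.X 1) * (1 - 2 * MvPolynomial.X 1)) ^ 2)
      ![0, 2, 0] (by simp; norm_num)
    simp only [map_add, map_sub, map_mul, map_pow, map_one, map_ofNat] at this
    exact this
  have hcK : c ∈ K := by
    have : c = 2 * wHat U := by
      rw [wHat, map_div₀, map_one, map_ofNat, hc]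
      field_simp
    rw [this]
    exact mul_mem (ofNat_mem K 2) hwK
  have hMK : M ∈ K := by
    have : M = 4 * c * tHat p U V - 4 * p * c := by
      have h4 : 4 * c = 4 * U * (1 - U) * (1 - 2 * U) := by rw [hc]; ring
      rw [tHat, h4, mul_div_cancel₀ _ hd0, hM, hc]
      ring
    rw [this]
    exact sub_mem (mul_mem (mul_mem (ofNat_mem K 4) hcK) hTK)
      (mul_mem (mul_mem (ofNat_mem K 4) hpK) hcK)
  have hqK : q ∈ K := by
    have : q = yHat p U V * (4 * p * c + M) / 2 := by
      have h2 : 4 * p * c + M = 4 * p * U * (1 - U) * (1 - 2 * U) + 2 * U * (1 - 3 * U) * V +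
        2 * (1 - 3 * U) * V ^ 2 - V ^ 3 := by rw [hc, hM]; ring
      rw [h2, yHat, div_mul_cancel₀ _ hN0, hq]
      ring
    rw [this]
    exact div_mem (mul_mem hyK (add_mem (mul_mem (mul_mem (ofNat_mem K 4) hpK) hcK) hMK))
      (ofNat_mem K 2)
  -- `U` satisfies a quadratic equation over `K`
  set D := (M ^ 2 - 2 * M * q + 4 * M * c + q ^ 3 - q * c) / q with hD
  have hDK : D ∈ K := div_mem (sub_mem (add_mem (add_mem (sub_mem (pow_mem hMK 2)
    (mul_mem (mul_mem (ofNat_mem K 2) hMK) hqK)) (mul_mem (mul_mem (ofNat_mem K 4) hMK) hcK))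
    (pow_mem hqK 3)) (mul_mem hqK hcK)) hqK
  have hDU : D = U ^ 2 - (1 - 6 * c) * U := by
    rw [hD, div_eq_iff hq0, hM, hc, hq]
    ring
  -- Reducing the cubic equation `c = U (1 - U) (1 - 2 U)` modulo the quadratic one leaves a linear
  -- equation.
  have hUK : U ∈ K := by
    have : U = (c + 3 * D - 2 * (1 - 6 * c) * D) / (2 * (D - 3 * c + 36 * c ^ 2)) := by
      rw [hDU, eq_div_iff (mul_ne_zero two_ne_zero ha0), hc]
      ring
    rw [this]
    exact div_mem (sub_mem (add_mem hcK (mul_mem (ofNat_mem K 3) hDK)) (mul_mem (mul_mem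
      (ofNat_mem K 2) (sub_mem (one_mem K) (mul_mem (ofNat_mem K 6) hcK))) hDK))
      (mul_mem (ofNat_mem K 2) (add_mem (sub_mem hDK (mul_mem (ofNat_mem K 3) hcK))
      (mul_mem (ofNat_mem K 36) (pow_mem hcK 2))))
  -- Likewise, `M` is linear in `V` modulo the quadratic equation `q = V (2 - 4 U - V)`.
  have hVK : V ∈ K := by
    have : V = (M - 2 * U * q) / (q - 2 * U * (1 - U)) := by
      rw [eq_div_iff hs0, hM, hq]
      ring
    rw [this]
    exact div_mem (sub_mem hMK (mul_mem (mul_mem (ofNat_mem K 2) hUK) hqK)) (sub_mem hqK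
      (mul_mem (mul_mem (ofNat_mem K 2) hUK) (sub_mem (one_mem K) hUK)))
  refine eq_top_of_indet_mem fun i => ?_
  fin_cases i
  exacts [hpK, hUK, hVK]

end Proper

/-! ### Absolutely convergent power series -/

section AbsRing

theorem coeff_mul_mul_pow (x : ℝ) (F G : PowerSeries ℝ) (n : ℕ) :
    PowerSeries.coeff n (F * G) * x ^ n = ∑ kl ∈ Finset.HasAntidiagonal.antidiagonal n,
      PowerSeries.coeff kl.1 F * x ^ kl.1 * (PowerSeries.coeff kl.2 G * x ^ kl.2) := by
  rw [PowerSeries.coeff_mul, Finset.sum_mul]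
  refine Finset.sum_congr rfl fun kl hkl => ?_
  rw [← Finset.HasAntidiagonal.mem_antidiagonal.1 hkl, pow_add]
  ring

/-- Absolute convergence of a real power series at `x`. -/
def IsAbsSummable (x : ℝ) (F : PowerSeries ℝ) : Prop :=
  Summable fun n => ‖PowerSeries.coeff n F * x ^ n‖

theorem isAbsSummable_of_coeff_eq_zero {x : ℝ} {F : PowerSeries ℝ} {N : ℕ}
    (hF : ∀ n, N ≤ n → PowerSeries.coeff n F = 0) : IsAbsSummable x F := by
  refine summable_of_ne_finset_zero (s := Finset.range N) fun n hn => ?_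
  rw [hF n (by simpa using hn), zero_mul, norm_zero]

theorem isAbsSummable_C (x a : ℝ) : IsAbsSummable x (PowerSeries.C a) :=
  isAbsSummable_of_coeff_eq_zero (N := 1) fun n hn => by
    rw [PowerSeries.coeff_C, if_neg (by omega)]

theorem isAbsSummable_X (x : ℝ) : IsAbsSummable x PowerSeries.X :=
  isAbsSummable_of_coeff_eq_zero (N := 2) fun n hn => by
    rw [PowerSeries.coeff_X, if_neg (by omega)]

theorem IsAbsSummable.mul {x : ℝ} {F G : PowerSeries ℝ} (hF : IsAbsSummable x F)
    (hG : IsAbsSummable x G) : IsAbsSummable x (F * G) :=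
  (summable_norm_sum_mul_antidiagonal_of_summable_norm hF hG).congr fun n => by
    rw [coeff_mul_mul_pow]

theorem IsAbsSummable.add {x : ℝ} {F G : PowerSeries ℝ} (hF : IsAbsSummable x F)
    (hG : IsAbsSummable x G) : IsAbsSummable x (F + G) := by
  refine Summable.of_nonneg_of_le (fun _ => norm_nonneg _) (fun n => ?_) (Summable.add hF hG)
  rw [map_add, add_mul]
  exact norm_add_le _ _

theorem IsAbsSummable.neg {x : ℝ} {F : PowerSeries ℝ} (hF : IsAbsSummable x F) :
    IsAbsSummable x (-F) :=
  Summable.congr hF fun n => by rw [map_neg, neg_mul, norm_neg]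

/-- The real power series which converge absolutely at `x`. -/
def absRing (x : ℝ) : Subring (PowerSeries ℝ) where
  carrier := {F | IsAbsSummable x F}
  mul_mem' := IsAbsSummable.mul
  one_mem' := by
    have := isAbsSummable_C x 1
    rwa [map_one] at this
  add_mem' := IsAbsSummable.add
  zero_mem' := by
    have := isAbsSummable_C x 0
    rwa [map_zero] at this
  neg_mem' := IsAbsSummable.neg

/-- The value at `x` of a power series which converges absolutely at `x`. -/
def absEval (x : ℝ) : absRing x →+* ℝ where
  toFun F := ∑' n, PowerSeries.coeff n F.1 * x ^ n
  map_one' := by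
    rw [tsum_eq_single 0 fun n hn => by
      rw [OneMemClass.coe_one, PowerSeries.coeff_one, if_neg hn, zero_mul]]
    simp
  map_mul' F G := by
    rw [tsum_mul_tsum_eq_tsum_sum_antidiagonal_of_summable_norm F.2 G.2]
    exact tsum_congr fun n => coeff_mul_mul_pow x F.1 G.1 n
  map_zero' := by simp
  map_add' F G := by
    rw [← Summable.tsum_add F.2.of_norm G.2.of_norm]
    refine tsum_congr fun n => ?_
    rw [Subring.coe_add, map_add, add_mul]

theorem hasSum_absEval {x : ℝ} (F : absRing x) :
    HasSum (fun n => PowerSeries.coeff n F.1 * x ^ n) (absEval x F) :=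
  F.2.of_norm.hasSum

theorem absEval_C (x a : ℝ) : absEval x ⟨PowerSeries.C a, isAbsSummable_C x a⟩ = a := by
  refine (tsum_eq_single 0 fun n hn => ?_).trans ?_
  · rw [PowerSeries.coeff_C, if_neg hn, zero_mul]
  · simp

theorem absEval_X (x : ℝ) : absEval x ⟨PowerSeries.X, isAbsSummable_X x⟩ = x := by
  refine (tsum_eq_single 1 fun n hn => ?_).trans ?_
  · rw [PowerSeries.coeff_X, if_neg hn, zero_mul]
  · simp

end AbsRing

/-! ### Power series with nonnegative coefficients -/

section Positive

/-- A partial sum of the power series `F` at `x`. -/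
def partialSum (x : ℝ) (F : PowerSeries ℝ) (n : ℕ) : ℝ :=
  ∑ k ∈ Finset.range n, PowerSeries.coeff k F * x ^ k

/-- The first `n` coefficients are nonnegative. -/
def IsNonneg (F : PowerSeries ℝ) (n : ℕ) : Prop := ∀ k < n, 0 ≤ PowerSeries.coeff k F

variable {x : ℝ} {F G : PowerSeries ℝ} {n : ℕ}

theorem IsNonneg.mul (hF : IsNonneg F n) (hG : IsNonneg G n) : IsNonneg (F * G) n := by
  intro k hk
  rw [PowerSeries.coeff_mul]
  refine Finset.sum_nonneg fun ij hij => ?_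
  have := Finset.HasAntidiagonal.mem_antidiagonal.1 hij
  exact mul_nonneg (hF _ (by omega)) (hG _ (by omega))

theorem partialSum_nonneg (hx : 0 ≤ x) (hF : IsNonneg F n) : 0 ≤ partialSum x F n :=
  Finset.sum_nonneg fun k hk => mul_nonneg (hF k (Finset.mem_range.1 hk)) (pow_nonneg hx k)

/-- The product of two partial sums contains the terms of the partial sum of the product. -/
theorem partialSum_mul_le (hx : 0 ≤ x) (hF : IsNonneg F n) (hG : IsNonneg G n) :
    partialSum x (F * G) n ≤ partialSum x F n * partialSum x G n := by
  have h1 : partialSum x (F * G) n = ∑ m ∈ Finset.range n, ∑ k ∈ Finset.range (n - m),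
      PowerSeries.coeff m F * x ^ m * (PowerSeries.coeff k G * x ^ k) := by
    rw [← Finset.sum_range_diag_flip n fun m k =>
      PowerSeries.coeff m F * x ^ m * (PowerSeries.coeff k G * x ^ k)]
    refine Finset.sum_congr rfl fun m _ => ?_
    rw [coeff_mul_mul_pow]
    exact Finset.Nat.sum_antidiagonal_eq_sum_range_succ (fun i j =>
      PowerSeries.coeff i F * x ^ i * (PowerSeries.coeff j G * x ^ j)) m
  rw [h1, partialSum, Finset.sum_mul]
  refine Finset.sum_le_sum fun m hm => ?_
  rw [← Finset.mul_sum]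
  refine mul_le_mul_of_nonneg_left ?_
    (mul_nonneg (hF m (Finset.mem_range.1 hm)) (pow_nonneg hx m))
  exact Finset.sum_le_sum_of_subset_of_nonneg (Finset.range_mono (Nat.sub_le n m))
    fun k hk _ => mul_nonneg (hG k (Finset.mem_range.1 hk)) (pow_nonneg hx k)

theorem partialSum_one_add_X_mul (c : ℝ) (F : PowerSeries ℝ) (n : ℕ) :
    partialSum x (1 + PowerSeries.C c * (PowerSeries.X * F)) (n + 1) =
      1 + c * x * partialSum x F n := by
  rw [partialSum, Finset.sum_range_succ', partialSum, Finset.mul_sum, add_comm]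
  congr 1
  · simp
  · refine Finset.sum_congr rfl fun k _ => ?_
    rw [map_add, PowerSeries.coeff_one, if_neg (Nat.succ_ne_zero k), zero_add,
      PowerSeries.coeff_C_mul, PowerSeries.coeff_succ_X_mul, pow_succ]
    ring

theorem isNonneg_one_add_X_mul {c : ℝ} (hc : 0 ≤ c) (hF : IsNonneg F n) :
    IsNonneg (1 + PowerSeries.C c * (PowerSeries.X * F)) (n + 1) := by
  rintro (_ | k) hk
  · simp
  · rw [map_add, PowerSeries.coeff_one, if_neg (Nat.succ_ne_zero k), zero_add,
      PowerSeries.coeff_C_mul, PowerSeries.coeff_succ_X_mul]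
    exact mul_nonneg hc (hF k (by omega))

/-- The series `P = 1 / (1 - U)` and `Q = 1 / (1 - 2 U)` have nonnegative coefficients, and their
partial sums at `x` are bounded by the values which the equations predict. -/
theorem partialSum_le {P Q : PowerSeries ℝ}
    (hP : P = 1 + PowerSeries.C 2 * (PowerSeries.X * (P * P * Q)))
    (hQ : Q = 1 + PowerSeries.C 4 * (PowerSeries.X * (P * Q * Q))) (hx : 0 ≤ x) {a b : ℝ}
    (ha : 0 ≤ a) (hb : 0 ≤ b) (hPa : 1 + 2 * x * (a * a * b) ≤ a)
    (hQb : 1 + 4 * x * (a * b * b) ≤ b) (n : ℕ) :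
    (IsNonneg P n ∧ IsNonneg Q n) ∧ partialSum x P n ≤ a ∧ partialSum x Q n ≤ b := by
  induction n with
  | zero => exact ⟨⟨fun k hk => absurd hk k.not_lt_zero, fun k hk => absurd hk k.not_lt_zero⟩,
      by simpa [partialSum] using ha, by simpa [partialSum] using hb⟩
  | succ n ih =>
    obtain ⟨⟨hPn, hQn⟩, hPs, hQs⟩ := ih
    have hP0 := partialSum_nonneg hx hPn
    have hQ0 := partialSum_nonneg hx hQn
    have h1 : partialSum x (P * P * Q) n ≤ a * a * b :=
      (partialSum_mul_le hx (hPn.mul hPn) hQn).trans <| mul_le_mul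
        ((partialSum_mul_le hx hPn hPn).trans (mul_le_mul hPs hPs hP0 ha)) hQs hQ0 (by positivity)
    have h2 : partialSum x (P * Q * Q) n ≤ a * b * b :=
      (partialSum_mul_le hx (hPn.mul hQn) hQn).trans <| mul_le_mul
        ((partialSum_mul_le hx hPn hQn).trans (mul_le_mul hPs hQs hQ0 ha)) hQs hQ0 (by positivity)
    refine ⟨⟨?_, ?_⟩, ?_, ?_⟩
    · rw [hP]
      exact isNonneg_one_add_X_mul zero_le_two ((hPn.mul hPn).mul hQn)
    · rw [hQ]
      exact isNonneg_one_add_X_mul zero_le_four ((hPn.mul hQn).mul hQn)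
    · rw [hP, partialSum_one_add_X_mul]
      exact (add_le_add_right (mul_le_mul_of_nonneg_left h1 (by positivity)) 1).trans hPa
    · rw [hQ, partialSum_one_add_X_mul]
      exact (add_le_add_right (mul_le_mul_of_nonneg_left h2 (by positivity)) 1).trans hQb

theorem isAbsSummable_of_partialSum_le (hx : 0 ≤ x) (hF : ∀ n, IsNonneg F n) {c : ℝ}
    (hc : ∀ n, partialSum x F n ≤ c) : IsAbsSummable x F := by
  refine summable_of_sum_range_le (fun _ => norm_nonneg _) fun n => (le_of_eq ?_).trans (hc n)
  refine Finset.sum_congr rfl fun k _ => Real.norm_of_nonneg ?_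
  exact mul_nonneg (hF (k + 1) k k.lt_succ_self) (pow_nonneg hx k)

theorem absEval_le (hF : F ∈ absRing x) {c : ℝ}
    (hc : ∀ n, partialSum x F n ≤ c) : absEval x ⟨F, hF⟩ ≤ c :=
  le_of_tendsto' (hasSum_absEval ⟨F, hF⟩).tendsto_sum_nat hc

theorem absEval_nonneg (hF : F ∈ absRing x) (hx : 0 ≤ x) (h : ∀ n, IsNonneg F n) :
    0 ≤ absEval x ⟨F, hF⟩ :=
  (hasSum_absEval ⟨F, hF⟩).nonneg fun k => mul_nonneg (h (k + 1) k k.lt_succ_self) (pow_nonneg hx k)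

end Positive

/-! ### Solutions in the half-disc -/

section Roots

/-- The function `1 / ŷ` in partial fractions, as a function of `V`, with a free additive
constant `κ`. -/
def omg (p q a b κ : ℝ) (V : ℂ) : ℂ := V / 2 + κ + a * p / V - a * q / (b - V)

variable {p q a b κ R : ℝ}

/-- The sign of the imaginary part of `1 / ŷ` relative to that of `V` is governed by a real factor.
-/
theorem im_omg (V : ℂ) : (omg p q a b κ V).im =
    V.im * (1 / 2 - (a * p / Complex.normSq V + a * q / Complex.normSq (b - V))) := by
  have h1 : ((a : ℂ) * p / V).im = -(a * p * V.im / Complex.normSq V) := by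
    rw [Complex.div_im]
    simp
  have h2 : ((a : ℂ) * q / (b - V)).im = a * q * V.im / Complex.normSq (b - V) := by
    rw [Complex.div_im]
    simp
    ring
  have h3 : (V / 2).im = V.im / 2 := by
    rw [Complex.div_im]
    simp [Complex.normSq]
    ring
  rw [omg, Complex.sub_im, Complex.add_im, Complex.add_im, h1, h2, h3, Complex.ofReal_im]
  ring

theorem lt_norm_sub (hR : 0 < R) (hb : 2 * R ≤ b) {V : ℂ} (hV : ‖V‖ ≤ R) : R ≤ ‖(b : ℂ) - V‖ := by
  have h1 : ‖(b : ℂ)‖ = b := by rw [Complex.norm_real, Real.norm_of_nonneg (by linarith)]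
  have := norm_sub_norm_le (b : ℂ) V
  linarith

/-- A solution in the lower half-plane is not on the circle of radius `√(2 a)`. -/
theorem norm_ne_of_im_pos (hq : 0 ≤ q) (hpq : p + q = 1) (ha : 0 < a) (hR : 0 < R)
    (hR2 : R ^ 2 = 2 * a) (hb : 2 * R ≤ b) {V : ℂ} (hV : V.im ≤ 0) (hVR : ‖V‖ ≤ R)
    (hw : 0 < (omg p q a b κ V).im) : ‖V‖ < R ∧ V.im < 0 := by
  rw [im_omg] at hw
  have him : V.im < 0 := lt_of_le_of_ne hV fun h => by rw [h, zero_mul] at hw; exact hw.false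
  refine ⟨lt_of_le_of_ne hVR fun h => ?_, him⟩
  have h1 : Complex.normSq V = 2 * a := by rw [Complex.normSq_eq_norm_sq, h, hR2]
  have h2 : 2 * a ≤ Complex.normSq (b - V) := by
    rw [Complex.normSq_eq_norm_sq, ← hR2]
    exact pow_le_pow_left₀ hR.le (lt_norm_sub hR hb hVR) 2
  have h3 : a * q / Complex.normSq (b - V) ≤ a * q / (2 * a) :=
    div_le_div_of_nonneg_left (by positivity) (by positivity) h2
  have h4 : a * p / (2 * a) + a * q / (2 * a) = 1 / 2 := by
    rw [← add_div, ← mul_add, hpq]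
    field_simp
  rw [h1] at hw
  nlinarith

/-- The open lower half of the disc of radius `R`. -/
def lowerHalfDisc (R : ℝ) : Set ℂ := Metric.ball 0 R ∩ {V | V.im < 0}

theorem isOpen_lowerHalfDisc : IsOpen (lowerHalfDisc R) :=
  Metric.isOpen_ball.inter (isOpen_lt Complex.continuous_im continuous_const)

theorem convex_lowerHalfDisc : Convex ℝ (lowerHalfDisc R) :=
  (convex_ball 0 R).inter (convex_halfSpace_im_lt 0)

theorem sub_ne_zero_of_norm_le (hR : 0 < R) (hb : 2 * R ≤ b) {V : ℂ} (hV : ‖V‖ ≤ R) :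
    (b : ℂ) - V ≠ 0 := fun h => by
  have := lt_norm_sub hR hb hV
  rw [h, norm_zero] at this
  linarith

theorem continuousAt_omg {V : ℂ} (hV : V ≠ 0) (hV' : (b : ℂ) - V ≠ 0) :
    ContinuousAt (omg p q a b κ) V := by
  unfold omg
  exact (((continuousAt_id.div_const 2).add continuousAt_const).add
    (continuousAt_const.div continuousAt_id hV)).sub
    (continuousAt_const.div (continuousAt_const.sub continuousAt_id) hV')

theorem differentiableOn_omg (hR : 0 < R) (hb : 2 * R ≤ b) :
    DifferentiableOn ℂ (omg p q a b κ) (lowerHalfDisc R) := by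
  intro V hV
  have h1 : V ≠ 0 := fun h => by
    have := hV.2
    rw [Set.mem_ofPred_eq, h] at this
    exact this.false
  have h2 := sub_ne_zero_of_norm_le hR hb (mem_ball_zero_iff.1 hV.1).le
  refine DifferentiableAt.differentiableWithinAt ?_
  unfold omg
  exact (((differentiableAt_id.div_const 2).add_const _).add
    ((differentiableAt_const _).div differentiableAt_id h1)).sub
    ((differentiableAt_const _).div ((differentiableAt_const _).sub differentiableAt_id) h2)

theorem im_omg_neg_I_ge (ha : 0 < a) (hq : 0 ≤ q) {r : ℝ} (hr : 0 < r) :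
    a * p / r - r / 2 ≤ (omg p q a b κ (-(r * Complex.I))).im := by
  have h0 : Complex.normSq (-(r * Complex.I)) = r ^ 2 := by
    simp [Complex.normSq]; ring
  have h1 : 0 ≤ a * q / Complex.normSq (b - -(r * Complex.I)) :=
    div_nonneg (by positivity) (Complex.normSq_nonneg _)
  rw [im_omg, h0]
  have : (-(r * Complex.I)).im = -r := by simp
  rw [this]
  have h2 : a * p / r = r * (a * p / r ^ 2) := by field_simp
  rw [h2]
  nlinarith

/-- Every point of the upper half-plane is attained in the lower half-disc: the image is open by
the open mapping theorem, and closed in the upper half-plane by compactness, since the boundary of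
the half-disc is not mapped to the upper half-plane. -/
theorem exists_omg_eq (hp : 0 < p) (hq : 0 ≤ q) (hpq : p + q = 1) (ha : 0 < a) (hR : 0 < R)
    (hR2 : R ^ 2 = 2 * a) (hb : 2 * R ≤ b) {w : ℂ} (hw : 0 < w.im) :
    ∃ V, ‖V‖ < R ∧ V.im < 0 ∧ omg p q a b κ V = w := by
  have hmem : ∀ r : ℝ, 0 < r → r < R → -(r * Complex.I) ∈ lowerHalfDisc R := fun r h1 h2 => by
    refine ⟨?_, ?_⟩
    · rw [mem_ball_zero_iff, norm_neg, norm_mul, Complex.norm_I, mul_one, Complex.norm_real,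
        Real.norm_of_nonneg h1.le]
      exact h2
    · change (-(r * Complex.I)).im < 0
      simpa using h1
  have hop : IsOpen (omg p q a b κ '' lowerHalfDisc R) := by
    have hA : AnalyticOnNhd ℂ (omg p q a b κ) (lowerHalfDisc R) :=
      (differentiableOn_omg hR hb).analyticOnNhd isOpen_lowerHalfDisc
    refine (hA.is_constant_or_isOpen convex_lowerHalfDisc.isPreconnected).elim ?_
      fun h => h _ subset_rfl isOpen_lowerHalfDisc
    -- the function is unbounded at `0`
    rintro ⟨c, hc⟩
    exfalso
    set r : ℝ := min (R / 2) (a * p / (|c.im| + R)) with hr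
    have hr0 : 0 < r := lt_min (by positivity) (by positivity)
    have hr1 : r < R := (min_le_left _ _).trans_lt (by linarith)
    have h1 := im_omg_neg_I_ge (p := p) (b := b) (κ := κ) ha hq hr0
    rw [hc _ (hmem r hr0 hr1)] at h1
    have h2 : |c.im| + R ≤ a * p / r := by
      rw [le_div_iff₀ hr0]
      have : r ≤ a * p / (|c.im| + R) := min_le_right _ _
      rw [le_div_iff₀ (by positivity)] at this
      linarith
    have := le_abs_self c.im
    linarith
  have hsub : {w : ℂ | 0 < w.im} ⊆ omg p q a b κ '' lowerHalfDisc R := by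
    refine (convex_halfSpace_im_gt 0).isPreconnected.subset_of_closure_inter_subset hop ?_ ?_
    · set r : ℝ := min (R / 2) (p * R / 2) with hr
      have hr0 : 0 < r := lt_min (by positivity) (by positivity)
      have hr1 : r ≤ R / 2 := min_le_left _ _
      have h1 := im_omg_neg_I_ge (p := p) (b := b) (κ := κ) ha hq hr0
      refine ⟨_, lt_of_lt_of_le ?_ h1, _, hmem r hr0 (hr1.trans_lt (by linarith)), rfl⟩
      rw [sub_pos, lt_div_iff₀ hr0]
      have h2 : r ≤ p * R / 2 := min_le_right _ _
      have h3 : r * r ≤ p * R / 2 * (R / 2) := mul_le_mul h2 hr1 hr0.le (by positivity)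
      nlinarith [mul_pos ha hp]
    · rintro w ⟨hwc, hw⟩
      obtain ⟨x, hx, hlim⟩ := mem_closure_iff_seq_limit.1 hwc
      choose V hV hVx using hx
      obtain ⟨V₀, hV₀, φ, hφ, hφlim⟩ := (isCompact_closedBall (0 : ℂ) R).tendsto_subseq
        fun n => Metric.ball_subset_closedBall (hV n).1
      have hlim' : Tendsto (fun n => omg p q a b κ (V (φ n))) atTop (𝓝 w) := by
        have := hlim.comp hφ.tendsto_atTop
        refine this.congr fun n => ?_
        exact (hVx (φ n)).symm
      have hV₀R : ‖V₀‖ ≤ R := mem_closedBall_zero_iff.1 hV₀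
      have hb₀ := sub_ne_zero_of_norm_le hR hb hV₀R
      have hne : V₀ ≠ 0 := by
        intro h0
        have h1 : Tendsto (fun n => V (φ n) * omg p q a b κ (V (φ n))) atTop (𝓝 (V₀ * w)) :=
          hφlim.mul hlim'
        have h2 : Tendsto (fun n => V (φ n) * omg p q a b κ (V (φ n))) atTop
            (𝓝 (V₀ * (V₀ / 2 + κ - a * q / (b - V₀)) + a * p)) := by
          have h3 : Tendsto (fun n => V (φ n) * (V (φ n) / 2 + κ - a * q / (b - V (φ n))) + a * p)
              atTop (𝓝 (V₀ * (V₀ / 2 + κ - a * q / (b - V₀)) + a * p)) :=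
            (hφlim.mul (((hφlim.div_const 2).add_const _).sub
              (tendsto_const_nhds.div (tendsto_const_nhds.sub hφlim) hb₀))).add_const _
          refine h3.congr fun n => ?_
          have : V (φ n) ≠ 0 := fun h => by
            have := (hV (φ n)).2
            rw [Set.mem_ofPred_eq, h] at this
            exact this.false
          rw [omg]
          field_simp
          ring
        have h3 := tendsto_nhds_unique h1 h2
        rw [h0, zero_mul, zero_mul, zero_add] at h3
        have : a * p = 0 := by exact_mod_cast h3.symm
        exact (mul_pos ha hp).ne' this
      have hw₀ : omg p q a b κ V₀ = w :=
        tendsto_nhds_unique ((continuousAt_omg hne hb₀).tendsto.comp hφlim) hlim'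
      have him : V₀.im ≤ 0 := le_of_tendsto ((Complex.continuous_im.tendsto _).comp hφlim)
        (Eventually.of_forall fun n => (hV (φ n)).2.le)
      rw [← hw₀] at hw
      obtain ⟨h1, h2⟩ := norm_ne_of_im_pos hq hpq ha hR hR2 hb him hV₀R hw
      exact ⟨V₀, ⟨mem_ball_zero_iff.2 h1, h2⟩, hw₀⟩
  obtain ⟨V, hV, h⟩ := hsub hw
  exact ⟨V, mem_ball_zero_iff.1 hV.1, hV.2, h⟩

end Roots

/-! ### The three solutions of the cubic equation -/

section Cubic

/-- Two distinct roots of a cubic polynomial determine the third one. -/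
theorem cubic_factor {s e₂ e₃ A B : ℂ} (hA : A ^ 3 - s * A ^ 2 + e₂ * A - e₃ = 0)
    (hB : B ^ 3 - s * B ^ 2 + e₂ * B - e₃ = 0) (hAB : A ≠ B) (X : ℂ) :
    X ^ 3 - s * X ^ 2 + e₂ * X - e₃ = (X - A) * (X - B) * (X - (s - A - B)) := by
  have h1 : e₂ = s * (A + B) - (A ^ 2 + A * B + B ^ 2) := by
    refine mul_left_cancel₀ (sub_ne_zero.2 hAB) ?_
    linear_combination hA - hB
  rw [h1] at hA ⊢
  linear_combination hA

variable {p u R : ℝ}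

/-- For `κ = u` the function `omg` is `1 / ŷ`, and its equation is a cubic equation for `V`. -/
theorem omg_eq_iff {V w : ℂ} (hV : V ≠ 0) (hV' : ((2 - 4 * u : ℝ) : ℂ) - V ≠ 0) :
    omg p (1 - p) (u * (1 - u)) (2 - 4 * u) u V = w ↔
      V ^ 3 - (2 * w + (2 - 4 * u) - 2 * u) * V ^ 2 + (2 * w * (2 - 4 * u) - 2 * u * (1 - 3 * u)) * V -
        2 * p * (u * (1 - u)) * (2 - 4 * u) = 0 := by
  push_cast at hV'
  rw [omg]
  push_cast
  have h2 : 2 * V * (2 - 4 * u - V) ≠ 0 := mul_ne_zero (mul_ne_zero two_ne_zero hV) hV'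
  have h3 : 2 * V * (2 - 4 * u - V) * (V / 2 + u + u * (1 - u) * p / V -
      u * (1 - u) * (1 - p) / (2 - 4 * u - V)) = V ^ 2 * (2 - 4 * u - V) +
      2 * u * V * (2 - 4 * u - V) + 2 * (u * (1 - u) * p) * (2 - 4 * u - V) -
      2 * V * (u * (1 - u) * (1 - p)) := by
    field_simp
  constructor
  · intro h
    rw [h] at h3
    linear_combination h3
  · intro h
    refine mul_left_cancel₀ h2 ?_
    rw [h3]
    linear_combination -h

/-- For `w` in the upper half-plane exactly one solution lies in the lower half of the disc of
radius `R`: a second one lies in the disc about `2 - 4 u`, and the third one in the upper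
half-plane. -/
theorem exists_factor (hp : 0 < p) (hp1 : p ≤ 1) (hu : 0 < u) (hR : 0 < R)
    (hR2 : R ^ 2 = 2 * (u * (1 - u))) (hb : 2 * R ≤ 2 - 4 * u) {w : ℂ} (hw : 0 < w.im) :
    ∃ A B C : ℂ, ‖A‖ < R ∧ A.im < 0 ∧ R ≤ ‖B‖ ∧ 0 < C.im ∧ ∀ X : ℂ,
      X ^ 3 - (2 * w + (2 - 4 * u) - 2 * u) * X ^ 2 + (2 * w * (2 - 4 * u) - 2 * u * (1 - 3 * u)) * X -
        2 * p * (u * (1 - u)) * (2 - 4 * u) = (X - A) * (X - B) * (X - C) := by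
  have ha : 0 < u * (1 - u) := mul_pos hu (by linarith)
  obtain ⟨A, hA, hA', hAw⟩ := exists_omg_eq (κ := u) hp (sub_nonneg.2 hp1) (by ring) ha hR hR2 hb hw
  have hne : ∀ V : ℂ, V.im < 0 → V ≠ 0 := fun V h h0 => by rw [h0] at h; exact h.false
  rw [omg_eq_iff (hne A hA') (sub_ne_zero_of_norm_le hR hb hA.le)] at hAw
  have hB : ∃ B : ℂ, R ≤ ‖B‖ ∧ B.im ≤ 0 ∧ B ^ 3 - (2 * w + (2 - 4 * u) - 2 * u) * B ^ 2 +
      (2 * w * (2 - 4 * u) - 2 * u * (1 - 3 * u)) * B - 2 * p * (u * (1 - u)) * (2 - 4 * u) = 0 := by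
    rcases hp1.eq_or_lt with rfl | hp1
    · refine ⟨(2 - 4 * u : ℝ), ?_, (Complex.ofReal_im _).le, ?_⟩
      · rw [Complex.norm_real, Real.norm_of_nonneg (by linarith)]
        linarith
      · push_cast
        ring
    · -- the symmetry `V ↦ b - conj V`, `p ↦ 1 - p`
      obtain ⟨V, hV, hV', hVw⟩ := exists_omg_eq (p := 1 - p) (q := p) (κ := -u - (2 - 4 * u) / 2)
        (sub_pos.2 hp1) hp.le (by ring) ha hR hR2 hb (w := -(starRingEnd ℂ) w) (by simpa using hw)
      have hc : ‖(starRingEnd ℂ) V‖ ≤ R := by rw [RCLike.norm_conj]; exact hV.le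
      have h1 := sub_ne_zero_of_norm_le hR hb hc
      have h2 : ((2 - 4 * u : ℝ) : ℂ) - ((2 - 4 * u : ℝ) - (starRingEnd ℂ) V) ≠ 0 := by
        rw [sub_sub_cancel]
        exact (map_ne_zero _).2 (hne V hV')
      refine ⟨(2 - 4 * u : ℝ) - (starRingEnd ℂ) V, lt_norm_sub hR hb hc, ?_,
        (omg_eq_iff h1 h2).1 ?_⟩
      · rw [Complex.sub_im, Complex.ofReal_im, Complex.conj_im]
        linarith
      · have h3 := congrArg (starRingEnd ℂ) hVw
        rw [map_neg, Complex.conj_conj, omg] at h3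
        simp only [map_sub, map_add, map_div₀, map_mul, Complex.conj_ofReal, map_ofNat] at h3
        rw [omg, sub_sub_cancel]
        push_cast at h3 ⊢
        linear_combination -h3
  obtain ⟨B, hB, hB', hBw⟩ := hB
  have hAB : A ≠ B := fun h => by rw [h] at hA; linarith
  refine ⟨A, B, 2 * w + (2 - 4 * u) - 2 * u - A - B, hA, hA', hB, ?_, cubic_factor hAw hBw hAB⟩
  simp
  linarith

end Cubic

/-! ### Critical points of `1 / ŷ` on the real line -/

section Real

/-- The common numerator of `T̂` and denominator of `ŷ`. -/
def cubicNum {K : Type*} [CommRing K] (p u v : K) : K :=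
  4 * p * u * (1 - u) * (1 - 2 * u) + 2 * u * (1 - 3 * u) * v + 2 * (1 - 3 * u) * v ^ 2 - v ^ 3

theorem map_cubicNum {K L : Type*} [CommRing K] [CommRing L] (φ : K →+* L) (p u v : K) :
    φ (cubicNum p u v) = cubicNum (φ p) (φ u) (φ v) := by
  simp only [cubicNum, map_sub, map_add, map_mul, map_pow, map_one, map_ofNat]

/-- The values of `p` and `u` that occur for `p ∈ (0, 1]` and `t ∈ (0, t_c]`; the critical
value of `u` is the smallest root of `6 u (1 - u) = 1`. -/
structure Subcritical (p u : ℝ) : Prop where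
  p_pos : 0 < p
  p_le_one : p ≤ 1
  u_pos : 0 < u
  u_lt_half : u < 1 / 2
  le : 6 * (u * (1 - u)) ≤ 1

/-- The radius of the disc in which the relevant value of `V` lies: on its boundary the imaginary
parts of `1 / ŷ` and `V` do not have opposite signs. -/
def rad (u : ℝ) : ℝ := √(2 * (u * (1 - u)))

/-- The function `1 / ŷ` on the real line. -/
def invY (p u V : ℝ) : ℝ :=
  V / 2 + u + u * (1 - u) * p / V - u * (1 - u) * (1 - p) / (2 - 4 * u - V)

/-- The derivative of `-1 / ŷ` multiplied by `V ^ 2`, on the real line, so that `V = 0` is no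
exception. -/
def gap (p u V : ℝ) : ℝ :=
  u * (1 - u) * p + u * (1 - u) * (1 - p) * (V ^ 2 / (2 - 4 * u - V) ^ 2) - V ^ 2 / 2

namespace Subcritical

variable {p u : ℝ} (h : Subcritical p u)
include h

theorem four_u_lt : 4 * u < 1 := by nlinarith [h.le, h.u_lt_half, h.u_pos]

theorem a_pos : 0 < u * (1 - u) := mul_pos h.u_pos (by linarith [h.u_lt_half])

theorem q_nonneg : 0 ≤ 1 - p := sub_nonneg.2 h.p_le_one

theorem rad_pos : 0 < rad u := Real.sqrt_pos.2 (by linarith [h.a_pos])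

theorem rad_sq : rad u ^ 2 = 2 * (u * (1 - u)) := Real.sq_sqrt (by linarith [h.a_pos])

theorem two_rad_le : 2 * rad u ≤ 2 - 4 * u := by
  refine (pow_le_pow_iff_left₀ (by linarith [h.rad_pos]) (by linarith [h.u_lt_half]) two_ne_zero).1 ?_
  nlinarith [h.rad_sq, h.le]

theorem rad_add_lt : rad u + u < 1 := by
  have : rad u < 1 - u := by
    refine (pow_lt_pow_iff_left₀ h.rad_pos.le (by linarith [h.u_lt_half]) two_ne_zero).1 ?_
    nlinarith [h.rad_sq, h.four_u_lt, h.u_pos]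
  linarith

theorem rad_le_sub {V : ℝ} (hV : V ≤ rad u) : rad u ≤ 2 - 4 * u - V := by
  linarith [h.two_rad_le]

theorem sub_pos_of_le {V : ℝ} (hV : V ≤ rad u) : 0 < 2 - 4 * u - V :=
  h.rad_pos.trans_le (h.rad_le_sub hV)

theorem continuousOn_gap : ContinuousOn (gap p u) (Set.Iic (rad u)) := by
  intro V hV
  have := (h.sub_pos_of_le hV).ne'
  unfold gap
  refine ContinuousAt.continuousWithinAt ?_
  fun_prop (disch := positivity)

theorem gap_nonpos {V : ℝ} (hV : V ^ 2 = rad u ^ 2) (hV' : V ≤ rad u) : gap p u V ≤ 0 := by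
  have h1 : V ^ 2 / (2 - 4 * u - V) ^ 2 ≤ 1 := by
    rw [div_le_one (pow_pos (h.sub_pos_of_le hV') 2), hV]
    exact pow_le_pow_left₀ h.rad_pos.le (h.rad_le_sub hV') 2
  have h2 := mul_le_mul_of_nonneg_left h1 (mul_nonneg h.a_pos.le h.q_nonneg)
  have h3 := h.rad_sq
  rw [← hV] at h3
  rw [gap]
  linarith

theorem gap_zero : 0 < gap p u 0 := by
  simpa [gap] using mul_pos h.a_pos h.p_pos

end Subcritical

/-- The smallest zero of a continuous function that changes its sign. -/
theorem exists_first_zero {g : ℝ → ℝ} {r : ℝ} (hr : 0 ≤ r) (hg : ContinuousOn g (Set.Icc 0 r))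
    (h0 : 0 < g 0) (hgr : g r ≤ 0) :
    ∃ c, 0 < c ∧ c ≤ r ∧ g c = 0 ∧ ∀ V, 0 ≤ V → V < c → 0 < g V := by
  have hcl : IsCompact (Set.Icc 0 r ∩ g ⁻¹' Set.Iic 0) :=
    isCompact_Icc.of_isClosed_subset (hg.preimage_isClosed_of_isClosed isClosed_Icc isClosed_Iic)
      Set.inter_subset_left
  obtain ⟨c, ⟨⟨hc0, hcr⟩, hc⟩, hmin⟩ := hcl.exists_isLeast ⟨r, ⟨hr, le_rfl⟩, hgr⟩
  have hpos : ∀ V, 0 ≤ V → V < c → 0 < g V := fun V hV hVc => by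
    by_contra hn
    exact (hmin ⟨⟨hV, hVc.le.trans hcr⟩, not_lt.1 hn⟩).not_gt hVc
  have hc' : 0 < c := hc0.lt_of_ne fun h => by
    rw [← h] at hc
    exact h0.not_ge hc
  refine ⟨c, hc', hcr, le_antisymm hc ?_, hpos⟩
  by_contra hn
  obtain ⟨V, hV, hV'⟩ := intermediate_value_Icc' hc0 (hg.mono (Set.Icc_subset_Icc_right hcr))
    ⟨(not_le.1 hn).le, h0.le⟩
  rcases hV.2.eq_or_lt with rfl | hlt
  · rw [hV'] at hn
    exact hn le_rfl
  · exact (hpos V hV.1 hlt).ne' hV'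

/-- The critical points `cm < 0 < cp` of `1 / ŷ` closest to `0` on either side. -/
structure IsCritPair (p u cm cp : ℝ) : Prop where
  cm_neg : cm < 0
  cp_pos : 0 < cp
  neg_rad_le : -rad u ≤ cm
  le_rad : cp ≤ rad u
  gap_cm : gap p u cm = 0
  gap_cp : gap p u cp = 0
  gap_pos : ∀ V, cm < V → V < cp → 0 < gap p u V

/-- The function `gap` is positive at `0` and nonpositive at both ends of the interval of radius
`rad u`. -/
theorem Subcritical.exists_isCritPair {p u : ℝ} (h : Subcritical p u) :
    ∃ cm cp, IsCritPair p u cm cp := by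
  have hr := h.rad_pos.le
  obtain ⟨c, h1, h2, h3, h4⟩ := exists_first_zero hr
    (h.continuousOn_gap.mono fun V hV => hV.2) h.gap_zero (h.gap_nonpos rfl le_rfl)
  obtain ⟨d, k1, k2, k3, k4⟩ := exists_first_zero (g := fun V => gap p u (-V)) hr
    (h.continuousOn_gap.comp continuous_neg.continuousOn fun V hV =>
      (neg_nonpos.2 hV.1).trans hr) (by simpa using h.gap_zero)
    (h.gap_nonpos (by ring) (by linarith))
  refine ⟨-d, c, neg_lt_zero.2 k1, h1, neg_le_neg k2, h2, k3, h3, fun V hV hV' => ?_⟩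
  rcases le_total 0 V with h0 | h0
  · exact h4 V h0 hV'
  · simpa using k4 (-V) (neg_nonneg.2 h0) (by linarith)

/-! ### Values of `1 / ŷ` on the real line -/

section InvY

variable {p u : ℝ}

/-- Partial fractions of `1 / ŷ`. -/
theorem cubicNum_eq_invY {V : ℝ} (hV : V ≠ 0) (hV' : 2 - 4 * u - V ≠ 0) :
    cubicNum p u V = 2 * V * (2 - 4 * u - V) * invY p u V := by
  have h3 : 2 * V * (2 - 4 * u - V) * invY p u V = V ^ 2 * (2 - 4 * u - V) +
      2 * u * V * (2 - 4 * u - V) + 2 * (u * (1 - u) * p) * (2 - 4 * u - V) -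
      2 * V * (u * (1 - u) * (1 - p)) := by
    rw [invY]
    field_simp
  rw [h3, cubicNum]
  ring

theorem div_sub_div_eq (c : ℝ) {d e : ℝ} (hd : d ≠ 0) (he : e ≠ 0) :
    c / d - c / e = (e - d) * (c / (d * e)) := by
  field_simp

theorem invY_sub {V W : ℝ} (hV : V ≠ 0) (hV' : 2 - 4 * u - V ≠ 0) (hW : W ≠ 0)
    (hW' : 2 - 4 * u - W ≠ 0) : invY p u V - invY p u W = (V - W) * (1 / 2 -
      u * (1 - u) * p / (V * W) - u * (1 - u) * (1 - p) / ((2 - 4 * u - V) * (2 - 4 * u - W))) := by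
  have h1 := div_sub_div_eq (u * (1 - u) * p) hV hW
  have h2 := div_sub_div_eq (u * (1 - u) * (1 - p)) hV' hW'
  rw [invY, invY]
  linear_combination h1 - h2

theorem gap_eq {V : ℝ} (hV : V ≠ 0) : gap p u V = V ^ 2 * (u * (1 - u) * p / (V * V) +
    u * (1 - u) * (1 - p) / ((2 - 4 * u - V) * (2 - 4 * u - V)) - 1 / 2) := by
  rw [gap]
  field_simp

theorem hasDerivAt_invY {V : ℝ} (hV : V ≠ 0) (hV' : 2 - 4 * u - V ≠ 0) :
    HasDerivAt (invY p u) (-(gap p u V / V ^ 2)) V := by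
  have h1 := ((((hasDerivAt_id V).div_const 2).add_const u).add
    ((hasDerivAt_const V (u * (1 - u) * p)).div (hasDerivAt_id V) hV)).sub
    ((hasDerivAt_const V (u * (1 - u) * (1 - p))).div ((hasDerivAt_id V).const_sub (2 - 4 * u)) hV')
  refine h1.congr_deriv ?_
  simp only [id]
  rw [gap_eq hV, mul_div_cancel_left₀ _ (pow_ne_zero 2 hV)]
  field_simp
  ring

end InvY

namespace IsCritPair

variable {p u cm cp : ℝ} (hc : IsCritPair p u cm cp) (h : Subcritical p u)
include hc h

theorem invY_lt_invY {V W : ℝ} (hV : 0 < V) (hVW : V < W) (hW : W ≤ cp) :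
    invY p u W < invY p u V := by
  have hd : ∀ x ∈ Set.Ioc 0 cp, HasDerivAt (invY p u) (-(gap p u x / x ^ 2)) x := fun x hx =>
    hasDerivAt_invY hx.1.ne' (h.sub_pos_of_le (hx.2.trans hc.le_rad)).ne'
  refine strictAntiOn_of_deriv_neg (convex_Ioc 0 cp)
    (fun x hx => (hd x hx).continuousAt.continuousWithinAt) (fun x hx => ?_)
    ⟨hV, hVW.le.trans hW⟩ ⟨hV.trans hVW, hW⟩ hVW
  rw [interior_Ioc] at hx
  rw [(hd x ⟨hx.1, hx.2.le⟩).deriv, neg_lt_zero]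
  exact div_pos (hc.gap_pos x (hc.cm_neg.trans hx.1) hx.2) (pow_pos hx.1 2)

theorem invY_lt_invY_of_neg {V W : ℝ} (hV : cm ≤ V) (hVW : V < W) (hW : W < 0) :
    invY p u W < invY p u V := by
  have hr := h.rad_pos
  have hd : ∀ x ∈ Set.Ico cm 0, HasDerivAt (invY p u) (-(gap p u x / x ^ 2)) x := fun x hx =>
    hasDerivAt_invY hx.2.ne (h.sub_pos_of_le (hx.2.le.trans hr.le)).ne'
  refine strictAntiOn_of_deriv_neg (convex_Ico cm 0)
    (fun x hx => (hd x hx).continuousAt.continuousWithinAt) (fun x hx => ?_)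
    ⟨hV, hVW.trans hW⟩ ⟨hV.trans hVW.le, hW⟩ hVW
  rw [interior_Ico] at hx
  rw [(hd x ⟨hx.1.le, hx.2⟩).deriv, neg_lt_zero]
  exact div_pos (hc.gap_pos x hx.1 (hx.2.trans hc.cp_pos)) (pow_pos (neg_pos.2 hx.2) 2 |>.trans_eq
    (neg_sq x))

omit hc in
theorem invY_pos {V : ℝ} (hV : 0 < V) (hVr : V ≤ rad u) : 0 < invY p u V := by
  have hs := h.rad_le_sub hVr
  have hr := h.rad_pos
  have hb := h.two_rad_le
  have hb0 : 0 < 2 - 4 * u := by linarith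
  have hbV := h.sub_pos_of_le hVr
  have h1 : u * (1 - u) * (1 - p) / (2 - 4 * u - V) ≤ u * (1 - u) / (2 - 4 * u) + V / 4 := by
    rw [div_le_iff₀ hbV]
    have h2 : u * (1 - u) / (2 - 4 * u) * (2 - 4 * u - V) =
        u * (1 - u) - u * (1 - u) / (2 - 4 * u) * V := by
      rw [mul_sub, div_mul_cancel₀ _ hb0.ne']
    have h3 : u * (1 - u) / (2 - 4 * u) ≤ (2 - 4 * u - V) / 4 := by
      rw [div_le_iff₀ hb0]
      nlinarith [h.rad_sq]
    have h4 := mul_le_mul_of_nonneg_right h3 hV.le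
    have h5 := mul_nonneg h.a_pos.le h.p_pos.le
    nlinarith
  have h2 : u * (1 - u) / (2 - 4 * u) < u := by
    rw [div_lt_iff₀ hb0]
    have := mul_pos h.u_pos (sub_pos.2 h.four_u_lt)
    nlinarith [h.u_pos, h.four_u_lt]
  have h3 := div_pos (mul_pos h.a_pos h.p_pos) hV
  rw [invY]
  linarith

/-- The estimate `y₊ > 1`. -/
theorem invY_cp_lt_one : invY p u cp < 1 := by
  have h0 := hc.cp_pos
  have hbV := h.sub_pos_of_le hc.le_rad
  have h1 := hc.gap_cp
  rw [gap_eq h0.ne', mul_eq_zero] at h1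
  have h2 := h1.resolve_left (pow_pos h0 2).ne'
  have h3 : u * (1 - u) * p / cp = cp * (u * (1 - u) * p / (cp * cp)) := by field_simp
  have hq := mul_nonneg h.a_pos.le h.q_nonneg
  have h4 := div_nonneg hq (mul_pos hbV hbV).le
  have h5 := div_nonneg hq hbV.le
  have h6 : cp * (u * (1 - u) * p / (cp * cp)) ≤ cp * (1 / 2) :=
    mul_le_mul_of_nonneg_left (by linarith) h0.le
  rw [invY, h3]
  linarith [h.rad_add_lt, hc.le_rad]

/-- At the critical point `cm` the function `1 / ŷ` is maximal over the negative half-line. -/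
theorem invY_le_invY_cm {V : ℝ} (hV : V < 0) : invY p u V ≤ invY p u cm := by
  have hr := h.rad_pos
  have h0 := hc.cm_neg
  have hb0 : 0 < 2 - 4 * u := by linarith [h.two_rad_le]
  have h1 := hc.gap_cm
  rw [gap_eq h0.ne, mul_eq_zero] at h1
  have h2 := h1.resolve_left (pow_ne_zero 2 h0.ne)
  have hbc : 0 < 2 - 4 * u - cm := by linarith
  have hbV : 0 < 2 - 4 * u - V := by linarith
  have hq := mul_nonneg h.a_pos.le h.q_nonneg
  have hp := mul_nonneg h.a_pos.le h.p_pos.le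
  rw [← sub_nonneg, invY_sub h0.ne hbc.ne' hV.ne hbV.ne']
  rcases le_total V cm with hle | hle
  · have h3 : u * (1 - u) * p / (cm * V) ≤ u * (1 - u) * p / (cm * cm) :=
      div_le_div_of_nonneg_left hp (mul_pos_of_neg_of_neg h0 h0) (by nlinarith)
    have h4 : u * (1 - u) * (1 - p) / ((2 - 4 * u - cm) * (2 - 4 * u - V)) ≤
        u * (1 - u) * (1 - p) / ((2 - 4 * u - cm) * (2 - 4 * u - cm)) :=
      div_le_div_of_nonneg_left hq (mul_pos hbc hbc) (by nlinarith)
    exact mul_nonneg (sub_nonneg.2 hle) (by linarith)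
  · have h3 : u * (1 - u) * p / (cm * cm) ≤ u * (1 - u) * p / (cm * V) :=
      div_le_div_of_nonneg_left hp (mul_pos_of_neg_of_neg h0 hV) (by nlinarith)
    have h4 : u * (1 - u) * (1 - p) / ((2 - 4 * u - cm) * (2 - 4 * u - cm)) ≤
        u * (1 - u) * (1 - p) / ((2 - 4 * u - cm) * (2 - 4 * u - V)) :=
      div_le_div_of_nonneg_left hq (mul_pos hbc hbV) (by nlinarith)
    exact mul_nonneg_of_nonpos_of_nonpos (sub_nonpos.2 hle) (by linarith)

/-- The negative critical value is the maximum of `1 / ŷ` over the negative half-line; comparing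
it with the value at `-cp` shows that `y₋ < -y₊`. -/
theorem invY_add_pos : 0 < invY p u cp + invY p u cm := by
  have h0 := hc.cp_pos
  have h1 := hc.invY_le_invY_cm h (neg_lt_zero.2 h0)
  have hr := h.two_rad_le
  have hb := h.sub_pos_of_le hc.le_rad
  have hb' : 0 < 2 - 4 * u - -cp := by linarith
  have h2 : invY p u cp + invY p u (-cp) = 2 * u - u * (1 - u) * (1 - p) *
      (2 * (2 - 4 * u) / ((2 - 4 * u - cp) * (2 - 4 * u - -cp))) := by
    have h3 : (2 - 4 * u - cp)⁻¹ + (2 - 4 * u - -cp)⁻¹ =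
        2 * (2 - 4 * u) / ((2 - 4 * u - cp) * (2 - 4 * u - -cp)) := by
      rw [inv_add_inv hb.ne' hb'.ne']
      ring
    rw [invY, invY, ← h3]
    ring
  have h3 : u * (1 - u) * (1 - p) * (2 * (2 - 4 * u) / ((2 - 4 * u - cp) * (2 - 4 * u - -cp))) <
      2 * u := by
    rw [← mul_div_assoc, div_lt_iff₀ (mul_pos hb hb')]
    have h4 : cp ^ 2 ≤ 2 * (u * (1 - u)) :=
      (pow_le_pow_left₀ h0.le hc.le_rad 2).trans_eq h.rad_sq
    have h5 : u * (1 - u) * (1 - p) ≤ u * (1 - u) :=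
      mul_le_of_le_one_right h.a_pos.le (by linarith [h.p_pos])
    have h6 : 0 < 2 * (2 - 4 * u) := by linarith [h.u_lt_half]
    have h7 := mul_le_mul_of_nonneg_right h5 h6.le
    have h8 : (1 - u) * (2 * (2 - 4 * u)) < 2 * ((2 - 4 * u - cp) * (2 - 4 * u - -cp)) := by
      nlinarith [h.le, h.four_u_lt, h.u_pos]
    have h9 := mul_lt_mul_of_pos_left h8 h.u_pos
    nlinarith
  linarith

/-- The values over the negative half-line stay below the positive critical value, so that for
positive `y` no solution is negative. -/
theorem invY_lt_invY_cp {V : ℝ} (hV : V < 0) : invY p u V < invY p u cp := by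
  have h0 := hc.cp_pos
  have hr := h.rad_pos
  have hbc := h.sub_pos_of_le hc.le_rad
  have hbc' := h.rad_le_sub hc.le_rad
  have hbV : 2 * rad u ≤ 2 - 4 * u - V := by linarith [h.two_rad_le]
  rw [← sub_pos, invY_sub h0.ne' hbc.ne' hV.ne (by linarith)]
  refine mul_pos (by linarith) ?_
  have h1 : u * (1 - u) * p / (cp * V) < 0 :=
    div_neg_of_pos_of_neg (mul_pos h.a_pos h.p_pos) (mul_neg_of_pos_of_neg h0 hV)
  have h2 : u * (1 - u) * (1 - p) / ((2 - 4 * u - cp) * (2 - 4 * u - V)) ≤ 1 / 4 := by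
    have h3 : rad u * (2 * rad u) ≤ (2 - 4 * u - cp) * (2 - 4 * u - V) :=
      mul_le_mul hbc' hbV (by linarith) hbc.le
    rw [div_le_iff₀ (lt_of_lt_of_le (by positivity) h3)]
    have h5 : u * (1 - u) * (1 - p) ≤ u * (1 - u) :=
      mul_le_of_le_one_right h.a_pos.le (by linarith [h.p_pos])
    nlinarith [h.rad_sq]
  linarith

end IsCritPair

end Real

/-! ### The region of the branch, and its value at non-real points -/

section Region

/-- The function `gap` on the complex plane; up to a positive factor, it is the ratio of the
imaginary parts of `-1 / ŷ` and `V`. -/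
def gapC (p u : ℝ) (V : ℂ) : ℝ :=
  u * (1 - u) * p + u * (1 - u) * (1 - p) *
    (Complex.normSq V / Complex.normSq ((2 - 4 * u : ℝ) - V)) - Complex.normSq V / 2

/-- The region in which the analytic continuation of `V` takes its values. The condition on `gapC`
means that `V` and `ŷ` lie on the same side of the real line, if `V` is not real. -/
def region (p u cm cp : ℝ) : Set ℂ :=
  {V | ‖V‖ < rad u ∧ 0 < gapC p u V ∧ (V.im = 0 → cm < V.re ∧ V.re < cp)}

/-- The equation `y = ŷ(p, u, V)` without denominators. -/
def IsRoot (p u : ℝ) (y V : ℂ) : Prop := y * cubicNum (p : ℂ) u V = 2 * V * (2 - 4 * u - V)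

/-- The derivative in `V` of `y * cubicNum p u V - 2 * V * (2 - 4 * u - V)`. -/
def rootDeriv (u : ℝ) (y V : ℂ) : ℂ :=
  y * (2 * u * (1 - 3 * u) + 4 * (1 - 3 * u) * V - 3 * V ^ 2) - (2 * (2 - 4 * u) - 4 * V)

/-- The equation `y = ŷ(p, u, V)` has exactly one solution in the region, and it is simple. -/
def HasSimpleRoot (p u cm cp : ℝ) (y : ℂ) : Prop :=
  ∃ V ∈ region p u cm cp, IsRoot p u y V ∧ rootDeriv u y V ≠ 0 ∧
    ∀ W ∈ region p u cm cp, IsRoot p u y W → W = V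

variable {p u cm cp : ℝ}

theorem gapC_ofReal (V : ℝ) : gapC p u V = gap p u V := by
  rw [gapC, gap, ← Complex.ofReal_sub, Complex.normSq_ofReal, Complex.normSq_ofReal]
  ring

theorem gapC_conj (V : ℂ) : gapC p u ((starRingEnd ℂ) V) = gapC p u V := by
  have : ((2 - 4 * u : ℝ) : ℂ) - (starRingEnd ℂ) V = (starRingEnd ℂ) ((2 - 4 * u : ℝ) - V) := by
    rw [map_sub, Complex.conj_ofReal]
  rw [gapC, gapC, this, Complex.normSq_conj, Complex.normSq_conj]

theorem conj_mem_region {V : ℂ} (hV : V ∈ region p u cm cp) :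
    (starRingEnd ℂ) V ∈ region p u cm cp := by
  refine ⟨by rw [RCLike.norm_conj]; exact hV.1, by rw [gapC_conj]; exact hV.2.1, fun h => ?_⟩
  rw [Complex.conj_re]
  exact hV.2.2 (by simpa using h)

theorem IsRoot.conj {y V : ℂ} (h : IsRoot p u y V) :
    IsRoot p u ((starRingEnd ℂ) y) ((starRingEnd ℂ) V) := by
  have h1 := congrArg (starRingEnd ℂ) h
  rw [map_mul, map_cubicNum] at h1
  simp only [map_mul, map_sub, map_ofNat, Complex.conj_ofReal] at h1
  exact h1

theorem rootDeriv_conj (y V : ℂ) :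
    rootDeriv u ((starRingEnd ℂ) y) ((starRingEnd ℂ) V) = (starRingEnd ℂ) (rootDeriv u y V) := by
  simp only [rootDeriv, map_mul, map_sub, map_add, map_pow, map_ofNat, map_one,
    Complex.conj_ofReal]

theorem HasSimpleRoot.conj {y : ℂ} (h : HasSimpleRoot p u cm cp ((starRingEnd ℂ) y)) :
    HasSimpleRoot p u cm cp y := by
  obtain ⟨V, hV, hr, hd, huniq⟩ := h
  refine ⟨_, conj_mem_region hV, ?_, ?_, fun W hW hWr => ?_⟩
  · simpa only [Complex.conj_conj] using hr.conj
  · have := rootDeriv_conj (u := u) ((starRingEnd ℂ) y) V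
    rw [Complex.conj_conj] at this
    rw [this]
    exact (map_ne_zero _).2 hd
  · rw [← huniq _ (conj_mem_region hW) hWr.conj, Complex.conj_conj]

theorem isOpen_region (h : Subcritical p u) : IsOpen (region p u cm cp) := by
  have hcont : ContinuousOn (gapC p u) (Metric.ball 0 (rad u)) := by
    intro V hV
    have h1 : Complex.normSq (((2 - 4 * u : ℝ) : ℂ) - V) ≠ 0 := fun h0 =>
      sub_ne_zero_of_norm_le h.rad_pos h.two_rad_le (mem_ball_zero_iff.1 hV).le
        (Complex.normSq_eq_zero.1 h0)
    unfold gapC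
    refine ContinuousAt.continuousWithinAt ?_
    have h2 : ContinuousAt Complex.normSq V := Complex.continuous_normSq.continuousAt
    have h3 : ContinuousAt (fun V => Complex.normSq (((2 - 4 * u : ℝ) : ℂ) - V)) V :=
      (Complex.continuous_normSq.comp (continuous_const.sub continuous_id)).continuousAt
    exact (continuousAt_const.add (continuousAt_const.mul (h2.div h3 h1))).sub (h2.div_const 2)
  have h1 := hcont.isOpen_inter_preimage Metric.isOpen_ball (isOpen_Ioi (a := (0 : ℝ)))
  have h2 : IsClosed {V : ℂ | V.im = 0 ∧ (V.re ≤ cm ∨ cp ≤ V.re)} := by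
    refine (isClosed_eq Complex.continuous_im continuous_const).inter ?_
    exact (isClosed_le Complex.continuous_re continuous_const).union
      (isClosed_le continuous_const Complex.continuous_re)
  convert h1.inter h2.isOpen_compl using 1
  ext V
  simp only [region, Set.mem_ofPred_eq, Set.mem_inter_iff, Set.mem_preimage, Set.mem_Ioi,
    Set.mem_compl_iff, mem_ball_zero_iff, not_and, not_or, not_le, and_assoc]

theorem ofReal_mem_region (hc : IsCritPair p u cm cp) {V : ℝ} (h1 : cm < V)
    (h2 : V < cp) : (V : ℂ) ∈ region p u cm cp := by
  refine ⟨?_, ?_, fun _ => ?_⟩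
  · rw [Complex.norm_real, Real.norm_eq_abs, abs_lt]
    exact ⟨hc.neg_rad_le.trans_lt h1, h2.trans_le hc.le_rad⟩
  · rw [gapC_ofReal]
    exact hc.gap_pos V h1 h2
  · rw [Complex.ofReal_re]
    exact ⟨h1, h2⟩

theorem Subcritical.sub_ne_zero (h : Subcritical p u) {V : ℂ} (hV : ‖V‖ ≤ rad u) :
    2 - 4 * (u : ℂ) - V ≠ 0 := by
  have := sub_ne_zero_of_norm_le h.rad_pos h.two_rad_le hV
  push_cast at this
  exact this

theorem Subcritical.cubicNum_zero_ne (h : Subcritical p u) : cubicNum (p : ℂ) u 0 ≠ 0 := by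
  have h1 : 0 < 4 * p * u * (1 - u) * (1 - 2 * u) := by
    have := h.u_lt_half
    have := h.p_pos
    have := h.u_pos
    exact mul_pos (mul_pos (by positivity) (by linarith)) (by linarith)
  have h2 : cubicNum (p : ℂ) u 0 = ((4 * p * u * (1 - u) * (1 - 2 * u) : ℝ) : ℂ) := by
    rw [cubicNum]
    push_cast
    ring
  rw [h2]
  exact Complex.ofReal_ne_zero.2 h1.ne'

theorem IsRoot.ne_zero (h : Subcritical p u) {y V : ℂ} (hr : IsRoot p u y V) (hy : y ≠ 0) :
    V ≠ 0 := by
  rintro rfl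
  rw [IsRoot, mul_zero, zero_mul] at hr
  exact mul_ne_zero hy h.cubicNum_zero_ne hr

theorem IsRoot.cubicNum_ne (h : Subcritical p u) {y V : ℂ} (hr : IsRoot p u y V)
    (hV : ‖V‖ ≤ rad u) : cubicNum (p : ℂ) u V ≠ 0 := fun h0 => by
  rw [IsRoot, h0, mul_zero] at hr
  rcases mul_eq_zero.1 hr.symm with h1 | h1
  · rcases mul_eq_zero.1 h1 with h2 | h2
    · exact two_ne_zero h2
    · rw [h2] at h0
      exact h.cubicNum_zero_ne h0
  · exact h.sub_ne_zero hV h1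

theorem isRoot_iff_cubic {y V : ℂ} (hy : y ≠ 0) : IsRoot p u y V ↔
    V ^ 3 - (2 * y⁻¹ + (2 - 4 * u) - 2 * u) * V ^ 2 +
      (2 * y⁻¹ * (2 - 4 * u) - 2 * u * (1 - 3 * u)) * V - 2 * p * (u * (1 - u)) * (2 - 4 * u) = 0 := by
  rw [IsRoot, cubicNum, ← sub_eq_zero, ← mul_eq_zero_iff_left (neg_ne_zero.2 (inv_ne_zero hy))]
  refine Eq.congr ?_ rfl
  field_simp
  ring

theorem isRoot_iff_omg {y V : ℂ} (hy : y ≠ 0) (hV0 : V ≠ 0)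
    (hV : 2 - 4 * (u : ℂ) - V ≠ 0) :
    IsRoot p u y V ↔ omg p (1 - p) (u * (1 - u)) (2 - 4 * u) u V = y⁻¹ := by
  rw [isRoot_iff_cubic hy, omg_eq_iff hV0 (by push_cast; exact hV)]

theorem im_omg_eq {V : ℂ} (hV : V ≠ 0) :
    (omg p (1 - p) (u * (1 - u)) (2 - 4 * u) u V).im =
      -(V.im * gapC p u V / Complex.normSq V) := by
  have : Complex.normSq V ≠ 0 := (Complex.normSq_pos.2 hV).ne'
  rw [im_omg, gapC]
  push_cast
  field_simp
  ring

/-- For a non-real `y` the three solutions are separated by the disc and the real line. -/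
theorem hasSimpleRoot_of_im_neg (h : Subcritical p u) {y : ℂ} (hy : y.im < 0) :
    HasSimpleRoot p u cm cp y := by
  have hy0 : y ≠ 0 := fun h0 => by rw [h0] at hy; exact hy.false
  have hw : 0 < (y⁻¹).im := by
    rw [Complex.inv_im]
    exact div_pos (by linarith) (Complex.normSq_pos.2 hy0)
  obtain ⟨A, B, C, hA, hA', hB, hC, hfac⟩ := exists_factor h.p_pos h.p_le_one h.u_pos
    h.rad_pos h.rad_sq h.two_rad_le hw
  have hroot : ∀ X, IsRoot p u y X ↔ (X - A) * (X - B) * (X - C) = 0 := fun X => by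
    rw [isRoot_iff_cubic hy0, hfac X]
  have hAr : IsRoot p u y A := by rw [hroot, sub_self, zero_mul, zero_mul]
  have hsign : ∀ V : ℂ, ‖V‖ ≤ rad u → IsRoot p u y V → V.im * gapC p u V < 0 := fun V hV hr => by
    have hV0 := hr.ne_zero h hy0
    have h1 := (isRoot_iff_omg hy0 hV0 (h.sub_ne_zero hV)).1 hr
    rw [← h1, im_omg_eq hV0, neg_pos] at hw
    exact ((div_neg_iff.1 hw).resolve_left fun hn => (Complex.normSq_nonneg V).not_gt hn.2).1
  refine ⟨A, ⟨hA, ?_, fun h0 => absurd h0 hA'.ne⟩, hAr, ?_, fun W hW hWr => ?_⟩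
  · exact pos_of_mul_neg_right (hsign A hA.le hAr) hA'.le
  · -- the derivative at `A` is `-y (A - B) (A - C)`
    have hAB : A - B ≠ 0 := _root_.sub_ne_zero.2 fun h0 => by rw [h0] at hA; linarith
    have hAC : A - C ≠ 0 := _root_.sub_ne_zero.2 fun h0 => by rw [h0] at hA'; linarith
    have h0 := hfac 0
    have h1 := hfac 1
    have h2 := hfac (-1)
    have h3 : y * y⁻¹ = 1 := mul_inv_cancel₀ hy0
    have h4 : rootDeriv u y A = -(y * ((A - B) * (A - C))) := by
      rw [rootDeriv]
      linear_combination -(y * A) * (h1 + h2 - 2 * h0) - y / 2 * (h1 - h2) +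
        (2 * (2 - 4 * u) - 4 * A) * h3
    rw [h4]
    exact neg_ne_zero.2 (mul_ne_zero hy0 (mul_ne_zero hAB hAC))
  · rcases mul_eq_zero.1 ((hroot W).1 hWr) with h1 | h1
    · rcases mul_eq_zero.1 h1 with h2 | h2
      · exact sub_eq_zero.1 h2
      · rw [sub_eq_zero.1 h2] at hW
        exact absurd hW.1 hB.not_gt
    · rw [sub_eq_zero.1 h1] at hW hWr
      exact absurd (hsign C hW.1.le hWr) (mul_pos hC hW.2.1).not_gt

end Region

/-! ### The slit plane, and the value of the branch at real points -/

section Domain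

/-- The negative singularity `y₋`, or `-∞` if `1 / ŷ` is nonnegative at the negative critical
point. -/
def yMin (p u cm : ℝ) : EReal :=
  if invY p u cm < 0 then (((invY p u cm)⁻¹ : ℝ) : EReal) else ⊥

/-- The slit plane to which the generating series continues. -/
def domain (p u cm cp : ℝ) : Set ℂ := slitPlane₂ (yMin p u cm) (((invY p u cp)⁻¹ : ℝ) : EReal)

variable {p u cm cp : ℝ} (h : Subcritical p u) (hc : IsCritPair p u cm cp)
include h hc

theorem invY_cp_pos : 0 < invY p u cp := IsCritPair.invY_pos h hc.cp_pos hc.le_rad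

/-- Membership of real points without division, uniformly in the cases of finite and infinite `y₋`.
-/
theorem mem_domain_of_im_eq_zero {z : ℂ} (hz : z.im = 0) : z ∈ domain p u cm cp ↔
    (0 < z.re → z.re * invY p u cp < 1) ∧ (z.re < 0 → z.re * invY p u cm < 1) := by
  have hp := invY_cp_pos h hc
  have h1 : (z.re : EReal) < ((invY p u cp)⁻¹ : ℝ) ↔ (0 < z.re → z.re * invY p u cp < 1) := by
    rw [EReal.coe_lt_coe_iff, inv_eq_one_div, lt_div_iff₀ hp]
    exact ⟨fun hlt _ => hlt, fun hlt => (le_or_gt z.re 0).elim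
      (fun h0 => (mul_nonpos_of_nonpos_of_nonneg h0 hp.le).trans_lt one_pos) hlt⟩
  have h2 : yMin p u cm < (z.re : EReal) ↔ (z.re < 0 → z.re * invY p u cm < 1) := by
    rw [yMin]
    split_ifs with hm
    · rw [EReal.coe_lt_coe_iff, inv_eq_one_div, div_lt_iff_of_neg hm]
      exact ⟨fun hlt _ => hlt, fun hlt => (lt_or_ge z.re 0).elim hlt
        fun h0 => (mul_nonpos_of_nonneg_of_nonpos h0 hm.le).trans_lt one_pos⟩
    · exact ⟨fun _ h0 => (mul_nonpos_of_nonpos_of_nonneg h0.le (not_lt.1 hm)).trans_lt one_pos,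
        fun _ => EReal.bot_lt_coe _⟩
  rw [← h1, ← h2]
  simp only [domain, slitPlane₂, Set.mem_ofPred_eq, hz, true_and, not_or, not_le, and_comm]

theorem ofReal_mem_domain {y : ℝ} : (y : ℂ) ∈ domain p u cm cp ↔
    (0 < y → y * invY p u cp < 1) ∧ (y < 0 → y * invY p u cm < 1) :=
  mem_domain_of_im_eq_zero h hc (Complex.ofReal_im y)

omit h hc in
theorem mem_domain_of_im_ne_zero {z : ℂ} (hz : z.im ≠ 0) : z ∈ domain p u cm cp :=
  fun hn => hz hn.1

theorem yMin_lt : yMin p u cm < ((-(invY p u cp)⁻¹ : ℝ) : EReal) := by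
  have hp := invY_cp_pos h hc
  rw [yMin]
  split_ifs with hm
  · rw [EReal.coe_lt_coe_iff, ← inv_neg, inv_lt_inv_of_neg hm (neg_lt_zero.2 hp)]
    linarith [hc.invY_add_pos h]
  · exact EReal.bot_lt_coe _

theorem ball_subset_domain : Metric.ball 0 (invY p u cp)⁻¹ ⊆ domain p u cm cp := by
  intro z hz hn
  rw [mem_ball_zero_iff] at hz
  have h1 := abs_lt.1 ((Complex.abs_re_le_norm z).trans_lt hz)
  rcases hn.2 with h2 | h2
  · exact (EReal.coe_lt_coe_iff.2 h1.1).not_ge (h2.trans (yMin_lt h hc).le)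
  · exact h1.2.not_ge (EReal.coe_le_coe_iff.1 h2)

omit hc in
theorem isRoot_ofReal {y V : ℝ} (hV : V ≤ rad u) (hy : y ≠ 0) :
    IsRoot p u y V ↔ V ≠ 0 ∧ y * invY p u V = 1 := by
  have hb := (h.sub_pos_of_le hV).ne'
  have h1 : IsRoot p u y V ↔ y * cubicNum p u V = 2 * V * (2 - 4 * u - V) := by
    have h2 : cubicNum (p : ℂ) u V = (cubicNum p u V : ℝ) :=
      (map_cubicNum Complex.ofRealHom p u V).symm
    rw [IsRoot, h2]
    norm_cast
  by_cases hV0 : V = 0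
  · refine iff_of_false (fun hr => ?_) fun hr => hr.1 hV0
    exact hr.ne_zero h (Complex.ofReal_ne_zero.2 hy) (by rw [hV0, Complex.ofReal_zero])
  · rw [h1, cubicNum_eq_invY hV0 hb]
    have h2 : 2 * V * (2 - 4 * u - V) ≠ 0 := mul_ne_zero (mul_ne_zero two_ne_zero hV0) hb
    refine ⟨fun hr => ⟨hV0, mul_left_cancel₀ h2 ?_⟩, fun hr => ?_⟩
    · linear_combination hr
    · linear_combination 2 * V * (2 - 4 * u - V) * hr.2

/-- For real `y` the imaginary part of `1 / ŷ` vanishes, which forces `V` to be real in the region.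
-/
theorem im_eq_zero_of_isRoot {y : ℝ} {V : ℂ} (hV : V ∈ region p u cm cp) (hy : y ≠ 0)
    (hr : IsRoot p u y V) : V.im = 0 := by
  have hy' : (y : ℂ) ≠ 0 := Complex.ofReal_ne_zero.2 hy
  have hV0 := hr.ne_zero h hy'
  have h1 := (isRoot_iff_omg hy' hV0 (h.sub_ne_zero hV.1.le)).1 hr
  have h2 := im_omg_eq (p := p) (u := u) hV0
  rw [h1, ← Complex.ofReal_inv, Complex.ofReal_im, eq_comm, neg_eq_zero, div_eq_zero_iff,
    mul_eq_zero] at h2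
  rcases h2 with (h2 | h2) | h2
  · exact h2
  · exact absurd h2 hV.2.1.ne'
  · exact absurd (Complex.normSq_eq_zero.1 h2) hV0

/-- Existence by the intermediate value theorem between `0` and a critical point. -/
theorem exists_real_root {y : ℝ} (hy : y ≠ 0) (hyd : (y : ℂ) ∈ domain p u cm cp) :
    ∃ V : ℝ, cm < V ∧ V < cp ∧ V ≠ 0 ∧ y * invY p u V = 1 := by
  rw [ofReal_mem_domain h hc] at hyd
  have hm := hc.cm_neg
  have hp := hc.cp_pos
  have hr := h.rad_pos
  set Φ : ℝ → ℝ := fun V => y * cubicNum p u V - 2 * V * (2 - 4 * u - V) with hΦ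
  have hcont : Continuous Φ := by
    unfold Φ cubicNum
    fun_prop
  have hΦeq : ∀ V ≤ rad u, V ≠ 0 → Φ V = 2 * V * (2 - 4 * u - V) * (y * invY p u V - 1) :=
    fun V hV hV0 => by
      rw [hΦ]
      simp only
      rw [cubicNum_eq_invY hV0 (h.sub_pos_of_le hV).ne']
      ring
  have h0 : Φ 0 = y * (4 * p * u * (1 - u) * (1 - 2 * u)) := by
    simp only [hΦ, cubicNum]
    ring
  have hpos : 0 < 4 * p * u * (1 - u) * (1 - 2 * u) := by
    have := h.p_pos
    have := h.u_pos
    exact mul_pos (mul_pos (by positivity) (by linarith [h.u_lt_half])) (by linarith [h.u_lt_half])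
  have hfin : ∀ V ≤ rad u, Φ V = 0 → V ≠ 0 ∧ y * invY p u V = 1 := fun V hV hV0 => by
    have hne : V ≠ 0 := fun h1 => by
      rw [h1, h0] at hV0
      exact mul_ne_zero hy hpos.ne' hV0
    refine ⟨hne, ?_⟩
    rw [hΦeq V hV hne] at hV0
    have := (mul_eq_zero.1 hV0).resolve_left
      (mul_ne_zero (mul_ne_zero two_ne_zero hne) (h.sub_pos_of_le hV).ne')
    linarith
  rcases hy.lt_or_gt with hneg | hpos'
  · have h1 : Φ 0 < 0 := by rw [h0]; exact mul_neg_of_neg_of_pos hneg hpos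
    have h2 : 0 < Φ cm := by
      rw [hΦeq cm (by linarith) hm.ne]
      refine mul_pos_of_neg_of_neg (mul_neg_of_neg_of_pos (by linarith) ?_) ?_
      · exact h.sub_pos_of_le (by linarith)
      · linarith [hyd.2 hneg]
    obtain ⟨V, hV, hV0⟩ := intermediate_value_Icc' hm.le hcont.continuousOn ⟨h1.le, h2.le⟩
    refine ⟨V, hV.1.lt_of_ne ?_, hV.2.trans_lt hp, hfin V (hV.2.trans hr.le) hV0⟩
    rintro rfl
    exact h2.ne' hV0
  · have h1 : 0 < Φ 0 := by rw [h0]; exact mul_pos hpos' hpos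
    have h2 : Φ cp < 0 := by
      rw [hΦeq cp hc.le_rad hp.ne']
      refine mul_neg_of_pos_of_neg (mul_pos (by linarith) (h.sub_pos_of_le hc.le_rad)) ?_
      linarith [hyd.1 hpos']
    obtain ⟨V, hV, hV0⟩ := intermediate_value_Icc' hp.le hcont.continuousOn ⟨h2.le, h1.le⟩
    refine ⟨V, hm.trans_le hV.1, hV.2.lt_of_ne ?_, hfin V (hV.2.trans hc.le_rad) hV0⟩
    rintro rfl
    exact h2.ne hV0

/-- The sign of `V` is that of `y`, and `1 / ŷ` is monotone on either side of `0`. -/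
theorem real_root_unique {y V W : ℝ} (hyd : (y : ℂ) ∈ domain p u cm cp)
    (hV : cm < V) (hV' : V < cp) (hW : cm < W) (hW' : W < cp) (hV0 : V ≠ 0) (hW0 : W ≠ 0)
    (hVr : y * invY p u V = 1) (hWr : y * invY p u W = 1) : V = W := by
  rw [ofReal_mem_domain h hc] at hyd
  have hy : y ≠ 0 := left_ne_zero_of_mul_eq_one hVr
  have heq : invY p u V = invY p u W := mul_left_cancel₀ hy (hVr.trans hWr.symm)
  rcases hy.lt_or_gt with hneg | hpos
  · have hlt : ∀ X, X < cp → X ≠ 0 → y * invY p u X = 1 → X < 0 := fun X h1 h2 h3 => by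
      refine lt_of_not_ge fun h4 => ?_
      have := IsCritPair.invY_pos h (h4.lt_of_ne' h2) (h1.le.trans hc.le_rad)
      have := mul_neg_of_neg_of_pos hneg this
      linarith
    have h1 := hlt V hV' hV0 hVr
    have h2 := hlt W hW' hW0 hWr
    rcases lt_trichotomy V W with h3 | h3 | h3
    · exact absurd heq (hc.invY_lt_invY_of_neg h hV.le h3 h2).ne'
    · exact h3
    · exact absurd heq (hc.invY_lt_invY_of_neg h hW.le h3 h1).ne
  · have hgt : ∀ X, X ≠ 0 → y * invY p u X = 1 → 0 < X := fun X h2 h3 => by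
      refine lt_of_not_ge fun h4 => ?_
      have := mul_lt_mul_of_pos_left (hc.invY_lt_invY_cp h (h4.lt_of_ne h2)) hpos
      linarith [hyd.1 hpos]
    have h1 := hgt V hV0 hVr
    have h2 := hgt W hW0 hWr
    rcases lt_trichotomy V W with h3 | h3 | h3
    · exact absurd heq (hc.invY_lt_invY h h1 h3 hW'.le).ne'
    · exact h3
    · exact absurd heq (hc.invY_lt_invY h h2 h3 hV'.le).ne

omit hc in
/-- At a real solution the derivative of the equation is a nonzero multiple of `gap`. -/
theorem rootDeriv_mul {V : ℝ} (hV : V ≤ rad u) {y : ℂ}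
    (hr : IsRoot p u y V) : rootDeriv u y V * cubicNum (p : ℂ) u V =
      -(4 * (2 - 4 * u - V) ^ 2 * gap p u V) := by
  have hb := (h.sub_pos_of_le hV).ne'
  have h1 : (2 - 4 * u - V) ^ 2 * gap p u V = (2 - 4 * u - V) ^ 2 * (u * (1 - u) * p - V ^ 2 / 2) +
      u * (1 - u) * (1 - p) * V ^ 2 := by
    rw [gap]
    field_simp
    ring
  have h2 : ((2 - 4 * u - V) ^ 2 * gap p u V : ℂ) = (2 - 4 * u - V) ^ 2 * (u * (1 - u) * p - V ^ 2 / 2) +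
      u * (1 - u) * (1 - p) * V ^ 2 := by
    exact_mod_cast h1
  rw [mul_assoc, h2, rootDeriv, sub_mul, mul_right_comm, hr]
  rw [cubicNum]
  ring

theorem hasSimpleRoot_ofReal {y : ℝ} (hyd : (y : ℂ) ∈ domain p u cm cp) :
    HasSimpleRoot p u cm cp y := by
  have hne : ∀ V ∈ region p u cm cp, 2 - 4 * (u : ℂ) - V ≠ 0 := fun V hV => h.sub_ne_zero hV.1.le
  have hex : ∃ V : ℝ, cm < V ∧ V < cp ∧ IsRoot p u y V := by
    by_cases hy : y = 0
    · refine ⟨0, hc.cm_neg, hc.cp_pos, ?_⟩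
      simp [IsRoot, hy]
    · obtain ⟨V, h1, h2, h3, h4⟩ := exists_real_root h hc hy hyd
      exact ⟨V, h1, h2, (isRoot_ofReal h (h2.le.trans hc.le_rad) hy).2 ⟨h3, h4⟩⟩
  obtain ⟨V, h1, h2, h3⟩ := hex
  have hVR := h2.le.trans hc.le_rad
  refine ⟨V, ofReal_mem_region hc h1 h2, h3, fun h0 => ?_, fun W hW hWr => ?_⟩
  · have h4 := rootDeriv_mul h hVR h3
    rw [h0, zero_mul, eq_comm, neg_eq_zero] at h4
    have h5 : 4 * (2 - 4 * u - V) ^ 2 * gap p u V = 0 := by exact_mod_cast h4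
    exact (mul_pos (mul_pos four_pos (pow_pos (h.sub_pos_of_le hVR) 2))
      (hc.gap_pos V h1 h2)).ne' h5
  · by_cases hy : y = 0
    · have key : ∀ X ∈ region p u cm cp, IsRoot p u y X → X = 0 := fun X hX hr => by
        rw [IsRoot, hy, Complex.ofReal_zero, zero_mul, eq_comm] at hr
        exact (mul_eq_zero.1 ((mul_eq_zero.1 hr).resolve_right (hne X hX))).resolve_left two_ne_zero
      rw [key W hW hWr, key V (ofReal_mem_region hc h1 h2) h3]
    · have him := im_eq_zero_of_isRoot h hc hW hy hWr
      obtain ⟨k1, k2⟩ := hW.2.2 him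
      have hWre : W = (W.re : ℂ) := Complex.ext (by simp) (by simp [him])
      rw [hWre] at hWr ⊢
      obtain ⟨hV0, hVy⟩ := (isRoot_ofReal h hVR hy).1 h3
      obtain ⟨hW0, hWy⟩ := (isRoot_ofReal h (k2.le.trans hc.le_rad) hy).1 hWr
      rw [real_root_unique h hc hyd k1 k2 h1 h2 hW0 hV0 hWy hVy]

theorem hasSimpleRoot {y : ℂ} (hyd : y ∈ domain p u cm cp) : HasSimpleRoot p u cm cp y := by
  rcases lt_trichotomy y.im 0 with him | him | him
  · exact hasSimpleRoot_of_im_neg h him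
  · have hy : y = (y.re : ℂ) := Complex.ext (by simp) (by simp [him])
    rw [hy] at hyd ⊢
    exact hasSimpleRoot_ofReal h hc hyd
  · exact (hasSimpleRoot_of_im_neg h (by simpa using him)).conj

end Domain

/-! ### The analytic branch -/

theorem isOpen_slitPlane₂ (a b : EReal) : IsOpen (slitPlane₂ a b) := by
  have h1 : Continuous fun z : ℂ => (z.re : EReal) :=
    continuous_coe_real_ereal.comp Complex.continuous_re
  have h2 : IsClosed {z : ℂ | z.im = 0 ∧ ((z.re : EReal) ≤ a ∨ b ≤ (z.re : EReal))} :=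
    (isClosed_eq Complex.continuous_im continuous_const).inter
      ((isClosed_le h1 continuous_const).union (isClosed_le continuous_const h1))
  exact h2.isOpen_compl

/-- The analytic continuation of `V` to the slit plane: the only solution of `y = ŷ(p, u, V)` in
`region`. The value is `0` where there is no such solution, which does not occur in `domain`. -/
def branch (p u cm cp : ℝ) (y : ℂ) : ℂ :=
  open Classical in if h : HasSimpleRoot p u cm cp y then h.choose else 0

/-- The analytic continuation of `T(p, t, t y)` to the slit plane. -/
def continuation (p u cm cp : ℝ) (y : ℂ) : ℂ :=
  cubicNum (p : ℂ) u (branch p u cm cp y) / (4 * u * (1 - u) * (1 - 2 * u))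

section Branch

variable {p u cm cp : ℝ} (h : Subcritical p u) (hc : IsCritPair p u cm cp)
include h hc

theorem isOpen_domain : IsOpen (domain p u cm cp) := isOpen_slitPlane₂ _ _

theorem branch_spec {y : ℂ} (hy : y ∈ domain p u cm cp) : branch p u cm cp y ∈ region p u cm cp ∧
    IsRoot p u y (branch p u cm cp y) ∧ rootDeriv u y (branch p u cm cp y) ≠ 0 ∧
      ∀ W ∈ region p u cm cp, IsRoot p u y W → W = branch p u cm cp y := by
  have hs := hasSimpleRoot h hc hy
  rw [branch, dif_pos hs]
  exact hs.choose_spec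

/-- The inverse function theorem yields a local inverse of `ŷ` with values in the region; by
uniqueness of the solution there, it coincides with the branch. -/
theorem differentiableAt_branch {y : ℂ} (hy : y ∈ domain p u cm cp) :
    DifferentiableAt ℂ (branch p u cm cp) y := by
  obtain ⟨hV, hr, hd, -⟩ := branch_spec h hc hy
  set V := branch p u cm cp y with hVdef
  have hN := hr.cubicNum_ne h hV.1.le
  -- the branch is locally the inverse of `ŷ`
  set ψ : ℂ → ℂ := fun V => 2 * V * (2 - 4 * u - V) / cubicNum (p : ℂ) u V with hψ
  have hiff : ∀ y W, ‖W‖ < rad u → cubicNum (p : ℂ) u W ≠ 0 → (ψ W = y ↔ IsRoot p u y W) :=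
    fun y W _ h0 => by rw [hψ, IsRoot, div_eq_iff h0, eq_comm]
  have hcont : Continuous fun V : ℂ => cubicNum (p : ℂ) u V := by
    unfold cubicNum
    fun_prop
  have hψa : AnalyticAt ℂ ψ V := by
    refine AnalyticAt.div (by fun_prop) ?_ hN
    unfold cubicNum
    fun_prop
  have hψV : ψ V = y := (hiff y V hV.1 hN).2 hr
  have hN' : HasDerivAt (fun V : ℂ => cubicNum (p : ℂ) u V)
      (2 * u * (1 - 3 * u) + 4 * (1 - 3 * u) * V - 3 * V ^ 2) V := by
    have h1 := (((hasDerivAt_id V).const_mul (2 * (u : ℂ) * (1 - 3 * u))).const_add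
      (4 * (p : ℂ) * u * (1 - u) * (1 - 2 * u))).add (((hasDerivAt_id V).pow 2).const_mul
        (2 * (1 - 3 * (u : ℂ)))) |>.sub ((hasDerivAt_id V).pow 3)
    refine h1.congr_deriv ?_
    simp
    ring
  have hQ' : HasDerivAt (fun V : ℂ => 2 * V * (2 - 4 * u - V)) (2 * (2 - 4 * u) - 4 * V) V := by
    have h1 := ((hasDerivAt_id V).const_mul 2).mul ((hasDerivAt_id V).const_sub (2 - 4 * (u : ℂ)))
    refine h1.congr_deriv ?_
    simp
    ring
  have hψ' := hQ'.div hN' hN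
  have hne : deriv ψ V ≠ 0 := by
    have h1 : deriv ψ V = -(rootDeriv u y V / cubicNum (p : ℂ) u V) := by
      refine hψ'.deriv.trans ?_
      rw [← hr, rootDeriv]
      field_simp
      ring
    rw [h1]
    exact neg_ne_zero.2 (div_ne_zero hd hN)
  have hs := hψa.hasStrictDerivAt
  have hg := hs.to_localInverse hne
  set g := hs.localInverse ψ (deriv ψ V) V hne with hgdef
  have hright : ∀ᶠ z in 𝓝 (ψ V), ψ (g z) = z :=
    (hs.hasStrictFDerivAt_equiv hne).eventually_right_inverse
  have hgV : g (ψ V) = V := (hs.hasStrictFDerivAt_equiv hne).localInverse_apply_image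
  rw [hψV] at hg hright hgV
  have hgc : Tendsto g (𝓝 y) (𝓝 V) := by
    have := hg.hasDerivAt.continuousAt.tendsto
    rwa [hgV] at this
  refine (hg.hasDerivAt.congr_of_eventuallyEq ?_).differentiableAt
  filter_upwards [hright, hgc.eventually ((isOpen_region h).mem_nhds hV),
    hgc.eventually (hcont.continuousAt.eventually_ne hN), (isOpen_domain h hc).mem_nhds hy]
    with z h1 h2 h3 h4
  exact ((branch_spec h hc h4).2.2.2 _ h2 ((hiff z _ h2.1 h3).1 h1)).symm

theorem differentiableOn_branch : DifferentiableOn ℂ (branch p u cm cp) (domain p u cm cp) :=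
  fun _ hy => (differentiableAt_branch h hc hy).differentiableWithinAt

theorem differentiableOn_continuation :
    DifferentiableOn ℂ (continuation p u cm cp) (domain p u cm cp) := by
  have := differentiableOn_branch h hc
  unfold continuation cubicNum
  fun_prop

theorem branch_ofReal {V : ℝ} (h1 : cm < V) (h2 : V < cp) (hV : V ≠ 0) (h0 : invY p u V ≠ 0)
    (hd : (((invY p u V)⁻¹ : ℝ) : ℂ) ∈ domain p u cm cp) :
    branch p u cm cp ((invY p u V)⁻¹ : ℝ) = V :=
  ((branch_spec h hc hd).2.2.2 _ (ofReal_mem_region hc h1 h2)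
    ((isRoot_ofReal h (h2.le.trans hc.le_rad) (inv_ne_zero h0)).2
      ⟨hV, inv_mul_cancel₀ h0⟩)).symm

end Branch

/-! ### Singularities at the critical values -/

/-- If a bounded function is a quotient of analytic functions on a dense set, then it extends
analytically. -/
theorem exists_differentiableAt_of_mul_eq {m d β : ℂ → ℂ} {c : ℂ} {Ω : Set ℂ} {R : ℝ}
    (hm : AnalyticAt ℂ m c) (hd : AnalyticAt ℂ d c) (hd0 : ∀ᶠ z in 𝓝[≠] c, d z ≠ 0)
    (hΩ : Dense Ω) (hc : c ∉ Ω) (hβ : ∀ᶠ z in 𝓝[Ω] c, ‖β z‖ ≤ R ∧ β z * d z = m z) :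
    ∃ W : ℂ → ℂ, DifferentiableAt ℂ W c ∧ ∀ᶠ z in 𝓝[Ω] c, W z = β z := by
  rw [eventually_nhdsWithin_iff] at hd0 hβ
  obtain ⟨ε, hε, hB⟩ := Metric.eventually_nhds_iff_ball.1 (hd0.and (hβ.and
    (hm.eventually_analyticAt.and hd.eventually_analyticAt)))
  set B := Metric.ball c ε
  have hBc : B ∈ 𝓝 c := Metric.ball_mem_nhds c hε
  have hle : ∀ z ∈ B, ‖m z‖ ≤ R * ‖d z‖ := by
    intro z hz
    refine ContinuousWithinAt.closure_le (s := B ∩ Ω)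
      (hΩ.open_subset_closure_inter Metric.isOpen_ball hz)
      (hB z hz).2.2.1.continuousAt.norm.continuousWithinAt
      ((hB z hz).2.2.2.continuousAt.norm.const_mul R).continuousWithinAt ?_
    rintro y ⟨hy, hyΩ⟩
    obtain ⟨h1, h2⟩ := (hB y hy).2.1 hyΩ
    rw [← h2, norm_mul]
    exact mul_le_mul_of_nonneg_right h1 (norm_nonneg _)
  refine ⟨Function.update (fun z => m z / d z) c (limUnder (𝓝[≠] c) fun z => m z / d z), ?_, ?_⟩
  · refine (Complex.differentiableOn_update_limUnder_of_bddAbove hBc ?_ ?_).differentiableAt hBc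
    · rintro z ⟨hz, hzc⟩
      exact ((hB z hz).2.2.1.differentiableAt.div (hB z hz).2.2.2.differentiableAt
        ((hB z hz).1 hzc)).differentiableWithinAt
    · refine ⟨R, ?_⟩
      rintro _ ⟨z, ⟨hz, hzc⟩, rfl⟩
      rw [Function.comp_apply, norm_div]
      exact (div_le_iff₀ (norm_pos_iff.2 ((hB z hz).1 hzc))).2 (hle z hz)
  · filter_upwards [mem_nhdsWithin_of_mem_nhds hBc, self_mem_nhdsWithin] with z hz hzΩ
    have hzc : z ≠ c := fun h0 => hc (h0 ▸ hzΩ)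
    rw [Function.update_of_ne hzc, div_eq_iff ((hB z hz).1 hzc)]
    exact ((hB z hz).2.1 hzΩ).2.symm

section Singular

variable {p u cm cp : ℝ} (h : Subcritical p u) (hc : IsCritPair p u cm cp)
include h hc

omit h hc in
theorem dense_domain : Dense (domain p u cm cp) :=
  ((dense_compl_singleton (0 : ℝ)).preimage Complex.isOpenMap_im).mono
    fun _ hz => mem_domain_of_im_ne_zero hz

/-- The value of `ŷ` at a critical point of `V ↦ ŷ(p, u, V)` is a singularity: an analytic
continuation would yield an analytic function `W` with `W (ŷ(p, u, V)) = V` on one side of the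
critical point, while the left-hand side has derivative zero there. -/
theorem isSingularAt_of_gap_eq_zero {c α β : ℝ} (hαβ : α < β) (hcl : c ∈ closure (Set.Ioo α β))
    (hcR : c ≤ rad u) (hc0 : c ≠ 0) (hgap : gap p u c = 0) (hinv : invY p u c ≠ 0)
    (hnot : (((invY p u c)⁻¹ : ℝ) : ℂ) ∉ domain p u cm cp)
    (hs : ∀ V ∈ Set.Ioo α β, branch p u cm cp ((invY p u V)⁻¹ : ℝ) = V ∧
      (((invY p u V)⁻¹ : ℝ) : ℂ) ∈ domain p u cm cp) :
    IsSingularAt (continuation p u cm cp) (domain p u cm cp) (((invY p u c)⁻¹ : ℝ) : ℂ) := by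
  rintro ⟨g, hg, heq⟩
  set Ω := domain p u cm cp
  set z₀ : ℂ := (((invY p u c)⁻¹ : ℝ) : ℂ) with hz₀
  have hκ : (4 * u * (1 - u) * (1 - 2 * u) : ℂ) ≠ 0 := by
    have h1 : 0 < 4 * u * (1 - u) * (1 - 2 * u) := by
      have := h.u_pos
      exact mul_pos (mul_pos (by positivity) (by linarith [h.u_lt_half])) (by linarith [h.u_lt_half])
    have h2 : ((4 * u * (1 - u) * (1 - 2 * u) : ℝ) : ℂ) ≠ 0 := Complex.ofReal_ne_zero.2 h1.ne'
    push_cast at h2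
    exact h2
  set κ : ℂ := 4 * u * (1 - u) * (1 - 2 * u) with hκdef
  have hne : (𝓝[Ω] z₀).NeBot := mem_closure_iff_nhdsWithin_neBot.1 (dense_domain z₀)
  -- Dividing the cubic equation `κ T = cubicNum p u V` by the quadratic relation
  -- `κ y T / 2 = V (2 - 4 u - V)` yields `V` as the quotient `m / d` of analytic functions.
  set d : ℂ → ℂ := fun y => κ / 2 * y * g y - 2 * u * (1 - u) with hd
  set m : ℂ → ℂ := fun y => κ * g y - κ * p - 2 * u * (κ / 2 * y * g y) with hm
  have hda : AnalyticAt ℂ d z₀ := by fun_prop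
  have hma : AnalyticAt ℂ m z₀ := by fun_prop
  have hmul : ∀ᶠ y in 𝓝[Ω] z₀, ‖branch p u cm cp y‖ ≤ rad u ∧ branch p u cm cp y * d y = m y := by
    filter_upwards [heq, self_mem_nhdsWithin] with y hy hyΩ
    obtain ⟨hV, hr, -, -⟩ := branch_spec h hc hyΩ
    refine ⟨hV.1.le, ?_⟩
    rw [continuation, eq_div_iff hκ] at hy
    rw [IsRoot, ← hy] at hr
    set V := branch p u cm cp y
    have h1 : κ / 2 * y * g y = V * (2 - 4 * u - V) := by linear_combination hr / 2
    simp only [hd, hm]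
    rw [h1]
    rw [cubicNum] at hy
    linear_combination -hy - p * hκdef
  have hd0 : ∀ᶠ z in 𝓝[≠] z₀, d z ≠ 0 := by
    refine hda.eventually_eq_zero_or_eventually_ne_zero.resolve_left fun h0 => ?_
    -- otherwise `y` would be constant
    have ha : (4 * u * (1 - u) : ℂ) ≠ 0 := left_ne_zero_of_mul hκ
    have hconst : ∀ᶠ y in 𝓝[Ω] z₀, y * (κ * p + 4 * u * (u * (1 - u))) = 4 * u * (1 - u) := by
      filter_upwards [mem_nhdsWithin_of_mem_nhds h0, hmul] with y hy hy'
      have hy₂ := hy'.2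
      rw [hy, mul_zero] at hy₂
      simp only [hd, hm] at hy hy₂
      linear_combination y * hy₂ + (2 - 2 * u * y) * hy
    have hlim : z₀ * (κ * p + 4 * u * (u * (1 - u))) = 4 * u * (1 - u) :=
      tendsto_nhds_unique ((tendsto_nhdsWithin_of_tendsto_nhds tendsto_id).mul_const _)
        (tendsto_const_nhds.congr' (hconst.mono fun _ hy => hy.symm))
    obtain ⟨y, hy, hyΩ⟩ := (hconst.and self_mem_nhdsWithin).exists
    have hC : κ * p + 4 * u * (u * (1 - u)) ≠ 0 := fun h0 => ha (by rw [← hlim, h0, mul_zero])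
    exact hnot (mul_right_cancel₀ hC (hy.trans hlim.symm) ▸ hyΩ)
  obtain ⟨W, hW, hWβ⟩ := exists_differentiableAt_of_mul_eq hma hda hd0 dense_domain hnot hmul
  -- `V ↦ ŷ(p, u, V)` on the real line
  set φ : ℝ → ℂ := fun V => (((invY p u V)⁻¹ : ℝ) : ℂ) with hφ
  have hφd : HasDerivAt φ 0 c := by
    have h1 := (hasDerivAt_invY (p := p) (u := u) hc0 (h.sub_pos_of_le hcR).ne').inv hinv
    rw [hgap, zero_div, neg_zero, neg_zero, zero_div] at h1
    exact_mod_cast h1.ofReal_comp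
  have hWφ : HasDerivAt (fun V => W (φ V)) 0 c := by
    have := (hW.hasDerivAt (x := z₀)).comp c hφd
    rwa [mul_zero] at this
  have hev : ∀ᶠ V in 𝓝[Set.Ioo α β] c, W (φ V) = (V : ℂ) := by
    have ht : Tendsto φ (𝓝[Set.Ioo α β] c) (𝓝[Ω] z₀) :=
      tendsto_nhdsWithin_iff.2 ⟨hφd.continuousAt.tendsto.mono_left nhdsWithin_le_nhds,
        eventually_nhdsWithin_of_forall fun V hV => (hs V hV).2⟩
    filter_upwards [ht.eventually hWβ, self_mem_nhdsWithin] with V h1 hV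
    rw [h1]
    exact (hs V hV).1
  have hne' : (𝓝[Set.Ioo α β] c).NeBot := mem_closure_iff_nhdsWithin_neBot.1 hcl
  have hval : W (φ c) = (c : ℂ) :=
    tendsto_nhds_unique (hWφ.continuousAt.tendsto.mono_left nhdsWithin_le_nhds)
      ((Complex.continuous_ofReal.continuousAt.tendsto.mono_left nhdsWithin_le_nhds).congr'
        (hev.mono fun _ hV => hV.symm))
  have hone : HasDerivWithinAt (fun V => W (φ V)) 1 (Set.Ioo α β) c :=
    ((hasDerivAt_id c).ofReal_comp.hasDerivWithinAt.congr_deriv Complex.ofReal_one).congr_of_eventuallyEq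
      hev hval
  have huniq : UniqueDiffWithinAt ℝ (Set.Ioo α β) c := by
    refine uniqueDiffWithinAt_convex (convex_Ioo α β) ?_ hcl
    rw [interior_Ioo]
    exact Set.nonempty_Ioo.2 hαβ
  exact zero_ne_one (huniq.eq_deriv _ hWφ.hasDerivWithinAt hone)

theorem isSingularAt_yPlus : IsSingularAt (continuation p u cm cp) (domain p u cm cp)
    (((invY p u cp)⁻¹ : ℝ) : ℂ) := by
  have hp := invY_cp_pos h hc
  have h0 := hc.cp_pos
  refine isSingularAt_of_gap_eq_zero h hc (α := 0) (β := cp) h0 ?_ hc.le_rad h0.ne' hc.gap_cp hp.ne'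
    ?_ fun V hV => ?_
  · rw [closure_Ioo h0.ne]
    exact ⟨h0.le, le_rfl⟩
  · rw [ofReal_mem_domain h hc]
    intro hn
    have := hn.1 (inv_pos.2 hp)
    rw [inv_mul_cancel₀ hp.ne'] at this
    exact this.false
  · have h1 := hc.invY_lt_invY h hV.1 hV.2 le_rfl
    have h2 := hp.trans h1
    have h3 : (((invY p u V)⁻¹ : ℝ) : ℂ) ∈ domain p u cm cp := by
      rw [ofReal_mem_domain h hc]
      refine ⟨fun _ => ?_, fun hn => absurd hn (inv_pos.2 h2).not_gt⟩
      rw [inv_mul_lt_iff₀ h2, mul_one]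
      exact h1
    exact ⟨branch_ofReal h hc (hc.cm_neg.trans hV.1) hV.2 hV.1.ne' h2.ne' h3, h3⟩

theorem isSingularAt_yMinus (hm : invY p u cm < 0) :
    IsSingularAt (continuation p u cm cp) (domain p u cm cp) (((invY p u cm)⁻¹ : ℝ) : ℂ) := by
  have h0 := hc.cm_neg
  refine isSingularAt_of_gap_eq_zero h hc (α := cm) (β := 0) h0 ?_ (h0.le.trans h.rad_pos.le) h0.ne
    hc.gap_cm hm.ne ?_ fun V hV => ?_
  · rw [closure_Ioo h0.ne]
    exact ⟨le_rfl, h0.le⟩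
  · rw [ofReal_mem_domain h hc]
    intro hn
    have := hn.2 (inv_lt_zero.2 hm)
    rw [inv_mul_cancel₀ hm.ne] at this
    exact this.false
  · have h1 := hc.invY_lt_invY_of_neg h le_rfl hV.1 hV.2
    have h2 := h1.trans hm
    have h3 : (((invY p u V)⁻¹ : ℝ) : ℂ) ∈ domain p u cm cp := by
      rw [ofReal_mem_domain h hc]
      refine ⟨fun hn => absurd hn (inv_lt_zero.2 h2).not_gt, fun _ => ?_⟩
      rw [inv_mul_eq_div, div_lt_one_of_neg h2]
      exact h1
    exact ⟨branch_ofReal h hc hV.1 (hV.2.trans hc.cp_pos) hV.2.ne h2.ne h3, h3⟩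

end Singular

/-! ### Evaluation of the coefficients at real numbers -/

section Evaluation

/-- `u (1 - u) (1 - 2 u) = 2 x` has a solution between `0` and the critical value `(3 - √3) / 6`. -/
theorem exists_solution {x : ℝ} (hx : 0 ≤ x) (hx' : x ≤ √3 / 36) :
    ∃ u : ℝ, 0 ≤ u ∧ u < 1 / 2 ∧ 6 * (u * (1 - u)) ≤ 1 ∧ u * (1 - u) * (1 - 2 * u) = 2 * x := by
  have h3 : √3 ^ 2 = 3 := Real.sq_sqrt (by norm_num)
  have hpos : 0 < √3 := Real.sqrt_pos.2 (by norm_num)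
  have hlt : √3 < 3 := by nlinarith
  obtain ⟨u, ⟨h0, h1⟩, hu⟩ := intermediate_value_Icc (a := (0 : ℝ)) (b := (3 - √3) / 6) (by linarith)
    (f := fun u : ℝ => u * (1 - u) * (1 - 2 * u)) (by fun_prop) (show 2 * x ∈ Set.Icc _ _ by
      refine ⟨by simpa using hx, ?_⟩
      have : (3 - √3) / 6 * (1 - (3 - √3) / 6) * (1 - 2 * ((3 - √3) / 6)) = √3 / 18 := by
        linear_combination -(√3 / 108) * h3
      rw [this]
      linarith)
  refine ⟨u, h0, by linarith, ?_, hu⟩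
  nlinarith

/-- The substitution of a real number for `p`. -/
def specialize (p : ℝ) : PowerSeries (Polynomial ℚ) →+* PowerSeries ℝ :=
  PowerSeries.map (Polynomial.aeval p : Polynomial ℚ →ₐ[ℚ] ℝ).toRingHom

theorem coeff_specialize (p : ℝ) (F : PowerSeries (Polynomial ℚ)) (n : ℕ) :
    PowerSeries.coeff n (specialize p F) = Polynomial.aeval p (PowerSeries.coeff n F) := by
  rw [specialize, PowerSeries.coeff_map]
  rfl

theorem specialize_X (p : ℝ) : specialize p PowerSeries.X = PowerSeries.X := PowerSeries.map_X _

theorem specialize_C_X (p : ℝ) : specialize p (PowerSeries.C Polynomial.X) = PowerSeries.C p := by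
  rw [specialize, PowerSeries.map_C]
  exact congrArg _ (Polynomial.aeval_X p)

variable {U : PowerSeries ℚ}

/-- The values of `P = 1 / (1 - U)` and `Q = 1 / (1 - 2 U)` at `x`, up to the critical value. -/
theorem IsSeriesU.exists_real_value (hU : IsSeriesU U) (p : ℝ) {x : ℝ} (hx : 0 < x)
    (hx' : x ≤ √3 / 36) : ∃ (h₁ : specialize p (inclX U) ∈ absRing x)
      (_ : specialize p (inclX (1 - 2 * U)⁻¹) ∈ absRing x),
      0 < absEval x ⟨_, h₁⟩ ∧ absEval x ⟨_, h₁⟩ < 1 / 2 ∧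
      6 * (absEval x ⟨_, h₁⟩ * (1 - absEval x ⟨_, h₁⟩)) ≤ 1 := by
  obtain ⟨u, hu0, hu1, hu2, hu⟩ := exists_solution hx.le hx'
  obtain ⟨P, hP⟩ : ∃ P, P = specialize p (inclX (1 - U)⁻¹) := ⟨_, rfl⟩
  obtain ⟨Q, hQ⟩ : ∃ Q, Q = specialize p (inclX (1 - 2 * U)⁻¹) := ⟨_, rfl⟩
  obtain ⟨w, hw⟩ : ∃ w, w = specialize p (inclX U) := ⟨_, rfl⟩
  have hPw : P * (1 - w) = 1 := by
    have h1 : (1 - U)⁻¹ * (1 - U) = 1 := by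
      refine PowerSeries.inv_mul_cancel _ ?_
      rw [map_sub, hU.1]
      simp
    have := congrArg (fun F => specialize p (inclX F)) h1
    simp only [map_mul, map_sub, map_one] at this
    rw [hP, hw]
    exact this
  have hQw : (1 - 2 * w) * Q = 1 := by
    have := congrArg (specialize p) hU.inclX_mul_inv
    simp only [map_mul, map_sub, map_one, map_ofNat] at this
    rw [hQ, hw]
    exact this
  have hXw : 2 * PowerSeries.X = w * (1 - w) * (1 - 2 * w) := by
    have := congrArg (specialize p) hU.inclX_eq
    simp only [map_mul, map_sub, map_one, map_ofNat, specialize_X] at this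
    rw [hw]
    exact this
  -- The system for `P = 1 / (1 - U)` and `Q = 1 / (1 - 2 U)` has nonnegative coefficients.
  have hwPQ : w = PowerSeries.C 2 * (PowerSeries.X * (P * Q)) := by
    rw [show PowerSeries.C (2 : ℝ) = 2 from map_ofNat _ 2]
    linear_combination (-(P * Q)) * hXw - w * (1 - 2 * w) * Q * hPw - w * hQw
  have hPeq : P = 1 + PowerSeries.C 2 * (PowerSeries.X * (P * P * Q)) := by
    linear_combination hPw + P * hwPQ
  have hQeq : Q = 1 + PowerSeries.C 4 * (PowerSeries.X * (P * Q * Q)) := by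
    have h4 : PowerSeries.C (4 : ℝ) = 2 * PowerSeries.C 2 := by
      rw [← map_ofNat PowerSeries.C 2, ← map_mul]
      norm_num
    rw [h4]
    linear_combination hQw + 2 * Q * hwPQ
  have h1u : 0 < 1 - u := by linarith
  have h2u : 0 < 1 - 2 * u := by linarith
  have hu' : 2 * x * ((1 - u)⁻¹ * (1 - 2 * u)⁻¹) = u := by
    rw [← hu]
    calc _ = u * ((1 - u) * (1 - u)⁻¹) * ((1 - 2 * u) * (1 - 2 * u)⁻¹) := by ring
      _ = u := by rw [mul_inv_cancel₀ h1u.ne', mul_inv_cancel₀ h2u.ne', mul_one, mul_one]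
  have hle := partialSum_le hPeq hQeq hx.le (a := (1 - u)⁻¹) (b := (1 - 2 * u)⁻¹) (by positivity)
    (by positivity) (le_of_eq (by
      have : (1 - u) * (1 - u)⁻¹ = 1 := mul_inv_cancel₀ h1u.ne'
      linear_combination (1 - u)⁻¹ * hu' - this)) (le_of_eq (by
      have : (1 - 2 * u) * (1 - 2 * u)⁻¹ = 1 := mul_inv_cancel₀ h2u.ne'
      linear_combination 2 * (1 - 2 * u)⁻¹ * hu' - this))
  have hPa : P ∈ absRing x :=
    isAbsSummable_of_partialSum_le hx.le (fun n => (hle n).1.1) fun n => (hle n).2.1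
  have hQa : Q ∈ absRing x :=
    isAbsSummable_of_partialSum_le hx.le (fun n => (hle n).1.2) fun n => (hle n).2.2
  have hwa : w ∈ absRing x := by
    rw [hwPQ]
    exact mul_mem (isAbsSummable_C x 2) (mul_mem (isAbsSummable_X x) (mul_mem hPa hQa))
  have hval : absEval x ⟨w, hwa⟩ = 2 * (x * (absEval x ⟨P, hPa⟩ * absEval x ⟨Q, hQa⟩)) := by
    have : (⟨w, hwa⟩ : absRing x) = ⟨_, isAbsSummable_C x 2⟩ * (⟨_, isAbsSummable_X x⟩ *
        (⟨P, hPa⟩ * ⟨Q, hQa⟩)) := Subtype.ext hwPQ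
    rw [this, map_mul, map_mul, map_mul, absEval_C, absEval_X]
  have hP0 := absEval_nonneg hPa hx.le fun n => (hle n).1.1
  have hQ0 := absEval_nonneg hQa hx.le fun n => (hle n).1.2
  have hP1 := absEval_le hPa fun n => (hle n).2.1
  have hQ1 := absEval_le hQa fun n => (hle n).2.2
  have hcub : 2 * x = absEval x ⟨w, hwa⟩ * (1 - absEval x ⟨w, hwa⟩) * (1 - 2 * absEval x ⟨w, hwa⟩) := by
    have h1 : 2 * (⟨_, isAbsSummable_X x⟩ : absRing x) =
        ⟨w, hwa⟩ * (1 - ⟨w, hwa⟩) * (1 - 2 * ⟨w, hwa⟩) := Subtype.ext hXw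
    have h2 := congrArg (absEval x) h1
    simp only [map_mul, map_sub, map_one, map_ofNat, absEval_X] at h2
    exact h2
  -- The value is a root of the equation of `u` and bounded by `u`, hence subcritical.
  have hwu : absEval x ⟨w, hwa⟩ ≤ u := by
    rw [hval, ← hu']
    have := mul_le_mul hP1 hQ1 hQ0 (by positivity)
    nlinarith
  have hw0 : 0 ≤ absEval x ⟨w, hwa⟩ := by
    rw [hval]
    positivity
  have hw0' : absEval x ⟨w, hwa⟩ ≠ 0 := fun h0 => by
    rw [h0] at hcub
    linarith
  subst hw hQ
  exact ⟨hwa, hQa, hw0.lt_of_ne' hw0', by linarith, by nlinarith⟩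

/-- The evaluation at `p` and `x` of the coefficients of `V`. -/
theorem IsSeriesU.exists_evaluation (hU : IsSeriesU U) {p : ℝ} (hp : 0 < p) (hp' : p ≤ 1) {x : ℝ}
    (hx : 0 < x) (hx' : x ≤ √3 / 36) : ∃ (u : ℝ) (ev : coeffRing U →+* ℝ), Subcritical p u ∧
      (∀ F : coeffRing U, HasSum (fun n => Polynomial.aeval p (PowerSeries.coeff n F.1) * x ^ n)
        (ev F)) ∧
      (∀ F : coeffRing U, F.1 = PowerSeries.C Polynomial.X → ev F = p) ∧
      ∀ F : coeffRing U, F.1 = inclX U → ev F = u := by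
  obtain ⟨h₁, h₂, hu0, hu1, hu2⟩ := hU.exists_real_value p hx hx'
  have hmem : ∀ F ∈ coeffRing U, specialize p F ∈ absRing x := by
    intro F hF
    induction hF using Algebra.adjoin_induction with
    | mem F hF =>
      rcases hF with rfl | rfl | rfl
      · rw [specialize_C_X]
        exact isAbsSummable_C x p
      · exact h₁
      · exact h₂
    | algebraMap r =>
      refine isAbsSummable_of_coeff_eq_zero (N := 1) fun n hn => ?_
      rw [coeff_specialize, PowerSeries.algebraMap_apply, PowerSeries.coeff_C, if_neg (by omega),
        map_zero]
    | add F G _ _ hF hG =>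
      rw [map_add]
      exact add_mem hF hG
    | mul F G _ _ hF hG =>
      rw [map_mul]
      exact mul_mem hF hG
  refine ⟨_, (absEval x).comp (((specialize p).comp (coeffRing U).val.toRingHom).codRestrict
    (absRing x) fun F => hmem F.1 F.2), ⟨hp, hp', hu0, hu1, hu2⟩, fun F => ?_, fun F hF => ?_,
    fun F hF => ?_⟩
  · have h := hasSum_absEval ⟨_, hmem F.1 F.2⟩
    simp only [coeff_specialize] at h
    exact h
  · refine Eq.trans (congrArg (absEval x) (Subtype.ext ?_)) (absEval_C x p)
    exact (congrArg (specialize p) hF).trans (specialize_C_X p)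
  · refine congrArg (absEval x) (Subtype.ext ?_)
    exact congrArg (specialize p) hF

/-- The equations of `V` and `T(p, t, t y)` as power series in `y`, at real `p` and `x`. -/
theorem IsSeriesU.exists_real_series (hU : IsSeriesU U) {S : SeriesRing} {p : ℝ} (hp : 0 < p)
    (hp' : p ≤ 1) {x : ℝ} (hx : 0 < x) (hx' : x ≤ √3 / 36)
    (hS : rescaledSeries = substCube S) :
    ∃ (u : ℝ) (v s : PowerSeries ℝ), Subcritical p u ∧ PowerSeries.X ∣ v ∧
      PowerSeries.X * cubicNum (PowerSeries.C p) (PowerSeries.C u) v =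
        2 * v * (2 - 4 * PowerSeries.C u - v) ∧
      cubicNum (PowerSeries.C p) (PowerSeries.C u) v =
        4 * PowerSeries.C u * (1 - PowerSeries.C u) * (1 - 2 * PowerSeries.C u) * s ∧
      ∀ k, HasSum (fun n => Polynomial.aeval p (PowerSeries.coeff n (PowerSeries.coeff k S)) * x ^ n)
        (PowerSeries.coeff k s) := by
  obtain ⟨u, ev, hsub, hev, hevp, hevu⟩ := hU.exists_evaluation hp hp' hx hx'
  have hx2 : 2 * algebraMap ℚ (coeffRing U) (1 / 2) = 1 := by
    rw [mul_comm]
    exact algebraMap_inv_mul 2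
  have h4 : algebraMap ℚ (coeffRing U) (1 / 4) * 4 = 1 := algebraMap_inv_mul 4
  have h8 : algebraMap ℚ (PowerSeries (coeffRing U)) (1 / 8) * 8 = 1 := algebraMap_inv_mul 8
  -- the equation of `Z = V / x` is solved in the ring of power series over `coeffRing U`
  obtain ⟨pA, hpA⟩ : ∃ F : coeffRing U, F.1 = PowerSeries.C Polynomial.X :=
    ⟨⟨_, Algebra.subset_adjoin (Or.inl rfl)⟩, rfl⟩
  obtain ⟨uA, huA⟩ : ∃ F : coeffRing U, F.1 = inclX U :=
    ⟨⟨_, Algebra.subset_adjoin (Or.inr (Or.inl rfl))⟩, rfl⟩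
  obtain ⟨qA, hqA⟩ : ∃ F : coeffRing U, F.1 = inclX (1 - 2 * U)⁻¹ :=
    ⟨⟨_, Algebra.subset_adjoin (Or.inr (Or.inr rfl))⟩, rfl⟩
  obtain ⟨xA, hxA⟩ : ∃ F : coeffRing U, 2 * F = uA * (1 - uA) * (1 - 2 * uA) :=
    ⟨algebraMap ℚ _ (1 / 2) * (uA * (1 - uA) * (1 - 2 * uA)), by rw [← mul_assoc, hx2, one_mul]⟩
  have hxA' : xA.1 = PowerSeries.X := by
    have h1 := congrArg Subtype.val hxA
    have h2 : (2 : PowerSeries (Polynomial ℚ)) * xA.1 =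
        uA.1 * (1 - uA.1) * (1 - 2 * uA.1) := h1
    rw [huA, ← hU.inclX_eq] at h2
    have := algebraRat.charZero (PowerSeries (Polynomial ℚ))
    exact mul_left_cancel₀ two_ne_zero h2
  have hq : (1 - 2 * uA) * qA = 1 := Subtype.ext (by
    have h1 := hU.inclX_mul_inv
    rw [← huA, ← hqA] at h1
    exact h1)
  have hunit : IsUnit (4 * (1 - 2 * uA)) :=
    IsUnit.of_mul_eq_one (algebraMap ℚ _ (1 / 4) * qA) (by
      linear_combination h4 + 4 * algebraMap ℚ (coeffRing U) (1 / 4) * hq)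
  obtain ⟨Z, ⟨hZX, hZ⟩, -⟩ := existsUnique_scaled_cubic hunit (2 * xA) 0
    ![8 * pA, 2 * uA * (1 - 3 * uA), 2 * (1 - 3 * uA) * xA, -xA ^ 2]
  simp only [cubic, Matrix.cons_val, map_mul, map_sub, map_ofNat, map_one, map_zero, map_neg,
    map_pow] at hZ
  set S' : PowerSeries (coeffRing U) := PowerSeries.C pA + algebraMap ℚ _ (1 / 8) *
    (2 * PowerSeries.C uA * (1 - 3 * PowerSeries.C uA) * Z +
      2 * (1 - 3 * PowerSeries.C uA) * PowerSeries.C xA * Z ^ 2 - PowerSeries.C xA ^ 2 * Z ^ 3)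
    with hS'
  set φ : PowerSeries (coeffRing U) →+* SeriesRing := PowerSeries.map (coeffRing U).val.toRingHom
    with hφ
  have hφp : φ (PowerSeries.C pA) = pVar := (PowerSeries.map_C _ _).trans (congrArg _ hpA)
  have hφu : φ (PowerSeries.C uA) = PowerSeries.C (inclX U) :=
    (PowerSeries.map_C _ _).trans (congrArg _ huA)
  have hφx : φ (PowerSeries.C xA) = xVar := (PowerSeries.map_C _ _).trans (congrArg _ hxA')
  have hφX : φ PowerSeries.X = yVar := PowerSeries.map_X _
  have hV : IsSeriesV U (xVar * φ Z) := by
    rw [hU.isSeriesV_iff]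
    refine ⟨Dvd.dvd.mul_left ?_ _, ?_⟩
    · have := map_dvd φ hZX
      rwa [hφX] at this
    · have h1 := congrArg φ hZ
      simp only [map_mul, map_sub, map_add, map_ofNat, map_one, map_zero, map_neg, map_pow, hφp,
        hφu, hφx, hφX] at h1
      rw [numer]
      linear_combination -xVar * h1
  have hφS : φ S' = quot U (φ Z) := by
    have h1 : φ (algebraMap ℚ _ (1 / 8)) = algebraMap ℚ SeriesRing (1 / 8) := by
      have h2 := congrArg φ h8
      simp only [map_mul, map_ofNat, map_one] at h2
      have h3 : algebraMap ℚ SeriesRing (1 / 8) * 8 = 1 := algebraMap_inv_mul 8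
      have := algebraRat.charZero SeriesRing
      exact mul_right_cancel₀ (OfNat.ofNat_ne_zero 8) (h2.trans h3.symm)
    rw [hS', quot]
    simp only [map_mul, map_sub, map_add, map_ofNat, map_one, map_pow, hφp, hφu, hφx, h1]
  have hSq : S = φ S' := by
    refine PowerSeries.map_injective _ ?_ (hS.symm.trans ((hU.rescaledSeries_eq hV).trans
      (congrArg substCube hφS.symm)))
    intro F G hFG
    ext1 n
    have := congrArg (PowerSeries.coeff (3 * n)) hFG
    simpa [expandCube, PowerSeries.coeff_expand_mul] using this
  set e : PowerSeries (coeffRing U) →+* PowerSeries ℝ := PowerSeries.map ev with he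
  have hep : e (PowerSeries.C pA) = PowerSeries.C p :=
    (PowerSeries.map_C _ _).trans (congrArg _ (hevp _ hpA))
  have heu : e (PowerSeries.C uA) = PowerSeries.C u :=
    (PowerSeries.map_C _ _).trans (congrArg _ (hevu _ huA))
  have heX : e PowerSeries.X = PowerSeries.X := PowerSeries.map_X _
  have h1 := congrArg e hZ
  have h2 := congrArg (fun F => e (PowerSeries.C F)) hxA
  have h3 := congrArg e h8
  simp only [map_mul, map_sub, map_add, map_ofNat, map_one, map_zero, map_neg, map_pow, hep, heu,
    heX] at h1 h2 h3
  have hs : e S' = PowerSeries.C p + e (algebraMap ℚ _ (1 / 8)) *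
      (2 * PowerSeries.C u * (1 - 3 * PowerSeries.C u) * e Z + 2 * (1 - 3 * PowerSeries.C u) *
        e (PowerSeries.C xA) * e Z ^ 2 - e (PowerSeries.C xA) ^ 2 * e Z ^ 3) := by
    rw [hS']
    simp only [map_mul, map_sub, map_add, map_ofNat, map_one, map_pow, hep, heu]
  refine ⟨u, e (PowerSeries.C xA) * e Z, e S', hsub, Dvd.dvd.mul_left ?_ _, ?_, ?_, fun k => ?_⟩
  · have := map_dvd e hZX
    rwa [heX] at this
  · rw [cubicNum]
    linear_combination -e (PowerSeries.C xA) * h1 - 4 * PowerSeries.C p * PowerSeries.X * h2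
  · rw [hs, cubicNum]
    linear_combination -e (PowerSeries.C xA) * (2 * PowerSeries.C u * (1 - 3 * PowerSeries.C u) *
      e Z + 2 * (1 - 3 * PowerSeries.C u) * e (PowerSeries.C xA) * e Z ^ 2 -
      e (PowerSeries.C xA) ^ 2 * e Z ^ 3) * h3 + 4 * e (algebraMap ℚ _ (1 / 8)) *
      (2 * PowerSeries.C u * (1 - 3 * PowerSeries.C u) * e Z + 2 * (1 - 3 * PowerSeries.C u) *
      e (PowerSeries.C xA) * e Z ^ 2 - e (PowerSeries.C xA) ^ 2 * e Z ^ 3) * h2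
  · have h4 := hev (PowerSeries.coeff k S')
    rw [he, PowerSeries.coeff_map, hSq, hφ]
    simp only [PowerSeries.coeff_map]
    exact h4

end Evaluation

/-! ### Taylor series -/

section Taylor

/-- The functions which are analytic at `0`. -/
def analyticRing : Subring (ℂ → ℂ) where
  carrier := {f | AnalyticAt ℂ f 0}
  mul_mem' := AnalyticAt.mul
  one_mem' := analyticAt_const
  add_mem' := AnalyticAt.add
  zero_mem' := analyticAt_const
  neg_mem' := AnalyticAt.neg

/-- The Taylor series at `0`; it is multiplicative by the Leibniz formula. -/
def taylorHom : analyticRing →+* PowerSeries ℂ where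
  toFun f := PowerSeries.mk fun n => (n.factorial : ℂ)⁻¹ * iteratedDeriv n f.1 0
  map_one' := by
    ext n
    rw [PowerSeries.coeff_mk, PowerSeries.coeff_one]
    have : iteratedDeriv n (fun _ : ℂ => (1 : ℂ)) 0 = if n = 0 then 1 else 0 := iteratedDeriv_const
    refine (congrArg _ this).trans ?_
    split_ifs with h <;> simp [h]
  map_mul' f g := by
    ext n
    have hf : AnalyticAt ℂ f.1 0 := f.2
    have hg : AnalyticAt ℂ g.1 0 := g.2
    rw [PowerSeries.coeff_mk, PowerSeries.coeff_mul, Subring.coe_mul,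
      iteratedDeriv_mul hf.contDiffAt hg.contDiffAt, Finset.mul_sum,
      Finset.Nat.sum_antidiagonal_eq_sum_range_succ_mk]
    refine Finset.sum_congr rfl fun i hi => ?_
    rw [PowerSeries.coeff_mk, PowerSeries.coeff_mk,
      Nat.cast_choose _ (Nat.lt_succ_iff.1 (Finset.mem_range.1 hi))]
    have h1 : (n.factorial : ℂ) ≠ 0 := Nat.cast_ne_zero.2 n.factorial_ne_zero
    field_simp
  map_zero' := by
    ext n
    rw [PowerSeries.coeff_mk, map_zero]
    have : iteratedDeriv n (fun _ : ℂ => (0 : ℂ)) 0 = if n = 0 then 0 else 0 := iteratedDeriv_const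
    refine (congrArg _ this).trans ?_
    simp
  map_add' f g := by
    ext n
    have hf : AnalyticAt ℂ f.1 0 := f.2
    have hg : AnalyticAt ℂ g.1 0 := g.2
    rw [PowerSeries.coeff_mk, map_add, PowerSeries.coeff_mk, PowerSeries.coeff_mk, Subring.coe_add,
      iteratedDeriv_add hf.contDiffAt hg.contDiffAt, mul_add]

theorem coeff_taylorHom (f : analyticRing) (n : ℕ) :
    PowerSeries.coeff n (taylorHom f) = (n.factorial : ℂ)⁻¹ * iteratedDeriv n f.1 0 :=
  PowerSeries.coeff_mk n fun n => (n.factorial : ℂ)⁻¹ * iteratedDeriv n f.1 0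

theorem taylorHom_congr {f g : analyticRing} (h : f.1 =ᶠ[𝓝 0] g.1) :
    taylorHom f = taylorHom g := by
  ext n
  rw [coeff_taylorHom, coeff_taylorHom, h.iteratedDeriv_eq]

theorem taylorHom_const (c : ℂ) :
    taylorHom ⟨fun _ => c, analyticAt_const⟩ = PowerSeries.C c := by
  ext n
  rw [coeff_taylorHom, PowerSeries.coeff_C]
  refine (congrArg _ (iteratedDeriv_const (n := n) (c := c) (x := (0 : ℂ)))).trans ?_
  split_ifs with h <;> simp [h]

theorem taylorHom_id : taylorHom ⟨id, analyticAt_id⟩ = PowerSeries.X := by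
  ext n
  rw [coeff_taylorHom, PowerSeries.coeff_X]
  refine (congrArg _ (iteratedDeriv_id (n := n) (x := (0 : ℂ)))).trans ?_
  split_ifs with h1 h2 h3 <;> simp_all

end Taylor

/-! ### Taylor series of the continuation -/

section Identification

variable {p u cm cp : ℝ}

/-- The equation of `V` over `ℂ` has at most one solution without constant term. -/
theorem eq_of_cubicNum_eq {p u : ℂ} (hu : 1 - 2 * u ≠ 0) {v w : PowerSeries ℂ}
    (hv : PowerSeries.X ∣ v) (hw : PowerSeries.X ∣ w)
    (hv' : PowerSeries.X * cubicNum (PowerSeries.C p) (PowerSeries.C u) v =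
      2 * v * (2 - 4 * PowerSeries.C u - v))
    (hw' : PowerSeries.X * cubicNum (PowerSeries.C p) (PowerSeries.C u) w =
      2 * w * (2 - 4 * PowerSeries.C u - w)) : v = w := by
  have hunit : IsUnit (4 * (1 - 2 * u)) := (mul_ne_zero (OfNat.ofNat_ne_zero 4) hu).isUnit
  have key : ∀ h : PowerSeries ℂ, PowerSeries.X * cubicNum (PowerSeries.C p) (PowerSeries.C u) h =
      2 * h * (2 - 4 * PowerSeries.C u - h) → PowerSeries.C (4 * (1 - 2 * u)) * h =
      cubic 2 0 ![4 * p * u * (1 - u) * (1 - 2 * u), 2 * u * (1 - 3 * u), 2 * (1 - 3 * u), -1] h := by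
    intro h hh
    simp only [cubic, Matrix.cons_val, map_mul, map_sub, map_ofNat, map_one, map_zero, map_neg]
    rw [cubicNum] at hh
    linear_combination -hh
  exact (existsUnique_scaled_cubic hunit _ _ _).unique ⟨hv, key v hv'⟩ ⟨hw, key w hw'⟩

theorem zero_mem_domain (h : Subcritical p u) (hc : IsCritPair p u cm cp) :
    (0 : ℂ) ∈ domain p u cm cp := by
  rw [mem_domain_of_im_eq_zero h hc Complex.zero_im]
  exact ⟨fun h0 => absurd h0 (lt_irrefl _), fun h0 => absurd h0 (lt_irrefl _)⟩

theorem branch_zero (h : Subcritical p u) (hc : IsCritPair p u cm cp) :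
    branch p u cm cp 0 = 0 := by
  refine ((branch_spec h hc (zero_mem_domain h hc)).2.2.2 0 ?_ ?_).symm
  · exact_mod_cast ofReal_mem_region hc hc.cm_neg hc.cp_pos
  · simp [IsRoot]

/-- The Taylor series of the continuation is the formal solution. -/
theorem taylorCoeff_continuation (h : Subcritical p u) (hc : IsCritPair p u cm cp)
    {v s : PowerSeries ℝ} (hvX : PowerSeries.X ∣ v)
    (hv : PowerSeries.X * cubicNum (PowerSeries.C p) (PowerSeries.C u) v =
      2 * v * (2 - 4 * PowerSeries.C u - v))
    (hs : cubicNum (PowerSeries.C p) (PowerSeries.C u) v =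
      4 * PowerSeries.C u * (1 - PowerSeries.C u) * (1 - 2 * PowerSeries.C u) * s) (n : ℕ) :
    (n.factorial : ℂ)⁻¹ * iteratedDeriv n (continuation p u cm cp) 0 =
      ((PowerSeries.coeff n s : ℝ) : ℂ) := by
  have h0 := zero_mem_domain h hc
  have hopen := isOpen_domain h hc
  have hβ : AnalyticAt ℂ (branch p u cm cp) 0 :=
    (differentiableOn_branch h hc).analyticAt (hopen.mem_nhds h0)
  have hf : AnalyticAt ℂ (continuation p u cm cp) 0 :=
    (differentiableOn_continuation h hc).analyticAt (hopen.mem_nhds h0)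
  set β : analyticRing := ⟨_, hβ⟩ with hβdef
  set f : analyticRing := ⟨_, hf⟩ with hfdef
  set P : analyticRing := ⟨fun _ => (p : ℂ), analyticAt_const⟩ with hP
  set W : analyticRing := ⟨fun _ => (u : ℂ), analyticAt_const⟩ with hW
  set Y : analyticRing := ⟨id, analyticAt_id⟩ with hY
  have hTP : taylorHom P = PowerSeries.C (p : ℂ) := taylorHom_const _
  have hTW : taylorHom W = PowerSeries.C (u : ℂ) := taylorHom_const _
  have hTY : taylorHom Y = PowerSeries.X := taylorHom_id
  have hu2 : (1 - 2 * u : ℂ) ≠ 0 := by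
    have : 1 - 2 * u ≠ 0 := by linarith [h.u_lt_half]
    exact_mod_cast this
  have hκ : (4 * u * (1 - u) * (1 - 2 * u) : ℂ) ≠ 0 := by
    have h1 : (4 * u * (1 - u) : ℂ) ≠ 0 := by
      have : 4 * u * (1 - u) ≠ 0 := by nlinarith [h.a_pos]
      exact_mod_cast this
    exact mul_ne_zero h1 hu2
  -- the equations satisfied by the Taylor series
  have h1 : PowerSeries.X * cubicNum (PowerSeries.C (p : ℂ)) (PowerSeries.C (u : ℂ)) (taylorHom β) =
      2 * taylorHom β * (2 - 4 * PowerSeries.C (u : ℂ) - taylorHom β) := by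
    rw [← hTP, ← hTW, ← hTY, ← map_cubicNum, ← map_mul, ← map_ofNat taylorHom 2, ← map_ofNat taylorHom 4,
      ← map_mul, ← map_mul, ← map_sub, ← map_sub, ← map_mul]
    refine taylorHom_congr ?_
    filter_upwards [hopen.mem_nhds h0] with y hy
    exact (branch_spec h hc hy).2.1
  have h2 : cubicNum (PowerSeries.C (p : ℂ)) (PowerSeries.C (u : ℂ)) (taylorHom β) =
      PowerSeries.C (4 * u * (1 - u) * (1 - 2 * u) : ℂ) * taylorHom f := by
    rw [← hTP, ← hTW, ← map_cubicNum, ← taylorHom_const, ← map_mul]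
    refine taylorHom_congr (Eventually.of_forall fun y => ?_)
    exact (mul_div_cancel₀ _ hκ).symm
  have hX : PowerSeries.X ∣ taylorHom β := by
    rw [PowerSeries.X_dvd_iff, ← PowerSeries.coeff_zero_eq_constantCoeff_apply, coeff_taylorHom,
      iteratedDeriv_zero]
    exact (congrArg _ (branch_zero h hc)).trans (mul_zero _)
  -- the equations satisfied by the formal series
  set ι : PowerSeries ℝ →+* PowerSeries ℂ := PowerSeries.map Complex.ofRealHom with hι
  have hιC : ∀ a : ℝ, ι (PowerSeries.C a) = PowerSeries.C (a : ℂ) := fun a => PowerSeries.map_C _ _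
  have hιX : ι PowerSeries.X = PowerSeries.X := PowerSeries.map_X _
  have h3 := congrArg ι hv
  have h4 := congrArg ι hs
  simp only [map_mul, map_sub, map_ofNat, map_one, hιC, hιX, map_cubicNum] at h3 h4
  have hvX' : PowerSeries.X ∣ ι v := by
    have := map_dvd ι hvX
    rwa [hιX] at this
  have hvβ := eq_of_cubicNum_eq hu2 hX hvX' h1 h3
  rw [← hvβ, h2] at h4
  have h5 : taylorHom f = ι s := by
    refine mul_left_cancel₀ (a := PowerSeries.C (4 * u * (1 - u) * (1 - 2 * u) : ℂ))
      (fun h0 => hκ (PowerSeries.C_injective (h0.trans (map_zero _).symm))) (h4.trans ?_)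
    simp only [map_mul, map_sub, map_ofNat, map_one]
  have h6 := congrArg (PowerSeries.coeff n) h5
  rw [coeff_taylorHom, hι, PowerSeries.coeff_map] at h6
  exact h6

end Identification

/-! ### Radius of convergence -/

section Radius

variable {p u cm cp : ℝ} (h : Subcritical p u) (hc : IsCritPair p u cm cp)
include h hc

/-- The slits lie on half-lines that point away from `0`. -/
theorem starConvex_domain : StarConvex ℝ 0 (domain p u cm cp) := by
  rw [starConvex_zero_iff]
  intro z hz s hs0 hs1
  rcases hs0.eq_or_lt with rfl | hs
  · rw [zero_smul]
    exact zero_mem_domain h hc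
  by_cases him : z.im = 0
  · rw [mem_domain_of_im_eq_zero h hc him] at hz
    rw [mem_domain_of_im_eq_zero h hc (by rw [Complex.smul_im, him, smul_zero]), Complex.smul_re,
      smul_eq_mul]
    have key : ∀ w : ℝ, z.re * w < 1 → s * z.re * w < 1 := fun w hw => by
      rcases le_total (z.re * w) 0 with h1 | h1 <;> nlinarith
    exact ⟨fun h1 => key _ (hz.1 (pos_of_mul_pos_right h1 hs.le)),
      fun h1 => key _ (hz.2 (neg_of_mul_neg_right h1 hs.le))⟩
  · refine mem_domain_of_im_ne_zero ?_
    rw [Complex.smul_im]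
    exact smul_ne_zero hs.ne' him

/-- A larger radius of convergence would extend the continuation analytically past `y₊`, where it is
singular. -/
theorem radius_eq {c : ℕ → ℂ} (hsum : ∀ z : ℂ, ‖z‖ < (invY p u cp)⁻¹ →
    HasSum (fun k => c k * z ^ k) (continuation p u cm cp z)) :
    (FormalMultilinearSeries.ofScalars ℂ c).radius = ENNReal.ofReal (invY p u cp)⁻¹ := by
  have hy : 0 < (invY p u cp)⁻¹ := inv_pos.2 (invY_cp_pos h hc)
  set P := FormalMultilinearSeries.ofScalars ℂ c with hP
  set r := (invY p u cp)⁻¹ with hr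
  have hle : ENNReal.ofReal r ≤ P.radius := by
    refine ENNReal.le_of_forall_nnreal_lt fun ρ hρ => P.le_radius_of_summable_norm ?_
    have h1 : (ρ : ℝ) < r := by
      rw [← ENNReal.ofReal_coe_nnreal] at hρ
      exact (ENNReal.ofReal_lt_ofReal_iff hy).1 hρ
    refine (hsum (ρ : ℝ) ?_).summable.norm.congr fun k => ?_
    · rwa [Complex.norm_real, NNReal.norm_eq]
    · rw [hP, FormalMultilinearSeries.ofScalars_norm, norm_mul, norm_pow, Complex.norm_real,
        NNReal.norm_eq]
  refine le_antisymm (not_lt.1 fun hlt => ?_) hle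
  have hpos : 0 < P.radius := (ENNReal.ofReal_pos.2 hy).trans_le hle
  have hin : ∀ z : ℂ, ‖z‖ ≤ r → z ∈ Metric.eball (0 : ℂ) P.radius := fun z hz => by
    rw [Metric.mem_eball, edist_zero_right, ← ofReal_norm]
    exact (ENNReal.ofReal_le_ofReal hz).trans_lt hlt
  have hball := (P.hasFPowerSeriesOnBall hpos).analyticOnNhd
  -- the sum coincides with the continuation on the intersection of the domain and the disc
  have hstar : StarConvex ℝ 0 (domain p u cm cp ∩ Metric.eball 0 P.radius) := by
    refine (starConvex_domain h hc).inter ?_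
    rw [starConvex_zero_iff]
    intro z hz s hs0 hs1
    rw [Metric.mem_eball, edist_zero_right] at hz ⊢
    refine lt_of_le_of_lt ?_ hz
    rw [enorm_le_iff_norm_le, norm_smul, Real.norm_of_nonneg hs0]
    exact mul_le_of_le_one_left (norm_nonneg _) hs1
  have h0 : (0 : ℂ) ∈ domain p u cm cp ∩ Metric.eball 0 P.radius :=
    ⟨zero_mem_domain h hc, Metric.mem_eball_self hpos⟩
  have hf : AnalyticOnNhd ℂ (continuation p u cm cp) (domain p u cm cp) :=
    (differentiableOn_continuation h hc).analyticOnNhd (isOpen_domain h hc)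
  have heq : Set.EqOn P.sum (continuation p u cm cp)
      (domain p u cm cp ∩ Metric.eball 0 P.radius) := by
    refine (hball.mono Set.inter_subset_right).eqOn_of_preconnected_of_eventuallyEq
      (hf.mono Set.inter_subset_left) (hstar.isPathConnected h0).isConnected.isPreconnected h0 ?_
    filter_upwards [Metric.ball_mem_nhds (0 : ℂ) hy] with z hz
    refine HasSum.unique (P.hasSum ?_) ?_
    · exact hin z (mem_ball_zero_iff.1 hz).le
    · refine (hsum z (mem_ball_zero_iff.1 hz)).congr_fun fun k => ?_
      rw [hP, FormalMultilinearSeries.ofScalars_apply_eq, smul_eq_mul]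
  have hmem : ((r : ℝ) : ℂ) ∈ Metric.eball (0 : ℂ) P.radius :=
    hin _ (by rw [Complex.norm_real, Real.norm_of_nonneg hy.le])
  refine isSingularAt_yPlus h hc ⟨P.sum, hball _ hmem, ?_⟩
  filter_upwards [self_mem_nhdsWithin, mem_nhdsWithin_of_mem_nhds
    (Metric.isOpen_eball.mem_nhds hmem)] with z h1 h2
  exact heq ⟨h1, h2⟩

end Radius

/-! ### Continuation of the generating series -/

section Continuation

/-- From the series in `x` and `y` to the series in `t`: the coefficient of `y ^ k` in
`T(p, t, t y)` is `t ^ k T_k(p, t)`, and only the powers of `t ^ 3` occur. -/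
theorem hasSum_boundaryTerm {S : SeriesRing} (hS : rescaledSeries = substCube S) {p t : ℝ}
    (ht : t ≠ 0) {k : ℕ} {a : ℝ} (h : HasSum (fun n =>
      Polynomial.aeval p (PowerSeries.coeff n (PowerSeries.coeff k S)) * (t ^ 3) ^ n) a) :
    HasSum (boundaryTerm p t k) ((t ^ k)⁻¹ * a) := by
  have hcoeff : PowerSeries.X ^ k * PowerSeries.coeff k triangulationSeries =
      expandCube (Polynomial ℚ) (PowerSeries.coeff k S) := by
    have := congrArg (PowerSeries.coeff k) hS
    rwa [rescaledSeries, PowerSeries.coeff_rescale, substCube, PowerSeries.coeff_map] at this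
  set E := expandCube (Polynomial ℚ) (PowerSeries.coeff k S) with hE
  have hEmul : ∀ m, PowerSeries.coeff (3 * m) E = PowerSeries.coeff m (PowerSeries.coeff k S) :=
    fun m => PowerSeries.coeff_expand_mul 3 three_ne_zero _ m
  have hEnot : ∀ m, ¬ 3 ∣ m → PowerSeries.coeff m E = 0 :=
    fun m hm => PowerSeries.coeff_expand_of_not_dvd 3 three_ne_zero _ hm
  have h1 : HasSum (fun n => Polynomial.aeval p (PowerSeries.coeff n E) * t ^ n) a := by
    refine ((mul_right_injective₀ (three_ne_zero' ℕ)).hasSum_iff fun n hn => ?_).1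
      (h.congr_fun fun m => ?_)
    · rw [hEnot n fun ⟨m, hm⟩ => hn ⟨m, hm.symm⟩, map_zero, zero_mul]
    · rw [Function.comp_apply, hEmul, pow_mul]
  have h2 : HasSum (fun e => t ^ k * boundaryTerm p t k e) a := by
    refine HasSum.congr_fun (((add_left_injective k).hasSum_iff fun n hn => ?_).2 h1) fun e => ?_
    · have hlt : n < k := lt_of_not_ge fun hle => hn ⟨n - k, Nat.sub_add_cancel hle⟩
      rw [← hcoeff, PowerSeries.coeff_X_pow_mul', if_neg hlt.not_ge, map_zero, zero_mul]
    · rw [Function.comp_apply, ← hcoeff, PowerSeries.coeff_X_pow_mul', if_pos (Nat.le_add_left k e),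
        Nat.add_sub_cancel, boundaryTerm, pow_add]
      ring
  have h3 := h2.mul_left (t ^ k)⁻¹
  simp only [inv_mul_cancel_left₀ (pow_ne_zero k ht)] at h3
  exact h3

theorem rescaledCoeff_eq {p t : ℝ} (ht : t ≠ 0) {k : ℕ} {a : ℝ}
    (h : HasSum (boundaryTerm p t k) ((t ^ k)⁻¹ * a)) : rescaledCoeff p t k = a := by
  rw [rescaledCoeff, h.tsum_eq, mul_inv_cancel_left₀ (pow_ne_zero k ht)]

theorem cube_le_of_le_tCrit {t : ℝ} (h0 : 0 < t) (ht : t ≤ tCrit) : t ^ 3 ≤ √3 / 36 := by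
  refine (pow_le_pow_left₀ h0.le ht 3).trans_eq ?_
  rw [tCrit, ← Real.rpow_natCast, ← Real.rpow_mul (by positivity)]
  norm_num

theorem exists_continuation {p t : ℝ} (hp : p ∈ Set.Ioc (0 : ℝ) 1) (ht : t ∈ Set.Ioc 0 tCrit) :
    (∀ k : ℕ, Summable (boundaryTerm p t k)) ∧
      ∃ (yPlus : ℝ) (yMinus : EReal) (f : ℂ → ℂ),
        1 < yPlus ∧ yMinus < ((-yPlus : ℝ) : EReal) ∧
        (FormalMultilinearSeries.ofScalars ℂ
          (fun k : ℕ => (rescaledCoeff p t k : ℂ))).radius = ENNReal.ofReal yPlus ∧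
        (∀ z : ℂ, ‖z‖ < yPlus →
          HasSum (fun k : ℕ => (rescaledCoeff p t k : ℂ) * z ^ k) (f z)) ∧
        AnalyticOnNhd ℂ f (slitPlane₂ yMinus yPlus) ∧
        IsSingularAt f (slitPlane₂ yMinus yPlus) (yPlus : ℂ) ∧
        ∀ a : ℝ, yMinus = (a : EReal) → IsSingularAt f (slitPlane₂ yMinus yPlus) (a : ℂ) := by
  obtain ⟨U, hU, -⟩ := existsUnique_isSeriesU
  obtain ⟨V, hV, -⟩ := hU.existsUnique_isSeriesV
  obtain ⟨S, hS, -⟩ := exists_parametrization hU hV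
  obtain ⟨u, v, s, h, hvX, hv, hs, hsum⟩ := hU.exists_real_series hp.1 hp.2 (pow_pos ht.1 3)
    (cube_le_of_le_tCrit ht.1 ht.2) hS
  obtain ⟨cm, cp, hc⟩ := h.exists_isCritPair
  have hT := fun k => hasSum_boundaryTerm hS ht.1.ne' (hsum k)
  have hcoeff := fun k => rescaledCoeff_eq ht.1.ne' (hT k)
  have hω := invY_cp_pos h hc
  have hd := differentiableOn_continuation h hc
  have hball : ∀ z : ℂ, ‖z‖ < (invY p u cp)⁻¹ →
      HasSum (fun k : ℕ => (rescaledCoeff p t k : ℂ) * z ^ k) (continuation p u cm cp z) := by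
    intro z hz
    refine HasSum.congr_fun (Complex.hasSum_taylorSeries_on_ball
      (hd.mono (ball_subset_domain h hc)) (mem_ball_zero_iff.2 hz)) fun k => ?_
    rw [hcoeff, ← taylorCoeff_continuation h hc hvX hv hs, sub_zero, smul_eq_mul, smul_eq_mul]
    ring
  refine ⟨fun k => (hT k).summable, (invY p u cp)⁻¹, yMin p u cm, continuation p u cm cp,
    (one_lt_inv₀ hω).2 (hc.invY_cp_lt_one h), yMin_lt h hc, radius_eq h hc hball, hball,
    hd.analyticOnNhd (isOpen_domain h hc), isSingularAt_yPlus h hc, fun a ha => ?_⟩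
  rw [yMin] at ha
  split_ifs at ha with hm
  · rw [← EReal.coe_eq_coe_iff.1 ha]
    have := isSingularAt_yMinus h hc hm
    exact this
  · exact absurd ha (EReal.bot_ne_coe a)

end Continuation

end PercMaps

end

theorem mainTheorem5 :
    -- the series `U`
    (∃! U : PowerSeries ℚ, PercMaps.IsSeriesU U) ∧
    -- the series `V` and the parametrization of `T(p, t, t y)` as a series in `x = t ^ 3` and `y`
    (∀ U : PowerSeries ℚ, PercMaps.IsSeriesU U →
      (∃! V : PercMaps.SeriesRing, PercMaps.IsSeriesV U V) ∧
      ∀ V : PercMaps.SeriesRing, PercMaps.IsSeriesV U V →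
        (∀ n : ℕ, PowerSeries.coeff n V ∈ PercMaps.coeffRing U) ∧
        ∃ S : PercMaps.SeriesRing,
          PercMaps.rescaledSeries = PercMaps.substCube S ∧
          IsAlgebraic (Algebra.adjoin ℚ
            ({PercMaps.pVar, PercMaps.xVar, PercMaps.yVar} : Set PercMaps.SeriesRing)) S ∧
          PercMaps.toFrac S = PercMaps.tHat (PercMaps.toFrac PercMaps.pVar)
            (PercMaps.toFrac (PowerSeries.C (PercMaps.inclX U))) (PercMaps.toFrac V)) ∧
    -- the parametrization is proper
    PercMaps.ParametrizationIsProper ∧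
    -- singularities and analytic continuation in `y`
    (∀ p ∈ Set.Ioc (0 : ℝ) 1, ∀ t ∈ Set.Ioc (0 : ℝ) PercMaps.tCrit,
      (∀ k : ℕ, Summable (PercMaps.boundaryTerm p t k)) ∧
      ∃ (yPlus : ℝ) (yMinus : EReal) (f : ℂ → ℂ),
        1 < yPlus ∧ yMinus < ((-yPlus : ℝ) : EReal) ∧
        (FormalMultilinearSeries.ofScalars ℂ
          (fun k : ℕ => (PercMaps.rescaledCoeff p t k : ℂ))).radius = ENNReal.ofReal yPlus ∧
        (∀ z : ℂ, ‖z‖ < yPlus →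
          HasSum (fun k : ℕ => (PercMaps.rescaledCoeff p t k : ℂ) * z ^ k) (f z)) ∧
        AnalyticOnNhd ℂ f (PercMaps.slitPlane₂ yMinus yPlus) ∧
        PercMaps.IsSingularAt f (PercMaps.slitPlane₂ yMinus yPlus) (yPlus : ℂ) ∧
        ∀ a : ℝ, yMinus = (a : EReal) →
          PercMaps.IsSingularAt f (PercMaps.slitPlane₂ yMinus yPlus) (a : ℂ)) := by
  refine ⟨PercMaps.existsUnique_isSeriesU, fun U hU => ⟨hU.existsUnique_isSeriesV,
    fun V hV => ⟨hU.coeff_mem hV, PercMaps.exists_parametrization hU hV⟩⟩,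
    PercMaps.parametrizationIsProper, fun _ hp _ ht => PercMaps.exists_continuation hp ht⟩
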